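/- Model. We use a randomized word RAM with $w$-bit words (unit-cost arithmetic, bitwise, shift and comparison operations, indirect addressing, and drawing a uniformly random word). For a problem with size parameter $n$ we require $2^w\ge (n+2)^k$ for a constant $k$ belonging to the algorithm, and memory outside the input has arbitrary initial contents. Algorithms are zero-error (with probability $1$ they give no wrong answer), and running times are worst-case expected times (over all inputs, all admissible $w$ and all initial memory contents). In 3SUM one is given a set $A$ of $n$ integers of absolute value at most $n^{\kappa}$, and has to decide whether there are distinct $a,b,c\in A$ with $a+b=c$. The 3SUM conjecture says that, for some constant $\kappa$, every algorithm for 3SUM has expected running time $\Omega(n^{2-o(1)})$. Let $1/2\le\gamma<1$. Suppose that there is a data structure which, for every integer $d>0$ and every undirected simple graph $G=(V,E)$ with at most $d^{\frac{1}{2-2\gamma}}$ vertices and at most $d^{\frac{2-\gamma}{2-2\gamma}}$ edges, preprocesses $(G,d)$ (the size parameter being $d$) and then supports, in any order, 1. deletions: given a list of a set $F\subseteq V$ with $|F|\le d$, make $F$ the current set of deleted vertices (replacing the previous one, which is initially empty; the procedures of the data structure do not write to the array in which the user passes $F$); 2. queries: given $s,t\in V\setminus F$, decide whether $s$ and $t$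 are connected in the subgraph of $G$ induced by $V\setminus F$. Let its expected preprocessing time be at most $t_p=t_p(d)$, its amortized expected deletion time $t_d=t_d(d)$ and its amortized expected query time $t_q=t_q(d)$; that is, for every fixed finite sequence of $x$ deletions and $y$ queries following the preprocessing, the expected total time of these operations is at most $x\,t_d+y\,t_q$. Assume the 3SUM conjecture. Then, as $d\to\infty$, $$t_p + d^{\frac{1}{2-2\gamma}}\cdot t_d + d^{\frac{1+\gamma}{2-2\gamma}}\cdot t_q = \Omega\left(d^{\frac{1}{1-\gamma}-o(1)}\right).$$ Consequently, if in addition $t_p$ and $d^{\frac{1}{2-2\gamma}}\,t_d$ are both $O\big(d^{\frac{1}{1-\gamma}-\varepsilon}\big)$ for some constant $\varepsilon>0$, then $t_q=\Omega(d^{1/2-o(1)})$. Here $\Omega$ refers to all sufficiently large arguments, both in the conjecture and in the conclusions. The same implications hold if "$=\Omega(x^{e-o(1)})$" is replaced throughout, in the conjecture and in the two conclusions, by "is not $O(x^{e-\varepsilon'})$ for any constant $\varepsilon'>0$". -/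

import Mathlib

open Filter Topology
open scoped ENNReal NNReal

/-! ## The randomized word RAM

Programs are finite texts.  Words have `w` bits and all arithmetic is modulo `2 ^ w`.  A program uses
finitely many named word variables and finitely many named arrays, each of which is addressed by
words; an assignment, an array write, a test and the drawing of a random word cost one unit of time. -/

/-- The unit-cost word operations; comparisons return the word `1` or `0`. -/
inductive WordOp where
  | add | sub | mul | div | mod | and | or | xor | shl | shr | eq | lt

/-- Evaluation of a word operation, on words read as unsigned numbers. -/
def WordOp.eval {w : ℕ} : WordOp → BitVec w → BitVec w → BitVec w
  | add, x, y => x + y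
  | sub, x, y => x - y
  | mul, x, y => x * y
  | div, x, y => x / y
  | mod, x, y => x % y
  | and, x, y => x &&& y
  | or, x, y => x ||| y
  | xor, x, y => x ^^^ y
  | shl, x, y => x <<< y.toNat
  | shr, x, y => x >>> y.toNat
  | eq, x, y => if x = y then 1 else 0
  | lt, x, y => if x.toNat < y.toNat then 1 else 0

/-- Expressions: literals, variables, array cells, and word operations.  Since the size of an
expression is bounded by the size of the program text, evaluating one is charged as a single step. -/
inductive Expr where
  | lit (k : ℕ)
  | var (x : ℕ)
  | read (a : ℕ) (i : Expr)
  | op (o : WordOp) (e₁ e₂ : Expr)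

/-- Programs. `rand x` stores a fresh uniformly random word in variable `x`;
tests regard nonzero words as true. -/
inductive Cmd where
  | skip
  | assign (x : ℕ) (e : Expr)
  | write (a : ℕ) (i e : Expr)
  | rand (x : ℕ)
  | seq (c₁ c₂ : Cmd)
  | cond (e : Expr) (c₁ c₂ : Cmd)
  | loop (e : Expr) (c : Cmd)

/-- The program text contains no write to the array named `b`. -/
def Cmd.NeverWrites (b : ℕ) : Cmd → Prop
  | skip => True
  | assign _ _ => True
  | write a _ _ => a ≠ b
  | rand _ => True
  | seq c₁ c₂ => c₁.NeverWrites b ∧ c₂.NeverWrites b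
  | cond _ c₁ c₂ => c₁.NeverWrites b ∧ c₂.NeverWrites b
  | loop _ c => c.NeverWrites b

/-- Machine states with word length `w`. The clock counts elapsed steps;
programs can neither read it nor reset it. -/
structure MState (w : ℕ) where
  var : ℕ → BitVec w
  arr : ℕ → BitVec w → BitVec w
  clock : ℕ

namespace MState

variable {w : ℕ}

def tick (s : MState w) : MState w := { s with clock := s.clock + 1 }

def resetClock (s : MState w) : MState w := { s with clock := 0 }

def setVar (s : MState w) (x : ℕ) (v : BitVec w) : MState w :=
  { s with var := Function.update s.var x v }

def setArr (s : MState w) (a : ℕ) (b : BitVec w → BitVec w) : MState w :=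
  { s with arr := Function.update s.arr a b }

def setCell (s : MState w) (a : ℕ) (i v : BitVec w) : MState w :=
  s.setArr a (Function.update (s.arr a) i v)

end MState

/-- The array whose first cells hold the numbers in the list `l` and whose other cells agree
with `b`. -/
def withPrefix {w : ℕ} (l : List ℕ) (b : BitVec w → BitVec w) : BitVec w → BitVec w :=
  fun i => if h : i.toNat < l.length then BitVec.ofNat w l[i.toNat] else b i

def Expr.eval {w : ℕ} (s : MState w) : Expr → BitVec w
  | lit k => BitVec.ofNat w k
  | var x => s.var x
  | read a i => s.arr a (i.eval s)
  | op o e₁ e₂ => o.eval (e₁.eval s) (e₂.eval s)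

/-- Semantics of programs: `c.exp f s` is the expectation, over the random words drawn, of the value
of `f` at the final state of `c` started in `s`, where runs that do not halt contribute `0`.
For a loop this is the supremum over `n` of the contributions of the runs that leave the loop in
fewer than `n` iterations. -/
noncomputable def Cmd.exp {w : ℕ} : Cmd → (MState w → ℝ≥0∞) → MState w → ℝ≥0∞
  | skip, f, s => f s.tick
  | assign x e, f, s => f (s.tick.setVar x (e.eval s))
  | write a i e, f, s => f (s.tick.setCell a (i.eval s) (e.eval s))
  | rand x, f, s => (∑ k ∈ Finset.range (2 ^ w), f (s.tick.setVar x (BitVec.ofNat w k))) / 2 ^ w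
  | seq c₁ c₂, f, s => c₁.exp (c₂.exp f) s
  | cond e c₁ c₂, f, s => if e.eval s ≠ 0 then c₁.exp f s.tick else c₂.exp f s.tick
  | loop e c, f, s =>
      ⨆ n : ℕ, ((fun (g : MState w → ℝ≥0∞) (t : MState w) =>
        if e.eval t ≠ 0 then c.exp g t.tick else f t.tick)^[n] (fun _ => 0)) s

/-- The expected reading of the clock at the end of a random computation, which is given by its
expectation functional `E`; it is infinite if the computation may run forever with positive
probability. -/
noncomputable def expectedTime {w : ℕ} (E : (MState w → ℝ≥0∞) → ℝ≥0∞) : ℝ≥0∞ :=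
  open Classical in if E (fun _ => 1) = 1 then E (fun s => s.clock) else ⊤

/-! ## Asymptotic lower bounds -/

/-- `T n = Ω(n ^ (e - o(1)))`. -/
def IsOmegaPow (T : ℕ → ℝ≥0∞) (e : ℝ) : Prop :=
  ∃ δ : ℕ → ℝ, Tendsto δ atTop (𝓝 0) ∧
    ∃ c : ℝ, 0 < c ∧ ∀ᶠ n : ℕ in atTop, ENNReal.ofReal (c * (n : ℝ) ^ (e - δ n)) ≤ T n

/-- `T n` is not `O(n ^ (e - ε))` for any constant `ε > 0`. -/
def IsNeverBigOPow (T : ℕ → ℝ≥0∞) (e : ℝ) : Prop :=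
  ∀ ε : ℝ, 0 < ε →
    ¬ ∃ C : ℝ, ∀ᶠ n : ℕ in atTop, T n ≤ ENNReal.ofReal (C * (n : ℝ) ^ (e - ε))

/-! ## 3SUM -/

/-- The set `A` (listed without repetition) has three distinct elements `a, b, c` with
`a + b = c`. -/
def HasThreeSum {n : ℕ} (A : Fin n → ℤ) : Prop :=
  ∃ i j k : Fin n, i ≠ j ∧ i ≠ k ∧ j ≠ k ∧ A i + A j = A k

/-- Instances: `n` distinct integers between `-n ^ κ` and `n ^ κ`. -/
def IsThreeSumInstance (κ n : ℕ) (A : Fin n → ℤ) : Prop :=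
  Function.Injective A ∧ ∀ i, |A i| ≤ (n : ℤ) ^ κ

/-- The start state for the input `A`: variable `0` holds `n`, the first `n` cells of array `0` hold
the elements of `A` in two's complement; the rest of the memory is as in `s`. -/
def threeSumInput {w n : ℕ} (A : Fin n → ℤ) (s : MState w) : MState w :=
  ((s.setVar 0 (BitVec.ofNat w n)).setArr 0
    (fun i => if h : i.toNat < n then BitVec.ofInt w (A ⟨i.toNat, h⟩) else s.arr 0 i)).resetClock

/-- `c` is a zero-error algorithm for 3SUM, on words of at least `k * log (n + 2)` bits and whatever
the initial contents of the rest of the memory: with probability `0` it halts with an answer in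
variable `0` that is not the correct one (`1` for yes, `0` for no). -/
def SolvesThreeSum (κ k : ℕ) (c : Cmd) : Prop :=
  ∀ (n w : ℕ) (A : Fin n → ℤ) (s : MState w), (n + 2) ^ k ≤ 2 ^ w → IsThreeSumInstance κ n A →
    open Classical in
    c.exp (fun t => if t.var 0 = (if HasThreeSum A then 1 else 0) then 0 else 1)
      (threeSumInput A s) = 0

/-- The worst-case expected running time of `c` on 3SUM instances of size `n`. -/
noncomputable def threeSumTime (κ k : ℕ) (c : Cmd) (n : ℕ) : ℝ≥0∞ :=
  ⨆ (w : ℕ) (A : Fin n → ℤ) (s : MState w) (_ : (n + 2) ^ k ≤ 2 ^ w)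
    (_ : IsThreeSumInstance κ n A), expectedTime (fun f => c.exp f (threeSumInput A s))

/-- The 3SUM conjecture: for integers of `O(log n)` bits on a word RAM with words of `O(log n)` bits,
every algorithm takes expected time `Ω(n ^ (2 - o(1)))`. -/
def ThreeSumConjecture : Prop :=
  ∃ κ : ℕ, ∀ (k : ℕ) (c : Cmd), SolvesThreeSum κ k c → IsOmegaPow (threeSumTime κ k c) 2

/-- The 3SUM conjecture in the form: no algorithm takes expected time `O(n ^ (2 - ε))`, for any
constant `ε > 0`. -/
def ThreeSumConjectureNoAlgorithm : Prop :=
  ∃ κ : ℕ, ∀ (k : ℕ) (c : Cmd), SolvesThreeSum κ k c → IsNeverBigOPow (threeSumTime κ k c) 2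

/-! ## Connectivity oracles for vertex failures -/

/-- The list `es` contains each edge of `G` exactly once, in one of its two orientations. -/
def IsEdgeList {N : ℕ} (G : SimpleGraph (Fin N)) (es : List (Fin N × Fin N)) : Prop :=
  (es.map fun e => s(e.1, e.2)).Nodup ∧
    ∀ u v, G.Adj u v ↔ s(u, v) ∈ es.map fun e => s(e.1, e.2)

/-- `u` and `v` are connected in the subgraph of `G` induced by the vertices outside `F`. -/
def ConnectedAvoiding {N : ℕ} (G : SimpleGraph (Fin N)) (F : List (Fin N)) (u v : Fin N) : Prop :=
  ∃ (hu : u ∉ F) (hv : v ∉ F), (G.induce {x | x ∉ F}).Reachable ⟨u, hu⟩ ⟨v, hv⟩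

/-- The operations on an `N`-vertex graph.
`fail F b` makes `F` the set of deleted vertices, in place of the previous one; the user passes `F`
as the beginning of an array whose further contents `b` are arbitrary.
`query u v` asks if `u` and `v` are connected. -/
inductive FailureOp (N w : ℕ) where
  | fail (F : List (Fin N)) (b : BitVec w → BitVec w)
  | query (u v : Fin N)

/-- Legal sequences of operations, when `F` is the current set of deleted vertices: at most `d`
vertices are deleted at a time, and queries concern vertices that are not deleted. -/
def LegalOps {N w : ℕ} (d : ℕ) : List (Fin N) → List (FailureOp N w) → Prop
  | _, [] => True
  | _, .fail F' _ :: ops => F'.Nodup ∧ F'.length ≤ d ∧ LegalOps d F' ops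
  | F, .query u v :: ops => u ∉ F ∧ v ∉ F ∧ LegalOps d F ops

/-- The number of deletions in a sequence of operations. -/
def numFails {N w : ℕ} : List (FailureOp N w) → ℕ
  | [] => 0
  | .fail _ _ :: ops => numFails ops + 1
  | .query _ _ :: ops => numFails ops

/-- The number of queries in a sequence of operations. -/
def numQueries {N w : ℕ} : List (FailureOp N w) → ℕ
  | [] => 0
  | .fail _ _ :: ops => numQueries ops
  | .query _ _ :: ops => numQueries ops + 1

/-- A data structure is given by three procedures, which share the memory.  The array `2`, through
which the user passes the sets of deleted vertices, is read-only for them. -/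
structure FailureOracle where
  prep : Cmd
  fail : Cmd
  query : Cmd
  prep_readOnly : prep.NeverWrites 2
  fail_readOnly : fail.NeverWrites 2
  query_readOnly : query.NeverWrites 2

/-- Input of the preprocessing: the variables `0, 1, 2` hold the number of vertices, the number of
edges and `d`, the arrays `0, 1` hold the two ends of each edge. -/
def graphInput {w N : ℕ} (d : ℕ) (es : List (Fin N × Fin N)) (s : MState w) : MState w :=
  (((((s.setVar 0 (BitVec.ofNat w N)).setVar 1 (BitVec.ofNat w es.length)).setVar 2
    (BitVec.ofNat w d)).setArr 0 (withPrefix (es.map fun e => (e.1 : ℕ)) (s.arr 0))).setArr 1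
    (withPrefix (es.map fun e => (e.2 : ℕ)) (s.arr 1))).resetClock

/-- Input of a deletion: variable `0` holds the size of `F`, array `2` begins with the elements
of `F`. -/
def failInput {w N : ℕ} (F : List (Fin N)) (b : BitVec w → BitVec w) (s : MState w) : MState w :=
  (s.setVar 0 (BitVec.ofNat w F.length)).setArr 2 (withPrefix (F.map fun x => (x : ℕ)) b)

/-- Input of a query: the variables `0, 1` hold the two vertices. -/
def queryInput {w N : ℕ} (u v : Fin N) (s : MState w) : MState w :=
  (s.setVar 0 (BitVec.ofNat w u)).setVar 1 (BitVec.ofNat w v)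

namespace FailureOracle

variable {w N : ℕ}

/-- The expectation of `f` at the state after a sequence of operations. -/
noncomputable def opsExp (D : FailureOracle) :
    List (FailureOp N w) → (MState w → ℝ≥0∞) → MState w → ℝ≥0∞
  | [], f, s => f s
  | .fail F b :: ops, f, s => D.fail.exp (D.opsExp ops f) (failInput F b s)
  | .query u v :: ops, f, s => D.query.exp (D.opsExp ops f) (queryInput u v s)

open Classical in
/-- The expected number of queries with a wrong answer in a sequence of operations, when `F` is the
current set of deleted vertices; answers are left in variable `0`. -/
noncomputable def opsErrors (D : FailureOracle) (G : SimpleGraph (Fin N)) :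
    List (Fin N) → List (FailureOp N w) → MState w → ℝ≥0∞
  | _, [], _ => 0
  | _, .fail F' b :: ops, s => D.fail.exp (D.opsErrors G F' ops) (failInput F' b s)
  | F, .query u v :: ops, s =>
      D.query.exp
        (fun t => (if t.var 0 = (if ConnectedAvoiding G F u v then 1 else 0) then 0 else 1)
          + D.opsErrors G F ops t)
        (queryInput u v s)

/-- On graphs with at most `d ^ (1 / (2 - 2γ))` vertices and at most `d ^ ((2 - γ) / (2 - 2γ))` edges,
`D` is a (zero-error) `d`-failure connectivity structure with expected preprocessing time `tp d`,
amortized expected deletion time `td d` and amortized expected query time `tq d`: the expected total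
time of each legal sequence of operations, carried out after the preprocessing, is at most the sum of
the amortized times of its members.
Words have at least `k * log (d + 2)` bits for a constant `k`, and the initial contents of the memory
outside the input are arbitrary. -/
def HasTimes (D : FailureOracle) (γ : ℝ) (tp td tq : ℕ → ℝ≥0) : Prop :=
  ∃ k : ℕ, ∀ (d w N : ℕ) (G : SimpleGraph (Fin N)) (es : List (Fin N × Fin N)) (s : MState w),
    0 < d → (d + 2) ^ k ≤ 2 ^ w → IsEdgeList G es →
    (N : ℝ) ≤ (d : ℝ) ^ (1 / (2 - 2 * γ)) →
    (es.length : ℝ) ≤ (d : ℝ) ^ ((2 - γ) / (2 - 2 * γ)) →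
    expectedTime (fun f => D.prep.exp f (graphInput d es s)) ≤ tp d ∧
    ∀ ops : List (FailureOp N w), LegalOps d [] ops →
      D.prep.exp (D.opsErrors G [] ops) (graphInput d es s) = 0 ∧
      expectedTime (fun f =>
        D.prep.exp (fun t => D.opsExp ops f t.resetClock) (graphInput d es s)) ≤
        numFails ops * td d + numQueries ops * tq d

end FailureOracle

/-- `tp + d ^ (1 / (2 - 2γ)) * td + d ^ ((1 + γ) / (2 - 2γ)) * tq`, as a function of `d`. -/
noncomputable def failureTradeoff (γ : ℝ) (tp td tq : ℕ → ℝ≥0) (d : ℕ) : ℝ≥0∞ :=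
  ENNReal.ofReal (tp d + (d : ℝ) ^ (1 / (2 - 2 * γ)) * td d +
    (d : ℝ) ^ ((1 + γ) / (2 - 2 * γ)) * tq d)

/-- Both `tp` and `d ^ (1 / (2 - 2γ)) * td` are `O(d ^ (1 / (1 - γ) - ε))` for some
constant `ε > 0`. -/
def CheapPrepAndFail (γ : ℝ) (tp td : ℕ → ℝ≥0) : Prop :=
  ∃ ε : ℝ, 0 < ε ∧ ∃ C : ℝ, ∀ᶠ d : ℕ in atTop,
    (tp d : ℝ) ≤ C * (d : ℝ) ^ (1 / (1 - γ) - ε) ∧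
    (d : ℝ) ^ (1 / (2 - 2 * γ)) * (td d : ℝ) ≤ C * (d : ℝ) ^ (1 / (1 - γ) - ε)

/-! The bound comes from a reduction: a fast data structure yields a fast zero-error program for
3SUM. The given numbers are shifted by `S = n ^ κ` to become nonnegative, padded, sorted, and cut
into `G` groups of `g` consecutive numbers, `L = G * g` in all. A solution is now a relation `Z a +
Z b = Z c + S`. For fixed `c`, the pairs of groups `(i, j)` that can contain `a` and `b` form a
staircase in the sorted order, so there are only `O(G)` of them (`Sizes.stair_of_solution`,
`sum_stair_le`). For each such pair the program asks whether the relation holds modulo `m` for some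
`a` in group `i` and `b` in group `j`, where `m` is random between `Y` and `2 * Y`. A positive
answer triggers an exhaustive search through group `i` in `O(g)` steps. False alarms are rare: a
nonzero difference has few divisors (`card_divisors_pow_le`), hence vanishes modulo few `m`
(`Sizes.sum_totalBads_le`).

The questions are connectivity queries. The graph has a vertex for each hash value below `m`, a hub
`m` joined to all of them, and for each group `j` and each `x₂ < X` a set vertex joined to the hash
values `x₂ - Z b`, with `b` in group `j`. Write the residue of `Z c + S` as `x₁ * X + x₂`. For group
`i` and block `x₁`, all hash values are deleted except those of the form `Z a - x₁ * X` with `a` in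
group `i`. Every surviving hash value is adjacent to the hub, so the hub is connected with the set
vertex of `(j, x₂)` exactly if `Z a - x₁ * X` and `x₂ - Z b` are congruent for some `a` and `b`
(`Sizes.connectedAvoiding_iff`, `Sizes.exists_kept_iff`). The numbers `c` are treated in the order
of their hash values, so that `G * (m / X + 1)` deletions are enough; there are at most `2 * G * L`
queries (`Prog.wp_search`).

Let `K` be the integral part of `n ^ (1 / e)`, and choose `b` with `b / e` close to `1 - γ`. With
`d` about `K ^ (2 * b)`, `g = K ^ (b - 1)`, `X = K ^ (b - 2)` and `Y = d / 4`, the graph has an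
admissible size, the program's own work is `O(K ^ (2 * e - 1))`, and there are `O(K ^ (e + 3))`
deletions and `O(K ^ (2 * e - b + 1))` queries (`Prog.exists_reduction`). Up to a factor `n ^ (4 /
e)`, the last two are the coefficients in the tradeoff (`exists_time_le`), and `e` can be taken
arbitrarily large.

One point needs care: the data structure is randomized, and its times are guaranteed for fixed
sequences of operations only. After the choice of `m` the user's program is deterministic, and all
answers are correct with probability 1; hence the sequence of operations is almost surely a fixed
one. This is the content of `Prog.wp_sound`, which reduces everything about the program to weakest
preconditions over natural numbers. -/

/-! ## Basic properties of the expectation semantics -/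

namespace Cmd

variable {w : ℕ}

/-- One unrolling of a loop. -/
noncomputable def loopStep (e : Expr) (c : Cmd) (f g : MState w → ℝ≥0∞) (t : MState w) : ℝ≥0∞ :=
  if e.eval t ≠ 0 then c.exp g t.tick else f t.tick

theorem exp_loop_eq_iSup (e : Expr) (c : Cmd) (f : MState w → ℝ≥0∞) (s : MState w) :
    (loop e c).exp f s = ⨆ n : ℕ, (loopStep e c f)^[n] (fun _ => 0) s := rfl

theorem exp_mono (c : Cmd) : ∀ {f g : MState w → ℝ≥0∞}, f ≤ g → c.exp f ≤ c.exp g := by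
  induction c with
  | skip => intro f g h s; exact h _
  | assign x e => intro f g h s; exact h _
  | write a i e => intro f g h s; exact h _
  | rand x =>
    intro f g h s
    simp only [exp]
    gcongr
    exact h _
  | seq c₁ c₂ h₁ h₂ => intro f g h s; exact h₁ (h₂ h) s
  | cond e c₁ c₂ h₁ h₂ =>
    intro f g h s
    simp only [exp]
    split_ifs
    · exact h₁ h _
    · exact h₂ h _
  | loop e c hc =>
    intro f g h s
    rw [exp_loop_eq_iSup, exp_loop_eq_iSup]
    refine iSup_mono fun n => ?_
    induction n generalizing s with
    | zero => simp
    | succ n ih =>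
      rw [Function.iterate_succ_apply', Function.iterate_succ_apply']
      simp only [loopStep]
      split_ifs
      · exact hc (fun t => ih t) _
      · exact h _

theorem loopStep_mono (e : Expr) (c : Cmd) {f f' g g' : MState w → ℝ≥0∞} (hf : f ≤ f')
    (hg : g ≤ g') : loopStep e c f g ≤ loopStep e c f' g' := by
  intro s
  simp only [loopStep]
  split_ifs
  · exact exp_mono c hg _
  · exact hf _

theorem monotone_iterate_loopStep (e : Expr) (c : Cmd) (f : MState w → ℝ≥0∞) :
    Monotone fun n => (loopStep e c f)^[n] (fun _ => 0) := by
  refine monotone_nat_of_le_succ fun n => ?_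
  induction n with
  | zero => intro s; simp
  | succ n ih =>
    rw [Function.iterate_succ_apply', Function.iterate_succ_apply']
    exact loopStep_mono e c le_rfl ih

theorem iterate_loopStep_mono (e : Expr) (c : Cmd) {f g : MState w → ℝ≥0∞} (h : f ≤ g) (n : ℕ) :
    (loopStep e c f)^[n] (fun _ => 0) ≤ (loopStep e c g)^[n] (fun _ => 0) := by
  induction n with
  | zero => exact le_rfl
  | succ n ih =>
    rw [Function.iterate_succ_apply', Function.iterate_succ_apply']
    exact loopStep_mono e c h ih

/-- Continuity along increasing sequences. It lets the body of a loop pass through the supremum that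
defines the loop, which gives the fixed point equation `exp_loop`. -/
theorem exp_iSup (c : Cmd) : ∀ (F : ℕ → MState w → ℝ≥0∞), Monotone F → ∀ s,
    c.exp (fun t => ⨆ n, F n t) s = ⨆ n, c.exp (F n) s := by
  induction c with
  | skip => intro F hF s; rfl
  | assign x e => intro F hF s; rfl
  | write a i e => intro F hF s; rfl
  | rand x =>
    intro F hF s
    simp only [exp]
    rw [ENNReal.finsetSum_iSup_of_monotone
      (f := fun k n => F n (s.tick.setVar x (BitVec.ofNat w k))) (fun k => fun a b hab => hF hab _),
      ENNReal.iSup_div]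
  | seq c₁ c₂ h₁ h₂ =>
    intro F hF s
    simp only [exp]
    have : c₂.exp (fun t => ⨆ n, F n t) = fun t => ⨆ n, c₂.exp (F n) t := funext fun t => h₂ F hF t
    rw [this, h₁ (fun n => c₂.exp (F n)) (fun a b hab => exp_mono c₂ (hF hab))]
  | cond e c₁ c₂ h₁ h₂ =>
    intro F hF s
    simp only [exp]
    split_ifs
    · exact h₁ F hF _
    · exact h₂ F hF _
  | loop e c hc =>
    intro F hF s
    simp only [exp_loop_eq_iSup]
    rw [iSup_comm]
    refine iSup_congr fun k => ?_
    induction k generalizing s with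
    | zero => simp
    | succ k ih =>
      simp only [Function.iterate_succ_apply']
      have : ((loopStep e c (fun t => ⨆ n, F n t))^[k] fun _ => 0)
          = fun t => ⨆ n, (loopStep e c (F n))^[k] (fun _ => 0) t := funext ih
      rw [this]
      simp only [loopStep]
      split_ifs
      · exact hc (fun n => (loopStep e c (F n))^[k] fun _ => 0)
          (fun a b hab => iterate_loopStep_mono e c (hF hab) k) _
      · rfl

theorem exp_loop (e : Expr) (c : Cmd) (f : MState w → ℝ≥0∞) (s : MState w) :
    (loop e c).exp f s = if e.eval s ≠ 0 then c.exp ((loop e c).exp f) s.tick else f s.tick := by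
  have h1 : (loop e c).exp f s = ⨆ n : ℕ, (loopStep e c f)^[n + 1] (fun _ => 0) s :=
    (Monotone.iSup_nat_add (f := fun n => (loopStep e c f)^[n] (fun _ => 0) s)
      (fun a b hab => monotone_iterate_loopStep e c f hab s) 1).symm
  rw [h1]
  simp only [Function.iterate_succ_apply']
  by_cases he : e.eval s ≠ 0
  · simp only [loopStep, if_pos he]
    exact (exp_iSup c _ (monotone_iterate_loopStep e c f) s.tick).symm
  · simp only [loopStep, if_neg he, ciSup_const]

theorem exp_add (c : Cmd) : ∀ (f g : MState w → ℝ≥0∞) (s : MState w),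
    c.exp (fun t => f t + g t) s = c.exp f s + c.exp g s := by
  induction c with
  | skip => intro f g s; rfl
  | assign x e => intro f g s; rfl
  | write a i e => intro f g s; rfl
  | rand x => intro f g s; simp only [exp, Finset.sum_add_distrib, ENNReal.add_div]
  | seq c₁ c₂ h₁ h₂ =>
    intro f g s
    simp only [exp]
    rw [show c₂.exp (fun t => f t + g t) = fun t => c₂.exp f t + c₂.exp g t from
      funext fun t => h₂ f g t, h₁]
  | cond e c₁ c₂ h₁ h₂ =>
    intro f g s
    simp only [exp]
    split_ifs
    · exact h₁ f g _
    · exact h₂ f g _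
  | loop e c hc =>
    intro f g s
    simp only [exp_loop_eq_iSup]
    rw [ENNReal.iSup_add_iSup_of_monotone
      (fun a b hab => monotone_iterate_loopStep e c f hab s)
      (fun a b hab => monotone_iterate_loopStep e c g hab s)]
    refine iSup_congr fun k => ?_
    induction k generalizing s with
    | zero => simp
    | succ k ih =>
      simp only [Function.iterate_succ_apply']
      rw [show ((loopStep e c fun t => f t + g t)^[k] fun _ => 0)
        = fun t => (loopStep e c f)^[k] (fun _ => 0) t + (loopStep e c g)^[k] (fun _ => 0) t from
        funext ih]
      simp only [loopStep]
      split_ifs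
      · exact hc _ _ _
      · rfl

theorem exp_const_mul (c : Cmd) (a : ℝ≥0∞) : ∀ (f : MState w → ℝ≥0∞) (s : MState w),
    c.exp (fun t => a * f t) s = a * c.exp f s := by
  induction c with
  | skip => intro f s; rfl
  | assign x e => intro f s; rfl
  | write a i e => intro f s; rfl
  | rand x => intro f s; simp only [exp, ← Finset.mul_sum, mul_div_assoc]
  | seq c₁ c₂ h₁ h₂ =>
    intro f s
    simp only [exp]
    rw [show c₂.exp (fun t => a * f t) = fun t => a * c₂.exp f t from funext fun t => h₂ f t, h₁]
  | cond e c₁ c₂ h₁ h₂ =>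
    intro f s
    simp only [exp]
    split_ifs
    · exact h₁ f _
    · exact h₂ f _
  | loop e c hc =>
    intro f s
    simp only [exp_loop_eq_iSup]
    rw [ENNReal.mul_iSup]
    refine iSup_congr fun k => ?_
    induction k generalizing s with
    | zero => simp
    | succ k ih =>
      simp only [Function.iterate_succ_apply']
      rw [show ((loopStep e c fun t => a * f t)^[k] fun _ => 0)
        = fun t => a * (loopStep e c f)^[k] (fun _ => 0) t from funext ih]
      simp only [loopStep]
      split_ifs
      · exact hc _ _
      · rfl

theorem exp_le_one (c : Cmd) : ∀ {f : MState w → ℝ≥0∞}, (∀ t, f t ≤ 1) → ∀ s, c.exp f s ≤ 1 := by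
  induction c with
  | skip => intro f h s; exact h _
  | assign x e => intro f h s; exact h _
  | write a i e => intro f h s; exact h _
  | rand x =>
    intro f h s
    simp only [exp]
    refine ENNReal.div_le_of_le_mul ?_
    calc _ ≤ ∑ k ∈ Finset.range (2 ^ w), (1 : ℝ≥0∞) := Finset.sum_le_sum fun k _ => h _
      _ = _ := by simp
  | seq c₁ c₂ h₁ h₂ => intro f h s; exact h₁ (h₂ h) s
  | cond e c₁ c₂ h₁ h₂ =>
    intro f h s
    simp only [exp]
    split_ifs
    · exact h₁ h _
    · exact h₂ h _
  | loop e c hc =>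
    intro f h s
    rw [exp_loop_eq_iSup]
    refine iSup_le fun n => ?_
    induction n generalizing s with
    | zero => simp
    | succ n ih =>
      rw [Function.iterate_succ_apply']
      simp only [loopStep]
      split_ifs
      · exact hc ih _
      · exact h _

/-- Changing `f` where `g` is nonzero does not matter if `g` has expectation zero. -/
theorem exp_congr_of_exp_eq_zero (c : Cmd) {f f' g : MState w → ℝ≥0∞} {s : MState w}
    (hg : c.exp g s = 0) (h : ∀ t, g t = 0 → f t = f' t) : c.exp f s = c.exp f' s := by
  have key : ∀ f f' : MState w → ℝ≥0∞, (∀ t, g t = 0 → f t = f' t) → c.exp f s ≤ c.exp f' s := by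
    intro f f' h
    -- The factor `⊤` makes the second summand infinite wherever `g` is nonzero, so the pointwise
    -- inequality is trivial there; still its expectation is `⊤ * 0 = 0`.
    calc c.exp f s ≤ c.exp (fun t => f' t + ⊤ * g t) s := by
          refine exp_mono c (fun t => ?_) s
          by_cases ht : g t = 0
          · simp [h t ht]
          · simp [ENNReal.top_mul ht]
      _ = c.exp f' s := by rw [exp_add, exp_const_mul, hg]; simp
  exact le_antisymm (key f f' h) (key f' f fun t ht => (h t ht).symm)

/-- A loop whose test succeeds under an invariant never halts, and runs that do not halt contribute
nothing. -/
theorem exp_loop_of_forall_ne {e : Expr} {c : Cmd} {f : MState w → ℝ≥0∞} {s : MState w}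
    (I : MState w → Prop) (hs : I s) (he : ∀ t, I t → e.eval t ≠ 0)
    (hc : ∀ t, I t → ∀ g : MState w → ℝ≥0∞, (∀ t, I t → g t = 0) → c.exp g t.tick = 0) :
    (loop e c).exp f s = 0 := by
  rw [exp_loop_eq_iSup]
  refine ENNReal.iSup_eq_zero.2 fun n => ?_
  induction n generalizing s with
  | zero => rfl
  | succ n ih =>
    rw [Function.iterate_succ_apply']
    simp only [loopStep, if_pos (he s hs)]
    exact hc s hs _ fun t ht => ih ht

end Cmd

/-! ## Programs do not depend on memory that they do not name -/

/-- All names of variables and arrays in the expression are smaller than `M`. -/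
def Expr.Below (M : ℕ) : Expr → Prop
  | lit _ => True
  | var x => x < M
  | read a i => a < M ∧ i.Below M
  | op _ e₁ e₂ => e₁.Below M ∧ e₂.Below M

/-- All names of variables and arrays in the program are smaller than `M`. -/
def Cmd.Below (M : ℕ) : Cmd → Prop
  | skip => True
  | assign x e => x < M ∧ e.Below M
  | write a i e => a < M ∧ i.Below M ∧ e.Below M
  | rand x => x < M
  | seq c₁ c₂ => c₁.Below M ∧ c₂.Below M
  | cond e c₁ c₂ => e.Below M ∧ c₁.Below M ∧ c₂.Below M
  | loop e c => e.Below M ∧ c.Below M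

theorem Expr.Below.mono {M M' : ℕ} (h : M ≤ M') : ∀ {e : Expr}, e.Below M → e.Below M'
  | lit _, _ => trivial
  | var _, hx => lt_of_lt_of_le hx h
  | read _ _, hx => ⟨lt_of_lt_of_le hx.1 h, hx.2.mono h⟩
  | op _ _ _, hx => ⟨hx.1.mono h, hx.2.mono h⟩

theorem Cmd.Below.mono {M M' : ℕ} (h : M ≤ M') : ∀ {c : Cmd}, c.Below M → c.Below M'
  | skip, _ => trivial
  | assign _ _, hx => ⟨lt_of_lt_of_le hx.1 h, hx.2.mono h⟩
  | write _ _ _, hx => ⟨lt_of_lt_of_le hx.1 h, hx.2.1.mono h, hx.2.2.mono h⟩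
  | rand _, hx => lt_of_lt_of_le hx h
  | seq _ _, hx => ⟨hx.1.mono h, hx.2.mono h⟩
  | cond _ _ _, hx => ⟨hx.1.mono h, hx.2.1.mono h, hx.2.2.mono h⟩
  | loop _ _, hx => ⟨hx.1.mono h, hx.2.mono h⟩

theorem Expr.exists_below (e : Expr) : ∃ M, e.Below M := by
  induction e with
  | lit k => exact ⟨0, trivial⟩
  | var x => exact ⟨x + 1, Nat.lt_succ_self x⟩
  | read a i hi =>
    obtain ⟨M, hM⟩ := hi
    exact ⟨max M (a + 1), lt_max_of_lt_right (Nat.lt_succ_self a), hM.mono (le_max_left _ _)⟩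
  | op o e₁ e₂ h₁ h₂ =>
    obtain ⟨M₁, h₁⟩ := h₁
    obtain ⟨M₂, h₂⟩ := h₂
    exact ⟨max M₁ M₂, h₁.mono (le_max_left _ _), h₂.mono (le_max_right _ _)⟩

theorem Cmd.exists_below (c : Cmd) : ∃ M, c.Below M := by
  induction c with
  | skip => exact ⟨0, trivial⟩
  | assign x e =>
    obtain ⟨M, hM⟩ := e.exists_below
    exact ⟨max M (x + 1), lt_max_of_lt_right (Nat.lt_succ_self x), hM.mono (le_max_left _ _)⟩
  | write a i e =>
    obtain ⟨M₁, h₁⟩ := i.exists_below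
    obtain ⟨M₂, h₂⟩ := e.exists_below
    exact ⟨max (max M₁ M₂) (a + 1), lt_max_of_lt_right (Nat.lt_succ_self a),
      h₁.mono (le_max_of_le_left (le_max_left _ _)), h₂.mono (le_max_of_le_left (le_max_right _ _))⟩
  | rand x => exact ⟨x + 1, Nat.lt_succ_self x⟩
  | seq c₁ c₂ h₁ h₂ =>
    obtain ⟨M₁, h₁⟩ := h₁
    obtain ⟨M₂, h₂⟩ := h₂
    exact ⟨max M₁ M₂, h₁.mono (le_max_left _ _), h₂.mono (le_max_right _ _)⟩
  | cond e c₁ c₂ h₁ h₂ =>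
    obtain ⟨M₀, h₀⟩ := e.exists_below
    obtain ⟨M₁, h₁⟩ := h₁
    obtain ⟨M₂, h₂⟩ := h₂
    exact ⟨max M₀ (max M₁ M₂), h₀.mono (le_max_left _ _),
      h₁.mono (le_max_of_le_right (le_max_left _ _)), h₂.mono (le_max_of_le_right (le_max_right _ _))⟩
  | loop e c h =>
    obtain ⟨M₀, h₀⟩ := e.exists_below
    obtain ⟨M₁, h₁⟩ := h
    exact ⟨max M₀ M₁, h₀.mono (le_max_left _ _), h₁.mono (le_max_right _ _)⟩

/-- `φ` changes only memory outside the names below `M`, possibly the read-only array `2`, and shifts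
the clock; it leaves array `2` alone on states in which that array is `β`. -/
structure IsFrame {w : ℕ} (M : ℕ) (β : BitVec w → BitVec w) (φ : MState w → MState w) : Prop where
  tick : ∀ s, φ s.tick = (φ s).tick
  setVar : ∀ s x v, x < M → φ (s.setVar x v) = (φ s).setVar x v
  setCell : ∀ s a i v, a < M → a ≠ 2 → s.arr 2 = β → φ (s.setCell a i v) = (φ s).setCell a i v
  var : ∀ s x, x < M → (φ s).var x = s.var x
  arr : ∀ s a, a < M → s.arr 2 = β → (φ s).arr a = s.arr a

theorem Expr.eval_frame {w M : ℕ} {β : BitVec w → BitVec w} {φ : MState w → MState w}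
    (h : IsFrame M β φ) {s : MState w} (hs : s.arr 2 = β) :
    ∀ {e : Expr}, e.Below M → e.eval (φ s) = e.eval s
  | lit _, _ => rfl
  | var x, hx => h.var s x hx
  | read a i, hx => by
    simp only [eval]
    rw [eval_frame h hs hx.2, h.arr s a hx.1 hs]
  | op o e₁ e₂, hx => by
    simp only [eval]
    rw [eval_frame h hs hx.1, eval_frame h hs hx.2]

/-- A program commutes with every change of memory that it cannot notice. This separates the
procedures of the data structure from the memory of the user, and also shows that programs are
insensitive to the clock. The condition that array `2` is `β` survives the run because the program
never writes to this array. -/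
theorem Cmd.exp_frame {w M : ℕ} {β : BitVec w → BitVec w} {φ : MState w → MState w}
    (h : IsFrame M β φ) (c : Cmd) : c.Below M → c.NeverWrites 2 →
    ∀ (f f' : MState w → ℝ≥0∞), (∀ t, t.arr 2 = β → f (φ t) = f' t) →
    ∀ s, s.arr 2 = β → c.exp f (φ s) = c.exp f' s := by
  induction c with
  | skip =>
    intro _ _ f f' hf s hs
    simp only [exp]
    rw [← h.tick]
    exact hf _ hs
  | assign x e =>
    intro hb _ f f' hf s hs
    simp only [exp]
    rw [← h.tick, ← h.setVar _ _ _ hb.1, e.eval_frame h hs hb.2]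
    exact hf _ hs
  | write a i e =>
    intro hb hn f f' hf s hs
    simp only [exp]
    rw [← h.tick, i.eval_frame h hs hb.2.1, e.eval_frame h hs hb.2.2,
      ← h.setCell _ _ _ _ hb.1 hn (show s.tick.arr 2 = β from hs)]
    refine hf _ ?_
    have hn' : (2 : ℕ) ≠ a := Ne.symm hn
    simp [MState.setCell, MState.setArr, MState.tick, hn', hs]
  | rand x =>
    intro hb _ f f' hf s hs
    simp only [exp]
    congr 1
    refine Finset.sum_congr rfl fun k _ => ?_
    rw [← h.tick, ← h.setVar _ _ _ hb]
    exact hf _ hs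
  | seq c₁ c₂ h₁ h₂ =>
    intro hb hn f f' hf s hs
    simp only [exp]
    exact h₁ hb.1 hn.1 _ _ (fun t ht => h₂ hb.2 hn.2 _ _ hf t ht) s hs
  | cond e c₁ c₂ h₁ h₂ =>
    intro hb hn f f' hf s hs
    simp only [exp]
    rw [e.eval_frame h hs hb.1, ← h.tick]
    split_ifs
    · exact h₁ hb.2.1 hn.1 _ _ hf _ hs
    · exact h₂ hb.2.2 hn.2 _ _ hf _ hs
  | loop e c hc =>
    intro hb hn f f' hf s hs
    rw [exp_loop_eq_iSup, exp_loop_eq_iSup]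
    refine iSup_congr fun n => ?_
    induction n generalizing s with
    | zero => rfl
    | succ n ih =>
      rw [Function.iterate_succ_apply', Function.iterate_succ_apply']
      simp only [loopStep]
      rw [e.eval_frame h hs hb.1, ← h.tick]
      split_ifs
      · exact hc hb.2 hn _ _ ih _ hs
      · exact hf _ hs

/-! ## Sequences of operations -/

/-- The set of deleted vertices after a sequence of operations. -/
def finalFail {N w : ℕ} : List (Fin N) → List (FailureOp N w) → List (Fin N)
  | F, [] => F
  | _, .fail F' _ :: ops => finalFail F' ops
  | F, .query _ _ :: ops => finalFail F ops

section Ops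

variable {N w : ℕ}

theorem finalFail_append (a b : List (FailureOp N w)) :
    ∀ F, finalFail F (a ++ b) = finalFail (finalFail F a) b := by
  induction a with
  | nil => intro F; rfl
  | cons o a ih => intro F; cases o <;> exact ih _

theorem numFails_append (a b : List (FailureOp N w)) :
    numFails (a ++ b) = numFails a + numFails b := by
  induction a with
  | nil => simp [numFails]
  | cons o a ih => cases o <;> simp [numFails, ih]; omega

theorem numQueries_append (a b : List (FailureOp N w)) :
    numQueries (a ++ b) = numQueries a + numQueries b := by
  induction a with
  | nil => simp [numQueries]
  | cons o a ih => cases o <;> simp [numQueries, ih]; omega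

theorem eq_nil_of_num_eq_zero {a : List (FailureOp N w)} (h : numFails a = 0)
    (h' : numQueries a = 0) : a = [] := by
  cases a with
  | nil => rfl
  | cons o a => cases o <;> simp [numFails, numQueries] at h h'

theorem LegalOps.append {d : ℕ} {a b : List (FailureOp N w)} :
    ∀ {F}, LegalOps d F a → LegalOps d (finalFail F a) b → LegalOps d F (a ++ b) := by
  induction a with
  | nil => intro F _ h; exact h
  | cons o a ih =>
    intro F h h'
    cases o with
    | fail F' c => exact ⟨h.1, h.2.1, ih h.2.2 h'⟩
    | query u v => exact ⟨h.1, h.2.1, ih h.2.2 h'⟩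

namespace FailureOracle

variable (D : FailureOracle)

theorem opsExp_append (a b : List (FailureOp N w)) (f : MState w → ℝ≥0∞) :
    D.opsExp (a ++ b) f = D.opsExp a (D.opsExp b f) := by
  induction a with
  | nil => rfl
  | cons o a ih => cases o <;> simp only [List.cons_append, opsExp, ih]

theorem opsErrors_append (G : SimpleGraph (Fin N)) (a b : List (FailureOp N w)) :
    ∀ F t, D.opsErrors G F (a ++ b) t
      = D.opsErrors G F a t + D.opsExp a (D.opsErrors G (finalFail F a) b) t := by
  induction a with
  | nil => intro F t; simp [opsErrors, opsExp, finalFail]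
  | cons o a ih =>
    intro F t
    cases o with
    | fail F' c =>
      simp only [List.cons_append, opsErrors, opsExp, finalFail, ← Cmd.exp_add, ← ih]
    | query u v =>
      simp only [List.cons_append, opsErrors, opsExp, finalFail, ← Cmd.exp_add]
      congr 1
      funext t
      rw [ih, add_assoc]

/-- Almost sure reasoning: where `g` is the expected number of errors of later operations and its
expectation is `0`, values of `f` at states with `g` nonzero are irrelevant. -/
theorem opsExp_congr {f f' g : MState w → ℝ≥0∞} (h : ∀ t, g t = 0 → f t = f' t)
    (a : List (FailureOp N w)) : ∀ t, D.opsExp a g t = 0 → D.opsExp a f t = D.opsExp a f' t := by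
  induction a with
  | nil => exact h
  | cons o a ih =>
    intro t ht
    cases o with
    | fail F c => exact Cmd.exp_congr_of_exp_eq_zero _ ht ih
    | query u v => exact Cmd.exp_congr_of_exp_eq_zero _ ht ih

theorem opsExp_le_one {f : MState w → ℝ≥0∞} (h : ∀ t, f t ≤ 1)
    (a : List (FailureOp N w)) : ∀ t, D.opsExp a f t ≤ 1 := by
  induction a with
  | nil => exact h
  | cons o a ih => cases o <;> exact fun t => Cmd.exp_le_one _ ih _

theorem opsExp_add (f g : MState w → ℝ≥0∞) (a : List (FailureOp N w)) :
    ∀ t, D.opsExp a (fun t => f t + g t) t = D.opsExp a f t + D.opsExp a g t := by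
  induction a with
  | nil => exact fun t => rfl
  | cons o a ih => 
    intro t
    cases o <;> simp only [opsExp, ← Cmd.exp_add, funext ih] 

theorem opsExp_const_mul (x : ℝ≥0∞) (f : MState w → ℝ≥0∞) (a : List (FailureOp N w)) :
    ∀ t, D.opsExp a (fun t => x * f t) t = x * D.opsExp a f t := by
  induction a with
  | nil => exact fun t => rfl
  | cons o a ih => intro t; cases o <;> simp only [opsExp, ← Cmd.exp_const_mul, funext ih]

/-- All names in the procedures of `D` are smaller than `M`. -/
def Below (M : ℕ) : Prop := 3 ≤ M ∧ D.prep.Below M ∧ D.fail.Below M ∧ D.query.Below M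

theorem exists_below : ∃ M, D.Below M := by
  obtain ⟨M₁, h₁⟩ := D.prep.exists_below
  obtain ⟨M₂, h₂⟩ := D.fail.exists_below
  obtain ⟨M₃, h₃⟩ := D.query.exists_below
  exact ⟨3 + M₁ + M₂ + M₃, by omega, h₁.mono (by omega), h₂.mono (by omega), h₃.mono (by omega)⟩

end FailureOracle

end Ops

/-! ## A language for the user of the data structure

Expressions and programs over natural numbers; the names `0, 1, 2` denote the memory shared with the
data structure, and the other names are shifted by `M` to avoid the memory of the data structure. -/

/-- Binary operations; `wadd` is addition modulo `2 ^ w`, all others must not overflow. -/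
inductive NatOp where
  | add | sub | mul | div | mod | eq | lt | wadd

namespace NatOp

/-- The value of an operation on natural numbers. -/
def nat (w : ℕ) : NatOp → ℕ → ℕ → ℕ
  | add, x, y => x + y
  | sub, x, y => x - y
  | mul, x, y => x * y
  | div, x, y => x / y
  | mod, x, y => x % y
  | eq, x, y => if x = y then 1 else 0
  | lt, x, y => if x < y then 1 else 0
  | wadd, x, y => (x + y) % 2 ^ w

/-- The operation does not overflow. -/
def Ok (w : ℕ) : NatOp → ℕ → ℕ → Prop
  | add, x, y => x + y < 2 ^ w
  | sub, x, y => y ≤ x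
  | mul, x, y => x * y < 2 ^ w
  | _, _, _ => True

/-- The corresponding word operation. -/
def toWordOp : NatOp → WordOp
  | add => .add
  | sub => .sub
  | mul => .mul
  | div => .div
  | mod => .mod
  | eq => .eq
  | lt => .lt
  | wadd => .add

theorem eval_toWordOp {w : ℕ} (hw : 0 < w) (o : NatOp) {x y : ℕ} (hx : x < 2 ^ w) (hy : y < 2 ^ w)
    (h : o.Ok w x y) : o.toWordOp.eval (BitVec.ofNat w x) (BitVec.ofNat w y)
      = BitVec.ofNat w (o.nat w x y) ∧ o.nat w x y < 2 ^ w := by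
  have h1 : 1 < 2 ^ w := Nat.one_lt_two_pow hw.ne'
  have hx' : (BitVec.ofNat w x).toNat = x := by simp [Nat.mod_eq_of_lt hx]
  have hy' : (BitVec.ofNat w y).toNat = y := by simp [Nat.mod_eq_of_lt hy]
  cases o with
  | add => exact ⟨BitVec.ofNat_add_ofNat x y, h⟩
  | sub =>
    refine ⟨?_, lt_of_le_of_lt (Nat.sub_le _ _) hx⟩
    apply BitVec.eq_of_toNat_eq
    simp only [toWordOp, WordOp.eval, nat, BitVec.toNat_sub, hx', hy']
    have hyx : y ≤ x := h
    rw [show 2 ^ w - y + x = x - y + 2 ^ w by omega, Nat.add_mod_right]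
    simp
  | mul => exact ⟨BitVec.ofNat_mul_ofNat x y, h⟩
  | div =>
    refine ⟨?_, lt_of_le_of_lt (Nat.div_le_self _ _) hx⟩
    apply BitVec.eq_of_toNat_eq
    simp only [toWordOp, WordOp.eval, nat, BitVec.toNat_udiv, hx', hy']
    simp [Nat.mod_eq_of_lt (lt_of_le_of_lt (Nat.div_le_self x y) hx)]
  | mod =>
    refine ⟨?_, lt_of_le_of_lt (Nat.mod_le _ _) hx⟩
    apply BitVec.eq_of_toNat_eq
    simp only [toWordOp, WordOp.eval, nat, BitVec.toNat_umod, hx', hy']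
    simp [Nat.mod_eq_of_lt (lt_of_le_of_lt (Nat.mod_le x y) hx)]
  | eq =>
    simp only [toWordOp, WordOp.eval, nat, ← BitVec.toNat_inj, hx', hy']
    split_ifs <;> simp [h1, BitVec.ofNat_eq_ofNat]
  | lt =>
    simp only [toWordOp, WordOp.eval, nat, hx', hy']
    split_ifs <;> simp [h1, BitVec.ofNat_eq_ofNat]
  | wadd =>
    refine ⟨?_, Nat.mod_lt _ (by positivity)⟩
    apply BitVec.eq_of_toNat_eq
    simp [toWordOp, WordOp.eval, nat]

end NatOp

/-- Expressions over natural numbers. -/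
inductive NatExpr where
  | lit (k : ℕ)
  | var (x : ℕ)
  | read (a : ℕ) (i : NatExpr)
  | op (o : NatOp) (e₁ e₂ : NatExpr)

/-- The memory of the user, as natural numbers, together with a clock and a record of the dealings
with the data structure: the current set `F` of deleted vertices, the contents `fz` of the array `2` at
the time of its deletion, the numbers `nf` and `nq` of deletions and queries. -/
structure UState (N : ℕ) where
  v : ℕ → ℕ
  a : ℕ → ℕ → ℕ
  time : ℕ
  F : List (Fin N)
  fz : ℕ → ℕ
  nf : ℕ
  nq : ℕ

namespace UState

variable {N : ℕ}

def tick (σ : UState N) : UState N := { σ with time := σ.time + 1 }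

/-- Assign a variable, in one step. -/
def set (σ : UState N) (x n : ℕ) : UState N :=
  { σ with v := fun y => if y = x then n else σ.v y, time := σ.time + 1 }

/-- Write an array cell, in one step. -/
def put (σ : UState N) (b i n : ℕ) : UState N :=
  { σ with a := fun y j => if y = b ∧ j = i then n else σ.a y j, time := σ.time + 1 }

/-- Delete the vertices in `F`. -/
def delete (σ : UState N) (F : List (Fin N)) : UState N :=
  { σ with F := F, fz := σ.a 2, nf := σ.nf + 1 }

/-- Count a query. -/
def ask (σ : UState N) : UState N := { σ with nq := σ.nq + 1, time := σ.time + 2 }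

/-- All numbers in the memory fit into words. -/
def Bd (w : ℕ) (σ : UState N) : Prop := (∀ x, σ.v x < 2 ^ w) ∧ ∀ y i, σ.a y i < 2 ^ w

end UState

namespace NatExpr

variable {N : ℕ}

def nat (w : ℕ) (σ : UState N) : NatExpr → ℕ
  | lit k => k
  | var x => σ.v x
  | read a i => σ.a a (i.nat w σ)
  | op o e₁ e₂ => o.nat w (e₁.nat w σ) (e₂.nat w σ)

/-- The evaluation does not overflow and, unless `pre` holds, does not use the shared memory (except
for the array `2`). -/
def Ok (pre : Bool) (w : ℕ) (σ : UState N) : NatExpr → Prop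
  | lit k => k < 2 ^ w
  | var x => pre ∨ 3 ≤ x
  | read a i => (pre ∨ 2 ≤ a) ∧ i.Ok pre w σ
  | op o e₁ e₂ => e₁.Ok pre w σ ∧ e₂.Ok pre w σ ∧ o.Ok w (e₁.nat w σ) (e₂.nat w σ)

end NatExpr

/-- The names on the machine of the names of the user. -/
def machName (M k : ℕ) : ℕ := if k < 3 then k else M + k

/-- Inverse of `machName`. -/
def userName (M x : ℕ) : ℕ := if x < 3 then x else x - M

def NatExpr.compile (M : ℕ) : NatExpr → Expr
  | lit k => .lit k
  | var x => .var (machName M x)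
  | read a i => .read (machName M a) (i.compile M)
  | op o e₁ e₂ => .op o.toWordOp (e₁.compile M) (e₂.compile M)

/-- The variables which belong to the user: after the preprocessing (`pre = false`), those with large
names only. -/
def UserVar (M : ℕ) (pre : Bool) (x : ℕ) : Prop := (pre ∧ x < 3) ∨ M + 3 ≤ x

/-- The arrays which belong to the user. -/
def UserArr (M : ℕ) (pre : Bool) (x : ℕ) : Prop := UserVar M pre x ∨ x = 2

open Classical in
/-- The machine state which consists of the memory of the user and of the rest of the memory `t`. -/
noncomputable def UState.load {N w : ℕ} (M : ℕ) (pre : Bool) (σ : UState N) (t : MState w) :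
    MState w where
  var x := if UserVar M pre x then BitVec.ofNat w (σ.v (userName M x)) else t.var x
  arr y i := if UserArr M pre y then BitVec.ofNat w (σ.a (userName M y) i.toNat) else t.arr y i
  clock := σ.time + t.clock

section Load

variable {N w M : ℕ} {pre : Bool} (σ : UState N) (t : MState w)

theorem userName_machName (k : ℕ) : userName M (machName M k) = k := by
  unfold userName machName; split_ifs <;> omega

theorem userVar_machName {k : ℕ} (h : pre ∨ 3 ≤ k) : UserVar M pre (machName M k) := by
  unfold UserVar machName
  split_ifs with hk
  · exact Or.inl ⟨h.resolve_right (by omega), hk⟩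
  · exact Or.inr (by omega)

theorem userArr_machName {k : ℕ} (h : pre ∨ 2 ≤ k) : UserArr M pre (machName M k) := by
  by_cases hk : k = 2
  · exact Or.inr (by simp [hk, machName])
  · exact Or.inl (userVar_machName (h.imp_right fun h => by omega))

theorem machName_userName {x : ℕ} (h : UserVar M pre x) :
    machName M (userName M x) = x := by
  unfold UserVar at h; unfold userName machName
  split_ifs <;> omega

theorem machName_userName' {x : ℕ} (h : UserArr M pre x) :
    machName M (userName M x) = x := by
  rcases h with h | rfl
  · exact machName_userName h
  · rfl

theorem load_tick : (σ.load M pre t).tick = σ.tick.load M pre t := by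
  simp only [UState.load, MState.tick, UState.tick, MState.mk.injEq, true_and]
  omega

theorem load_var {k : ℕ} (h : pre ∨ 3 ≤ k) :
    (σ.load M pre t).var (machName M k) = BitVec.ofNat w (σ.v k) := by
  simp [UState.load, userVar_machName h, userName_machName k]

theorem load_arr {k : ℕ} (h : pre ∨ 2 ≤ k) (i : BitVec w) :
    (σ.load M pre t).arr (machName M k) i = BitVec.ofNat w (σ.a k i.toNat) := by
  simp [UState.load, userArr_machName h, userName_machName k]

theorem load_set {k : ℕ} (h : pre ∨ 3 ≤ k) (n : ℕ) :
    (σ.load M pre t).tick.setVar (machName M k) (BitVec.ofNat w n) = (σ.set k n).load M pre t := by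
  simp only [UState.load, MState.tick, UState.set, MState.setVar, MState.mk.injEq, true_and]
  refine ⟨funext fun x => ?_, by omega⟩
  rw [Function.update_apply]
  by_cases hx : x = machName M k
  · subst hx
    simp [userVar_machName h, userName_machName k]
  · rw [if_neg hx]
    split_ifs with h1 h2
    · exact absurd (by rw [← h2, machName_userName h1]) hx
    · rfl
    · rfl

theorem load_put {k : ℕ} (h : pre ∨ 2 ≤ k) {i : ℕ} (hi : i < 2 ^ w) (n : ℕ) :
    (σ.load M pre t).tick.setCell (machName M k) (BitVec.ofNat w i) (BitVec.ofNat w n)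
      = (σ.put k i n).load M pre t := by
  simp only [UState.load, MState.tick, UState.put, MState.setCell, MState.setArr, MState.mk.injEq,
    true_and]
  refine ⟨funext fun x => ?_, by omega⟩
  rw [Function.update_apply]
  by_cases hx : x = machName M k
  · subst hx
    funext j
    have hj : j = BitVec.ofNat w i ↔ j.toNat = i := by
      rw [← BitVec.toNat_inj]; simp [Nat.mod_eq_of_lt hi]
    simp only [userArr_machName h, userName_machName k, if_true, true_and, Function.update_apply,
      hj]
    split_ifs <;> rfl
  · rw [if_neg hx]
    funext j
    split_ifs with h1 h2
    · exact absurd (by rw [← h2.1, machName_userName' h1]) hx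
    · rfl
    · rfl

/-- Absence of overflow makes word arithmetic agree with arithmetic in `ℕ`, so that user programs
can be verified over the natural numbers. -/
theorem NatExpr.eval_compile (hw : 0 < w) (hσ : σ.Bd w) :
    ∀ {e : NatExpr}, e.Ok pre w σ →
      (e.compile M).eval (σ.load M pre t) = BitVec.ofNat w (e.nat w σ) ∧ e.nat w σ < 2 ^ w
  | lit k, h => ⟨rfl, h⟩
  | var x, h => ⟨load_var σ t h, hσ.1 x⟩
  | read a i, h => by
    obtain ⟨h1, h2⟩ := eval_compile hw hσ h.2
    refine ⟨?_, hσ.2 _ _⟩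
    simp only [compile, Expr.eval, h1, load_arr σ t h.1, nat]
    simp [Nat.mod_eq_of_lt h2]
  | op o e₁ e₂, h => by
    obtain ⟨h1, h2⟩ := eval_compile hw hσ h.1
    obtain ⟨h3, h4⟩ := eval_compile hw hσ h.2.1
    simp only [compile, Expr.eval, h1, h3, nat]
    exact o.eval_toWordOp hw h2 h4 h.2.2

theorem NatExpr.eval_compile_ne_zero (hw : 0 < w) (hσ : σ.Bd w) {e : NatExpr}
    (h : e.Ok pre w σ) : (e.compile M).eval (σ.load M pre t) ≠ 0 ↔ e.nat w σ ≠ 0 := by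
  obtain ⟨h1, h2⟩ := eval_compile σ t hw hσ h
  rw [h1, not_iff_not, ← BitVec.toNat_inj]
  simp [Nat.mod_eq_of_lt h2]

end Load

/-- Programs of the user. `query e₁ e₂ x` stores the answer to a query in `x`. -/
inductive Prog where
  | skip
  | assign (x : ℕ) (e : NatExpr)
  | write (a : ℕ) (i e : NatExpr)
  | seq (p q : Prog)
  | ite (e : NatExpr) (p q : Prog)
  | loop (e : NatExpr) (p : Prog)
  | fail (e : NatExpr)
  | query (e₁ e₂ : NatExpr) (x : ℕ)

namespace Prog

def compile (D : FailureOracle) (M : ℕ) : Prog → Cmd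
  | skip => .skip
  | assign x e => .assign (machName M x) (e.compile M)
  | write a i e => .write (machName M a) (i.compile M) (e.compile M)
  | seq p q => .seq (p.compile D M) (q.compile D M)
  | ite e p q => .cond (e.compile M) (p.compile D M) (q.compile D M)
  | loop e p => .loop (e.compile M) (p.compile D M)
  | fail e => .seq (.assign 0 (e.compile M)) D.fail
  | query e₁ e₂ x => .seq (.assign 0 (e₁.compile M)) (.seq (.assign 1 (e₂.compile M))
      (.seq D.query (.assign (machName M x) (.var 0))))

open Classical in
/-- Weakest preconditions for total correctness, when all queries are answered correctly. -/
def wp {N : ℕ} (pre : Bool) (w : ℕ) (G : SimpleGraph (Fin N)) (d : ℕ) :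
    Prog → (UState N → Prop) → UState N → Prop
  | skip, Q, σ => Q σ.tick
  | assign x e, Q, σ => e.Ok pre w σ ∧ (pre ∨ 3 ≤ x) ∧ Q (σ.set x (e.nat w σ))
  | write b i e, Q, σ => i.Ok pre w σ ∧ e.Ok pre w σ ∧ (pre ∨ 2 ≤ b) ∧
      Q (σ.put b (i.nat w σ) (e.nat w σ))
  | seq p q, Q, σ => p.wp pre w G d (q.wp pre w G d Q) σ
  | ite e p q, Q, σ => e.Ok pre w σ ∧
      if e.nat w σ ≠ 0 then p.wp pre w G d Q σ.tick else q.wp pre w G d Q σ.tick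
  -- Starting the iteration at the false predicate makes it part of the precondition that the loop
  -- is left after finitely many rounds.
  | loop e p, Q, σ => ∃ n : ℕ, (fun (X : UState N → Prop) (σ : UState N) => e.Ok pre w σ ∧
      if e.nat w σ ≠ 0 then p.wp pre w G d X σ.tick else Q σ.tick)^[n] (fun _ => False) σ
  | fail e, Q, σ => pre = false ∧ e.Ok pre w σ ∧ ∃ F : List (Fin N), F.Nodup ∧ F.length ≤ d ∧
      e.nat w σ = F.length ∧ (∀ i (h : i < F.length), σ.a 2 i = F[i]) ∧ Q (σ.tick.delete F)
  -- The condition on `fz` says that array `2` has its contents from the last deletion: sequences of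
  -- operations model only runs in which the user has not changed it when a query is asked.
  | query e₁ e₂ x, Q, σ => pre = false ∧ 3 ≤ x ∧ e₁.Ok pre w σ ∧ e₂.Ok pre w σ ∧
      (∀ i, σ.fz i = σ.a 2 i) ∧ ∃ u v : Fin N, e₁.nat w σ = u ∧ e₂.nat w σ = v ∧ u ∉ σ.F ∧
      v ∉ σ.F ∧ Q (σ.ask.set x (if ConnectedAvoiding G σ.F u v then 1 else 0))

end Prog

/-! ## Soundness -/

/-- The array `2` of the machine is as it was at the last deletion. -/
def UState.Compat {N w : ℕ} (σ : UState N) (t : MState w) : Prop :=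
  t.arr 2 = fun i => BitVec.ofNat w (σ.fz i.toNat)

/-- The program `c` leads from `σ` to `σ'` by performing a sequence of operations, as far as all queries
are answered correctly. -/
def Reach {N : ℕ} (D : FailureOracle) (M : ℕ) (pre : Bool) (w : ℕ) (G : SimpleGraph (Fin N)) (d : ℕ)
    (c : Cmd) (σ σ' : UState N) : Prop :=
  ∃ ops : List (FailureOp N w), σ'.F = finalFail σ.F ops ∧ σ'.nf = σ.nf + numFails ops ∧
    σ'.nq = σ.nq + numQueries ops ∧ LegalOps d σ.F ops ∧
    -- Here `t` is the memory as the data structure would have it without the user, whose memory is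
    -- laid over it by `load`. The sequence `ops` is chosen before `t`, hence independently of the
    -- random words drawn by the procedures.
    ∀ t : MState w, σ.Compat t → D.opsErrors G σ.F ops t = 0 →
      ∀ f g : MState w → ℝ≥0∞, (∀ t', σ'.Compat t' → f (σ'.load M pre t') = g t') →
        c.exp f (σ.load M pre t) = D.opsExp ops g t

namespace Reach

variable {N : ℕ} {D : FailureOracle} {M : ℕ} {pre : Bool} {w : ℕ} {G : SimpleGraph (Fin N)} {d : ℕ}

theorem of_exp_eq {c : Cmd} {σ σ' : UState N} (hF : σ'.F = σ.F) (hfz : σ'.fz = σ.fz)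
    (hnf : σ'.nf = σ.nf) (hnq : σ'.nq = σ.nq)
    (h : ∀ (t : MState w) f, c.exp f (σ.load M pre t) = f (σ'.load M pre t)) :
    Reach D M pre w G d c σ σ' := by
  refine ⟨[], hF, by simpa [numFails] using hnf, by simpa [numQueries] using hnq, trivial,
    fun t ht _ f g hfg => ?_⟩
  rw [h, hfg t (by simpa [UState.Compat, hfz] using ht)]
  rfl

theorem trans_exp {c c₁ c₂ : Cmd} {σ σ₁ σ₂ : UState N} (h₁ : Reach D M pre w G d c₁ σ σ₁)
    (h₂ : Reach D M pre w G d c₂ σ₁ σ₂)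
    (h : ∀ (t : MState w) f, c.exp f (σ.load M pre t) = c₁.exp (c₂.exp f) (σ.load M pre t)) :
    Reach D M pre w G d c σ σ₂ := by
  classical
  obtain ⟨a, hF, hnf, hnq, hl, ha⟩ := h₁
  obtain ⟨b, hF', hnf', hnq', hl', hb⟩ := h₂
  refine ⟨a ++ b, by rw [finalFail_append, ← hF, hF'], by rw [numFails_append]; omega,
    by rw [numQueries_append]; omega, hl.append (hF ▸ hl'), fun t ht he f g hfg => ?_⟩
  rw [D.opsErrors_append, add_eq_zero, ← hF] at he
  rw [h, D.opsExp_append]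
  -- The second program is known to simulate `b` only at states from which `b` makes no errors. At
  -- the others the intermediate function is defined by what the program does; they have probability
  -- zero.
  rw [ha t ht he.1 (c₂.exp f) (fun t' => if D.opsErrors G σ₁.F b t' = 0 then D.opsExp b g t' else
    c₂.exp f (σ₁.load M pre t')) ?_]
  · exact D.opsExp_congr (fun t' ht' => by simp [ht']) a t he.2
  · intro t' ht'
    split_ifs with h0
    · exact hb t' ht' h0 f g hfg
    · rfl

theorem trans {c₁ c₂ : Cmd} {σ σ₁ σ₂ : UState N} (h₁ : Reach D M pre w G d c₁ σ σ₁)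
    (h₂ : Reach D M pre w G d c₂ σ₁ σ₂) : Reach D M pre w G d (.seq c₁ c₂) σ σ₂ :=
  h₁.trans_exp h₂ fun _ _ => rfl

theorem of_tick {c c' : Cmd} {σ σ' : UState N} (h : Reach D M pre w G d c' σ.tick σ')
    (he : ∀ (t : MState w) f, c.exp f (σ.load M pre t) = c'.exp f (σ.tick.load M pre t)) :
    Reach D M pre w G d c σ σ' :=
  (of_exp_eq (c := .skip) rfl rfl rfl rfl fun t f => by
    rw [Cmd.exp, load_tick] : Reach D M pre w G d .skip σ σ.tick).trans_exp h fun t f => by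
      rw [he, Cmd.exp, load_tick]

end Reach

/-- The names of the user beyond the shared ones start at `M + 3`, above all names in the
procedures, so the overlay is invisible to them except for array `2`, which they only read. -/
theorem isFrame_load {N M w : ℕ} (σ : UState N) :
    IsFrame M (fun i => BitVec.ofNat w (σ.a 2 i.toNat)) (σ.load M false) := by
  have hv : ∀ x, x < M → ¬ UserVar M false x := fun x hx h => by
    simp only [UserVar] at h; simp at h; omega
  have ha : ∀ x, x < M → x ≠ 2 → ¬ UserArr M false x := fun x hx h2 h =>
    h.elim (hv x hx) h2
  constructor
  · intro s
    simp only [UState.load, MState.tick, MState.mk.injEq, true_and]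
    omega
  · intro s x u hx
    simp only [UState.load, MState.setVar, MState.mk.injEq, and_true]
    funext y
    simp only [Function.update_apply]
    by_cases hy : y = x
    · subst hy; simp [hv y hx]
    · simp [hy]
  · intro s a i u ha' h2 _
    simp only [UState.load, MState.setCell, MState.setArr, MState.mk.injEq, and_true, true_and]
    funext y
    by_cases hy : y = a
    · subst hy; simp [ha y ha' h2]
    · simp [hy]
  · intro s x hx
    simp [UState.load, hv x hx]
  · intro s a ha' hs
    by_cases h2 : a = 2
    · subst h2
      rw [hs]
      simp [UState.load, UserArr, userName]
    · simp [UState.load, ha a ha' h2]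

theorem failInput_eq {w N : ℕ} (F : List (Fin N)) (b : BitVec w → BitVec w) (s : MState w) :
    failInput F b s
      = (s.setVar 0 (BitVec.ofNat w F.length)).setArr 2 (withPrefix (F.map Fin.val) b) := by
  rw [failInput, List.map_id']
  congr 2
  exact List.flatMap_pure_eq_map _ _

section Sound

variable {N : ℕ} {D : FailureOracle} {M : ℕ} {pre : Bool} {w : ℕ} {G : SimpleGraph (Fin N)} {d : ℕ}

theorem UState.Bd.tick {σ : UState N} (h : σ.Bd w) : σ.tick.Bd w := h

theorem UState.Bd.set {σ : UState N} (h : σ.Bd w) {x n : ℕ} (hn : n < 2 ^ w) : (σ.set x n).Bd w := by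
  refine ⟨fun y => ?_, h.2⟩
  simp only [UState.set]
  split_ifs
  · exact hn
  · exact h.1 y

theorem UState.Bd.put {σ : UState N} (h : σ.Bd w) {b i n : ℕ} (hn : n < 2 ^ w) :
    (σ.put b i n).Bd w := by
  refine ⟨h.1, fun y j => ?_⟩
  simp only [UState.put]
  split_ifs
  · exact hn
  · exact h.2 y j

theorem reach_fail (hD : D.Below M) (hw : 0 < w) {σ : UState N} (hσ : σ.Bd w) {e : NatExpr}
    (he : e.Ok false w σ) {F : List (Fin N)} (hn : F.Nodup) (hd : F.length ≤ d)
    (hl : e.nat w σ = F.length) (ha : ∀ i (h : i < F.length), σ.a 2 i = F[i]) :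
    Reach D M false w G d ((Prog.fail e).compile D M) σ (σ.tick.delete F) := by
  set b : BitVec w → BitVec w := fun i => BitVec.ofNat w (σ.a 2 i.toNat) with hb
  -- The user has already written `F` to the front of the array, so passing `F` with the current
  -- array as its continuation changes nothing.
  have hbF : withPrefix (F.map Fin.val) b = b := by
    funext i
    unfold withPrefix
    split_ifs with h
    · rw [List.length_map] at h
      rw [List.getElem_map, ← ha _ h]
    · rfl
  refine ⟨[.fail F b], rfl, rfl, rfl, ⟨hn, hd, trivial⟩, fun t ht _ f g hfg => ?_⟩
  simp only [Prog.compile, Cmd.exp, FailureOracle.opsExp]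
  rw [(e.eval_compile σ t hw hσ he).1, hl]
  have h1 : (σ.load M false t).tick.setVar 0 (BitVec.ofNat w F.length)
      = σ.tick.load M false (failInput F b t) := by
    have h0 : ¬ UserVar M false 0 := by simp [UserVar]
    rw [failInput_eq, hbF]
    simp only [UState.load, MState.tick, UState.tick, MState.setVar, MState.setArr, MState.mk.injEq]
    refine ⟨?_, ?_, by omega⟩
    · funext x
      by_cases hx : x = 0
      · subst hx; simp [h0]
      · simp [hx]
    · funext y i
      by_cases hy : y = 2
      · subst hy; simp [UserArr]
      · simp [hy]
  rw [h1]
  refine Cmd.exp_frame (isFrame_load σ.tick) D.fail hD.2.2.1 D.fail_readOnly _ _ ?_ _ ?_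
  · intro t' ht'
    rw [← hfg t' ht']
    rfl
  · simp only [failInput_eq, hbF, MState.setArr, Function.update_self]
    rfl

open Classical in
theorem reach_query (hD : D.Below M) (hw : 0 < w) {σ : UState N} (hσ : σ.Bd w) {e₁ e₂ : NatExpr}
    {x : ℕ} (hx : 3 ≤ x) (he₁ : e₁.Ok false w σ) (he₂ : e₂.Ok false w σ) {u v : Fin N}
    (hfz : ∀ i, σ.fz i = σ.a 2 i) (hu : e₁.nat w σ = u) (hv : e₂.nat w σ = v) (hu' : u ∉ σ.F)
    (hv' : v ∉ σ.F) :
    Reach D M false w G d ((Prog.query e₁ e₂ x).compile D M) σ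
      (σ.ask.set x (if ConnectedAvoiding G σ.F u v then 1 else 0)) := by
  refine ⟨[.query u v], rfl, rfl, rfl, ⟨hu', hv', trivial⟩, fun t ht he f g hfg => ?_⟩
  have h0 : ¬ UserVar M false 0 := by simp [UserVar]
  have h1 : ¬ UserVar M false 1 := by simp [UserVar]
  have hset : ∀ (n : ℕ) (k : ℕ) (t : MState w) (σ : UState N), k < 2 →
      (σ.load M false t).tick.setVar k (BitVec.ofNat w n)
        = σ.tick.load M false (t.setVar k (BitVec.ofNat w n)) := by
    intro n k t σ hk
    have hk' : ¬ UserVar M false k := by simp [UserVar]; omega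
    simp only [UState.load, MState.tick, UState.tick, MState.setVar, MState.mk.injEq]
    refine ⟨?_, trivial, by omega⟩
    funext y
    by_cases hy : y = k
    · subst hy; simp [hk']
    · simp [hy]
  have hσ' : σ.tick.Bd w := hσ
  have he₂' : e₂.Ok false w σ.tick := by
    have : ∀ e : NatExpr, e.nat w σ.tick = e.nat w σ := fun e => by
      induction e <;> simp_all [NatExpr.nat, UState.tick]
    clear hv
    induction e₂ with
    | lit k => exact he₂
    | var x => exact he₂
    | read a i hi => exact ⟨he₂.1, hi he₂.2⟩
    | op o e₁ e₂ h₁ h₂ =>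
      refine ⟨h₁ he₂.1, h₂ he₂.2.1, ?_⟩
      rw [this, this]
      exact he₂.2.2
  have hv2 : e₂.nat w σ.tick = v := by
    rw [← hv]
    clear hv he₂ he₂'
    induction e₂ <;> simp_all [NatExpr.nat, UState.tick]
  simp only [Prog.compile, Cmd.exp, FailureOracle.opsExp]
  rw [(e₁.eval_compile σ t hw hσ he₁).1, hu, hset _ _ _ _ (by norm_num),
    (e₂.eval_compile σ.tick _ hw hσ' he₂').1, hv2, hset _ _ _ _ (by norm_num)]
  have hc : ((t.setVar 0 (BitVec.ofNat w u)).setVar 1 (BitVec.ofNat w v)).arr 2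
      = fun i => BitVec.ofNat w (σ.a 2 i.toNat) := by
    have : t.arr 2 = fun i => BitVec.ofNat w (σ.fz i.toNat) := ht
    simp only [MState.setVar, this, hfz]
  -- After the query the user's state depends on the word in variable `0`, which is inserted here as
  -- a number; that it is the correct answer is used only outside a set of probability zero. The
  -- `else` branch is never reached from states with the right array `2`; the value `g t'` makes the
  -- final comparison trivial there.
  rw [Cmd.exp_frame (isFrame_load (σ := σ.tick.tick)) D.query hD.2.2.2 D.query_readOnly _
    (fun t' => if t'.arr 2 = (fun i => BitVec.ofNat w (σ.a 2 i.toNat)) then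
      f ((σ.tick.tick.set x (t'.var 0).toNat).load M false t') else g t') ?_ _ hc]
  · simp only [FailureOracle.opsErrors, add_zero] at he
    refine Cmd.exp_congr_of_exp_eq_zero _ he fun t' ht' => ?_
    split_ifs with h2
    · rw [← hfg t']
      · have hans' : (t'.var 0).toNat = if ConnectedAvoiding G σ.F u v then 1 else 0 := ?_
        · rw [hans']
          rfl
        by_cases hans : ConnectedAvoiding G σ.F u v
        · simp only [hans, if_true, ite_eq_left_iff, one_ne_zero, imp_false, not_not] at ht' ⊢
          rw [ht']; simp [Nat.mod_eq_of_lt (Nat.one_lt_two_pow hw.ne')]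
        · simp only [hans, if_false, ite_eq_left_iff, one_ne_zero, imp_false, not_not] at ht' ⊢
          rw [ht']; simp
      · simp only [UState.Compat, UState.set, UState.ask, h2, hfz]
    · rfl
  · intro t' ht'
    refine Eq.trans ?_ (if_pos ht').symm
    have : (Expr.var 0).eval (σ.tick.tick.load M false t') = BitVec.ofNat w (t'.var 0).toNat := by
      simp [Expr.eval, UState.load, h0]
    rw [this, load_set _ _ (Or.inr hx)]

/-- User programs draw no random words, so correct answers determine the final state and the
operations performed. The induction collects these operations into one fixed sequence, to which the
amortized bounds apply; a loop contributes the concatenation over its finitely many rounds. -/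
theorem Prog.wp_sound (hD : D.Below M) (hw : 0 < w) (p : Prog) :
    ∀ {Q : UState N → Prop} {σ : UState N}, p.wp pre w G d Q σ → σ.Bd w →
      ∃ σ', Reach D M pre w G d (p.compile D M) σ σ' ∧ σ'.Bd w ∧ Q σ' := by
  induction p with
  | skip =>
    intro Q σ h hσ
    exact ⟨σ.tick, Reach.of_exp_eq rfl rfl rfl rfl fun t f => by rw [compile, Cmd.exp, load_tick],
      hσ, h⟩
  | assign x e =>
    intro Q σ h hσ
    refine ⟨_, Reach.of_exp_eq (σ' := σ.set x (e.nat w σ)) rfl rfl rfl rfl fun t f => ?_,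
      hσ.set (e.eval_compile (M := M) σ ⟨fun _ => 0, fun _ _ => 0, 0⟩ hw hσ h.1).2, h.2.2⟩
    rw [compile, Cmd.exp, (e.eval_compile σ t hw hσ h.1).1, load_set _ _ h.2.1]
  | write b i e =>
    intro Q σ h hσ
    obtain ⟨h1, h2, h3, h4⟩ := h
    refine ⟨_, Reach.of_exp_eq (σ' := σ.put b (i.nat w σ) (e.nat w σ)) rfl rfl rfl rfl
      fun t f => ?_, hσ.put (e.eval_compile (M := M) σ ⟨fun _ => 0, fun _ _ => 0, 0⟩ hw hσ h2).2, h4⟩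
    obtain ⟨h5, h6⟩ := i.eval_compile (M := M) σ t hw hσ h1
    rw [compile, Cmd.exp, (e.eval_compile σ t hw hσ h2).1, h5, load_put _ _ h3 h6]
  | seq p q hp hq =>
    intro Q σ h hσ
    obtain ⟨σ₁, hr, hb, h'⟩ := hp h hσ
    obtain ⟨σ₂, hr', hb', h''⟩ := hq h' hb
    exact ⟨σ₂, hr.trans hr', hb', h''⟩
  | ite e p q hp hq =>
    intro Q σ h hσ
    obtain ⟨h1, h2⟩ := h
    split_ifs at h2 with h3
    · obtain ⟨σ', hr, hb, hQ⟩ := hp h2 hσ.tick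
      refine ⟨σ', hr.of_tick fun t f => ?_, hb, hQ⟩
      rw [compile, Cmd.exp, if_pos ((e.eval_compile_ne_zero σ t hw hσ h1).2 h3), load_tick]
    · obtain ⟨σ', hr, hb, hQ⟩ := hq h2 hσ.tick
      refine ⟨σ', hr.of_tick fun t f => ?_, hb, hQ⟩
      rw [compile, Cmd.exp, if_neg (mt (e.eval_compile_ne_zero σ t hw hσ h1).1 h3), load_tick]
  | loop e p hp =>
    intro Q σ h hσ
    obtain ⟨n, h⟩ := h
    induction n generalizing σ with
    | zero => exact False.elim h
    | succ n ih =>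
      rw [Function.iterate_succ_apply'] at h
      obtain ⟨h1, h2⟩ := h
      split_ifs at h2 with h3
      · obtain ⟨σ₁, hr, hb, h'⟩ := hp h2 hσ.tick
        obtain ⟨σ₂, hr', hb', hQ⟩ := ih hb h'
        refine ⟨σ₂, (hr.trans hr').of_tick fun t f => ?_, hb', hQ⟩
        rw [compile, Cmd.exp_loop, if_pos ((e.eval_compile_ne_zero σ t hw hσ h1).2 h3), load_tick]
        rfl
      · refine ⟨σ.tick, Reach.of_exp_eq rfl rfl rfl rfl fun t f => ?_, hσ, h2⟩
        rw [compile, Cmd.exp_loop, if_neg (mt (e.eval_compile_ne_zero σ t hw hσ h1).1 h3), load_tick]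
  | fail e =>
    intro Q σ h hσ
    obtain ⟨rfl, he, F, hn, hd, hl, ha, hQ⟩ := h
    exact ⟨_, reach_fail hD hw hσ he hn hd hl ha, hσ, hQ⟩
  | query e₁ e₂ x =>
    intro Q σ h hσ
    obtain ⟨rfl, hx, he₁, he₂, hfz, u, v, hu, hv, hu', hv', hQ⟩ := h
    refine ⟨_, reach_query hD hw hσ hx he₁ he₂ hfz hu hv hu' hv', ?_, hQ⟩
    have h1 : 1 < 2 ^ w := Nat.one_lt_two_pow hw.ne'
    exact UState.Bd.set (σ := σ.ask) hσ (by split_ifs <;> omega)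

end Sound

/-! ## Reasoning about programs -/

namespace NatExpr

instance (n : ℕ) : OfNat NatExpr n := ⟨.lit n⟩
instance : Add NatExpr := ⟨.op .add⟩
instance : Sub NatExpr := ⟨.op .sub⟩
instance : Mul NatExpr := ⟨.op .mul⟩
instance : Div NatExpr := ⟨.op .div⟩
instance : Mod NatExpr := ⟨.op .mod⟩

/-- Comparison, with value `1` or `0`. -/
def lt (e₁ e₂ : NatExpr) : NatExpr := .op .lt e₁ e₂

/-- Equality test, with value `1` or `0`. -/
def eq (e₁ e₂ : NatExpr) : NatExpr := .op .eq e₁ e₂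

/-- Addition modulo `2 ^ w`. -/
def wadd (e₁ e₂ : NatExpr) : NatExpr := .op .wadd e₁ e₂

variable {N : ℕ} (pre : Bool) (w : ℕ) (σ : UState N) (a b : NatExpr) (n : ℕ)

@[simp] theorem nat_literal : (lit n).nat w σ = n := rfl
@[simp] theorem nat_ofNat : (ofNat(n) : NatExpr).nat w σ = n := rfl
@[simp] theorem nat_var : (var n).nat w σ = σ.v n := rfl
@[simp] theorem nat_read : (read n a).nat w σ = σ.a n (a.nat w σ) := rfl
@[simp] theorem nat_add : (a + b).nat w σ = a.nat w σ + b.nat w σ := rfl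
@[simp] theorem nat_sub : (a - b).nat w σ = a.nat w σ - b.nat w σ := rfl
@[simp] theorem nat_mul : (a * b).nat w σ = a.nat w σ * b.nat w σ := rfl
@[simp] theorem nat_div : (a / b).nat w σ = a.nat w σ / b.nat w σ := rfl
@[simp] theorem nat_mod : (a % b).nat w σ = a.nat w σ % b.nat w σ := rfl
@[simp] theorem nat_lt : (a.lt b).nat w σ = if a.nat w σ < b.nat w σ then 1 else 0 := rfl
@[simp] theorem nat_eq : (a.eq b).nat w σ = if a.nat w σ = b.nat w σ then 1 else 0 := rfl
@[simp] theorem nat_wadd : (a.wadd b).nat w σ = (a.nat w σ + b.nat w σ) % 2 ^ w := rfl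

@[simp] theorem ok_literal : (lit n).Ok pre w σ ↔ n < 2 ^ w := Iff.rfl
@[simp] theorem ok_ofNat : (ofNat(n) : NatExpr).Ok pre w σ ↔ n < 2 ^ w := Iff.rfl
@[simp] theorem ok_var : (var n).Ok pre w σ ↔ pre ∨ 3 ≤ n := Iff.rfl
@[simp] theorem ok_read : (read n a).Ok pre w σ ↔ (pre ∨ 2 ≤ n) ∧ a.Ok pre w σ := Iff.rfl
@[simp] theorem ok_add : (a + b).Ok pre w σ ↔
    a.Ok pre w σ ∧ b.Ok pre w σ ∧ a.nat w σ + b.nat w σ < 2 ^ w := Iff.rfl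
@[simp] theorem ok_sub : (a - b).Ok pre w σ ↔
    a.Ok pre w σ ∧ b.Ok pre w σ ∧ b.nat w σ ≤ a.nat w σ := Iff.rfl
@[simp] theorem ok_mul : (a * b).Ok pre w σ ↔
    a.Ok pre w σ ∧ b.Ok pre w σ ∧ a.nat w σ * b.nat w σ < 2 ^ w := Iff.rfl
@[simp] theorem ok_div : (a / b).Ok pre w σ ↔ a.Ok pre w σ ∧ b.Ok pre w σ :=
  ⟨fun h => ⟨h.1, h.2.1⟩, fun h => ⟨h.1, h.2, trivial⟩⟩
@[simp] theorem ok_mod : (a % b).Ok pre w σ ↔ a.Ok pre w σ ∧ b.Ok pre w σ :=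
  ⟨fun h => ⟨h.1, h.2.1⟩, fun h => ⟨h.1, h.2, trivial⟩⟩
@[simp] theorem ok_lt : (a.lt b).Ok pre w σ ↔ a.Ok pre w σ ∧ b.Ok pre w σ :=
  ⟨fun h => ⟨h.1, h.2.1⟩, fun h => ⟨h.1, h.2, trivial⟩⟩
@[simp] theorem ok_eq : (a.eq b).Ok pre w σ ↔ a.Ok pre w σ ∧ b.Ok pre w σ :=
  ⟨fun h => ⟨h.1, h.2.1⟩, fun h => ⟨h.1, h.2, trivial⟩⟩
@[simp] theorem ok_wadd : (a.wadd b).Ok pre w σ ↔ a.Ok pre w σ ∧ b.Ok pre w σ :=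
  ⟨fun h => ⟨h.1, h.2.1⟩, fun h => ⟨h.1, h.2, trivial⟩⟩

end NatExpr

namespace UState

variable {N : ℕ} (σ : UState N) (x y n i j : ℕ)

@[simp] theorem tick_v : σ.tick.v = σ.v := rfl
@[simp] theorem tick_a : σ.tick.a = σ.a := rfl
@[simp] theorem tick_time : σ.tick.time = σ.time + 1 := rfl
@[simp] theorem tick_F : σ.tick.F = σ.F := rfl
@[simp] theorem tick_fz : σ.tick.fz = σ.fz := rfl
@[simp] theorem tick_nf : σ.tick.nf = σ.nf := rfl
@[simp] theorem tick_nq : σ.tick.nq = σ.nq := rfl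
@[simp] theorem set_v : (σ.set x n).v y = if y = x then n else σ.v y := rfl
@[simp] theorem set_a : (σ.set x n).a = σ.a := rfl
@[simp] theorem set_time : (σ.set x n).time = σ.time + 1 := rfl
@[simp] theorem set_F : (σ.set x n).F = σ.F := rfl
@[simp] theorem set_fz : (σ.set x n).fz = σ.fz := rfl
@[simp] theorem set_nf : (σ.set x n).nf = σ.nf := rfl
@[simp] theorem set_nq : (σ.set x n).nq = σ.nq := rfl
@[simp] theorem put_v : (σ.put x i n).v = σ.v := rfl
@[simp] theorem put_a : (σ.put x i n).a y j = if y = x ∧ j = i then n else σ.a y j := rfl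
@[simp] theorem put_time : (σ.put x i n).time = σ.time + 1 := rfl
@[simp] theorem put_F : (σ.put x i n).F = σ.F := rfl
@[simp] theorem put_fz : (σ.put x i n).fz = σ.fz := rfl
@[simp] theorem put_nf : (σ.put x i n).nf = σ.nf := rfl
@[simp] theorem put_nq : (σ.put x i n).nq = σ.nq := rfl
@[simp] theorem ask_v : σ.ask.v = σ.v := rfl
@[simp] theorem ask_a : σ.ask.a = σ.a := rfl
@[simp] theorem ask_time : σ.ask.time = σ.time + 2 := rfl
@[simp] theorem ask_F : σ.ask.F = σ.F := rfl
@[simp] theorem ask_fz : σ.ask.fz = σ.fz := rfl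
@[simp] theorem ask_nf : σ.ask.nf = σ.nf := rfl
@[simp] theorem ask_nq : σ.ask.nq = σ.nq + 1 := rfl
variable (F : List (Fin N))
@[simp] theorem delete_v : (σ.delete F).v = σ.v := rfl
@[simp] theorem delete_a : (σ.delete F).a = σ.a := rfl
@[simp] theorem delete_time : (σ.delete F).time = σ.time := rfl
@[simp] theorem delete_F : (σ.delete F).F = F := rfl
@[simp] theorem delete_fz : (σ.delete F).fz = σ.a 2 := rfl
@[simp] theorem delete_nf : (σ.delete F).nf = σ.nf + 1 := rfl
@[simp] theorem delete_nq : (σ.delete F).nq = σ.nq := rfl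

end UState

infixr:30 " ;; " => Prog.seq

/-! ### Memory that a program cannot change, and rules for loops. -/

namespace Prog

/-- The variables that a program may change. -/
def modV : Prog → List ℕ
  | skip => []
  | assign x _ => [x]
  | write _ _ _ => []
  | seq p q => p.modV ++ q.modV
  | ite _ p q => p.modV ++ q.modV
  | loop _ p => p.modV
  | fail _ => []
  | query _ _ x => [x]

/-- The arrays that a program may change. -/
def modA : Prog → List ℕ
  | skip => []
  | assign _ _ => []
  | write b _ _ => [b]
  | seq p q => p.modA ++ q.modA
  | ite _ p q => p.modA ++ q.modA
  | loop _ p => p.modA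
  | fail _ => []
  | query _ _ _ => []

/-- The program does not call the data structure. -/
def local' : Prog → Bool
  | seq p q => p.local' && q.local'
  | ite _ p q => p.local' && q.local'
  | loop _ p => p.local'
  | fail _ => false
  | query _ _ _ => false
  | _ => true

end Prog

/-- The two states agree on everything that the program `p` cannot change. -/
structure UState.Agree {N : ℕ} (p : Prog) (σ σ' : UState N) : Prop where
  v : ∀ x, x ∉ p.modV → σ'.v x = σ.v x
  a : ∀ y, y ∉ p.modA → σ'.a y = σ.a y
  ghost : p.local' = true → σ'.F = σ.F ∧ σ'.fz = σ.fz ∧ σ'.nf = σ.nf ∧ σ'.nq = σ.nq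

namespace UState.Agree

variable {N : ℕ} {p q : Prog} {σ σ₁ σ₂ : UState N}

theorem refl (p : Prog) (σ : UState N) : σ.Agree p σ :=
  ⟨fun _ _ => rfl, fun _ _ => rfl, fun _ => ⟨rfl, rfl, rfl, rfl⟩⟩

theorem tick (h : σ.Agree p σ₁) : σ.Agree p σ₁.tick := ⟨h.v, h.a, h.ghost⟩

theorem trans (h : σ.Agree p σ₁) (h' : σ₁.Agree p σ₂) : σ.Agree p σ₂ :=
  ⟨fun x hx => (h'.v x hx).trans (h.v x hx), fun x hx => (h'.a x hx).trans (h.a x hx), fun hp =>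
    ⟨(h'.ghost hp).1.trans (h.ghost hp).1, (h'.ghost hp).2.1.trans (h.ghost hp).2.1,
      (h'.ghost hp).2.2.1.trans (h.ghost hp).2.2.1, (h'.ghost hp).2.2.2.trans (h.ghost hp).2.2.2⟩⟩

theorem mono (h : σ.Agree p σ₁) (hv : p.modV ⊆ q.modV) (ha : p.modA ⊆ q.modA)
    (hl : q.local' = true → p.local' = true) : σ.Agree q σ₁ :=
  ⟨fun x hx => h.v x fun h => hx (hv h), fun x hx => h.a x fun h => hx (ha h), fun hq =>
    h.ghost (hl hq)⟩

end UState.Agree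

namespace Prog

variable {N : ℕ} {pre : Bool} {w : ℕ} {G : SimpleGraph (Fin N)} {d : ℕ}

/-- The frame rule: whatever the program text cannot modify may be used in the postcondition, so
that invariants need to mention only what changes. -/
theorem wp_mono_agree (p : Prog) : ∀ {Q R : UState N → Prop} {σ : UState N},
    p.wp pre w G d Q σ → (∀ σ', σ.Agree p σ' → Q σ' → R σ') → p.wp pre w G d R σ := by
  induction p with
  | skip => intro Q R σ h hQR; exact hQR _ (UState.Agree.refl _ _).tick h
  | assign x e =>
    intro Q R σ h hQR
    refine ⟨h.1, h.2.1, hQR _ ⟨fun y hy => ?_, fun _ _ => rfl, fun _ => ⟨rfl, rfl, rfl, rfl⟩⟩ h.2.2⟩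
    simp only [modV, List.mem_singleton] at hy
    simp [hy]
  | write b i e =>
    intro Q R σ h hQR
    refine ⟨h.1, h.2.1, h.2.2.1, hQR _ ⟨fun y hy => rfl, fun y hy => ?_,
      fun _ => ⟨rfl, rfl, rfl, rfl⟩⟩ h.2.2.2⟩
    simp only [modA, List.mem_singleton] at hy
    funext j
    simp [hy]
  | seq p q hp hq =>
    intro Q R σ h hQR
    refine hp h fun σ₁ h₁ h' => hq h' fun σ₂ h₂ h'' => hQR _ ?_ h''
    exact (h₁.mono (by simp [modV]) (by simp [modA]) (by simp +contextual [local'])).trans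
      (h₂.mono (by simp [modV]) (by simp [modA]) (by simp +contextual [local']))
  | ite e p q hp hq =>
    intro Q R σ h hQR
    refine ⟨h.1, ?_⟩
    have h2 := h.2
    split_ifs at h2 ⊢ with h3
    · exact hp h2 fun σ₁ h₁ h' => hQR _ ((UState.Agree.refl _ _).tick.trans (h₁.mono
        (p := p) (q := ite e p q) (by simp [modV]) (by simp [modA]) (by simp +contextual [local']))) h'
    · exact hq h2 fun σ₁ h₁ h' => hQR _ ((UState.Agree.refl _ _).tick.trans (h₁.mono
        (p := q) (q := ite e p q) (by simp [modV]) (by simp [modA]) (by simp +contextual [local']))) h'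
  | loop e p hp =>
    intro Q R σ h hQR
    obtain ⟨n, h⟩ := h
    refine ⟨n, ?_⟩
    induction n generalizing σ with
    | zero => exact h
    | succ n ih =>
      rw [Function.iterate_succ_apply'] at h ⊢
      refine ⟨h.1, ?_⟩
      have h2 := h.2
      split_ifs at h2 ⊢ with h3
      · refine hp h2 fun σ₁ h₁ h' => ih (fun σ' h4 => hQR _ ?_) h'
        exact (UState.Agree.tick (UState.Agree.refl _ _)).trans
          ((h₁.mono (p := p) (q := loop e p) (by simp [modV]) (by simp [modA])
            (by simp +contextual [local'])).trans h4)
      · exact hQR _ (UState.Agree.refl _ _).tick h2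
  | fail e =>
    intro Q R σ h hQR
    obtain ⟨h1, he, F, hn, hd, hl, ha, hQ⟩ := h
    exact ⟨h1, he, F, hn, hd, hl, ha, hQR _ ⟨fun _ _ => rfl, fun _ _ => rfl, fun h => by
      simp [local'] at h⟩ hQ⟩
  | query e₁ e₂ x =>
    intro Q R σ h hQR
    obtain ⟨h1, hx, he₁, he₂, hfz, u, v, hu, hv, hu', hv', hQ⟩ := h
    refine ⟨h1, hx, he₁, he₂, hfz, u, v, hu, hv, hu', hv', hQR _ ⟨fun y hy => ?_, fun _ _ => rfl,
      fun h => by simp [local'] at h⟩ hQ⟩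
    simp only [modV, List.mem_singleton] at hy
    simp [hy]

theorem wp_mono (p : Prog) {Q R : UState N → Prop} {σ : UState N}
    (h : p.wp pre w G d Q σ) (hQR : ∀ σ', Q σ' → R σ') : p.wp pre w G d R σ :=
  p.wp_mono_agree h fun σ' _ => hQR σ'

theorem wp_seq {p q : Prog} {Q : UState N → Prop} {σ : UState N} :
    (p ;; q).wp pre w G d Q σ ↔ p.wp pre w G d (q.wp pre w G d Q) σ := Iff.rfl

theorem wp_assign {x : ℕ} {e : NatExpr} {Q : UState N → Prop} {σ : UState N} :
    (assign x e).wp pre w G d Q σ ↔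
      e.Ok pre w σ ∧ (pre ∨ 3 ≤ x) ∧ Q (σ.set x (e.nat w σ)) := Iff.rfl

theorem wp_write {b : ℕ} {i e : NatExpr} {Q : UState N → Prop} {σ : UState N} :
    (write b i e).wp pre w G d Q σ ↔ i.Ok pre w σ ∧ e.Ok pre w σ ∧ (pre ∨ 2 ≤ b) ∧
      Q (σ.put b (i.nat w σ) (e.nat w σ)) := Iff.rfl

theorem wp_ite {e : NatExpr} {p q : Prog} {Q : UState N → Prop} {σ : UState N} :
    (ite e p q).wp pre w G d Q σ ↔ e.Ok pre w σ ∧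
      (e.nat w σ ≠ 0 → p.wp pre w G d Q σ.tick) ∧ (e.nat w σ = 0 → q.wp pre w G d Q σ.tick) := by
  simp only [wp]
  split_ifs with h <;> simp_all

theorem wp_skip {Q : UState N → Prop} {σ : UState N} : skip.wp pre w G d Q σ ↔ Q σ.tick := Iff.rfl

/-- Loops, with a variant `μ`. -/
theorem wp_loop {e : NatExpr} {p : Prog} {Q : UState N → Prop} {σ : UState N}
    (I : UState N → Prop) (μ : UState N → ℕ) (h0 : I σ)
    (hstep : ∀ σ₁, σ.Agree p σ₁ → I σ₁ → e.Ok pre w σ₁ ∧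
      (e.nat w σ₁ ≠ 0 → p.wp pre w G d (fun σ₂ => I σ₂ ∧ μ σ₂ < μ σ₁) σ₁.tick) ∧
      (e.nat w σ₁ = 0 → Q σ₁.tick)) :
    (loop e p).wp pre w G d Q σ := by
  have key : ∀ n σ₁, σ.Agree p σ₁ → I σ₁ → μ σ₁ < n →
      (fun (X : UState N → Prop) (σ : UState N) => e.Ok pre w σ ∧
      if e.nat w σ ≠ 0 then p.wp pre w G d X σ.tick else Q σ.tick)^[n] (fun _ => False) σ₁ := by
    intro n
    induction n with
    | zero => intro σ₁ _ _ h; exact absurd h (by omega)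
    | succ n ih =>
      intro σ₁ ha hI hμ
      rw [Function.iterate_succ_apply']
      obtain ⟨h1, h2, h3⟩ := hstep σ₁ ha hI
      refine ⟨h1, ?_⟩
      split_ifs with h4
      · exact wp_mono_agree p (h2 h4) fun σ₂ h5 h6 => ih σ₂ (ha.tick.trans h5) h6.1 (by omega)
      · exact h3 (not_not.1 h4)
  exact ⟨μ σ + 1, key _ _ (.refl _ _) h0 (Nat.lt_succ_self _)⟩

/-- `for x := 0, …, e - 1 do p`. -/
def for' (x : ℕ) (e : NatExpr) (p : Prog) : Prog :=
  assign x 0 ;; loop ((NatExpr.var x).lt e) (p ;; assign x (.var x + 1))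

/-- The loop rule without a separate account of time. The state after a round is compared with the
invariant only after the counter has been increased; this is why `set x (i + 1)` occurs in the
premise. -/
theorem wp_for_inv {x : ℕ} {e : NatExpr} {p : Prog} {Q : UState N → Prop} {σ : UState N} (n : ℕ)
    (I : ℕ → UState N → Prop)
    (hn : n < 2 ^ w) (hxp : x ∉ p.modV) (hx : pre ∨ 3 ≤ x)
    (he : ∀ σ₁, σ.Agree (for' x e p) σ₁ → e.Ok pre w σ₁ ∧ e.nat w σ₁ = n)
    (h0 : I 0 (σ.set x 0))
    (hstep : ∀ i < n, ∀ σ₁, σ.Agree (for' x e p) σ₁ → σ₁.v x = i → I i σ₁ →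
      p.wp pre w G d (fun σ₂ => I (i + 1) (σ₂.set x (i + 1))) σ₁.tick)
    (hQ : ∀ σ₁, σ.Agree (for' x e p) σ₁ → σ₁.v x = n → I n σ₁ → Q σ₁.tick) :
    (for' x e p).wp pre w G d Q σ := by
  rw [for', wp_seq, wp_assign]
  refine ⟨by simp, hx, ?_⟩
  have hag0 : σ.Agree (for' x e p) (σ.set x 0) :=
    ⟨fun y hy => by simp [for', modV] at hy; simp [hy.1], fun _ _ => rfl,
      fun _ => ⟨rfl, rfl, rfl, rfl⟩⟩
  have hag : ∀ σ₁, (σ.set x 0).Agree (p ;; assign x (.var x + 1)) σ₁ → σ.Agree (for' x e p) σ₁ :=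
    fun σ₁ h => hag0.trans (h.mono (by simp [for', modV]) (by simp [for', modA])
      (by simp [for', local']))
  refine wp_loop (fun σ₁ => σ₁.v x ≤ n ∧ I (σ₁.v x) σ₁) (fun σ₁ => n - σ₁.v x) ?_ ?_
  · simpa using h0
  · rintro σ₁ h₁ ⟨h2, h3⟩
    have h5 := hag σ₁ h₁
    obtain ⟨h6, h7⟩ := he σ₁ h5
    refine ⟨by simpa [hx] using h6, fun h8 => ?_, fun h8 => ?_⟩
    · have h8' : σ₁.v x < n := by simpa [h7] using h8
      rw [wp_seq]
      refine wp_mono_agree p (hstep _ h8' σ₁ h5 rfl h3) fun σ₂ h9 h10 => ?_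
      have hx2 : σ₂.v x = σ₁.v x := h9.v x hxp
      rw [wp_assign]
      refine ⟨by simp only [NatExpr.ok_add, NatExpr.ok_var, NatExpr.ok_ofNat, NatExpr.nat_var,
        NatExpr.nat_ofNat, hx2]; exact ⟨hx, by omega, by omega⟩, hx, ?_⟩
      simp only [NatExpr.nat_add, NatExpr.nat_var, NatExpr.nat_ofNat, hx2, UState.set_v, if_true]
      exact ⟨⟨by omega, h10⟩, by omega⟩
    · have h8' : σ₁.v x = n := by
        simp [h7] at h8; omega
      rw [h8'] at h3
      exact hQ _ h5 h8' h3

/-- Besides `B i`, a round costs one step for the test and one for the increment; the final `2`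
accounts for the initialization and the last test. -/
theorem wp_for {x : ℕ} {e : NatExpr} {p : Prog} {Q : UState N → Prop} {σ : UState N} (n : ℕ)
    (I : ℕ → UState N → Prop) (B : ℕ → ℕ)
    (hn : n < 2 ^ w) (hxp : x ∉ p.modV) (hx : pre ∨ 3 ≤ x)
    (he : ∀ σ₁, σ.Agree (for' x e p) σ₁ → e.Ok pre w σ₁ ∧ e.nat w σ₁ = n)
    (h0 : I 0 (σ.set x 0))
    (hstep : ∀ i < n, ∀ σ₁, σ.Agree (for' x e p) σ₁ → σ₁.v x = i → I i σ₁ →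
      p.wp pre w G d (fun σ₂ => σ₂.time ≤ σ₁.time + B i ∧ I (i + 1) (σ₂.set x (i + 1))) σ₁)
    (hQ : ∀ σ₁, σ.Agree (for' x e p) σ₁ → σ₁.v x = n → I n σ₁ →
      σ₁.time ≤ σ.time + ∑ i ∈ Finset.range n, (B i + 2) + 2 → Q σ₁)
    (hI : ∀ i σ, I i σ → I i σ.tick := by exact fun _ _ h => h) :
    (for' x e p).wp pre w G d Q σ := by
  refine wp_for_inv n (fun i σ₁ => I i σ₁ ∧
    σ₁.time ≤ σ.time + ∑ i ∈ Finset.range i, (B i + 2) + 1) hn hxp hx he ⟨h0, by simp⟩ ?_ ?_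
  · rintro i hi σ₁ ha hx1 ⟨h1, h2⟩
    refine wp_mono p (hstep i hi σ₁.tick ha.tick hx1 (hI _ _ h1)) fun σ₂ h3 => ⟨h3.2, ?_⟩
    rw [Finset.sum_range_succ]
    have := h3.1
    simp only [UState.tick_time, UState.set_time] at this ⊢
    omega
  · rintro σ₁ ha hx1 ⟨h1, h2⟩
    exact hQ _ ha.tick hx1 (hI _ _ h1) (by simp only [UState.tick_time]; omega)

/-- Loops with a fixed number of iterations and a common bound for their costs. -/
theorem wp_for_const {x : ℕ} {e : NatExpr} {p : Prog} {Q : UState N → Prop} {σ : UState N} (n : ℕ)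
    (I : ℕ → UState N → Prop) (B : ℕ)
    (hn : n < 2 ^ w) (hxp : x ∉ p.modV) (hx : pre ∨ 3 ≤ x)
    (he : ∀ σ₁, σ.Agree (for' x e p) σ₁ → e.Ok pre w σ₁ ∧ e.nat w σ₁ = n)
    (h0 : I 0 (σ.set x 0))
    (hstep : ∀ i < n, ∀ σ₁, σ.Agree (for' x e p) σ₁ → σ₁.v x = i → I i σ₁ →
      p.wp pre w G d (fun σ₂ => σ₂.time ≤ σ₁.time + B ∧ I (i + 1) (σ₂.set x (i + 1))) σ₁)
    (hQ : ∀ σ₁, σ.Agree (for' x e p) σ₁ → σ₁.v x = n → I n σ₁ →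
      σ₁.time ≤ σ.time + n * (B + 2) + 2 → Q σ₁)
    (hI : ∀ i σ, I i σ → I i σ.tick := by exact fun _ _ h => h) :
    (for' x e p).wp pre w G d Q σ := by
  refine wp_for n I (fun _ => B) hn hxp hx he h0 hstep (fun σ₁ h1 h2 h3 h4 => hQ σ₁ h1 h2 h3 ?_) hI
  simpa using h4

end Prog

local notation "V" => NatExpr.var
local notation "rd" => NatExpr.read

namespace Prog

/-! ## Sorting -/

/-- `v` is the least of the numbers in block `b` (of length `g`) of `X` which are at least `θ`,
or `B` if there are none. -/
def IsNext (X : ℕ → ℕ) (g B θ b v : ℕ) : Prop :=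
  (v = B ∨ ∃ u < g, v = X (b * g + u) ∧ θ ≤ v) ∧ v ≤ B ∧ ∀ u < g, θ ≤ X (b * g + u) → v ≤ X (b * g + u)

/-- Store in cell `v₂₄` of array `4` the least element, not below `v₂₃`, of the block `v₂₄` of `src`. -/
def nextMin (src : ℕ) : Prog :=
  assign 25 (V 13) ;;
  for' 26 (V 8) (assign 27 (rd src (V 24 * V 8 + V 26)) ;;
    ite ((V 27).lt (V 23)) skip (ite ((V 27).lt (V 25)) (assign 25 (V 27)) skip)) ;;
  write 4 (V 24) (V 25)

/-- Sort the first `v₁₀ = v₉ * v₈` cells of `src` into `dst`. -/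
def sort (src dst : ℕ) : Prog :=
  assign 23 0 ;;
  for' 24 (V 9) (nextMin src) ;;
  for' 28 (V 10) (
    assign 24 0 ;;
    for' 29 (V 9) (ite ((rd 4 (V 29)).lt (rd 4 (V 24))) (assign 24 (V 29)) skip) ;;
    assign 25 (rd 4 (V 24)) ;;
    write dst (V 28) (V 25) ;;
    assign 23 (V 25 + 1) ;;
    nextMin src)

variable {N : ℕ} {w : ℕ} {G : SimpleGraph (Fin N)} {d : ℕ}

theorem wp_nextMin {src : ℕ} (h2 : 2 ≤ src) {σ : UState N} {Q : UState N → Prop} {g b : ℕ}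
    (hg : σ.v 8 = g) (hb : σ.v 24 = b) (hw : (b + 1) * g < 2 ^ w)
    (hQ : ∀ σ' v, σ.Agree (nextMin src) σ' → IsNext (σ.a src) g (σ.v 13) (σ.v 23) b v →
      (∀ j, σ'.a 4 j = if j = b then v else σ.a 4 j) → σ'.time ≤ σ.time + (6 * g + 4) → Q σ') :
    (nextMin src).wp true w G d Q σ := by
  refine wp_mono_agree _ (Q := fun σ' => ∃ v, IsNext (σ.a src) g (σ.v 13) (σ.v 23) b v ∧
      (∀ j, σ'.a 4 j = if j = b then v else σ.a 4 j) ∧ σ'.time ≤ σ.time + (6 * g + 4)) ?_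
    (fun σ' ha ⟨v, h1, h2, h3⟩ => hQ σ' v ha h1 h2 h3)
  rw [nextMin, wp_seq, wp_assign]
  refine ⟨by simp, by simp, ?_⟩
  rw [wp_seq]
  have hgw : g < 2 ^ w := lt_of_le_of_lt (by nlinarith) hw
  refine wp_for_const g (fun i σ₁ => (σ₁.v 25 = σ.v 13 ∨
    ∃ u < i, σ₁.v 25 = σ.a src (b * g + u) ∧ σ.v 23 ≤ σ₁.v 25) ∧ σ₁.v 25 ≤ σ.v 13 ∧
    ∀ u < i, σ.v 23 ≤ σ.a src (b * g + u) → σ₁.v 25 ≤ σ.a src (b * g + u)) 4 hgw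
    (by simp [modV]) (by simp) ?_ ?_ ?_ ?_
  · intro σ₁ h
    have := h.v 8 (by simp [modV, for'])
    simp [this, hg]
  · simp
  · intro i hi σ₁ h hi1 hI
    have e8 := h.v 8 (by simp [modV, for'])
    have e23 := h.v 23 (by simp [modV, for'])
    have e24 := h.v 24 (by simp [modV, for'])
    have ea : σ₁.a src = σ.a src := h.a src (by simp [modA, for'])
    simp [hg, hb] at e8 e23 e24
    have hlt : b * g + i < 2 ^ w := lt_of_lt_of_le (by nlinarith) hw.le
    rw [wp_seq, wp_assign]
    obtain ⟨h3, h4, h5⟩ := hI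
    refine ⟨by simp [e24, e8, hi1, h2]; omega, by simp, ?_⟩
    rw [wp_ite, wp_ite]
    simp only [wp_skip, wp_assign]
    simp [e24, e8, hi1, ea, e23]
    refine ⟨fun hlt => ⟨?_, h4, fun u hu hu' => ?_⟩, fun hge => ⟨fun hlt => ⟨?_, ?_, ?_⟩, fun hge' => ⟨?_, h4, ?_⟩⟩⟩
    · exact h3.imp_right fun ⟨u, hu, h⟩ => ⟨u, by omega, h⟩
    · rcases hu.lt_or_eq with hu | rfl
      · exact h5 u hu hu'
      · omega
    · exact Or.inr ⟨i, by omega, rfl, hge⟩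
    · omega
    · intro u hu hu'
      rcases hu.lt_or_eq with hu | rfl
      · exact hlt.le.trans (h5 u hu hu')
      · exact le_rfl
    · exact h3.imp_right fun ⟨u, hu, h⟩ => ⟨u, by omega, h⟩
    · intro u hu hu'
      rcases hu.lt_or_eq with hu | rfl
      · exact h5 u hu hu'
      · exact hge'
  · intro σ₁ h hi1 hI ht
    have e24 := h.v 24 (by simp [modV, for'])
    have ea : σ₁.a 4 = σ.a 4 := h.a 4 (by simp [modA, for'])
    simp [hb] at e24
    rw [wp_write]
    simp only [UState.set_time] at ht
    refine ⟨by simp, by simp, by simp, σ₁.v 25, hI, fun j => by simp [e24, ea], ?_⟩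
    simp only [UState.put_time]
    omega

/-- The numbers `Y t`, `t < L`, are the distinct numbers `X i`, `i < L`, in increasing order. -/
structure IsSorting (X Y : ℕ → ℕ) (L : ℕ) : Prop where
  lt : ∀ s t, s < t → t < L → Y s < Y t
  mem : ∀ t < L, ∃ i < L, Y t = X i
  surj : ∀ i < L, ∃ t < L, Y t = X i

/-- Invariant of the main loop of `sort`, when the elements below `θ` have been moved. -/
structure SortInv (X : ℕ → ℕ) (G g B : ℕ) (t θ : ℕ) (Mn Y : ℕ → ℕ) : Prop where
  next : ∀ b < G, IsNext X g B θ b (Mn b)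
  lt : ∀ s < t, Y s < θ
  mem : ∀ s < t, ∃ i < G * g, Y s = X i
  surj : ∀ i < G * g, X i < θ → ∃ s < t, Y s = X i
  mono : ∀ s s', s < s' → s' < t → Y s < Y s'
  card : ((Finset.range (G * g)).filter fun i => X i < θ).card = t

/-- Fewer than `G * g` numbers are below `θ`, so one remains, and it is less than the default value
`B`. Therefore the least of the block minima is a genuine element and not the default. -/
theorem SortInv.exists_least {X : ℕ → ℕ} {G g B t θ : ℕ} {Mn Y : ℕ → ℕ}
    (h : SortInv X G g B t θ Mn Y) (ht : t < G * g) (hX : ∀ i < G * g, X i < B) {b : ℕ} (hb : b < G)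
    (hmin : ∀ b' < G, Mn b ≤ Mn b') :
    (∃ u < g, Mn b = X (b * g + u) ∧ θ ≤ Mn b) ∧ ∀ i < G * g, θ ≤ X i → Mn b ≤ X i := by
  have hle : ∀ i < G * g, θ ≤ X i → Mn b ≤ X i := by
    intro i hi hθ
    have hg : 0 < g := Nat.pos_of_ne_zero (by rintro rfl; simp at hi)
    have h1 : i / g < G := Nat.div_lt_of_lt_mul (by rwa [mul_comm])
    have h2 : i / g * g + i % g = i := by rw [mul_comm]; exact Nat.div_add_mod i g
    have h3 := (h.next _ h1).2.2 (i % g) (Nat.mod_lt _ hg)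
    rw [h2] at h3
    exact (hmin _ h1).trans (h3 hθ)
  refine ⟨?_, hle⟩
  obtain ⟨i, hi, hθ⟩ : ∃ i < G * g, θ ≤ X i := by
    by_contra! hcon
    have h1 : ((Finset.range (G * g)).filter fun i => X i < θ) = Finset.range (G * g) :=
      Finset.filter_true_of_mem fun i hi => hcon i (Finset.mem_range.1 hi)
    have h2 := h.card
    rw [h1, Finset.card_range] at h2
    omega
  rcases (h.next b hb).1 with h1 | h1
  · have := hle i hi hθ
    have := hX i hi
    omega
  · exact h1

theorem block_lt {G g b u : ℕ} (hb : b < G) (hu : u < g) : b * g + u < G * g :=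
  lt_of_lt_of_le (by rw [Nat.add_one_mul]; omega : b * g + u < (b + 1) * g)
    (Nat.mul_le_mul_right g hb)

/-- As the numbers are distinct, the minima of different blocks differ unless they are defaults.
Raising the threshold just above the least one therefore invalidates the stored minimum of its own
block only. -/
theorem SortInv.step {X : ℕ → ℕ} {G g B t θ : ℕ} {Mn Mn' Y : ℕ → ℕ} {v : ℕ}
    (h : SortInv X G g B t θ Mn Y) (ht : t < G * g) (hX : ∀ i < G * g, X i < B)
    (hinj : ∀ i < G * g, ∀ j < G * g, X i = X j → i = j) {b : ℕ} (hb : b < G)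
    (hmin : ∀ b' < G, Mn b ≤ Mn b') (hv : IsNext X g B (Mn b + 1) b v)
    (hMn : ∀ j, Mn' j = if j = b then v else Mn j) :
    SortInv X G g B (t + 1) (Mn b + 1) Mn' (fun s => if s = t then Mn b else Y s) := by
  obtain ⟨⟨u, hu, hMb, hθ⟩, hle⟩ := h.exists_least ht hX hb hmin
  have hi0 := block_lt hb hu
  refine ⟨fun b' hb' => ?_, fun s hs => ?_, fun s hs => ?_, fun i hi hiθ => ?_, fun s s' hs hs' => ?_, ?_⟩
  · rw [hMn]
    split_ifs with hbb
    · rw [hbb]; exact hv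
    · obtain ⟨h1, h2, h3⟩ := h.next b' hb'
      refine ⟨h1.imp_right ?_, h2, fun u hu hle => h3 u hu (by omega)⟩
      rintro ⟨u', hu', h4, h5⟩
      refine ⟨u', hu', h4, ?_⟩
      have h6 := hmin b' hb'
      rcases h6.lt_or_eq with h6 | h6
      · exact h6
      · exfalso
        have h7 := hinj _ hi0 _ (block_lt hb' hu') (by rw [← hMb, ← h4, h6])
        have h8 : (b * g + u) / g = (b' * g + u') / g := by rw [h7]
        have hg : 0 < g := by omega
        rw [mul_comm b, mul_comm b', Nat.mul_add_div hg, Nat.mul_add_div hg, Nat.div_eq_of_lt hu,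
          Nat.div_eq_of_lt hu'] at h8
        omega
  · split_ifs with hst
    · omega
    · have := h.lt s (by omega); omega
  · split_ifs with hst
    · exact ⟨_, hi0, hMb⟩
    · exact h.mem s (by omega)
  · by_cases hiθ' : X i < θ
    · obtain ⟨s, hs, hs'⟩ := h.surj i hi hiθ'
      exact ⟨s, by omega, by rw [if_neg (by omega)]; exact hs'⟩
    · have := hle i hi (by omega)
      exact ⟨t, by omega, by rw [if_pos rfl]; omega⟩
  · rw [if_neg (by omega)]
    split_ifs with hst
    · have := h.lt s (by omega); omega
    · exact h.mono s s' hs (by omega)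
  · have h1 : ((Finset.range (G * g)).filter fun i => X i < Mn b + 1)
        = insert (b * g + u) ((Finset.range (G * g)).filter fun i => X i < θ) := by
      ext i
      simp only [Finset.mem_filter, Finset.mem_range, Finset.mem_insert]
      constructor
      · rintro ⟨h1, h2⟩
        by_cases h3 : X i < θ
        · exact Or.inr ⟨h1, h3⟩
        · have := hle i h1 (by omega)
          exact Or.inl (hinj _ h1 _ hi0 (by omega))
      · rintro (rfl | ⟨h1, h2⟩)
        · exact ⟨hi0, by omega⟩
        · exact ⟨h1, by omega⟩
    rw [h1, Finset.card_insert_of_notMem, h.card]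
    simp only [Finset.mem_filter, not_and, not_lt]
    intro _
    omega

/-- Selection sort with a table of block minima in array `4`: each round scans the `n` minima and
recomputes one block of length `g`. The resulting cost, of order `n * g * (n + g)`, is well within
the time allowed for the reduction, so no faster method is needed. The threshold in variable `23`
replaces any marking of removed elements. -/
theorem wp_sort {src dst : ℕ} (hsrc : src ≠ 4) (hdst : dst ≠ 4) (hsd : src ≠ dst) (hs2 : 2 ≤ src)
    (hd2 : 2 ≤ dst) {σ : UState N} {Q : UState N → Prop} {n g : ℕ}
    (hg : σ.v 8 = g) (hG : σ.v 9 = n) (hL : σ.v 10 = n * g) (hgp : 0 < g)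
    (hX : ∀ i < n * g, σ.a src i < σ.v 13) (hLB : n * g ≤ σ.v 13) (hw : σ.v 13 + 1 < 2 ^ w)
    (hinj : ∀ i < n * g, ∀ j < n * g, σ.a src i = σ.a src j → i = j)
    (hQ : ∀ σ', σ.Agree (sort src dst) σ' → IsSorting (σ.a src) (σ'.a dst) (n * g) →
      σ'.time ≤ σ.time + (n * (6 * g + 6) + n * g * (4 * n + 6 * g + 12) + 5) → Q σ') :
    (sort src dst).wp true w G d Q σ := by
  refine wp_mono_agree _ (Q := fun σ' => IsSorting (σ.a src) (σ'.a dst) (n * g) ∧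
      σ'.time ≤ σ.time + (n * (6 * g + 6) + n * g * (4 * n + 6 * g + 12) + 5)) ?_
    (fun σ' ha ⟨h1, h2⟩ => hQ σ' ha h1 h2)
  have hnL : n ≤ n * g := Nat.le_mul_of_pos_right n hgp
  have hw0 : w ≠ 0 := by rintro rfl; simp at hw
  rw [sort, wp_seq, wp_assign]
  refine ⟨by simp, by simp, ?_⟩
  rw [wp_seq]
  refine wp_for_const n (fun i σ₁ => ∀ b < i, IsNext (σ.a src) g (σ.v 13) 0 b (σ₁.a 4 b)) (6 * g + 4)
    (by omega) (by simp [modV, nextMin, for']) (by simp) ?_ ?_ ?_ ?_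
  · intro σ₁ h
    have := h.v 9 (by simp [modV, for', nextMin])
    simp [this, hG]
  · simp
  · intro i hi σ₁ h hi1 hI
    have e8 := h.v 8 (by simp [modV, for', nextMin])
    have e13 := h.v 13 (by simp [modV, for', nextMin])
    have e23 := h.v 23 (by simp [modV, for', nextMin])
    have ea : σ₁.a src = σ.a src := h.a src (by simp [modA, for', nextMin, hsrc])
    simp at e8 e13 e23
    refine wp_nextMin hs2 (by rw [e8, hg]) hi1
      (lt_of_le_of_lt (Nat.mul_le_mul_right g hi) (by omega)) ?_
    intro σ' v h1 h2 h3 h4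
    refine ⟨h4, fun b hb => ?_⟩
    rw [ea, e13, e23] at h2
    simp only [UState.set_a, h3]
    split_ifs with hbi
    · rw [hbi]; exact h2
    · exact hI b (by omega)
  · intro σ₁ h hi1 hI ht
    have e8 := h.v 8 (by simp [modV, for', nextMin])
    have e9 := h.v 9 (by simp [modV, for', nextMin])
    have e10 := h.v 10 (by simp [modV, for', nextMin])
    have e13 := h.v 13 (by simp [modV, for', nextMin])
    have e23 := h.v 23 (by simp [modV, for', nextMin])
    have ea : σ₁.a src = σ.a src := h.a src (by simp [modA, for', nextMin, hsrc])
    simp [hg, hG, hL] at e8 e9 e10 e13 e23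
    refine wp_for_const (n * g) (fun t σ₂ => SortInv (σ.a src) n g (σ.v 13) t (σ₂.v 23) (σ₂.a 4)
      (σ₂.a dst)) (4 * n + 6 * g + 10) (by omega) (by simp [modV, nextMin, for']) (by simp) ?_ ?_ ?_ ?_
    · intro σ₂ h
      have := h.v 10 (by simp [modV, for', nextMin])
      simp [this, e10]
    · simp only [UState.set_v, UState.set_a]
      simp only [e23]
      norm_num
      exact ⟨hI, by simp, by simp, by simp, by simp, by simp⟩
    · intro t htL σ₂ h' ht1 hI'
      have f8 := h'.v 8 (by simp [modV, for', nextMin])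
      have f9 := h'.v 9 (by simp [modV, for', nextMin])
      have f13 := h'.v 13 (by simp [modV, for', nextMin])
      have fa : σ₂.a src = σ₁.a src := h'.a src (by simp [modA, for', nextMin, hsrc, hsd])
      rw [e8] at f8
      rw [e9] at f9
      rw [e13] at f13
      rw [ea] at fa
      have hn0 : 0 < n := Nat.pos_of_ne_zero (by rintro rfl; simp at htL)
      rw [wp_seq, wp_assign]
      refine ⟨by simp, by simp, ?_⟩
      rw [wp_seq]
      refine wp_for_const n (fun i σ₃ => σ₃.v 24 < n ∧ ∀ b < i, σ₂.a 4 (σ₃.v 24) ≤ σ₂.a 4 b)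
        2 (by omega) (by simp [modV]) (by simp) ?_ ?_ ?_ ?_
      · intro σ₃ h
        have := h.v 9 (by simp [modV, for'])
        simp [this, f9]
      · simp [hn0]
      · rintro i hi σ₃ h hi1 ⟨hI1, hI2⟩
        have ea : σ₃.a 4 = σ₂.a 4 := h.a 4 (by simp [modA, for'])
        rw [wp_ite]
        simp only [wp_skip, wp_assign]
        simp [ea, hi1]
        refine ⟨fun hlt => ⟨hi, fun b hb => ?_⟩, fun hge => ⟨hI1, fun b hb => ?_⟩⟩
        · rcases hb.lt_or_eq with hb | rfl
          · exact hlt.le.trans (hI2 b hb)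
          · exact le_rfl
        · rcases hb.lt_or_eq with hb | rfl
          · exact hI2 b hb
          · exact hge
      · rintro σ₃ h'' hi1 ⟨hI1, hI2⟩ htime
        have g8 := h''.v 8 (by simp [modV, for'])
        have g13 := h''.v 13 (by simp [modV, for'])
        have g23 := h''.v 23 (by simp [modV, for'])
        have g28 := h''.v 28 (by simp [modV, for'])
        have ga : σ₃.a = σ₂.a := funext fun y => h''.a y (by simp [modA, for'])
        simp [f8, f13, ht1] at g8 g13 g28 g23
        have hlt : σ₂.a 4 (σ₃.v 24) ≤ σ.v 13 := (hI'.next _ hI1).2.1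
        rw [wp_seq, wp_assign]
        refine ⟨by simp, by simp, ?_⟩
        rw [wp_seq, wp_write]
        refine ⟨by simp, by simp, by simp [hd2], ?_⟩
        rw [wp_seq, wp_assign]
        refine ⟨by simp [ga, hw0]; omega, by simp, ?_⟩
        refine wp_nextMin hs2 (g := g) (b := σ₃.v 24) (by simp [g8]) (by simp)
          (lt_of_le_of_lt (Nat.mul_le_mul_right g hI1) (by omega)) ?_
        intro σ' v h1 h2 h3 h4
        have k23 := h1.v 23 (by simp [modV, for', nextMin])
        have kd : σ'.a dst = _ := h1.a dst (by simp [modA, for', nextMin, hdst])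
        simp [ga] at k23 h3
        simp [hdst.symm] at h3
        have h2' : IsNext (σ.a src) g (σ.v 13) (σ₂.a 4 (σ₃.v 24) + 1) (σ₃.v 24) v := by
          have : (fun j => if src = dst ∧ j = t then σ₂.a 4 (σ₃.v 24) else σ₂.a src j) = σ.a src := by
            funext j; simp [hsd, fa]
          convert h2 using 1
          · funext j; simp [hsd, ga, fa]
          · simp [g13]
          · simp [ga]
        refine ⟨?_, ?_⟩
        · simp at h4 htime
          omega
        · have := hI'.step htL hX hinj hI1 hI2 h2' h3
          simp only [UState.set_v, UState.set_a, k23]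
          norm_num
          convert this using 1
          rw [kd]
          funext s
          simp [g28, ga]
    · intro σ₂ h' ht1 hI' ht'
      have hall : ∀ i < n * g, σ.a src i < σ₂.v 23 := by
        intro i hi
        have h1 := Finset.filter_card_eq (s := Finset.range (n * g)) (p := fun i => σ.a src i < σ₂.v 23)
          (by rw [hI'.card, Finset.card_range])
        exact h1 i (Finset.mem_range.2 hi)
      refine ⟨⟨hI'.mono, hI'.mem, fun i hi => hI'.surj i hi (hall i hi)⟩, ?_⟩
      simp at ht ht'
      nlinarith

end Prog

/-! ## The graph -/

/-- The numbers which govern the reduction: there are `G` groups of `g` numbers, shifted by `S`; hash values are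
taken modulo numbers between `Y` and `2 * Y`, and set vertices belong to a group and a
number below `X`; `B` bounds all numbers that occur. -/
structure Sizes (w : ℕ) where
  (S d g G Y X B : ℕ)
  g_pos : 0 < g
  G_pos : 0 < G
  X_pos : 0 < X
  X_le : X ≤ g
  Y_pos : 0 < Y
  -- The moduli are below `2 * Y ≤ d / 2`, so any set of hash values may be deleted.
  Y_le : 4 * Y ≤ d
  -- This leaves room for the padded numbers and for the sorting keys, which combine a hash value
  -- with a position.
  B_ge : (5 * S + d + 1) * (G * g + 1) ≤ B
  B_lt : (B + 2) * (B + 2) ≤ 2 ^ w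

namespace Sizes

variable {w : ℕ} (P : Sizes w)

/-- The number of numbers. -/
def L : ℕ := P.G * P.g

/-- The universe end of the `z`-th edge, for the hash function modulo `m`. -/
def edgeEnd (Z : ℕ → ℕ) (m z : ℕ) : ℕ :=
  -- The index `z` encodes the set vertex `z / g`, consisting of the group `z / g / X` and the shift
  -- `z / g % X`, and the position `z % g` in that group. The end is shift minus number, modulo `m`.
  ((z / P.g) % P.X + (m - Z (z / P.g / P.X * P.g + z % P.g) % m)) % m

/-- The number of vertices. -/
def numV (m : ℕ) : ℕ := m + 1 + P.G * P.X

/-- The directed edges, up to the `z`-th one. -/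
def IsEdge (Z : ℕ → ℕ) (m z x y : ℕ) : Prop :=
  (x < m ∧ y = m) ∨ ∃ z' < z, x = P.edgeEnd Z m z' ∧ y = m + 1 + z' / P.g

theorem hw0 (P : Sizes w) : w ≠ 0 := by
  intro h
  have h1 := P.B_lt
  have h2 : 2 ^ w = 1 := by simp [h]
  nlinarith

theorem d_L_le : P.d + 1 + P.L ≤ P.B := by
  refine le_trans ?_ P.B_ge
  calc P.d + 1 + P.L ≤ (P.d + 1) * (P.L + 1) := by nlinarith
    _ ≤ (5 * P.S + P.d + 1) * (P.G * P.g + 1) := Nat.mul_le_mul_right _ (by omega)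

theorem L_le : P.L ≤ P.B := by
  have := P.d_L_le
  omega

theorem mul_lt {x y : ℕ} (hx : x ≤ P.B) (hy : y ≤ P.B) : x * y + 2 * P.B < 2 ^ w := by
  have := P.B_lt
  nlinarith [Nat.mul_le_mul hx hy]

theorem B_lt' : 3 * P.B < 2 ^ w := by
  have := P.mul_lt (x := 0) (y := 0) (by omega) (by omega)
  have := P.B_lt
  nlinarith

theorem GX_le : P.G * P.X ≤ P.L := Nat.mul_le_mul_left _ P.X_le

theorem group_lt {i u : ℕ} (hi : i < P.G) (hu : u < P.g) : i * P.g + u < P.L := Prog.block_lt hi hu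

end Sizes

/-- The edges in the list `es` are those up to the `z`-th one, without repetition. -/
structure EdgeList {w : ℕ} (P : Sizes w) (Z : ℕ → ℕ) (m z : ℕ) {N : ℕ} (es : List (Fin N × Fin N)) :
    Prop where
  nodup : es.Nodup
  mem : ∀ x y, (x, y) ∈ es ↔ P.IsEdge Z m z x y
  len : es.length ≤ m + z

section EdgeList

variable {w : ℕ} {P : Sizes w} {Z : ℕ → ℕ} {m z N : ℕ} {es : List (Fin N × Fin N)}

theorem EdgeList.skip (h : EdgeList P Z m z es)
    (hdup : ∃ z' < z, z' / P.g = z / P.g ∧ P.edgeEnd Z m z' = P.edgeEnd Z m z) :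
    EdgeList P Z m (z + 1) es := by
  refine ⟨h.nodup, fun x y => ?_, h.len.trans (by omega)⟩
  rw [h.mem, Sizes.IsEdge, Sizes.IsEdge]
  refine or_congr_right ⟨fun ⟨z', h1, h2⟩ => ⟨z', by omega, h2⟩, ?_⟩
  rintro ⟨z', h1, h2, h3⟩
  rcases (show z' < z ∨ z' = z by omega) with h1 | rfl
  · exact ⟨z', h1, h2, h3⟩
  · obtain ⟨z'', h4, h5, h6⟩ := hdup
    exact ⟨z'', h4, by rw [h6, h2], by rw [h5, h3]⟩

theorem EdgeList.insert (h : EdgeList P Z m z es) {U q : Fin N}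
    (hU : (U : ℕ) = P.edgeEnd Z m z) (hq : (q : ℕ) = m + 1 + z / P.g)
    (hdup : ¬ ∃ z' < z, z' / P.g = z / P.g ∧ P.edgeEnd Z m z' = P.edgeEnd Z m z) :
    EdgeList P Z m (z + 1) (es ++ [(U, q)]) := by
  refine ⟨?_, fun x y => ?_, ?_⟩
  · rw [List.nodup_append]
    refine ⟨h.nodup, by simp, ?_⟩
    rintro ⟨x, y⟩ hxy _ hb rfl
    simp only [List.mem_singleton, Prod.mk.injEq] at hb
    rw [h.mem] at hxy
    obtain ⟨rfl, rfl⟩ := hb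
    rcases hxy with ⟨h1, h2⟩ | ⟨z', h1, h2, h3⟩
    · generalize z / P.g = t at hq
      omega
    · exact hdup ⟨z', h1, by omega, by omega⟩
  · rw [List.mem_append, h.mem, Sizes.IsEdge, Sizes.IsEdge, or_assoc]
    refine or_congr_right ?_
    simp only [List.mem_singleton, Prod.mk.injEq, Fin.ext_iff, hU, hq]
    constructor
    · rintro (⟨z', h1, h2⟩ | h1)
      · exact ⟨z', by omega, h2⟩
      · exact ⟨z, by omega, h1⟩
    · rintro ⟨z', h1, h2⟩
      rcases (show z' < z ∨ z' = z by omega) with h1 | rfl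
      · exact Or.inl ⟨z', h1, h2⟩
      · exact Or.inr h2
  · have := h.len
    simp only [List.length_append, List.length_singleton]
    omega

/-- The array `st` tells which hash values are adjacent to the current set vertex. -/
def IsStamp (P : Sizes w) (Z : ℕ → ℕ) (m z : ℕ) (st : ℕ → ℕ) : Prop :=
  ∀ u < m, ∀ q, z ≤ (q + 1) * P.g →
    -- The stamps of different set vertices differ, so the array need not be cleared between them.
    -- Only the current set vertex and later ones are considered, since older stamps get
    -- overwritten.
    (st u = m + 1 + q ↔ ∃ z' < z, z' / P.g = q ∧ P.edgeEnd Z m z' = u)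

theorem IsStamp.skip {st : ℕ → ℕ} (h : IsStamp P Z m z st)
    (hdup : ∃ z' < z, z' / P.g = z / P.g ∧ P.edgeEnd Z m z' = P.edgeEnd Z m z) :
    IsStamp P Z m (z + 1) st := by
  intro u hu q' hq'
  rw [h u hu q' (by omega)]
  refine ⟨fun ⟨z', h1, h2⟩ => ⟨z', by omega, h2⟩, ?_⟩
  rintro ⟨z', h1, h2, h3⟩
  rcases (show z' < z ∨ z' = z by omega) with h1 | rfl
  · exact ⟨z', h1, h2, h3⟩
  · obtain ⟨z'', h4, h5, h6⟩ := hdup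
    exact ⟨z'', h4, by rw [h5, ← h2], by rw [h6, ← h3]⟩

theorem IsStamp.insert {st : ℕ → ℕ} (h : IsStamp P Z m z st) :
    IsStamp P Z m (z + 1) (fun u => if u = P.edgeEnd Z m z then m + 1 + z / P.g else st u) := by
  intro u hu q' hq'
  dsimp only
  split_ifs with huU
  · rw [add_right_inj]
    constructor
    · rintro rfl; exact ⟨z, by omega, rfl, huU.symm⟩
    · rintro ⟨z', h1, h2, -⟩
      have h3 : z' / P.g ≤ z / P.g := Nat.div_le_div_right (by omega)
      have h4 : z / P.g < q' + 1 := Nat.div_lt_of_lt_mul (by rw [mul_comm]; omega)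
      omega
  · rw [h u hu q' (by omega)]
    refine ⟨fun ⟨z', h1, h2⟩ => ⟨z', by omega, h2⟩, ?_⟩
    rintro ⟨z', h1, h2, h3⟩
    rcases (show z' < z ∨ z' = z by omega) with h1 | rfl
    · exact ⟨z', h1, h2, h3⟩
    · exact absurd h3.symm huU

end EdgeList

/-! ### Programs that write down the graph. -/

namespace Prog

/-- Initialize the arrays indexed by hash values, and the edges at the hub `m = v₁₄`. -/
def initUniverse : Prog :=
  for' 16 (V 14) (write 9 (V 16) 0 ;; write 10 (V 16) (V 16) ;; write 2 (V 16) (V 16) ;;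
    write 0 (V 16) (V 16) ;; write 1 (V 16) (V 14))

/-- Write the edges between hash values and set vertices. -/
def buildEdges : Prog :=
  assign 17 (V 14) ;;
  for' 16 (V 9 * V 12 * V 8) (
    assign 18 (V 16 / V 8) ;;
    assign 19 ((V 18 % V 12 + (V 14 - rd 5 (V 18 / V 12 * V 8 + V 16 % V 8) % V 14)) % V 14) ;;
    ite ((rd 9 (V 19)).eq (V 14 + 1 + V 18)) skip (
      write 9 (V 19) (V 14 + 1 + V 18) ;; write 0 (V 17) (V 19) ;;
      write 1 (V 17) (V 14 + 1 + V 18) ;; assign 17 (V 17 + 1)))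

variable {N : ℕ} {w : ℕ} {G : SimpleGraph (Fin N)} {d : ℕ}

theorem wp_initUniverse (P : Sizes w) {σ : UState N} {Q : UState N → Prop} {m : ℕ} (hm : σ.v 14 = m)
    (hmd : m ≤ P.d)
    (hQ : ∀ σ', σ.Agree initUniverse σ' → (∀ u < m, σ'.a 9 u = 0 ∧ σ'.a 10 u = u ∧ σ'.a 2 u = u ∧
      σ'.a 0 u = u ∧ σ'.a 1 u = m) → σ'.time ≤ σ.time + (m * 7 + 2) → Q σ') :
    initUniverse.wp true w G d Q σ := by
  have h1 := P.d_L_le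
  have h2 := P.B_lt'
  refine wp_for_const m (fun i σ₁ => ∀ u < i, σ₁.a 9 u = 0 ∧ σ₁.a 10 u = u ∧ σ₁.a 2 u = u ∧
      σ₁.a 0 u = u ∧ σ₁.a 1 u = m) 5 (by omega) (by simp [modV]) (by simp) ?_ (by simp) ?_ ?_
  · intro σ₁ h
    have := h.v 14 (by simp [modV, for'])
    simp [this, hm]
  · intro i hi σ₁ h hi1 hI
    have e14 := h.v 14 (by simp [modV, for'])
    simp only [wp_seq, wp_write]
    simp [hi1, e14, hm]
    intro u hu
    by_cases hui : u = i
    · simp [hui]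
    · simpa [hui] using hI u (by omega)
  · intro σ₁ h hi1 hI ht
    exact hQ σ₁ h hI (by omega)

/-- Numbers of the same group may share a hash value. The stamps detect this in constant time, which
keeps the edge list free of repetitions. -/
theorem wp_buildEdges (P : Sizes w) {N' : ℕ} {σ : UState N} {Q : UState N → Prop} {m : ℕ} (Z : ℕ → ℕ)
    (hm : σ.v 14 = m) (hm0 : 0 < m) (hmd : m ≤ P.d) (hN : N' = P.numV m)
    (hg : σ.v 8 = P.g) (hG : σ.v 9 = P.G) (hX : σ.v 12 = P.X) (hZ : σ.a 5 = Z)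
    (h9 : ∀ u < m, σ.a 9 u = 0) (h0 : ∀ u < m, σ.a 0 u = u) (h1 : ∀ u < m, σ.a 1 u = m)
    (hQ : ∀ σ', σ.Agree buildEdges σ' → ∀ es : List (Fin N' × Fin N'),
      EdgeList P Z m (P.G * P.X * P.g) es → σ'.v 17 = es.length →
      (∀ k (h : k < es.length), σ'.a 0 k = es[k].1 ∧ σ'.a 1 k = es[k].2) →
      σ'.time ≤ σ.time + (P.G * P.X * P.g * 9 + 3) → Q σ') :
    buildEdges.wp true w G d Q σ := by
  refine wp_mono_agree _ (Q := fun σ' => ∃ es : List (Fin N' × Fin N'),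
      EdgeList P Z m (P.G * P.X * P.g) es ∧ σ'.v 17 = es.length ∧
      (∀ k (h : k < es.length), σ'.a 0 k = es[k].1 ∧ σ'.a 1 k = es[k].2) ∧
      σ'.time ≤ σ.time + (P.G * P.X * P.g * 9 + 3)) ?_
    (fun σ' ha ⟨es, h1, h2, h3, h4⟩ => hQ σ' ha es h1 h2 h3 h4)
  have hdL := P.d_L_le
  have hB := P.B_lt'
  have hgp := P.g_pos
  have hXp := P.X_pos
  have hGX := P.GX_le
  -- Edge counters may exceed `B`, but they stay near `L * L`, which still fits into a word.
  have hG1 : P.G * P.X * P.g ≤ P.L * P.L := Nat.mul_le_mul hGX (by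
    have := P.G_pos; unfold Sizes.L; nlinarith)
  have hLL := P.mul_lt P.L_le P.L_le
  have hw0 := P.hw0
  rw [buildEdges, wp_seq, wp_assign]
  refine ⟨by simp, by simp, ?_⟩
  refine wp_for_const (P.G * P.X * P.g) (fun z σ₁ => ∃ es : List (Fin N' × Fin N'),
      EdgeList P Z m z es ∧ σ₁.v 17 = es.length ∧
      (∀ k (h : k < es.length), σ₁.a 0 k = es[k].1 ∧ σ₁.a 1 k = es[k].2) ∧
      IsStamp P Z m z (σ₁.a 9)) 7
    (by omega) (by simp [modV]) (by simp) ?_ ?_ ?_ ?_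
  · intro σ₁ h
    have e8 := h.v 8 (by simp [modV, for'])
    have e9 := h.v 9 (by simp [modV, for'])
    have e12 := h.v 12 (by simp [modV, for'])
    simp [hg, hG, hX] at e8 e9 e12
    simp [e8, e9, e12]
    have : P.G * P.X ≤ P.G * P.X * P.g := Nat.le_mul_of_pos_right _ hgp
    omega
  · refine ⟨List.ofFn fun u : Fin m => (⟨u, by rw [hN, Sizes.numV]; omega⟩,
      ⟨m, by rw [hN, Sizes.numV]; omega⟩), ⟨?_, ?_, by simp⟩, by simp [hm], ?_, ?_⟩
    · rw [List.nodup_ofFn]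
      intro a b hab
      simpa [Fin.ext_iff] using hab
    · intro x y
      simp only [List.mem_ofFn, Sizes.IsEdge, Prod.mk.injEq, Fin.ext_iff]
      constructor
      · rintro ⟨u, h1, h2⟩
        exact Or.inl ⟨by have := u.2; omega, h2.symm⟩
      · rintro (⟨h1, h2⟩ | ⟨z', h, -⟩)
        · exact ⟨⟨x, h1⟩, rfl, h2.symm⟩
        · omega
    · intro k hk
      simp only [List.length_ofFn] at hk
      simp [h0 k hk, h1 k hk]
    · intro u hu q _
      simp [h9 u hu]
      omega
  · rintro z hz σ₁ h hz1 ⟨es, hes, h17, hk, hst⟩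
    have e8 := h.v 8 (by simp [modV, for'])
    have e9 := h.v 9 (by simp [modV, for'])
    have e12 := h.v 12 (by simp [modV, for'])
    have e14 := h.v 14 (by simp [modV, for'])
    have ea : σ₁.a 5 = _ := h.a 5 (by simp [modA, for'])
    simp [hg, hX, hm] at e8 e12 e14
    simp only [UState.set_a, hZ] at ea
    set q := z / P.g with hq
    set U := P.edgeEnd Z m z with hU
    have hqlt : q < P.G * P.X := Nat.div_lt_of_lt_mul (by rwa [mul_comm])
    have hUlt : U < m := Nat.mod_lt _ hm0
    have hmodm : Z (q / P.X * P.g + z % P.g) % m < m := Nat.mod_lt _ hm0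
    have hqX : q % P.X < P.X := Nat.mod_lt _ hXp
    have hqX' : q / P.X < P.G := Nat.div_lt_of_lt_mul (by rwa [mul_comm])
    have hidx := P.group_lt hqX' (Nat.mod_lt z hgp)
    have hXL : P.X ≤ P.L := le_trans (Nat.le_mul_of_pos_left _ P.G_pos) hGX
    have hU' : (q % P.X + (m - Z (q / P.X * P.g + z % P.g) % m)) % m = U := rfl
    have hzq : z < (q + 1) * P.g := by
      rw [mul_comm]; exact Nat.lt_mul_div_succ z hgp
    have hqz : q * P.g ≤ z := Nat.div_mul_le_self z P.g
    have hlen := hes.len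
    have hGL : P.G * P.X * P.g ≤ P.L * P.L := hG1
    rw [wp_seq, wp_assign]
    refine ⟨by simp, by simp, ?_⟩
    rw [wp_seq, wp_assign]
    refine ⟨?_, by simp, ?_⟩
    · simp [e8, e12, e14, ea, hz1, ← hq]
      omega
    rw [wp_ite]
    simp only [wp_seq, wp_skip, wp_write, wp_assign]
    simp [e8, e12, e14, hz1, ea, ← hq]
    simp only [hU']
    have hdup := hst U hUlt q hzq.le
    refine ⟨by omega, fun hst1 => ?_, fun hst1 => ?_⟩
    · exact ⟨es, hes.skip (hdup.1 hst1), h17, hk, hst.skip (hdup.1 hst1)⟩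
    · refine ⟨by omega, by omega, ?_⟩
      have hUN : U < N' := by rw [hN, Sizes.numV]; omega
      have hqN : m + 1 + q < N' := by rw [hN, Sizes.numV]; omega
      refine ⟨es ++ [(⟨U, hUN⟩, ⟨m + 1 + q, hqN⟩)], hes.insert rfl rfl fun h => hst1 (hdup.2 h),
        by simp [h17], fun k hk' => ?_,
        (congrArg (IsStamp P Z m (z + 1)) (funext fun u => ?_)).mpr hst.insert⟩
      swap
      · simp [hU, hq]
      simp only [List.length_append, List.length_singleton] at hk'
      by_cases hkl : k = es.length
      · subst hkl; simp [h17]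
      · have : k < es.length := by omega
        simp [h17, hkl, List.getElem_append_left this, hk k this]
  · rintro σ₁ h hz1 ⟨es, hes, h17, hk, -⟩ ht
    exact ⟨es, hes, h17, hk, by simp only [UState.set_time] at ht; omega⟩

end Prog

/-- The numbers `Z i` are increasing, and `Z i + S` is bounded. -/
structure Nums {w : ℕ} (P : Sizes w) (Z : ℕ → ℕ) : Prop where
  lt : ∀ i j, i < j → j < P.L → Z i < Z j
  le : ∀ i < P.L, Z i + P.S ≤ P.B

theorem Nums.inj {w : ℕ} {P : Sizes w} {Z : ℕ → ℕ} (h : Nums P Z) {i j : ℕ} (hi : i < P.L)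
    (hj : j < P.L) (hij : Z i = Z j) : i = j := by
  rcases lt_trichotomy i j with h1 | h1 | h1
  · have := h.lt i j h1 hj; omega
  · exact h1
  · have := h.lt j i h1 hi; omega

theorem Nums.mono {w : ℕ} {P : Sizes w} {Z : ℕ → ℕ} (h : Nums P Z) {i j : ℕ} (hij : i ≤ j)
    (hj : j < P.L) : Z i ≤ Z j := by
  rcases hij.lt_or_eq with h1 | rfl
  · exact (h.lt i j h1 hj).le
  · exact le_rfl

/-- The memory holds the sizes, the numbers and the table of their positions. -/
structure Base {w N : ℕ} (P : Sizes w) (Z : ℕ → ℕ) (σ : UState N) : Prop where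
  v4 : σ.v 4 = P.S
  v5 : σ.v 5 = P.d
  v8 : σ.v 8 = P.g
  v9 : σ.v 9 = P.G
  v10 : σ.v 10 = P.L
  v11 : σ.v 11 = P.Y
  v12 : σ.v 12 = P.X
  v13 : σ.v 13 = P.B
  a5 : σ.a 5 = Z
  a6 : ∀ i < P.L, σ.a 6 (Z i) = i

theorem Base.of_eq {w N : ℕ} {P : Sizes w} {Z : ℕ → ℕ} {σ σ' : UState N} (h : Base P Z σ)
    (hv : ∀ x, 4 ≤ x → x ≤ 13 → σ'.v x = σ.v x) (h5 : σ'.a 5 = σ.a 5) (h6 : σ'.a 6 = σ.a 6) :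
    Base P Z σ' := by
  obtain ⟨v4, v5, v8, v9, v10, v11, v12, v13, a5, a6⟩ := h
  constructor <;> first | rw [hv _ (by norm_num) (by norm_num)]; assumption | (try rw [h5]); (try rw [h6]); assumption

theorem Base.of_agree {w N : ℕ} {P : Sizes w} {Z : ℕ → ℕ} {σ σ' : UState N} {p : Prog}
    (h : Base P Z σ) (ha : σ.Agree p σ') (hp : ∀ x ∈ p.modV, ¬ (4 ≤ x ∧ x ≤ 13)) (h5 : 5 ∉ p.modA)
    (h6 : 6 ∉ p.modA) : Base P Z σ' :=
  h.of_eq (fun x hx hx' => ha.v x fun hm => hp x hm ⟨hx, hx'⟩) (ha.a 5 h5) (ha.a 6 h6)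

/-- Combination of the hash value of `Z i + S` and the index `i`. -/
def Sizes.key {w : ℕ} (P : Sizes w) (Z : ℕ → ℕ) (m i : ℕ) : ℕ := (Z i + P.S) % m * P.L + i

/-- The state of the user's memory after the preprocessing. -/
structure Ready {w N : ℕ} (P : Sizes w) (Z : ℕ → ℕ) (m : ℕ) (σ : UState N) : Prop where
  base : Base P Z σ
  v14 : σ.v 14 = m
  v15 : σ.v 15 = m / P.X + 1
  v20 : σ.v 20 = 0
  -- Variable `21` holds the code of the current deleted set. Proper codes are positive, so `0`
  -- means that nothing has been deleted yet.
  v21 : σ.v 21 = 0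
  a8 : Prog.IsSorting (P.key Z m) (σ.a 8) P.L
  perm : ∀ u < m, σ.a 10 u = u ∧ σ.a 2 u = u
  -- The staircase of every number starts at the last group.
  a11 : ∀ i < P.L, σ.a 11 i = P.G - 1

namespace Prog

/-- The keys of all numbers. -/
def makeKeys : Prog :=
  for' 16 (V 10) (write 7 (V 16) ((rd 5 (V 16) + V 4) % V 14 * V 10 + V 16))

/-- The preparations that depend on the random number in `v₁₄`. -/
def prepare : Prog :=
  assign 14 (V 11 + V 14 % V 11) ;;
  assign 15 (V 14 / V 12 + 1) ;;
  makeKeys ;;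
  sort 7 8 ;;
  initUniverse ;;
  buildEdges ;;
  for' 16 (V 10) (write 11 (V 16) (V 9 - 1)) ;;
  assign 20 0 ;;
  assign 21 0 ;;
  assign 0 (V 14 + 1 + V 9 * V 12) ;;
  assign 1 (V 17) ;;
  assign 2 (V 5)

variable {N : ℕ} {w : ℕ} {G : SimpleGraph (Fin N)} {d : ℕ}

theorem key_lt (P : Sizes w) {Z : ℕ → ℕ} {m i : ℕ} (hm0 : 0 < m) (hmd : m ≤ P.d) (hi : i < P.L) :
    P.key Z m i < m * P.L ∧ m * P.L + P.L ≤ P.B := by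
  have h1 : (Z i + P.S) % m + 1 ≤ m := Nat.mod_lt _ hm0
  have h2 := P.B_ge
  constructor
  · unfold Sizes.key
    nlinarith [Nat.mul_le_mul_right P.L h1]
  · calc m * P.L + P.L = (m + 1) * P.L := by ring
      _ ≤ (5 * P.S + P.d + 1) * (P.L + 1) := Nat.mul_le_mul (by omega) (by omega)
      _ ≤ P.B := h2

theorem wp_makeKeys (P : Sizes w) {Z : ℕ → ℕ} (hZ : Nums P Z) {σ : UState N} {Q : UState N → Prop}
    {m : ℕ} (hb : Base P Z σ) (hm : σ.v 14 = m) (hm0 : 0 < m) (hmd : m ≤ P.d)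
    (hQ : ∀ σ', σ.Agree makeKeys σ' → (∀ i < P.L, σ'.a 7 i = P.key Z m i) →
      σ'.time ≤ σ.time + (P.L * 3 + 2) → Q σ') :
    makeKeys.wp true w G d Q σ := by
  have h1 := P.d_L_le
  have h2 := P.B_lt'
  refine wp_for_const P.L (fun i σ₁ => ∀ u < i, σ₁.a 7 u = P.key Z m u) 1
    (by omega) (by simp [modV]) (by simp) ?_ (by simp) ?_ ?_
  · intro σ₁ h
    have := h.v 10 (by simp [modV, for'])
    simp [this, hb.v10]
  · intro i hi σ₁ h hi1 hI
    have e14 := h.v 14 (by simp [modV, for'])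
    have e10 := h.v 10 (by simp [modV, for'])
    have e4 := h.v 4 (by simp [modV, for'])
    have ea : σ₁.a 5 = _ := h.a 5 (by simp [modA, for'])
    rw [hm] at e14
    rw [hb.v10] at e10
    rw [hb.v4] at e4
    rw [hb.a5] at ea
    obtain ⟨hk1, hk2⟩ := key_lt P (Z := Z) hm0 hmd hi
    have hk3 : P.key Z m i = (Z i + P.S) % m * P.L + i := rfl
    have hle := hZ.le i hi
    rw [wp_write]
    simp [hi1, e14, e10, e4, ea]
    refine ⟨by omega, fun u hu => ?_⟩
    by_cases hui : u = i
    · simp [hui, Sizes.key]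
    · simpa [hui] using hI u (by omega)
  · intro σ₁ h hi1 hI ht
    exact hQ σ₁ h hI (by omega)

theorem key_inj (P : Sizes w) {Z : ℕ → ℕ} {m i j : ℕ} (hi : i < P.L) (hj : j < P.L)
    (h : P.key Z m i = P.key Z m j) : i = j := by
  have h1 : P.key Z m i % P.L = P.key Z m j % P.L := by rw [h]
  simp only [Sizes.key, Nat.mul_add_mod'] at h1
  rwa [Nat.mod_eq_of_lt hi, Nat.mod_eq_of_lt hj] at h1

/-- The modulus becomes `Y` plus the residue of a random word modulo `Y`. All work here precedes the
first call of the data structure, so it may use the shared names and ends by placing the graph where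
the preprocessing expects it. -/
theorem wp_prepare (P : Sizes w) {Z : ℕ → ℕ} (hZ : Nums P Z) {N' : ℕ} {σ : UState N}
    {Q : UState N → Prop} {m : ℕ} (hb : Base P Z σ) (hm : m = P.Y + σ.v 14 % P.Y)
    (hN : N' = P.numV m)
    (hQ : ∀ σ', (prepare.local' = true → σ'.nf = σ.nf ∧ σ'.nq = σ.nq) → Ready P Z m σ' →
      ∀ es : List (Fin N' × Fin N'), EdgeList P Z m (P.G * P.X * P.g) es →
        (∀ k (h : k < es.length), σ'.a 0 k = es[k].1 ∧ σ'.a 1 k = es[k].2) →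
        σ'.v 0 = N' → σ'.v 1 = es.length → σ'.v 2 = P.d →
        σ'.time ≤ σ.time + (P.G * (6 * P.g + 6) + P.L * (4 * P.G + 6 * P.g + 12) + m * 7 +
          P.G * P.X * P.g * 9 + P.L * 6 + 30) → Q σ') :
    prepare.wp true w G d Q σ := by
  have hdL := P.d_L_le
  have hB := P.B_lt'
  have hw0 := P.hw0
  have hYp := P.Y_pos
  have hYd := P.Y_le
  have hmY : σ.v 14 % P.Y < P.Y := Nat.mod_lt _ hYp
  have hm0 : 0 < m := by omega
  have hmd : m ≤ P.d := by omega
  have hmX : m / P.X ≤ m := Nat.div_le_self _ _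
  have hGX := P.GX_le
  refine wp_mono_agree _ (Q := fun σ' => Ready P Z m σ' ∧
      ∃ es : List (Fin N' × Fin N'), EdgeList P Z m (P.G * P.X * P.g) es ∧
        (∀ k (h : k < es.length), σ'.a 0 k = es[k].1 ∧ σ'.a 1 k = es[k].2) ∧
        σ'.v 0 = N' ∧ σ'.v 1 = es.length ∧ σ'.v 2 = P.d ∧
        σ'.time ≤ σ.time + (P.G * (6 * P.g + 6) + P.L * (4 * P.G + 6 * P.g + 12) + m * 7 +
          P.G * P.X * P.g * 9 + P.L * 6 + 30)) ?_ (fun σ' ha h => ?_)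
  swap
  · obtain ⟨h1, es, h2, h3, h4, h5, h6, h7⟩ := h
    exact hQ σ' (fun h => ⟨(ha.ghost h).2.2.1, (ha.ghost h).2.2.2⟩) h1 es h2 h3 h4 h5 h6 h7
  rw [prepare, wp_seq, wp_assign]
  refine ⟨by simp [hb.v11]; omega, by simp, ?_⟩
  rw [wp_seq, wp_assign]
  refine ⟨by simp [hb.v11, hb.v12, ← hm, hw0]; omega, by simp, ?_⟩
  set σ₁ := (σ.set 14 _).set 15 _ with hσ₁
  have hb1 : Base P Z σ₁ := hb.of_eq (fun x h1 h2 => by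
    simp [hσ₁, show x ≠ 14 by omega, show x ≠ 15 by omega]) rfl rfl
  have h14 : σ₁.v 14 = m := by simp [hσ₁, hb.v11, hm]
  have h15 : σ₁.v 15 = m / P.X + 1 := by simp [hσ₁, hb.v11, hb.v12, hm]
  have ht1 : σ₁.time = σ.time + 2 := rfl
  clear_value σ₁
  rw [wp_seq]
  refine wp_makeKeys P hZ hb1 h14 hm0 hmd fun σ₂ ha2 hkeys ht2 => ?_
  have hb2 := hb1.of_agree ha2 (by simp [makeKeys, for', modV]) (by simp [makeKeys, for', modA])
    (by simp [makeKeys, for', modA])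
  have e14 := ha2.v 14 (by simp [makeKeys, for', modV])
  have e15 := ha2.v 15 (by simp [makeKeys, for', modV])
  rw [wp_seq]
  refine wp_sort (by norm_num) (by norm_num) (by norm_num) (by norm_num) (by norm_num) (g := P.g)
    (n := P.G) hb2.v8 hb2.v9 (by rw [hb2.v10]; rfl) P.g_pos ?_ (by rw [hb2.v13]; exact P.L_le)
    (by rw [hb2.v13]; omega) ?_ fun σ₃ ha3 hsort ht3 => ?_
  · intro i hi
    rw [hkeys i hi, hb2.v13]
    have := key_lt P (Z := Z) hm0 hmd hi
    omega
  · intro i hi j hj hij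
    rw [hkeys i hi, hkeys j hj] at hij
    exact key_inj P hi hj hij
  have hsort' : IsSorting (P.key Z m) (σ₃.a 8) P.L :=
    ⟨hsort.lt, fun t ht => by
      obtain ⟨i, hi, h⟩ := hsort.mem t ht
      exact ⟨i, hi, by rw [h, hkeys i hi]⟩, fun i hi => by
      obtain ⟨t, ht, h⟩ := hsort.surj i hi
      exact ⟨t, ht, by rw [h, hkeys i hi]⟩⟩
  have hb3 := hb2.of_agree ha3 (by simp [sort, nextMin, for', modV]) (by simp [sort, nextMin, for', modA])
    (by simp [sort, nextMin, for', modA])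
  have f14 := ha3.v 14 (by simp [sort, nextMin, for', modV])
  have f15 := ha3.v 15 (by simp [sort, nextMin, for', modV])
  rw [wp_seq]
  refine wp_initUniverse P (m := m) (by rw [f14, e14, h14]) hmd fun σ₄ ha4 hinit ht4 => ?_
  have hb4 := hb3.of_agree ha4 (by simp [initUniverse, for', modV]) (by simp [initUniverse, for', modA])
    (by simp [initUniverse, for', modA])
  have g14 := ha4.v 14 (by simp [initUniverse, for', modV])
  have g15 := ha4.v 15 (by simp [initUniverse, for', modV])
  have g8 : σ₄.a 8 = _ := ha4.a 8 (by simp [initUniverse, for', modA])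
  rw [wp_seq]
  refine wp_buildEdges P (N' := N') Z (by rw [g14, f14, e14, h14]) hm0 hmd hN hb4.v8 hb4.v9 hb4.v12
    hb4.a5 (fun u hu => (hinit u hu).1) (fun u hu => (hinit u hu).2.2.2.1)
    (fun u hu => (hinit u hu).2.2.2.2) fun σ₅ ha5 es hes h17 hk ht5 => ?_
  have hb5 := hb4.of_agree ha5 (by simp [buildEdges, for', modV]) (by simp [buildEdges, for', modA])
    (by simp [buildEdges, for', modA])
  have k14 := ha5.v 14 (by simp [buildEdges, for', modV])
  have k15 := ha5.v 15 (by simp [buildEdges, for', modV])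
  have k8 : σ₅.a 8 = _ := ha5.a 8 (by simp [buildEdges, for', modA])
  have k10 : σ₅.a 10 = _ := ha5.a 10 (by simp [buildEdges, for', modA])
  have k2 : σ₅.a 2 = _ := ha5.a 2 (by simp [buildEdges, for', modA])
  rw [wp_seq]
  refine wp_for_const P.L (fun i σ₁ => ∀ u < i, σ₁.a 11 u = P.G - 1) 1
    (by omega) (by simp [modV]) (by simp) ?_ (by simp) ?_ ?_
  · intro σ' h
    have := h.v 10 (by simp [modV, for'])
    simp [this, hb5.v10]
  · intro i hi σ' h hi1 hI
    have e9 := h.v 9 (by simp [modV, for'])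
    rw [hb5.v9] at e9
    have := P.G_pos
    rw [wp_write]
    simp [hi1, e9, hw0]
    refine ⟨by omega, fun u hu => ?_⟩
    by_cases hui : u = i
    · simp [hui]
    · simpa [hui] using hI u (by omega)
  · intro σ₆ ha6 hi1 hI ht6
    have hb6 := hb5.of_agree ha6 (by simp [for', modV]) (by simp [for', modA])
      (by simp [for', modA])
    have l14 := ha6.v 14 (by simp [for', modV])
    have l15 := ha6.v 15 (by simp [for', modV])
    have l17 := ha6.v 17 (by simp [for', modV])
    have l8 : σ₆.a 8 = _ := ha6.a 8 (by simp [for', modA])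
    have l10 : σ₆.a 10 = _ := ha6.a 10 (by simp [for', modA])
    have l2 : σ₆.a 2 = _ := ha6.a 2 (by simp [for', modA])
    have l0 : σ₆.a 0 = _ := ha6.a 0 (by simp [for', modA])
    have l1 : σ₆.a 1 = _ := ha6.a 1 (by simp [for', modA])
    have z14 : σ₆.v 14 = m := by rw [l14, k14, g14, f14, e14, h14]
    simp only [wp_seq, wp_assign]
    simp [z14, hb6.v9, hb6.v12, hw0]
    refine ⟨by omega, ⟨?_, by simp [z14], ?_, by simp, by simp, ?_, ?_, ?_⟩, es, hes, ?_, ?_, ?_, ?_, ?_⟩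
    · exact hb6.of_eq (fun x h1 h2 => by
        simp [show x ≠ 20 by omega, show x ≠ 21 by omega, show x ≠ 0 by omega, show x ≠ 1 by omega,
          show x ≠ 2 by omega]) rfl rfl
    · simp; rw [l15, k15, g15, f15, e15, h15]
    · simp only [UState.set_a, l8, k8, g8]
      exact hsort'
    · intro u hu
      simp only [UState.set_a, l10, l2, k10, k2]
      exact ⟨(hinit u hu).2.1, (hinit u hu).2.2.1⟩
    · simpa using hI
    · simpa [l0, l1] using hk
    · rw [hN]; rfl
    · rw [l17, h17]
    · exact hb6.v5
    · unfold Sizes.L at *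
      omega

end Prog

/-! ## Answers to the queries -/

namespace Sizes

variable {w : ℕ} (P : Sizes w) (Z : ℕ → ℕ) (m : ℕ)

/-- The hash values which are not deleted when group `i` is considered together with the hash values
between `x₁ * X` and `(x₁ + 1) * X`. -/
def Kept (i x₁ u : ℕ) : Prop := ∃ k < P.g, (Z (i * P.g + k) + (m - x₁ * P.X)) % m = u

/-- The hash values do not exclude that `Z c + S` is the sum of a number in group `i` and one in
group `j`. -/
def Pos (i j c : ℕ) : Prop :=
  ∃ k < P.g, ∃ k' < P.g, (Z (i * P.g + k) + Z (j * P.g + k')) % m = (Z c + P.S) % m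

/-- `Z c + S` is the sum of a number in group `i` and another one, all with different indices. -/
def Val (i c : ℕ) : Prop :=
  ∃ k < P.g, ∃ b < P.L, Z (i * P.g + k) + Z b = Z c + P.S ∧ i * P.g + k ≠ b ∧ i * P.g + k ≠ c ∧ b ≠ c

/-- The graph with all edges. -/
def graph : SimpleGraph (Fin (P.numV m)) :=
  SimpleGraph.fromRel fun x y => P.IsEdge Z m (P.G * P.X * P.g) x y

variable {P Z m}

theorem IsEdge.lt (hm : 0 < m) {z x y : ℕ} (h : P.IsEdge Z m z x y) : x < m ∧ m ≤ y := by
  rcases h with ⟨h1, rfl⟩ | ⟨z', -, rfl, rfl⟩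
  · exact ⟨h1, le_rfl⟩
  · exact ⟨Nat.mod_lt _ hm, by rw [add_assoc]; exact Nat.le_add_right _ _⟩

theorem graph_adj (hm : 0 < m) {x y : Fin (P.numV m)} : (P.graph Z m).Adj x y ↔
    P.IsEdge Z m (P.G * P.X * P.g) x y ∨ P.IsEdge Z m (P.G * P.X * P.g) y x := by
  rw [graph, SimpleGraph.fromRel_adj, and_iff_right_iff_imp]
  rintro (h | h) rfl
  · have := h.lt hm; omega
  · have := h.lt hm; omega

theorem isEdgeList_graph (hm : 0 < m) {es : List (Fin (P.numV m) × Fin (P.numV m))}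
    (h : EdgeList P Z m (P.G * P.X * P.g) es) : IsEdgeList (P.graph Z m) es := by
  constructor
  · refine h.nodup.map_on ?_
    rintro ⟨x, y⟩ h1 ⟨x', y'⟩ h2 h3
    have h1 := ((h.mem x y).1 h1).lt hm
    have h2 := ((h.mem x' y').1 h2).lt hm
    simp only [Sym2.eq_iff] at h3
    rcases h3 with ⟨rfl, rfl⟩ | ⟨rfl, rfl⟩
    · rfl
    · omega
  · intro x y
    rw [graph_adj hm, ← h.mem, ← h.mem]
    simp only [List.mem_map, Sym2.eq_iff, Prod.exists]
    constructor
    · rintro (h | h)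
      · exact ⟨_, _, h, Or.inl ⟨rfl, rfl⟩⟩
      · exact ⟨_, _, h, Or.inr ⟨rfl, rfl⟩⟩
    · rintro ⟨a, b, h, ⟨rfl, rfl⟩ | ⟨rfl, rfl⟩⟩
      · exact Or.inl h
      · exact Or.inr h

/-- Decoding of the edge index: quotient by `g`, then digits in base `X`. The hub edges end at `m`,
below all set vertices, and play no part. -/
theorem isEdge_set_iff {u j x₂ : ℕ} (hj : j < P.G) (hx : x₂ < P.X) :
    P.IsEdge Z m (P.G * P.X * P.g) u (m + 1 + j * P.X + x₂) ↔
      ∃ k < P.g, (x₂ + (m - Z (j * P.g + k) % m)) % m = u := by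
  have hg := P.g_pos
  have hq : j * P.X + x₂ + 1 ≤ P.G * P.X := Prog.block_lt hj hx
  have e1 : (j * P.X + x₂) / P.X = j := by
    rw [mul_comm, Nat.mul_add_div P.X_pos, Nat.div_eq_of_lt hx, add_zero]
  have e2 : (j * P.X + x₂) % P.X = x₂ := by
    rw [mul_comm, Nat.mul_add_mod, Nat.mod_eq_of_lt hx]
  constructor
  · rintro (⟨-, h⟩ | ⟨z', h1, h2, h3⟩)
    · omega
    · have h4 : z' / P.g = j * P.X + x₂ := by
        generalize z' / P.g = q at h3; omega
      refine ⟨z' % P.g, Nat.mod_lt _ hg, ?_⟩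
      rw [h2, edgeEnd, h4, e1, e2]
  · rintro ⟨k, hk, h⟩
    refine Or.inr ⟨(j * P.X + x₂) * P.g + k, ?_, ?_, ?_⟩
    · calc (j * P.X + x₂) * P.g + k < (j * P.X + x₂ + 1) * P.g := by
            rw [add_mul (j * P.X + x₂)]; omega
        _ ≤ _ := Nat.mul_le_mul_right _ hq
    · have e3 : ((j * P.X + x₂) * P.g + k) / P.g = j * P.X + x₂ := by
        rw [mul_comm, Nat.mul_add_div hg, Nat.div_eq_of_lt hk, add_zero]
      have e4 : ((j * P.X + x₂) * P.g + k) % P.g = k := by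
        rw [mul_comm, Nat.mul_add_mod, Nat.mod_eq_of_lt hk]
      rw [edgeEnd, e3, e4, e1, e2, h]
    · rw [mul_comm _ P.g, Nat.mul_add_div hg, Nat.div_eq_of_lt hk]; omega

/-- The hub is connected with a set vertex exactly if some neighbor of the latter is not deleted. -/
theorem connectedAvoiding_iff (hm : 0 < m) {F : List (Fin (P.numV m))} {h s : Fin (P.numV m)}
    (hF : ∀ x ∈ F, (x : ℕ) < m) (hh : (h : ℕ) = m) (hs : m < (s : ℕ)) :
    ConnectedAvoiding (P.graph Z m) F h s ↔
      ∃ u : Fin (P.numV m), u ∉ F ∧ P.IsEdge Z m (P.G * P.X * P.g) u s := by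
  have hhF : h ∉ F := fun hx => by have := hF h hx; omega
  have hsF : s ∉ F := fun hx => by have := hF s hx; omega
  constructor
  · rintro ⟨hu, hv, hr⟩
    -- The first edge of a path leaving the set vertex is enough: all neighbors of a set vertex are
    -- hash values. Conversely, a surviving hash value is adjacent to the hub.
    obtain ⟨p⟩ := hr.symm
    cases p with
    | nil => omega
    | cons ha p =>
      rename_i v
      have ha : (P.graph Z m).Adj s v := ha
      rcases (graph_adj hm).1 ha with ha | ha
      · have := ha.lt hm; omega
      · exact ⟨v, v.2, ha⟩
  · rintro ⟨u, hu, hus⟩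
    have h1 : (P.graph Z m).Adj h u := (graph_adj hm).2 (Or.inr (Or.inl ⟨(hus.lt hm).1, hh⟩))
    have h2 : (P.graph Z m).Adj u s := (graph_adj hm).2 (Or.inl hus)
    refine ⟨hhF, hsF, ?_⟩
    have h1' : ((P.graph Z m).induce {x | x ∉ F}).Adj ⟨h, hhF⟩ ⟨u, hu⟩ := h1
    have h2' : ((P.graph Z m).induce {x | x ∉ F}).Adj ⟨u, hu⟩ ⟨s, hsF⟩ := h2
    exact h1'.reachable.trans h2'.reachable

/-- Both sides say that `m` divides a combination of the same numbers; passing to `ℤ` removes the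
truncated subtractions, which are harmless because the subtrahends are at most `m`. -/
theorem add_sub_mod_eq_iff {x y a b m : ℕ} (hm : 0 < m) (hx : x ≤ m) :
    (b + (m - y % m)) % m = (a + (m - x)) % m ↔ (a + y) % m = (x + b) % m := by
  have hy : y % m ≤ m := (Nat.mod_lt _ hm).le
  change b + (m - y % m) ≡ a + (m - x) [MOD m] ↔ a + y ≡ x + b [MOD m]
  have hy2 : y % m ≡ y [MOD m] := Nat.mod_modEq y m
  simp only [← Int.natCast_modEq_iff] at hy2 ⊢
  push_cast [Nat.cast_sub hx, Nat.cast_sub hy] at hy2 ⊢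
  simp only [Int.modEq_iff_dvd] at hy2 ⊢
  constructor
  · intro h
    have := (dvd_add h hy2).neg_right
    ring_nf at this ⊢
    exact this
  · intro h
    have := (dvd_add h hy2).neg_right
    ring_nf at this ⊢
    exact this

/-- The heart of the construction: a surviving hash value `Z a - x₁ * X` that is also a neighbor `x₂
- Z b` gives `Z a + Z b ≡ x₁ * X + x₂`, which is the residue of `Z c + S`. Splitting the residue
lets the deleted set depend on `i` and `x₁` only and the queried vertex on `j` and `x₂` only. -/
theorem exists_kept_iff (hm : 0 < m) {i j c x₁ x₂ : ℕ} (hi : x₁ * P.X ≤ m) (hj : j < P.G) (hx : x₂ < P.X)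
    (hc : x₁ * P.X + x₂ = (Z c + P.S) % m) :
    (∃ u, P.Kept Z m i x₁ u ∧ P.IsEdge Z m (P.G * P.X * P.g) u (m + 1 + j * P.X + x₂)) ↔
      P.Pos Z m i j c := by
  simp only [isEdge_set_iff hj hx, Kept, Pos]
  have hmod : (x₁ * P.X + x₂) % m = (Z c + P.S) % m := by rw [hc, Nat.mod_mod]
  constructor
  · rintro ⟨u, ⟨k, hk, rfl⟩, k', hk', h⟩
    exact ⟨k, hk, k', hk', by rw [← hmod]; exact (add_sub_mod_eq_iff hm hi).1 h⟩
  · rintro ⟨k, hk, k', hk', h⟩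
    exact ⟨_, ⟨k, hk, rfl⟩, k', hk', (add_sub_mod_eq_iff hm hi).2 (by rw [h, hmod])⟩

end Sizes

/-! ## Programs of the main loop -/

/-- The arrays `p` and `q` hold a permutation of the numbers below `m` and its inverse. -/
structure IsPerm (m : ℕ) (p q : ℕ → ℕ) : Prop where
  lt : ∀ u < m, p u < m ∧ q u < m
  inv : ∀ u < m, p (q u) = u ∧ q (p u) = u

/-- Move `e` to position `l - 1`. -/
theorem IsPerm.swap {m l e : ℕ} {p q : ℕ → ℕ} (h : IsPerm m p q) (he : e < m) (hel : q e < l)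
    (hl : l ≤ m) :
    let p' := fun k => if k = l - 1 then e else if k = q e then p (l - 1) else p k
    let q' := fun u => if u = e then l - 1 else if u = p (l - 1) then q e else q u
    IsPerm m p' q' ∧ ∀ u < m, q' u < l - 1 ↔ q u < l ∧ u ≠ e := by
  have h1 := h.lt
  have h2 := h.inv
  have h3 := h1 (l - 1) (by omega)
  have h4 := h2 (l - 1) (by omega)
  have h5 := h1 e he
  have h6 := h2 e he
  intro p' q'
  refine ⟨⟨fun u hu => ?_, fun u hu => ?_⟩, fun u hu => ?_⟩
  · have h7 := h1 u hu
    simp only [p', q']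
    constructor
    · split_ifs <;> omega
    · split_ifs <;> omega
  · have h7 := h1 u hu
    have h8 := h2 u hu
    simp only [p', q']
    constructor
    · split_ifs <;> grind
    · split_ifs <;> grind
  · have h7 := h1 u hu
    have h8 := h2 u hu
    simp only [q']
    split_ifs with h9 h10
    · simp [h9]
    · grind
    · grind

namespace Prog

/-- Write into array `2` the hash values that are to be deleted; `v₃₈` is their number. -/
def build : Prog :=
  assign 38 (V 14) ;;
  for' 41 (V 8) (
    assign 42 ((rd 5 (V 31 * V 8 + V 41) + (V 14 - V 35 * V 12)) % V 14) ;;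
    assign 43 (rd 10 (V 42)) ;;
    ite ((V 43).lt (V 38)) (
      assign 38 (V 38 - 1) ;; assign 44 (rd 2 (V 38)) ;; write 2 (V 43) (V 44) ;;
      write 10 (V 44) (V 43) ;; write 2 (V 38) (V 42) ;; write 10 (V 42) (V 38)) skip)

/-- Search for a solution that involves group `v₃₁` and the number `v₃₃`. -/
def verify : Prog :=
  for' 45 (V 8) (
    assign 46 (rd 5 (V 31 * V 8 + V 45)) ;;
    ite ((V 37).lt (V 46)) skip (
      assign 47 (V 37 - V 46) ;; assign 48 (rd 6 (V 47)) ;;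
      ite ((V 48).lt (V 10)) (ite ((rd 5 (V 48)).eq (V 47)) (
        ite ((V 31 * V 8 + V 45).eq (V 48)) skip (ite ((V 31 * V 8 + V 45).eq (V 33)) skip (
          ite ((V 48).eq (V 33)) skip (assign 20 1)))) skip) skip))

/-- What remains fixed in the main loop. -/
structure Fixed {w N : ℕ} (P : Sizes w) (Z : ℕ → ℕ) (m : ℕ) (σ : UState N) : Prop where
  base : Base P Z σ
  v14 : σ.v 14 = m
  v15 : σ.v 15 = m / P.X + 1
  a8 : Prog.IsSorting (P.key Z m) (σ.a 8) P.L

theorem Fixed.of_agree {w N : ℕ} {P : Sizes w} {Z : ℕ → ℕ} {m : ℕ} {σ σ' : UState N} {p : Prog}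
    (h : Fixed P Z m σ) (ha : σ.Agree p σ') (hp : ∀ x ∈ p.modV, ¬ (4 ≤ x ∧ x ≤ 15))
    (h5 : 5 ∉ p.modA) (h6 : 6 ∉ p.modA) (h8 : 8 ∉ p.modA) : Fixed P Z m σ' :=
  ⟨h.base.of_agree ha (fun x hx h => hp x hx ⟨h.1, h.2.trans (by norm_num)⟩) h5 h6,
    (ha.v 14 fun h => hp 14 h (by norm_num)).trans h.v14,
    (ha.v 15 fun h => hp 15 h (by norm_num)).trans h.v15, by rw [ha.a 8 h8]; exact h.a8⟩

theorem Fixed.of_eq {w N : ℕ} {P : Sizes w} {Z : ℕ → ℕ} {m : ℕ} {σ σ' : UState N}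
    (h : Fixed P Z m σ) (hv : ∀ x, 4 ≤ x → x ≤ 15 → σ'.v x = σ.v x) (h5 : σ'.a 5 = σ.a 5)
    (h6 : σ'.a 6 = σ.a 6) (h8 : σ'.a 8 = σ.a 8) : Fixed P Z m σ' :=
  ⟨h.base.of_eq (fun x h1 h2 => hv x h1 (by omega)) h5 h6,
    (hv 14 (by norm_num) (by norm_num)).trans h.v14,
    (hv 15 (by norm_num) (by norm_num)).trans h.v15, by rw [h8]; exact h.a8⟩

variable {N : ℕ} {w : ℕ} {G : SimpleGraph (Fin N)} {d : ℕ} {P : Sizes w} {Z : ℕ → ℕ} {m : ℕ}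

/-- Array `2` always holds a permutation of the hash values, with its inverse in array `10`. The
list starts as all of them, and each value to be kept is swapped behind its end. This costs `O(g)`
steps per deletion; writing the list afresh would cost `O(m)`, which is too much. It works because
the procedures leave array `2` intact. -/
theorem wp_build (hZ : Nums P Z) {σ : UState N} {Q : UState N → Prop} {i x₁ : ℕ}
    (hf : Fixed P Z m σ) (hm0 : 0 < m) (hmd : m ≤ P.d) (h31 : σ.v 31 = i) (hi : i < P.G)
    (h35 : σ.v 35 = x₁) (hx : x₁ * P.X ≤ m) (hp : IsPerm m (σ.a 2) (σ.a 10))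
    (hQ : ∀ σ', σ.Agree build σ' → IsPerm m (σ'.a 2) (σ'.a 10) → σ'.v 38 ≤ m →
      (∀ u < m, σ'.a 10 u < σ'.v 38 ↔ ¬ P.Kept Z m i x₁ u) →
      σ'.time ≤ σ.time + (P.g * 11 + 3) → Q σ') :
    build.wp false w G d Q σ := by
  refine wp_mono_agree _ (Q := fun σ' => IsPerm m (σ'.a 2) (σ'.a 10) ∧ σ'.v 38 ≤ m ∧
      (∀ u < m, σ'.a 10 u < σ'.v 38 ↔ ¬ P.Kept Z m i x₁ u) ∧
      σ'.time ≤ σ.time + (P.g * 11 + 3)) ?_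
    (fun σ' ha h => hQ σ' ha h.1 h.2.1 h.2.2.1 h.2.2.2)
  have hdL := P.d_L_le
  have hB := P.B_lt'
  have hgL : P.g ≤ P.L := Nat.le_mul_of_pos_left _ P.G_pos
  have hw0 := P.hw0
  rw [build, wp_seq, wp_assign]
  refine ⟨by simp, by simp, ?_⟩
  refine wp_for_const P.g (fun k σ₁ => IsPerm m (σ₁.a 2) (σ₁.a 10) ∧ σ₁.v 38 ≤ m ∧
      ∀ u < m, σ₁.a 10 u < σ₁.v 38 ↔
        ¬ ∃ k' < k, (Z (i * P.g + k') + (m - x₁ * P.X)) % m = u) 9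
    (by omega) (by simp [modV]) (by simp) ?_ ?_ ?_ ?_
  · intro σ₁ h
    have e8 := h.v 8 (by simp [modV, for'])
    simp [hf.base.v8] at e8
    simp [e8]
  · refine ⟨hp, by simp [hf.v14], fun u hu => ?_⟩
    simpa [hf.v14] using (hp.lt u hu).2
  · rintro k hk σ₁ h hk1 ⟨hp1, hl, hinv⟩
    have e8 := h.v 8 (by simp [modV, for'])
    have e12 := h.v 12 (by simp [modV, for'])
    have e14 := h.v 14 (by simp [modV, for'])
    have e31 := h.v 31 (by simp [modV, for'])
    have e35 := h.v 35 (by simp [modV, for'])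
    have ea : σ₁.a 5 = _ := h.a 5 (by simp [modA, for'])
    simp [hf.base.v8, hf.base.v12, hf.v14, h31, h35] at e8 e12 e14 e31 e35
    simp only [UState.set_a, hf.base.a5] at ea
    have hidx := P.group_lt hi hk
    have hZle := hZ.le _ hidx
    have hLB := P.L_le
    set e := (Z (i * P.g + k) + (m - x₁ * P.X)) % m with he
    have hem : e < m := Nat.mod_lt _ hm0
    have hstep : ∀ u, (∃ k' < k + 1, (Z (i * P.g + k') + (m - x₁ * P.X)) % m = u) ↔
        (∃ k' < k, (Z (i * P.g + k') + (m - x₁ * P.X)) % m = u) ∨ u = e := by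
      intro u
      constructor
      · rintro ⟨k', h1, h2⟩
        rcases (show k' < k ∨ k' = k by omega) with h1 | rfl
        · exact Or.inl ⟨k', h1, h2⟩
        · exact Or.inr h2.symm
      · rintro (⟨k', h1, h2⟩ | h2)
        · exact ⟨k', by omega, h2⟩
        · exact ⟨k, by omega, h2.symm⟩
    rw [wp_seq, wp_assign]
    refine ⟨?_, by simp, ?_⟩
    · simp [e8, e12, e14, e31, e35, ea, hk1]
      omega
    rw [wp_seq, wp_assign]
    refine ⟨by simp, by simp, ?_⟩
    have hval : ((rd 5 (V 31 * V 8 + V 41) + (V 14 - V 35 * V 12)) % V 14).nat w σ₁ = e := by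
      simp [e8, e12, e14, e31, e35, ea, hk1, he]
    rw [hval]
    rw [wp_ite]
    simp only [wp_seq, wp_skip, wp_write, wp_assign]
    have hsw := hp1.swap hem (l := σ₁.v 38)
    simp only [hstep, not_or]
    by_cases hlt : σ₁.a 10 e < σ₁.v 38
    · obtain ⟨h1, h2⟩ := hsw hlt hl
      simp [hlt]
      exact ⟨by omega, (congrArg₂ (IsPerm m) (funext fun k => by simp) (funext fun k => by simp)).mpr h1,
        by omega, fun u hu => (h2 u hu).trans (by rw [hinv u hu]; simp)⟩
    · simp [hlt, hp1, hl]
      intro u hu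
      rw [hinv u hu]
      simp
      intro h3 rfl
      exact hlt ((hinv _ hu).2 (by simpa using h3))
  · rintro σ₁ h hk1 ⟨hp1, hl, hinv⟩ ht
    exact ⟨hp1, hl, hinv, by simp only [UState.set_time] at ht; omega⟩

/-- The deleted vertices are the hash values that are not kept for group `i` and `x₁`. -/
structure _root_.FailState (P : Sizes w) (Z : ℕ → ℕ) (m i x₁ : ℕ) (σ : UState N) : Prop where
  fz : ∀ k, σ.fz k = σ.a 2 k
  mem : ∀ u : Fin N, u ∈ σ.F ↔ (u : ℕ) < m ∧ ¬ P.Kept Z m i x₁ u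

/-- Make the set of deleted vertices the one which is needed next. -/
def update : Prog :=
  ite ((V 31 * V 15 + V 35 + 1).eq (V 21)) skip
    (build ;; fail (V 38) ;; assign 21 (V 31 * V 15 + V 35 + 1))

theorem exists_failList {l : ℕ} {p q : ℕ → ℕ} (hp : IsPerm m p q) (hl : l ≤ m) (hm : m ≤ N) :
    ∃ F : List (Fin N), F.Nodup ∧ F.length = l ∧ (∀ i (h : i < F.length), p i = F[i]) ∧
      ∀ u : Fin N, u ∈ F ↔ (u : ℕ) < m ∧ q u < l := by
  refine ⟨List.ofFn fun k : Fin l => ⟨p k, by have := hp.lt k (by omega); omega⟩, ?_, by simp, ?_, ?_⟩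
  · rw [List.nodup_ofFn]
    intro a b hab
    have h1 := (hp.inv a (by omega)).2
    have h2 := (hp.inv b (by omega)).2
    have h3 : p a = p b := by simpa [Fin.ext_iff] using hab
    rw [h3] at h1
    exact Fin.ext (by omega)
  · intro i h
    simp
  · intro u
    simp only [List.mem_ofFn, Fin.ext_iff]
    constructor
    · rintro ⟨k, hk⟩
      have h1 := hp.lt k (by omega)
      have h2 := hp.inv k (by omega)
      rw [hk] at h1 h2
      exact ⟨h1.1, by omega⟩
    · rintro ⟨h1, h2⟩
      exact ⟨⟨q u, h2⟩, (hp.inv u h1).1⟩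

/-- A deletion is made only if the required code differs from the stored one. As the required code
is never smaller, each deletion raises the stored code, so the code bounds the number of deletions.
The work on the list, `O(g)` per deletion, is charged to `nf`. -/
theorem wp_update (hZ : Nums P Z) {σ : UState N} {Q : UState N → Prop} {i x₁ : ℕ}
    (hf : Fixed P Z m σ) (hm0 : 0 < m) (hmd : m ≤ P.d) (hN : m ≤ N) (hd : m ≤ d) (h31 : σ.v 31 = i)
    (hi : i < P.G) (h35 : σ.v 35 = x₁) (hx : x₁ * P.X ≤ m) (hx' : x₁ ≤ m / P.X)
    (hp : IsPerm m (σ.a 2) (σ.a 10))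
    (hlast : σ.v 21 = i * (m / P.X + 1) + x₁ + 1 → FailState P Z m i x₁ σ) (hnf : σ.nf ≤ σ.v 21)
    (hle : σ.v 21 ≤ i * (m / P.X + 1) + x₁ + 1)
    (hQ : ∀ σ', σ.Agree update σ' → IsPerm m (σ'.a 2) (σ'.a 10) → FailState P Z m i x₁ σ' →
      σ'.v 21 = i * (m / P.X + 1) + x₁ + 1 → σ'.nf ≤ σ'.v 21 → σ'.nq = σ.nq →
      σ'.time + (P.g * 11 + 8) * σ.nf ≤ σ.time + (P.g * 11 + 8) * σ'.nf + 2 → Q σ') :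
    update.wp false w G d Q σ := by
  refine wp_mono_agree _ (Q := fun σ' => IsPerm m (σ'.a 2) (σ'.a 10) ∧ FailState P Z m i x₁ σ' ∧
      σ'.v 21 = i * (m / P.X + 1) + x₁ + 1 ∧ σ'.nf ≤ σ'.v 21 ∧ σ'.nq = σ.nq ∧
      σ'.time + (P.g * 11 + 8) * σ.nf ≤ σ.time + (P.g * 11 + 8) * σ'.nf + 2) ?_
    (fun σ' ha h => hQ σ' ha h.1 h.2.1 h.2.2.1 h.2.2.2.1 h.2.2.2.2.1 h.2.2.2.2.2)
  have hdL := P.d_L_le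
  have hGL : P.G ≤ P.L := Nat.le_mul_of_pos_right _ P.g_pos
  have hmX : m / P.X ≤ m := Nat.div_le_self _ _
  have hmul := P.mul_lt (x := i) (y := m / P.X + 1) (by omega) (by omega)
  have hw0 := P.hw0
  have hok : (V 31 * V 15 + V 35 + 1).Ok false w σ ∧
      (V 31 * V 15 + V 35 + 1).nat w σ = i * (m / P.X + 1) + x₁ + 1 := by
    simp [h31, h35, hf.v15, hw0]
    omega
  rw [update, wp_ite]
  refine ⟨by rw [NatExpr.ok_eq]; exact ⟨hok.1, by simp⟩, fun h => ?_, fun h => ?_⟩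
  · have h1 : σ.v 21 = i * (m / P.X + 1) + x₁ + 1 := by
      by_contra h1
      simp only [NatExpr.nat_eq, hok.2, NatExpr.nat_var] at h
      simp [Ne.symm h1] at h
    rw [wp_skip]
    exact ⟨hp, ⟨(hlast h1).fz, (hlast h1).mem⟩, h1, hnf, rfl, by simp; omega⟩
  · have h1 : σ.v 21 ≠ i * (m / P.X + 1) + x₁ + 1 := by
      intro h1
      simp only [NatExpr.nat_eq, hok.2, NatExpr.nat_var] at h
      simp [h1] at h
    rw [wp_seq]
    refine wp_build hZ (hf.of_eq (fun _ _ _ => rfl) rfl rfl rfl) hm0 hmd (by simpa using h31) hi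
      (by simpa using h35) hx hp fun σ₁ ha hp1 hl hk ht => ?_
    have e31 := ha.v 31 (by simp [build, for', modV])
    have e35 := ha.v 35 (by simp [build, for', modV])
    have e15 := ha.v 15 (by simp [build, for', modV])
    have e21 := ha.v 21 (by simp [build, for', modV])
    have hgh := ha.ghost rfl
    simp [h31, h35, hf.v15] at e31 e35 e15 e21 hgh
    obtain ⟨F, hF1, hF2, hF3, hF4⟩ := exists_failList hp1 hl hN
    rw [wp_seq]
    refine ⟨rfl, by simp, F, hF1, by omega, by simp [hF2], fun i h => hF3 i h, ?_⟩
    rw [wp_assign]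
    simp [e31, e35, e15, hw0, hgh]
    refine ⟨by omega, ⟨hp1.lt, hp1.inv⟩, ⟨fun k => by simp, fun u => ?_⟩, by omega, ?_⟩
    · simp only [UState.set_F, UState.delete_F]
      rw [hF4]
      refine and_congr_right fun hu => hk u hu
    · simp at ht
      rw [mul_add]
      omega

/-- The partner of `a` must be `y = Z c + S - Z a`, whose position is looked up in array `6`. That
array has arbitrary contents outside the numbers `Z i`, so the position found is trusted only after
checking that array `5` holds `y` there. -/
theorem wp_verify {σ : UState N} {Q : UState N → Prop} {i c : ℕ} (hf : Fixed P Z m σ)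
    (h31 : σ.v 31 = i) (hi : i < P.G) (h33 : σ.v 33 = c) (h37 : σ.v 37 = Z c + P.S)
    (h20 : σ.v 20 = 0)
    (hQ : ∀ σ', σ.Agree verify σ' → (P.Val Z i c → σ'.v 20 = 1) → (¬ P.Val Z i c → σ'.v 20 = 0) →
      σ'.time ≤ σ.time + (P.g * 12 + 2) → Q σ') :
    verify.wp false w G d Q σ := by
  have hdL := P.d_L_le
  have hB := P.B_lt'
  have hgL : P.g ≤ P.L := Nat.le_mul_of_pos_left _ P.G_pos
  have hw0 := P.hw0
  refine wp_for_const P.g (fun k σ₁ =>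
      ((∃ k' < k, ∃ b < P.L, Z (i * P.g + k') + Z b = Z c + P.S ∧ i * P.g + k' ≠ b ∧ i * P.g + k' ≠ c ∧ b ≠ c) →
        σ₁.v 20 = 1) ∧
      ((¬ ∃ k' < k, ∃ b < P.L, Z (i * P.g + k') + Z b = Z c + P.S ∧ i * P.g + k' ≠ b ∧ i * P.g + k' ≠ c ∧ b ≠ c) →
        σ₁.v 20 = 0)) 10
    (by omega) (by simp [modV]) (by simp) ?_ ?_ ?_ ?_
  · intro σ₁ h
    have e8 := h.v 8 (by simp [modV, for'])
    simp [hf.base.v8] at e8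
    simp [e8]
  · simp [h20]
  · rintro k hk σ₁ h hk1 ⟨hI, hI'⟩
    have e8 := h.v 8 (by simp [modV, for'])
    have e10 := h.v 10 (by simp [modV, for'])
    have e31 := h.v 31 (by simp [modV, for'])
    have e33 := h.v 33 (by simp [modV, for'])
    have e37 := h.v 37 (by simp [modV, for'])
    have ea : σ₁.a 5 = _ := h.a 5 (by simp [modA, for'])
    have ea6 : σ₁.a 6 = _ := h.a 6 (by simp [modA, for'])
    rw [hf.base.v8] at e8
    rw [hf.base.v10] at e10
    rw [h31] at e31
    rw [h33] at e33
    rw [h37] at e37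
    rw [hf.base.a5] at ea
    have hidx := P.group_lt hi hk
    have hLB := P.L_le
    set a := i * P.g + k with ha
    set y := Z c + P.S - Z a with hy
    set b := σ.a 6 y with hb
    have hbL : ∀ b' < P.L, Z a + Z b' = Z c + P.S → b = b' := by
      intro b' hb' he
      have : y = Z b' := by omega
      rw [hb, this, hf.base.a6 b' hb']
    have hstep : (∃ k' < k + 1, ∃ b < P.L, Z (i * P.g + k') + Z b = Z c + P.S ∧
          i * P.g + k' ≠ b ∧ i * P.g + k' ≠ c ∧ b ≠ c) ↔
        (∃ k' < k, ∃ b < P.L, Z (i * P.g + k') + Z b = Z c + P.S ∧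
          i * P.g + k' ≠ b ∧ i * P.g + k' ≠ c ∧ b ≠ c) ∨
        Z a ≤ Z c + P.S ∧ b < P.L ∧ Z b = y ∧ a ≠ b ∧ a ≠ c ∧ b ≠ c := by
      constructor
      · rintro ⟨k', h1, b', h2, h3, h4⟩
        rcases (show k' < k ∨ k' = k by omega) with h1 | h1
        · exact Or.inl ⟨k', h1, b', h2, h3, h4⟩
        · rw [h1, ← ha] at h3 h4
          obtain rfl : b' = b := (hbL b' h2 h3).symm
          exact Or.inr ⟨by omega, h2, by omega, h4⟩
      · rintro (⟨k', h1, h2⟩ | ⟨h1, h2, h3, h4⟩)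
        · exact ⟨k', by omega, h2⟩
        · exact ⟨k, by omega, b, h2, by rw [← ha]; omega, h4⟩
    simp only [hstep]
    generalize hE : (∃ k' < k, ∃ b < P.L, Z (i * P.g + k') + Z b = Z c + P.S ∧
          i * P.g + k' ≠ b ∧ i * P.g + k' ≠ c ∧ b ≠ c) = E at hI hI' ⊢
    simp only [wp_seq, wp_skip, wp_assign, wp_ite]
    have e3 : σ₁.a 6 y = b := by rw [ea6]
    simp [e8, e10, e31, e33, e37, ea, hk1, ← ha]
    simp only [← hy, e3]
    have hbd : i * P.g < 2 ^ w ∧ a < 2 ^ w := by omega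
    refine ⟨by omega, ?_⟩
    clear hstep hbL hE
    clear_value a b y
    by_cases h1 : Z c + P.S < Z a
    · simp [h1, not_le.2 h1]
      exact ⟨hI, hI'⟩
    by_cases h2 : b < P.L
    swap
    · simp [h1, h2]
      grind
    by_cases h3 : Z b = y
    swap
    · simp [h1, h2, h3]
      grind
    by_cases h4 : a = b
    · simp [h2, h3, h4]
      grind
    by_cases h5 : a = c
    · simp [h2, h3, h5]
      grind
    by_cases h6 : b = c
    · simp [h1, h5, h6]
      grind
    · simp [h1, h2, h3, h4, h5, h6, hw0]
      omega
  · rintro σ₁ h hk1 ⟨hI, hI'⟩ ht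
    exact hQ σ₁ h hI hI' (by omega)

end Prog

/-! ## The groups that are tried -/

namespace Sizes

variable {w : ℕ} (P : Sizes w) (Z : ℕ → ℕ) (m : ℕ)

/-- The first group to be tried together with group `i`; the groups with smaller numbers follow, up to
number `stair (i + 1)`. -/
def stair (c : ℕ) : ℕ → ℕ
  | 0 => P.G - 1
  | i + 1 => Nat.findGreatest (fun j => Z (i * P.g + (P.g - 1)) + Z (j * P.g) ≤ Z c + P.S) (stair c i)

/-- A query with a positive answer that does not lead to a solution. -/
def Bad (i j c : ℕ) : Prop := P.Pos Z m i j c ∧ ¬ P.Val Z i c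

open Classical in
/-- The number of bad queries for group `i` and number `c`. -/
noncomputable def bads (i c : ℕ) : ℕ :=
  ((Finset.Icc (P.stair Z c (i + 1)) (P.stair Z c i)).filter fun j => P.Bad Z m i j c).card

variable {P Z}

theorem stair_succ_le (c i : ℕ) : P.stair Z c (i + 1) ≤ P.stair Z c i := by
  rw [stair]; exact Nat.findGreatest_le _

theorem stair_le (c i : ℕ) : P.stair Z c i ≤ P.G - 1 := by
  induction i with
  | zero => exact le_rfl
  | succ i ih => exact (stair_succ_le c i).trans ih

theorem stair_lt (c i : ℕ) : P.stair Z c i < P.G := by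
  have := P.stair_le (Z := Z) c i
  have := P.G_pos
  omega

/-- Monotonicity of `Z`. If `j` were below the step for `i + 1`, even the last number of group `i`
plus the first of that step would be at most the target, while the given sum is strictly smaller
still. If `i'` precedes `i`, the last number of group `i'` plus the first of group `j` does not
exceed the given sum, so no earlier step descends below `j`. The default value `0` of
`Nat.findGreatest` does no harm, being a lower bound anyway. -/
theorem stair_of_solution (hZ : Nums P Z) {i k j k' c : ℕ} (hi : i < P.G) (hk : k < P.g) (hj : j < P.G)
    (hk' : k' < P.g) (h : Z (i * P.g + k) + Z (j * P.g + k') = Z c + P.S) :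
    P.stair Z c (i + 1) ≤ j ∧ j ≤ P.stair Z c i := by
  have hg := P.g_pos
  have h1 : Z (j * P.g) ≤ Z (j * P.g + k') := hZ.mono (by omega) (P.group_lt hj hk')
  constructor
  · by_contra hlt
    rw [not_le] at hlt
    have h2 := Nat.findGreatest_of_ne_zero (rfl : P.stair Z c (i + 1) = _) (by omega)
    have h3 : Z (i * P.g + k) ≤ Z (i * P.g + (P.g - 1)) :=
      hZ.mono (by omega) (P.group_lt hi (by omega))
    have hs := P.stair_lt (Z := Z) c (i + 1)
    have h4 : Z (j * P.g + k') < Z (P.stair Z c (i + 1) * P.g) :=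
      hZ.lt _ _ (by nlinarith) (by simpa using P.group_lt hs hg)
    omega
  · have key : ∀ i' ≤ i, j ≤ P.stair Z c i' := by
      intro i'
      induction i' with
      | zero => intro _; change j ≤ P.G - 1; omega
      | succ i' ih =>
        intro hi'
        refine Nat.le_findGreatest (ih (by omega)) ?_
        have h2 : Z (i' * P.g + (P.g - 1)) ≤ Z (i * P.g + k) :=
          hZ.mono (by
            have : (i' + 1) * P.g ≤ i * P.g := Nat.mul_le_mul_right _ hi'
            rw [add_mul] at this
            omega) (P.group_lt hi hk)
        omega
    exact key i le_rfl

end Sizes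

namespace Prog

/-- Ask about the groups `v₃₁` and `v₃₉`. -/
def tryGroup : Prog :=
  query (V 14) (V 14 + 1 + (V 39 * V 12 + V 36)) 22 ;;
  ite (V 22) (ite (V 20) skip verify) skip ;;
  -- If the last number of group `i` plus the first of group `j` exceeds the target, group `j - 1`
  -- is tried next; otherwise `j` is where group `i + 1` has to start.
  ite ((V 37).lt (rd 5 (V 31 * V 8 + (V 8 - 1)) + rd 5 (V 39 * V 8)))
    (ite (V 39) (assign 39 (V 39 - 1)) (assign 40 0)) (assign 40 0)

/-- Ask about the group `v₃₁` and all other groups in question. -/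
def tryGroups : Prog :=
  assign 40 1 ;;
  loop (V 40) tryGroup

variable {N : ℕ} {w d : ℕ} {P : Sizes w} {Z : ℕ → ℕ} {m : ℕ}

open Classical in
/-- Invariant of `tryGroups`. -/
structure TryInv (P : Sizes w) (Z : ℕ → ℕ) (m i c : ℕ) (σ σ₁ : UState N) : Prop where
  -- The flag `v₄₀` is `1` as long as group `v₃₉` is still to be tried. So the groups already tried
  -- are those from `v₃₉ + v₄₀` up to the top of the step.
  v40 : σ₁.v 40 ≤ 1
  le : σ₁.v 39 ≤ P.stair Z c i
  gt : ∀ j, σ₁.v 39 < j → j ≤ P.stair Z c i →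
    ¬ Z (i * P.g + (P.g - 1)) + Z (j * P.g) ≤ Z c + P.S
  halted : σ₁.v 40 = 0 → σ₁.v 39 ≠ 0 →
    Z (i * P.g + (P.g - 1)) + Z (σ₁.v 39 * P.g) ≤ Z c + P.S
  v20 : σ₁.v 20 ≤ 1
  yes : σ₁.v 20 = 1 → σ.v 20 = 1 ∨ P.Val Z i c
  no : σ₁.v 20 = 0 → σ.v 20 = 0 ∧
    ∀ j, σ₁.v 39 + σ₁.v 40 ≤ j → j ≤ P.stair Z c i → P.Pos Z m i j c → ¬ P.Val Z i c
  F : σ₁.F = σ.F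
  fz : σ₁.fz = σ.fz
  nf : σ₁.nf = σ.nf
  nq : σ₁.nq + (σ₁.v 39 + σ₁.v 40) = σ.nq + (P.stair Z c i + 1)
  time : σ₁.time + (P.g * 12 + 2) * σ.v 20 + 10 * σ.nq ≤ σ.time + 10 * σ₁.nq + (P.g * 12 + 2) * (σ₁.v 20 +
    ((Finset.Icc (σ₁.v 39 + σ₁.v 40) (P.stair Z c i)).filter fun j => P.Bad Z m i j c).card)

/-- The two vertices of the query are never deleted, because deleted vertices are hash values; the
answer decides the congruence by `Sizes.connectedAvoiding_iff` and `Sizes.exists_kept_iff`. -/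
theorem wp_query_hub (hm0 : 0 < m) (hmd : m ≤ P.d) {σ : UState (P.numV m)} {Q : UState (P.numV m) → Prop}
    {i c j x₁ x₂ : ℕ} (hf : Fixed P Z m σ) (h39 : σ.v 39 = j) (hj : j < P.G) (h36 : σ.v 36 = x₂)
    (hx₂ : x₂ < P.X) (hx : x₁ * P.X + x₂ = (Z c + P.S) % m) (hF : FailState P Z m i x₁ σ)
    (hQ : ∀ b, (b = 1 → P.Pos Z m i j c) → (b = 0 → ¬ P.Pos Z m i j c) → b ≤ 1 → Q (σ.ask.set 22 b)) :
    (query (V 14) (V 14 + 1 + (V 39 * V 12 + V 36)) 22).wp false w (P.graph Z m) d Q σ := by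
  have hdL := P.d_L_le
  have hB := P.B_lt'
  have hGX := P.GX_le
  have hq : j * P.X + x₂ + 1 ≤ P.G * P.X := Prog.block_lt hj hx₂
  have hxm : x₁ * P.X + x₂ < m := by rw [hx]; exact Nat.mod_lt _ hm0
  have hmem : ∀ u : Fin (P.numV m), m ≤ (u : ℕ) → u ∉ σ.F := fun u hu h => by
    have := ((hF.mem u).1 h).1
    omega
  have hh : m < P.numV m := by rw [Sizes.numV]; omega
  have hs : m + 1 + (j * P.X + x₂) < P.numV m := by rw [Sizes.numV]; omega
  have hiff : ConnectedAvoiding (P.graph Z m) σ.F ⟨m, hh⟩ ⟨m + 1 + (j * P.X + x₂), hs⟩ ↔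
      P.Pos Z m i j c := by
    rw [Sizes.connectedAvoiding_iff hm0 (fun x hx => ((hF.mem x).1 hx).1) rfl
      (show m < m + 1 + (j * P.X + x₂) by omega), ← Sizes.exists_kept_iff hm0 (x₁ := x₁) (by omega) hj hx₂ hx]
    simp only [← add_assoc]
    constructor
    · rintro ⟨u, h1, h2⟩
      refine ⟨u, ?_, h2⟩
      by_contra h3
      exact h1 ((hF.mem u).2 ⟨(h2.lt hm0).1, h3⟩)
    · rintro ⟨u, h1, h2⟩
      have h3 := (h2.lt hm0).1
      exact ⟨⟨u, by omega⟩, fun h4 => ((hF.mem _).1 h4).2 h1, h2⟩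
  refine ⟨rfl, by norm_num, by simp, ?_, hF.fz, ⟨m, hh⟩, ⟨m + 1 + (j * P.X + x₂), hs⟩, by simp [hf.v14], ?_,
    hmem _ le_rfl, hmem _ (by simp only [add_assoc]; omega), ?_⟩
  · simp [hf.v14, h39, h36, hf.base.v12, P.hw0]
    omega
  · simp [hf.v14, h39, h36, hf.base.v12]
  · rw [hiff]
    refine hQ _ ?_ ?_ ?_
    all_goals split_ifs <;> simp_all

/-- The accounting for one query. An exhaustive search is made only while no solution is known, so
it either raises `v₂₀` from `0` to `1`, which happens once, or its query is bad and enters the set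
counted in the invariant. -/
theorem TryInv.step {σ σ₁ σ₂ : UState N} {i c j : ℕ} (h : TryInv P Z m i c σ σ₁) (h40 : σ₁.v 40 = 1)
    (h39 : σ₁.v 39 = j)
    (hv20 : σ₂.v 20 ≤ 1) (hyes : σ₂.v 20 = 1 → σ₁.v 20 = 1 ∨ P.Val Z i c)
    (hno : σ₂.v 20 = 0 → σ₁.v 20 = 0 ∧ (P.Pos Z m i j c → ¬ P.Val Z i c))
    (hF : σ₂.F = σ₁.F) (hfz : σ₂.fz = σ₁.fz) (hnf : σ₂.nf = σ₁.nf) (hnq : σ₂.nq = σ₁.nq + 1)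
    (ht : σ₂.time ≤ σ₁.time + 10 ∨ σ₂.time ≤ σ₁.time + (P.g * 12 + 12) ∧
      ((σ₁.v 20 = 0 ∧ σ₂.v 20 = 1) ∨ P.Bad Z m i j c))
    (hexit : (σ₂.v 40 = 0 ∧ σ₂.v 39 = j ∧
        (j ≠ 0 → Z (i * P.g + (P.g - 1)) + Z (j * P.g) ≤ Z c + P.S)) ∨
      (σ₂.v 40 = 1 ∧ σ₂.v 39 + 1 = j ∧ ¬ Z (i * P.g + (P.g - 1)) + Z (j * P.g) ≤ Z c + P.S)) :
    TryInv P Z m i c σ σ₂ ∧ σ₂.v 39 + σ₂.v 40 < σ₁.v 39 + σ₁.v 40 := by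
  classical
  have hsum : σ₂.v 39 + σ₂.v 40 = j := by omega
  have hle := h.le
  have hmono : σ₁.v 20 ≤ σ₂.v 20 := by
    rcases (show σ₂.v 20 = 0 ∨ σ₂.v 20 = 1 by omega) with h0 | h0
    · rw [(hno h0).1]; omega
    · have := h.v20; omega
  have hIcc : Finset.Icc j (P.stair Z c i) = insert j (Finset.Icc (j + 1) (P.stair Z c i)) := by
    rw [← Finset.insert_Icc_succ_left_eq_Icc (by omega)]; rfl
  refine ⟨⟨by omega, by omega, ?_, ?_, hv20, ?_, ?_, hF.trans h.F, hfz.trans h.fz, hnf.trans h.nf, ?_, ?_⟩, ?_⟩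
  · intro j' h1 h2
    rcases hexit with h3 | h3
    · exact h.gt j' (by omega) h2
    · rcases (show j' = j ∨ j < j' by omega) with rfl | h4
      · exact h3.2.2
      · exact h.gt j' (by omega) h2
  · intro h1 h2
    rcases hexit with h3 | h3
    · rw [h3.2.1] at h2 ⊢; exact h3.2.2 h2
    · omega
  · intro h1
    rcases hyes h1 with h2 | h2
    · exact h.yes h2
    · exact Or.inr h2
  · intro h1
    obtain ⟨h2, h3⟩ := hno h1
    obtain ⟨h4, h5⟩ := h.no h2
    refine ⟨h4, fun j' h6 h7 => ?_⟩
    rcases (show j' = j ∨ j + 1 ≤ j' by omega) with rfl | h8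
    · exact h3
    · exact h5 j' (by omega) h7
  · have := h.nq
    omega
  · have h1 := h.time
    rw [hsum, hIcc, Finset.filter_insert]
    rw [h39, h40] at h1
    have h2 : ((Finset.Icc (j + 1) (P.stair Z c i)).filter fun j => P.Bad Z m i j c).card +
        (if P.Bad Z m i j c then 1 else 0) ≤ (if P.Bad Z m i j c then
          insert j ((Finset.Icc (j + 1) (P.stair Z c i)).filter fun j => P.Bad Z m i j c) else
          (Finset.Icc (j + 1) (P.stair Z c i)).filter fun j => P.Bad Z m i j c).card := by
      split_ifs with h3
      · rw [Finset.card_insert_of_notMem (by simp)]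
      · simp
    set K := ((Finset.Icc (j + 1) (P.stair Z c i)).filter fun j => P.Bad Z m i j c).card
    refine le_trans ?_ (Nat.add_le_add_left (Nat.mul_le_mul_left _ (Nat.add_le_add_left h2 _)) _)
    have h4 : σ₂.time ≤ σ₁.time + 10 + (P.g * 12 + 2) * ((σ₂.v 20 - σ₁.v 20) +
        (if P.Bad Z m i j c then 1 else 0)) := by
      rcases ht with ht | ⟨ht, ht' | ht'⟩
      · exact ht.trans (by omega)
      · rw [ht'.1, ht'.2]
        nlinarith [Nat.zero_le (if P.Bad Z m i j c then 1 else 0)]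
      · rw [if_pos ht']
        nlinarith [Nat.zero_le (σ₂.v 20 - σ₁.v 20)]
    obtain ⟨e, he⟩ := Nat.exists_eq_add_of_le hmono
    rw [he, Nat.add_sub_cancel_left] at h4
    rw [he, hnq]
    simp only [mul_add] at h1 h4 ⊢
    omega
  · omega

theorem wp_tryGroup (hZ : Nums P Z) (hm0 : 0 < m) (hmd : m ≤ P.d) {σ σ₁ : UState (P.numV m)}
    {i c x₁ x₂ : ℕ} (hf : Fixed P Z m σ₁) (h31 : σ₁.v 31 = i) (hi : i < P.G) (h33 : σ₁.v 33 = c)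
    (h37 : σ₁.v 37 = Z c + P.S) (h36 : σ₁.v 36 = x₂)
    (hx₂ : x₂ < P.X) (hx : x₁ * P.X + x₂ = (Z c + P.S) % m) (hF : FailState P Z m i x₁ σ₁)
    (hI : TryInv P Z m i c σ σ₁) (h40 : σ₁.v 40 = 1) :
    tryGroup.wp false w (P.graph Z m) d (fun σ₂ => TryInv P Z m i c σ σ₂ ∧
      σ₂.v 39 + σ₂.v 40 < σ₁.v 39 + σ₁.v 40) σ₁.tick := by
  have hdL := P.d_L_le
  have hB := P.B_lt'
  have hg := P.g_pos
  have hw0 := P.hw0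
  set j := σ₁.v 39 with hj0
  have hj : j < P.G := lt_of_le_of_lt hI.le (Sizes.stair_lt c i)
  have hidx1 := P.group_lt hi (show P.g - 1 < P.g by omega)
  have hidx2 : j * P.g < P.L := by simpa using P.group_lt hj hg
  have hZ1 := hZ.le _ hidx1
  have hZ2 := hZ.le _ hidx2
  have hLB := P.L_le
  have h20 := hI.v20
  rw [tryGroup, wp_seq]
  refine wp_query_hub hm0 hmd (i := i) (c := c) (j := j) (x₁ := x₁) (x₂ := x₂) (hf.of_eq (fun _ _ _ => rfl) rfl rfl rfl) (by simp [hj0]) hj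
    (by simpa using h36) hx₂ hx ⟨hF.fz, hF.mem⟩ fun b hb1 hb0 hb => ?_
  set σ₂ := σ₁.tick.ask.set 22 b with hσ₂
  have e20 : σ₂.v 20 = σ₁.v 20 := by simp [hσ₂]
  have e39 : σ₂.v 39 = j := by simp [hσ₂, hj0]
  have e40 : σ₂.v 40 = 1 := by simp [hσ₂, h40]
  have e22 : σ₂.v 22 = b := by simp [hσ₂]
  have e31 : σ₂.v 31 = i := by simp [hσ₂, h31]
  have e33 : σ₂.v 33 = c := by simp [hσ₂, h33]
  have e37 : σ₂.v 37 = Z c + P.S := by simp [hσ₂, h37]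
  have hf2 : Fixed P Z m σ₂ := hf.of_eq (fun x h1 h2 => by simp [hσ₂, show x ≠ 22 by omega]) rfl rfl rfl
  have eF : σ₂.F = σ₁.F := rfl
  have efz : σ₂.fz = σ₁.fz := rfl
  have enf : σ₂.nf = σ₁.nf := rfl
  have enq : σ₂.nq = σ₁.nq + 1 := rfl
  have et : σ₂.time = σ₁.time + 4 := rfl
  clear_value σ₂
  rw [wp_seq]
  refine wp_mono_agree _ (Q := fun σ₃ => σ₃.v 20 ≤ 1 ∧ (σ₃.v 20 = 1 → σ₁.v 20 = 1 ∨ P.Val Z i c) ∧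
    (σ₃.v 20 = 0 → σ₁.v 20 = 0 ∧ (P.Pos Z m i j c → ¬ P.Val Z i c)) ∧
    (σ₃.time ≤ σ₁.time + 7 ∨ σ₃.time ≤ σ₁.time + (P.g * 12 + 8) ∧
      ((σ₁.v 20 = 0 ∧ σ₃.v 20 = 1) ∨ P.Bad Z m i j c))) ?_ ?_
  · rw [wp_ite]
    refine ⟨by simp, fun h1 => ?_, fun h1 => ?_⟩
    · simp only [NatExpr.nat_var, e22] at h1
      rw [wp_ite]
      refine ⟨by simp, fun h2 => ?_, fun h2 => ?_⟩
      · simp [e20] at h2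
        rw [wp_skip]
        exact ⟨by simpa [e20] using h20, fun h => Or.inl (by simpa [e20] using h),
          fun h => absurd (by simpa [e20] using h) h2, Or.inl (by simp [et])⟩
      · simp [e20] at h2
        refine wp_verify (i := i) (c := c) (hf2.of_eq (fun _ _ _ => rfl) rfl rfl rfl) (by simpa using e31) hi (by simpa using e33)
          (by simpa using e37) (by simp [e20, h2]) fun σ₃ ha hv hnv ht => ?_
        simp [et] at ht
        by_cases hval : P.Val Z i c
        · simp [hv hval, hval, h2]
          right; omega
        · simp [hnv hval, hval, h2]
          right
          exact ⟨by omega, hb1 (by omega), hval⟩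
    · simp only [NatExpr.nat_var, e22] at h1
      rw [wp_skip]
      exact ⟨by simpa [e20] using h20, fun h => Or.inl (by simpa [e20] using h),
        fun h => ⟨by simpa [e20] using h, fun h2 => absurd h2 (hb0 h1)⟩, Or.inl (by simp [et])⟩
  · rintro σ₃ ha ⟨g1, g2, g3, g4⟩
    have k39 := ha.v 39 (by simp [verify, for', modV])
    have k40 := ha.v 40 (by simp [verify, for', modV])
    have k31 := ha.v 31 (by simp [verify, for', modV])
    have k37 := ha.v 37 (by simp [verify, for', modV])
    rw [e39] at k39
    rw [e40] at k40
    rw [e31] at k31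
    rw [e37] at k37
    have hf3 := hf2.of_agree ha (by simp [verify, for', modV]) (by simp [verify, for', modA])
      (by simp [verify, for', modA]) (by simp [verify, for', modA])
    obtain ⟨q1, q2, q3, q4⟩ := ha.ghost (by simp [verify, for', local'])
    have hstep := fun (σ₄ : UState (P.numV m)) (hv20 : σ₄.v 20 = σ₃.v 20) (hF : σ₄.F = σ₃.F) (hfz : σ₄.fz = σ₃.fz)
      (hnf : σ₄.nf = σ₃.nf) (hnq : σ₄.nq = σ₃.nq) (ht : σ₄.time ≤ σ₃.time + 3) =>
      TryInv.step (σ₂ := σ₄) hI h40 hj0.symm (by rw [hv20]; exact g1) (by rw [hv20]; exact g2)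
        (by rw [hv20]; exact g3) (by rw [hF, q1, eF]) (by rw [hfz, q2, efz]) (by rw [hnf, q3, enf])
        (by rw [hnq, q4, enq]) (by
          rw [hv20]
          rcases g4 with g4 | g4
          · exact Or.inl (by omega)
          · exact Or.inr ⟨by omega, g4.2⟩)
    rw [h40] at hstep
    have hokv : ((V 37).lt (rd 5 (V 31 * V 8 + (V 8 - 1)) + rd 5 (V 39 * V 8))).nat w σ₃ =
        if Z c + P.S < Z (i * P.g + (P.g - 1)) + Z (j * P.g) then 1 else 0 := by
      simp [k31, k37, k39, hf3.base.v8, hf3.base.a5]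
    rw [wp_ite, wp_ite, hokv, h40]
    simp only [wp_assign]
    refine ⟨?_, fun h1 => ⟨by simp, fun h2 => ?_, fun h2 => ?_⟩, fun h1 => ?_⟩
    · simp [k31, k39, hf3.base.v8, hf3.base.a5, hw0]
      omega
    · have h3 : Z c + P.S < Z (i * P.g + (P.g - 1)) + Z (j * P.g) := by
        by_contra h3; simp [h3] at h1
      simp [k39] at h2
      refine ⟨by simp [k39, hw0]; omega, by simp, ?_⟩
      refine hstep _ (by simp) ?_ ?_ ?_ ?_ (by simp) (Or.inr ?_) <;> try rfl
      simp [k39, k40]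
      omega
    · simp [k39] at h2
      refine ⟨by simp, by simp, ?_⟩
      refine hstep _ (by simp) ?_ ?_ ?_ ?_ (by simp) (Or.inl ?_) <;> try rfl
      simp [k39, h2]
    · have h3 : ¬ Z c + P.S < Z (i * P.g + (P.g - 1)) + Z (j * P.g) := by
        intro h3; simp [h3] at h1
      refine ⟨by simp, by simp, ?_⟩
      refine hstep _ (by simp) ?_ ?_ ?_ ?_ (by simp) (Or.inl ?_) <;> try rfl
      simp [k39]
      omega

theorem wp_tryGroups (hZ : Nums P Z) (hm0 : 0 < m) (hmd : m ≤ P.d) {σ : UState (P.numV m)}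
    {Q : UState (P.numV m) → Prop}
    {i c x₁ x₂ : ℕ} (hf : Fixed P Z m σ) (h31 : σ.v 31 = i) (hi : i < P.G) (h33 : σ.v 33 = c)
    (h37 : σ.v 37 = Z c + P.S) (h36 : σ.v 36 = x₂)
    (hx₂ : x₂ < P.X) (hx : x₁ * P.X + x₂ = (Z c + P.S) % m) (hF : FailState P Z m i x₁ σ)
    (h39 : σ.v 39 = P.stair Z c i) (h20 : σ.v 20 ≤ 1)
    (hQ : ∀ σ', σ.Agree tryGroups σ' → σ'.v 39 = P.stair Z c (i + 1) → σ'.v 20 ≤ 1 →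
      (σ'.v 20 = 1 → σ.v 20 = 1 ∨ P.Val Z i c) → (σ'.v 20 = 0 → σ.v 20 = 0 ∧ ¬ P.Val Z i c) →
      σ'.F = σ.F → σ'.fz = σ.fz → σ'.nf = σ.nf →
      σ'.nq + P.stair Z c (i + 1) = σ.nq + (P.stair Z c i + 1) →
      σ'.time + (P.g * 12 + 2) * σ.v 20 + 10 * σ.nq ≤
        σ.time + 10 * σ'.nq + (P.g * 12 + 2) * (σ'.v 20 + P.bads Z m i c) + 2 → Q σ') :
    tryGroups.wp false w (P.graph Z m) d Q σ := by
  refine wp_mono_agree _ (Q := fun σ' => σ'.v 39 = P.stair Z c (i + 1) ∧ σ'.v 20 ≤ 1 ∧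
      (σ'.v 20 = 1 → σ.v 20 = 1 ∨ P.Val Z i c) ∧ (σ'.v 20 = 0 → σ.v 20 = 0 ∧ ¬ P.Val Z i c) ∧
      σ'.F = σ.F ∧ σ'.fz = σ.fz ∧ σ'.nf = σ.nf ∧
      σ'.nq + P.stair Z c (i + 1) = σ.nq + (P.stair Z c i + 1) ∧
      σ'.time + (P.g * 12 + 2) * σ.v 20 + 10 * σ.nq ≤
        σ.time + 10 * σ'.nq + (P.g * 12 + 2) * (σ'.v 20 + P.bads Z m i c) + 2) ?_
    (fun σ' ha h => by obtain ⟨h1, h2, h3, h4, h5, h6, h7, h8, h9⟩ := h; exact hQ σ' ha h1 h2 h3 h4 h5 h6 h7 h8 h9)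
  rw [tryGroups, wp_seq, wp_assign]
  refine ⟨by simp [P.hw0], by simp, ?_⟩
  have hf1 : Fixed P Z m (σ.set 40 1) :=
    hf.of_eq (fun x h1 h2 => by simp [show x ≠ 40 by omega]) rfl rfl rfl
  refine wp_loop (TryInv P Z m i c (σ.set 40 1)) (fun σ₁ => σ₁.v 39 + σ₁.v 40) ?_ ?_
  · refine ⟨by simp, by simp [h39], ?_, by simp, by simpa using h20, by simp; tauto, ?_, rfl, rfl, rfl, by simp [h39], ?_⟩
    · intro j h1 h2
      simp [h39] at h1
      omega
    · intro h
      refine ⟨by simpa using h, fun j h1 h2 => ?_⟩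
      simp [h39] at h1
      omega
    · simp [h39]
      omega
  · intro σ₁ ha hI
    have k31 := ha.v 31 (by simp [tryGroup, verify, for', modV])
    have k33 := ha.v 33 (by simp [tryGroup, verify, for', modV])
    have k36 := ha.v 36 (by simp [tryGroup, verify, for', modV])
    have k37 := ha.v 37 (by simp [tryGroup, verify, for', modV])
    simp [h31, h33, h36, h37] at k31 k33 k36 k37
    have hf2 := hf1.of_agree ha (by simp [tryGroup, verify, for', modV]) (by simp [tryGroup, verify, for', modA])
      (by simp [tryGroup, verify, for', modA]) (by simp [tryGroup, verify, for', modA])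
    have a2 : σ₁.a 2 = _ := ha.a 2 (by simp [tryGroup, verify, for', modA])
    have hF2 : FailState P Z m i x₁ σ₁ :=
      ⟨fun k => by rw [hI.fz, a2]; exact hF.fz k, fun u => by rw [hI.F]; exact hF.mem u⟩
    refine ⟨by simp, fun h1 => ?_, fun h1 => ?_⟩
    · have h40 : σ₁.v 40 = 1 := by
        have := hI.v40
        simp at h1
        omega
      exact wp_tryGroup hZ hm0 hmd hf2 k31 hi k33 k37 k36 hx₂ hx hF2 hI h40
    · simp at h1
      -- The loop walks down from the previous step and stops at the first group that satisfies the
      -- inequality, or at `0`; this is what `Nat.findGreatest` computes.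
      have h2 : σ₁.v 39 = P.stair Z c (i + 1) := by
        rw [Sizes.stair, eq_comm, Nat.findGreatest_eq_iff]
        exact ⟨hI.le, hI.halted h1, fun {j} => hI.gt j⟩
      have h3 := hI.nq
      have h4 := hI.time
      have h5 := hI.v20
      have h6 := hI.yes
      have h7 := hI.no
      rw [h1, h2, add_zero] at h3 h4 h7
      refine ⟨h2, h5, by simpa using h6, ?_, hI.F, hI.fz, hI.nf, by simpa using h3, ?_⟩
      · intro h8
        obtain ⟨h9, h10⟩ := h7 h8
        refine ⟨by simpa using h9, fun hval => ?_⟩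
        obtain ⟨k, hk, b, hb, he, -⟩ := id hval
        have hg := P.g_pos
        have hbj : b / P.g < P.G := Nat.div_lt_of_lt_mul (by rw [mul_comm]; exact hb)
        have hbe : b / P.g * P.g + b % P.g = b := Nat.div_add_mod' b P.g
        -- A solution would have its second number in a group of the step. That group has been tried
        -- with a positive answer, and the search would have succeeded.
        have h11 := Sizes.stair_of_solution hZ hi hk hbj (Nat.mod_lt b hg) (by rw [hbe]; exact he)
        exact h10 _ h11.1 h11.2 ⟨k, hk, _, Nat.mod_lt b hg, by rw [hbe, he]⟩ hval
      · rw [Sizes.bads]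
        simp only [UState.set_time, UState.set_nq, UState.tick_time, UState.tick_nq, UState.set_v] at h4 ⊢
        simp at h4
        simp
        convert Nat.add_le_add_right h4 1 using 1 <;> ring

end Prog

/-! ## The main loop -/

theorem mul_add_div_of_lt {a b c : ℕ} (h : b < c) : (a * c + b) / c = a := by
  rw [mul_comm, Nat.mul_add_div (by omega), Nat.div_eq_of_lt h, add_zero]

/-! ### Order of the numbers by hash value, and codes of the deleted sets. -/

section Keys

variable {w : ℕ} {P : Sizes w} {Z C : ℕ → ℕ} {m : ℕ}

theorem Sizes.L_pos (P : Sizes w) : 0 < P.L := Nat.mul_pos P.G_pos P.g_pos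

theorem key_div_mod (i : ℕ) (hi : i < P.L) :
    P.key Z m i % P.L = i ∧ P.key Z m i / P.L = (Z i + P.S) % m := by
  rw [Sizes.key, mul_comm]
  exact ⟨by rw [Nat.mul_add_mod, Nat.mod_eq_of_lt hi],
    by rw [Nat.mul_add_div P.L_pos, Nat.div_eq_of_lt hi, add_zero]⟩

theorem keys_spec (hC : Prog.IsSorting (P.key Z m) C P.L) {t : ℕ} (ht : t < P.L) :
    C t / P.L = (Z (C t % P.L) + P.S) % m := by
  obtain ⟨i, hi, h⟩ := hC.mem t ht
  obtain ⟨h1, h2⟩ := key_div_mod (P := P) (Z := Z) (m := m) i hi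
  rw [h, h1, h2]

theorem keys_surj (hC : Prog.IsSorting (P.key Z m) C P.L) {c : ℕ} (hc : c < P.L) :
    ∃ t < P.L, C t % P.L = c := by
  obtain ⟨t, ht, h⟩ := hC.surj c hc
  exact ⟨t, ht, by rw [h, (key_div_mod (P := P) (Z := Z) (m := m) c hc).1]⟩

/-- A key is determined by its position part, since the hash value is a function of it; and sorted
keys are distinct. -/
theorem keys_inj (hC : Prog.IsSorting (P.key Z m) C P.L) {s t : ℕ} (hs : s < P.L) (ht : t < P.L)
    (h : C s % P.L = C t % P.L) : s = t := by
  have h1 := keys_spec hC hs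
  have h2 := keys_spec hC ht
  have h3 : C s = C t := by
    rw [← Nat.div_add_mod' (C s) P.L, ← Nat.div_add_mod' (C t) P.L, h1, h2, h]
  rcases lt_trichotomy s t with h4 | h4 | h4
  · have := hC.lt s t h4 ht; omega
  · exact h4
  · have := hC.lt t s h4 hs; omega

/-- The number of the `z`-th set of deleted vertices. -/
def Sizes.code (P : Sizes w) (C : ℕ → ℕ) (m z : ℕ) : ℕ :=
  z / P.L * (m / P.X + 1) + C (z % P.L) / P.L / P.X + 1

theorem code_mod_le (hC : Prog.IsSorting (P.key Z m) C P.L) (hm : 0 < m) {t : ℕ} (ht : t < P.L) :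
    C t / P.L / P.X ≤ m / P.X := by
  refine Nat.div_le_div_right ?_
  rw [keys_spec hC ht]
  exact (Nat.mod_lt _ hm).le

/-- The code is a two-digit number in base `m / X + 1` plus one. The first digit is the group;
within a group, sorted keys have nondecreasing hash values, hence nondecreasing blocks `x₁`. This
monotonicity is the purpose of the sorting. -/
theorem code_mono (hC : Prog.IsSorting (P.key Z m) C P.L) (hm : 0 < m) {z z' : ℕ} (h : z ≤ z') :
    P.code C m z ≤ P.code C m z' := by
  have h1 : z / P.L ≤ z' / P.L := Nat.div_le_div_right h
  have hz := Nat.mod_lt z P.L_pos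
  have hz' := Nat.mod_lt z' P.L_pos
  unfold Sizes.code
  rcases h1.lt_or_eq with h2 | h2
  · have h3 := code_mod_le hC hm hz
    have h4 : (z / P.L + 1) * (m / P.X + 1) ≤ z' / P.L * (m / P.X + 1) := Nat.mul_le_mul_right _ h2
    rw [add_mul (z / P.L), one_mul] at h4
    exact Nat.add_le_add_right ((Nat.add_le_add_left h3 _).trans (le_trans (by omega)
      (Nat.le_add_right _ _))) 1
  · rw [h2]
    have h3 : z % P.L ≤ z' % P.L := by
      have e1 := Nat.div_add_mod z P.L
      have e2 := Nat.div_add_mod z' P.L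
      rw [h2] at e1
      omega
    have h4 : C (z % P.L) ≤ C (z' % P.L) := by
      rcases h3.lt_or_eq with h3 | h3
      · exact (hC.lt _ _ h3 hz').le
      · rw [h3]
    have h5 := Nat.div_le_div_right (c := P.X) (Nat.div_le_div_right (c := P.L) h4)
    omega

theorem code_inj (hC : Prog.IsSorting (P.key Z m) C P.L) (hm : 0 < m) {z z' : ℕ}
    (h : P.code C m z = P.code C m z') :
    z / P.L = z' / P.L ∧ C (z % P.L) / P.L / P.X = C (z' % P.L) / P.L / P.X := by
  have h1 := code_mod_le hC hm (Nat.mod_lt z P.L_pos)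
  have h2 := code_mod_le hC hm (Nat.mod_lt z' P.L_pos)
  unfold Sizes.code at h
  have h3 := congrArg (· / (m / P.X + 1)) (Nat.add_right_cancel h)
  simp only [mul_add_div_of_lt (Nat.lt_succ_of_le h1), mul_add_div_of_lt (Nat.lt_succ_of_le h2)] at h3
  rw [h3] at h
  exact ⟨h3, by omega⟩

theorem code_le (hC : Prog.IsSorting (P.key Z m) C P.L) (hm : 0 < m) {z : ℕ} (hz : z < P.G * P.L) :
    P.code C m z ≤ P.G * (m / P.X + 1) := by
  have h1 := code_mod_le hC hm (Nat.mod_lt z P.L_pos)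
  have h2 : z / P.L < P.G := Nat.div_lt_of_lt_mul (by rwa [mul_comm])
  unfold Sizes.code
  exact Prog.block_lt h2 (by omega)

end Keys

namespace Prog

/-- Look for solutions in which `c` is the next number and `a` belongs to the next group. -/
def step : Prog :=
  assign 31 (V 30 / V 10) ;;
  assign 32 (rd 8 (V 30 % V 10)) ;;
  assign 33 (V 32 % V 10) ;;
  assign 34 (V 32 / V 10) ;;
  assign 35 (V 34 / V 12) ;;
  assign 36 (V 34 % V 12) ;;
  assign 37 (rd 5 (V 33) + V 4) ;;
  update ;;
  assign 39 (rd 11 (V 33)) ;;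
  tryGroups ;;
  write 11 (V 33) (V 39)

/-- Look for a solution. -/
def search : Prog := for' 30 (V 9 * V 10) step

variable {N : ℕ} {w d : ℕ} {P : Sizes w} {Z C : ℕ → ℕ} {m : ℕ}

/-- There is a solution. -/
def _root_.Sizes.Sol (P : Sizes w) (Z : ℕ → ℕ) : Prop :=
  ∃ a < P.L, ∃ b < P.L, ∃ c < P.L, Z a + Z b = Z c + P.S ∧ a ≠ b ∧ a ≠ c ∧ b ≠ c

/-- Invariant of the main loop. -/
structure SearchInv (P : Sizes w) (Z C : ℕ → ℕ) (m t₀ z : ℕ) (σ : UState N) : Prop where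
  perm : IsPerm m (σ.a 2) (σ.a 10)
  last : σ.v 21 = 0 ∨ ∃ z' < z, σ.v 21 = P.code C m z' ∧
    FailState P Z m (z' / P.L) (C (z' % P.L) / P.L / P.X) σ
  nf : σ.nf ≤ σ.v 21
  v20 : σ.v 20 ≤ 1
  yes : σ.v 20 = 1 → P.Sol Z
  no : σ.v 20 = 0 → ∀ z' < z, ¬ P.Val Z (z' / P.L) (C (z' % P.L) % P.L)
  -- Numbers earlier in the order than the current one have finished the current group, so their
  -- pointers are already one step further down.
  ptr : ∀ t < P.L, σ.a 11 (C t % P.L) =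
    P.stair Z (C t % P.L) (if t < z % P.L then z / P.L + 1 else z / P.L)
  nq : σ.nq = ∑ z' ∈ Finset.range z, (P.stair Z (C (z' % P.L) % P.L) (z' / P.L) -
    P.stair Z (C (z' % P.L) % P.L) (z' / P.L + 1) + 1)
  time : σ.time ≤ t₀ + 30 * z + (P.g * 11 + 8) * σ.nf + 10 * σ.nq + (P.g * 12 + 2) * (σ.v 20 +
    ∑ z' ∈ Finset.range z, P.bads Z m (z' / P.L) (C (z' % P.L) % P.L))

theorem _root_.Sizes.Val.sol {i c : ℕ} (h : P.Val Z i c) (hi : i < P.G) (hc : c < P.L) : P.Sol Z := by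
  obtain ⟨k, hk, b, hb, h⟩ := h
  exact ⟨_, P.group_lt hi hk, b, hb, c, hc, h⟩

/-- Advancing `z` moves on the pointer of a single number. When `z + 1` is a multiple of `L`, all
pointers have moved, and the next group begins. -/
theorem ptr_step {z t : ℕ} {A : ℕ → ℕ} (hC : IsSorting (P.key Z m) C P.L) (ht : t < P.L)
    (h : ∀ t < P.L, A (C t % P.L) = P.stair Z (C t % P.L) (if t < z % P.L then z / P.L + 1 else z / P.L)) :
    (if C t % P.L = C (z % P.L) % P.L then P.stair Z (C (z % P.L) % P.L) (z / P.L + 1) else A (C t % P.L)) =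
      P.stair Z (C t % P.L) (if t < (z + 1) % P.L then (z + 1) / P.L + 1 else (z + 1) / P.L) := by
  have hL := P.L_pos
  have hz := Nat.mod_lt z hL
  have e : (if t = z % P.L then z / P.L + 1 else if t < z % P.L then z / P.L + 1 else z / P.L) =
      if t < (z + 1) % P.L then (z + 1) / P.L + 1 else (z + 1) / P.L := by
    have h2 := Nat.div_add_mod' z P.L
    by_cases h1 : z % P.L + 1 < P.L
    · have h3 : (z + 1) / P.L = z / P.L := by
        conv_lhs => rw [← h2, add_assoc]
        exact mul_add_div_of_lt h1
      have h4 : (z + 1) % P.L = z % P.L + 1 := by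
        conv_lhs => rw [← h2, add_assoc]
        rw [Nat.mul_add_mod', Nat.mod_eq_of_lt h1]
      rw [h3, h4]
      split_ifs <;> first | rfl | omega
    · have h5 : z + 1 = (z / P.L + 1) * P.L := by rw [add_mul]; omega
      rw [h5, Nat.mul_div_cancel _ hL, Nat.mul_mod_left]
      split_ifs <;> first | rfl | omega
  rw [← e]
  by_cases h1 : t = z % P.L
  · rw [if_pos (by rw [h1]), if_pos h1, h1]
  · rw [if_neg (fun h2 => h1 (keys_inj hC ht hz h2)), if_neg h1, h t ht]

theorem wp_step (hZ : Nums P Z) (hm0 : 0 < m) (hmd : m ≤ P.d) (hd : P.d ≤ d) {σ : UState (P.numV m)} {z t₀ : ℕ}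
    (hf : Fixed P Z m σ) (hC : σ.a 8 = C) (h30 : σ.v 30 = z) (hz : z < P.G * P.L)
    (hI : SearchInv P Z C m t₀ z σ) :
    step.wp false w (P.graph Z m) d (fun σ₂ => SearchInv P Z C m t₀ (z + 1) (σ₂.set 30 (z + 1)))
      σ.tick := by
  have hdL := P.d_L_le
  have hB := P.B_lt'
  have hLB := P.L_le
  have hw0 := P.hw0
  have hL := P.L_pos
  have hS := hf.a8
  rw [hC] at hS
  set t := z % P.L with ht
  have htL : t < P.L := Nat.mod_lt _ hL
  set i := z / P.L with hi
  have hiG : i < P.G := Nat.div_lt_of_lt_mul (by rwa [mul_comm])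
  set c := C t % P.L with hc
  have hcL : c < P.L := Nat.mod_lt _ hL
  have hv : C t / P.L = (Z c + P.S) % m := keys_spec hS htL
  have hvm : (Z c + P.S) % m < m := Nat.mod_lt _ hm0
  set x₁ := (Z c + P.S) % m / P.X with hx₁
  set x₂ := (Z c + P.S) % m % P.X with hx₂
  have hx : x₁ * P.X + x₂ = (Z c + P.S) % m := Nat.div_add_mod' _ _
  have hx₁m : x₁ ≤ m / P.X := Nat.div_le_div_right hvm.le
  have hZc := hZ.le c hcL
  rw [step]
  simp only [wp_seq, wp_assign]
  simp only [NatExpr.ok_div, NatExpr.ok_mod, NatExpr.ok_var, NatExpr.ok_read, NatExpr.ok_add,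
    NatExpr.nat_div, NatExpr.nat_mod, NatExpr.nat_var, NatExpr.nat_read, NatExpr.nat_add]
  simp [h30, hf.base.v10, hf.base.v12, hf.base.v4, hf.base.a5, hC, ← hi, ← ht, ← hc, hv, ← hx₁, ← hx₂]
  refine ⟨by omega, ?_⟩
  set σ₁ := ((((((σ.tick.set 31 i).set 32 (C t)).set 33 c).set 34 ((Z c + P.S) % m)).set 35 x₁).set 36
    x₂).set 37 (Z c + P.S) with hσ₁
  have hf1 : Fixed P Z m σ₁ := hf.of_eq (fun x h1 h2 => by
    simp [hσ₁, show x ≠ 31 by omega, show x ≠ 32 by omega, show x ≠ 33 by omega, show x ≠ 34 by omega,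
      show x ≠ 35 by omega, show x ≠ 36 by omega, show x ≠ 37 by omega]) rfl rfl rfl
  have e20 : σ₁.v 20 = σ.v 20 := rfl
  have e21 : σ₁.v 21 = σ.v 21 := rfl
  have e31 : σ₁.v 31 = i := rfl
  have e33 : σ₁.v 33 = c := rfl
  have e35 : σ₁.v 35 = x₁ := rfl
  have e36 : σ₁.v 36 = x₂ := rfl
  have e37 : σ₁.v 37 = Z c + P.S := rfl
  have ea : σ₁.a = σ.a := rfl
  have eF : σ₁.F = σ.F := rfl
  have efz : σ₁.fz = σ.fz := rfl
  have enf : σ₁.nf = σ.nf := rfl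
  have enq : σ₁.nq = σ.nq := rfl
  have et : σ₁.time = σ.time + 8 := rfl
  clear_value σ₁
  have hcode : P.code C m z = i * (m / P.X + 1) + x₁ + 1 := by
    rw [Sizes.code, ← ht, ← hi, hv]
  refine wp_update hZ hf1 hm0 hmd (by rw [Sizes.numV]; omega) (hmd.trans hd) e31 hiG e35 (by omega) hx₁m
    (by rw [ea]; exact hI.perm) ?_ (by rw [enf, e21]; exact hI.nf) ?_ fun σ₂ ha2 hp2 hF2 h21 hnf2 hnq2 ht2 => ?_
  · intro h1
    rw [e21, ← hcode] at h1
    -- Code `0` is excluded, as required codes are positive. Otherwise equal codes mean the same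
    -- group and the same block, so the set deleted last is still the right one.
    rcases hI.last with h2 | ⟨z', hz', h2, h3⟩
    · rw [h2, hcode] at h1; exact absurd h1.symm (Nat.succ_ne_zero _)
    · rw [h2] at h1
      obtain ⟨h4, h5⟩ := code_inj hS hm0 h1
      rw [h4, ← hi, h5, ← ht, hv] at h3
      exact ⟨fun k => by rw [efz, ea]; exact h3.fz k, fun u => by rw [eF]; exact h3.mem u⟩
  · rw [e21, ← hcode]
    rcases hI.last with h2 | ⟨z', hz', h2, h3⟩
    · omega
    · rw [h2]; exact code_mono hS hm0 hz'.le
  have hf2 := hf1.of_agree ha2 (by simp [update, build, for', modV]) (by simp [update, build, for', modA])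
    (by simp [update, build, for', modA]) (by simp [update, build, for', modA])
  have k20 := ha2.v 20 (by simp [update, build, for', modV])
  have k31 := ha2.v 31 (by simp [update, build, for', modV])
  have k33 := ha2.v 33 (by simp [update, build, for', modV])
  have k36 := ha2.v 36 (by simp [update, build, for', modV])
  have k37 := ha2.v 37 (by simp [update, build, for', modV])
  have k11 : σ₂.a 11 = _ := ha2.a 11 (by simp [update, build, for', modA])
  have hptr : σ₂.a 11 c = P.stair Z c i := by
    rw [k11, ea]
    have := hI.ptr t htL
    rwa [← ht, if_neg (lt_irrefl t)] at this
  refine ⟨by simp, ?_⟩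
  simp only [NatExpr.nat_read, NatExpr.nat_var, k33, e33, hptr]
  refine ⟨by simp, ?_⟩
  rw [wp_seq]
  refine wp_tryGroups hZ hm0 hmd (σ := σ₂.set 39 (P.stair Z c i)) (i := i) (c := c) (x₁ := x₁) (x₂ := x₂)
    (hf2.of_eq (fun x h1 h2 => by simp [show x ≠ 39 by omega]) rfl rfl rfl) (by simp [k31, e31]) hiG
    (by simp [k33, e33]) (by simp [k37, e37]) (by simp [k36, e36]) (Nat.mod_lt _ P.X_pos) hx
    ⟨hF2.fz, hF2.mem⟩ (by simp) (by simp [k20, e20, hI.v20])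
    fun σ₃ ha3 h39 h20 hyes hno hF hfz hnf hnq htime => ?_
  have l21 := ha3.v 21 (by simp [tryGroups, tryGroup, verify, for', modV])
  have l33 := ha3.v 33 (by simp [tryGroups, tryGroup, verify, for', modV])
  have l2 : σ₃.a 2 = _ := ha3.a 2 (by simp [tryGroups, tryGroup, verify, for', modA])
  have l10 : σ₃.a 10 = _ := ha3.a 10 (by simp [tryGroups, tryGroup, verify, for', modA])
  have l11 : σ₃.a 11 = _ := ha3.a 11 (by simp [tryGroups, tryGroup, verify, for', modA])
  simp [k20, e20, k33, e33, h21, hnq2, enq] at l21 l33 l2 l10 l11 hyes hno hnf hnq htime hF hfz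
  rw [wp_write]
  refine ⟨by simp, by simp, by simp, ?_⟩
  simp only [NatExpr.nat_var, l33, h39]
  have hm1 := hI.v20
  have hst := Sizes.stair_succ_le (P := P) (Z := Z) c i
  have hnq3 : σ₃.nq = σ.nq + (P.stair Z c i - P.stair Z c (i + 1) + 1) := by omega
  refine ⟨⟨?_, ?_⟩, Or.inr ⟨z, by omega, ?_, ⟨fun k => ?_, fun u => ?_⟩⟩, ?_, by simpa using h20, ?_, ?_, ?_, ?_, ?_⟩
  · simpa [l2, l10] using hp2.lt
  · simpa [l2, l10] using hp2.inv
  · simp [l21, hcode]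
  · simpa [hfz, l2] using hF2.fz k
  · rw [← hi, ← ht, hv]
    simpa [hF] using hF2.mem u
  · simp [hnf, l21]
    omega
  · intro h1
    rcases hyes (by simpa using h1) with h2 | h2
    · exact hI.yes h2
    · exact h2.sol hiG hcL
  · intro h1 z' hz'
    obtain ⟨h2, h3⟩ := hno (by simpa using h1)
    rcases (show z' < z ∨ z' = z by omega) with h4 | rfl
    · exact hI.no h2 z' h4
    · exact h3
  · intro s hs
    rw [← ptr_step hS hs hI.ptr]
    simp [l11, k11, ea, ← hc, ← ht, ← hi]
  · simp [Finset.sum_range_succ, hnq3, hI.nq, ← hc, ← ht, ← hi]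
  · simp only [UState.set_time, UState.put_time, UState.set_nf, UState.put_nf, UState.set_nq, UState.put_nq,
      UState.set_v, UState.put_v, if_neg (show (20 : ℕ) ≠ 30 by norm_num)]
    rw [Finset.sum_range_succ, ← ht, ← hi, ← hc]
    have h1 := hI.time
    rw [et, enf] at ht2
    rw [hnf]
    simp only [mul_add, mul_one] at h1 htime ht2 ⊢
    omega

theorem _root_.sum_range_mul_div_mod (f : ℕ → ℕ → ℕ) (G L : ℕ) :
    ∑ z ∈ Finset.range (G * L), f (z / L) (z % L) =
      ∑ i ∈ Finset.range G, ∑ t ∈ Finset.range L, f i t := by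
  induction G with
  | zero => simp
  | succ G ih =>
    rw [add_mul, one_mul, Finset.sum_range_add, ih, Finset.sum_range_succ]
    refine congrArg _ (Finset.sum_congr rfl fun t ht => ?_)
    have ht := Finset.mem_range.1 ht
    rw [mul_add_div_of_lt ht, Nat.mul_add_mod', Nat.mod_eq_of_lt ht]

theorem _root_.sum_keys (hC : IsSorting (P.key Z m) C P.L) (f : ℕ → ℕ) :
    ∑ t ∈ Finset.range P.L, f (C t % P.L) = ∑ c ∈ Finset.range P.L, f c := by
  refine Finset.sum_nbij (fun t => C t % P.L) (fun t _ => Finset.mem_range.2 (Nat.mod_lt _ P.L_pos))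
    (fun s hs t ht h => keys_inj hC (by simpa using hs) (by simpa using ht) h) (fun c hc => ?_) fun _ _ => rfl
  obtain ⟨t, ht, h⟩ := keys_surj hC (by simpa using hc)
  exact ⟨t, by simpa using ht, h⟩

/-- The number of all bad queries. -/
noncomputable def _root_.Sizes.totalBads (P : Sizes w) (Z : ℕ → ℕ) (m : ℕ) : ℕ :=
  ∑ i ∈ Finset.range P.G, ∑ c ∈ Finset.range P.L, P.bads Z m i c

/-- For each number the descents telescope to at most `G - 1`, and the summands `1` contribute `G`.
-/
theorem sum_stair_le (P : Sizes w) (Z : ℕ → ℕ) :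
    ∑ i ∈ Finset.range P.G, ∑ c ∈ Finset.range P.L, (P.stair Z c i - P.stair Z c (i + 1) + 1) ≤
      2 * (P.G * P.L) := by
  rw [Finset.sum_comm]
  calc _ ≤ ∑ c ∈ Finset.range P.L, 2 * P.G := Finset.sum_le_sum fun c _ => ?_
    _ = 2 * (P.G * P.L) := by simp; ring
  have h : ∀ n, ∑ i ∈ Finset.range n, (P.stair Z c i - P.stair Z c (i + 1) + 1) + P.stair Z c n =
      P.stair Z c 0 + n := by
    intro n
    induction n with
    | zero => simp
    | succ n ih =>
      have := Sizes.stair_succ_le (P := P) (Z := Z) c n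
      rw [Finset.sum_range_succ]
      omega
  have h1 := h P.G
  have h2 := P.stair_lt (Z := Z) c 0
  omega

theorem wp_search (hZ : Nums P Z) (hm0 : 0 < m) (hmd : m ≤ P.d) (hd : P.d ≤ d) {σ : UState (P.numV m)}
    {Q : UState (P.numV m) → Prop} (hr : Ready P Z m σ) (hnf : σ.nf = 0) (hnq : σ.nq = 0)
    (hQ : ∀ σ', (P.Sol Z → σ'.v 20 = 1) → (¬ P.Sol Z → σ'.v 20 = 0) →
      σ'.nf ≤ P.G * (m / P.X + 1) → σ'.nq ≤ 2 * (P.G * P.L) →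
      σ'.time ≤ σ.time + 30 * (P.G * P.L) + (P.g * 11 + 8) * σ'.nf + 10 * σ'.nq +
        (P.g * 12 + 2) * (1 + P.totalBads Z m) + 2 → Q σ') :
    search.wp false w (P.graph Z m) d Q σ := by
  have hf : Fixed P Z m σ := ⟨hr.base, hr.v14, hr.v15, hr.a8⟩
  have hLB := P.L_le
  have hL := P.L_pos
  have hGL : P.G ≤ P.L := Nat.le_mul_of_pos_right _ P.g_pos
  have hmul := P.mul_lt (x := P.G) (y := P.L) (by omega) (by omega)
  have hB := P.B_lt'
  have hC := hr.a8
  refine wp_for_inv (P.G * P.L) (fun z σ₁ => SearchInv P Z (σ.a 8) m (σ.time + 1) z σ₁) (by omega)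
    (by simp [step, update, build, tryGroups, tryGroup, verify, for', modV]) (by simp) ?_ ?_ ?_ ?_
  · intro σ₁ h
    have e9 := h.v 9 (by simp [step, update, build, tryGroups, tryGroup, verify, for', modV])
    have e10 := h.v 10 (by simp [step, update, build, tryGroups, tryGroup, verify, for', modV])
    rw [hf.base.v9] at e9
    rw [hf.base.v10] at e10
    simp [e9, e10]
    omega
  · refine ⟨⟨fun u hu => ?_, fun u hu => ?_⟩, Or.inl (by simp [hr.v21]), by simp [hnf], by simp [hr.v20],
      by simp [hr.v20], by simp, fun t ht => ?_, by simp [hnq], by simp; omega⟩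
    · obtain ⟨h1, h2⟩ := hr.perm u hu
      simp only [UState.set_a]
      omega
    · obtain ⟨h1, h2⟩ := hr.perm u hu
      simp only [UState.set_a, h1, h2, and_self]
    · simp only [UState.set_a, Nat.zero_mod, Nat.zero_div, Nat.not_lt_zero, if_false]
      exact hr.a11 _ (Nat.mod_lt _ hL)
  · intro z hz σ₁ h hz1 hI
    have hf1 := hf.of_agree h (by simp [step, update, build, tryGroups, tryGroup, verify, for', modV])
      (by simp [step, update, build, tryGroups, tryGroup, verify, for', modA])
      (by simp [step, update, build, tryGroups, tryGroup, verify, for', modA])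
      (by simp [step, update, build, tryGroups, tryGroup, verify, for', modA])
    have h8 : σ₁.a 8 = _ := h.a 8 (by simp [step, update, build, tryGroups, tryGroup, verify, for', modA])
    exact wp_step hZ hm0 hmd hd hf1 h8 hz1 hz hI
  · intro σ₁ h hz1 hI
    have hval : ∀ i < P.G, ∀ c < P.L, P.Val Z i c → σ₁.v 20 ≠ 0 := by
      intro i hi c hc hv h0
      obtain ⟨t, ht, rfl⟩ := keys_surj hC hc
      refine hI.no h0 (i * P.L + t) (block_lt hi ht) ?_
      rwa [mul_add_div_of_lt ht, Nat.mul_add_mod', Nat.mod_eq_of_lt ht]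
    have h20 := hI.v20
    refine hQ _ ?_ ?_ ?_ ?_ ?_
    · rintro ⟨a, ha, b, hb, c, hc, h1, h2⟩
      have hag : a / P.g < P.G := Nat.div_lt_of_lt_mul (by rw [mul_comm]; exact ha)
      have hae : a / P.g * P.g + a % P.g = a := Nat.div_add_mod' a P.g
      have := hval (a / P.g) hag c hc ⟨a % P.g, Nat.mod_lt _ P.g_pos, b, hb, by rw [hae]; exact ⟨h1, h2⟩⟩
      simp only [UState.tick_v]
      omega
    · intro hns
      by_contra h1
      simp only [UState.tick_v] at h1
      exact hns (hI.yes (by omega))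
    -- Every deletion has raised the code, so the code of the last deleted set bounds their number.
    · refine hI.nf.trans ?_
      rcases hI.last with h1 | ⟨z', hz', h1, -⟩
      · rw [h1]; exact Nat.zero_le _
      · rw [h1]; exact code_le hC hm0 hz'
    · refine hI.nq.trans_le ?_
      rw [sum_range_mul_div_mod (fun i t => P.stair Z (σ.a 8 t % P.L) i - P.stair Z (σ.a 8 t % P.L) (i + 1) + 1)
        P.G P.L]
      refine le_trans (le_of_eq ?_) (sum_stair_le P Z)
      exact Finset.sum_congr rfl fun i _ => sum_keys hC fun c => P.stair Z c i - P.stair Z c (i + 1) + 1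
    · have h1 := hI.time
      rw [sum_range_mul_div_mod (fun i t => P.bads Z m i (σ.a 8 t % P.L)) P.G P.L] at h1
      have h2 : ∑ i ∈ Finset.range P.G, ∑ t ∈ Finset.range P.L, P.bads Z m i (σ.a 8 t % P.L) =
          P.totalBads Z m := Finset.sum_congr rfl fun i _ => sum_keys hC fun c => P.bads Z m i c
      rw [h2] at h1
      have h3 : (P.g * 12 + 2) * (σ₁.v 20 + P.totalBads Z m) ≤ (P.g * 12 + 2) * (1 + P.totalBads Z m) :=
        Nat.mul_le_mul_left _ (by omega)
      simp only [UState.tick_time, UState.tick_nf, UState.tick_nq]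
      omega

end Prog

/-! ## Bad queries are rare -/

/-- From `e < r * (e / r + 1)` and `x + 1 ≤ 2 ^ x`. It controls the contribution of a small prime to
the divisor function. -/
theorem succ_pow_le_two_pow {r : ℕ} (hr : 0 < r) (e : ℕ) : (e + 1) ^ r ≤ r ^ r * 2 ^ e := by
  have h1 : e + 1 ≤ r * 2 ^ (e / r) := by
    have h2 : e < r * (e / r + 1) := Nat.lt_mul_div_succ e hr
    have h3 : e / r + 1 ≤ 2 ^ (e / r) := Nat.lt_two_pow_self
    exact (Nat.succ_le_of_lt h2).trans (Nat.mul_le_mul_left r h3)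
  calc (e + 1) ^ r ≤ (r * 2 ^ (e / r)) ^ r := Nat.pow_le_pow_left h1 r
    _ = r ^ r * 2 ^ (e / r * r) := by rw [mul_pow, ← pow_mul]
    _ ≤ r ^ r * 2 ^ e := Nat.mul_le_mul_left _ (Nat.pow_le_pow_right two_pos (Nat.div_mul_le_self e r))

/-- The divisor bound. -/
theorem card_divisors_pow_le {r : ℕ} (hr : 0 < r) {n : ℕ} (hn : n ≠ 0) :
    n.divisors.card ^ r ≤ (r ^ r) ^ 2 ^ r * n := by
  have hrr : 1 ≤ r ^ r := Nat.one_le_pow _ _ hr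
  rw [Nat.card_divisors hn, ← Finset.prod_pow]
  calc ∏ p ∈ n.primeFactors, (n.factorization p + 1) ^ r
      ≤ ∏ p ∈ n.primeFactors, (if p < 2 ^ r then r ^ r else 1) * p ^ n.factorization p := by
        refine Finset.prod_le_prod' fun p hp => ?_
        have hp2 := (Nat.prime_of_mem_primeFactors hp).two_le
        -- A prime below `2 ^ r` costs a factor `r ^ r`, and there are at most `2 ^ r` of these. A
        -- larger prime costs nothing, since `(v + 1) ^ r ≤ (2 ^ r) ^ v ≤ p ^ v`.
        split_ifs with h
        · exact (succ_pow_le_two_pow hr _).trans (Nat.mul_le_mul_left _ (Nat.pow_le_pow_left hp2 _))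
        · rw [one_mul]
          calc (n.factorization p + 1) ^ r ≤ (2 ^ n.factorization p) ^ r :=
                Nat.pow_le_pow_left Nat.lt_two_pow_self r
            _ = (2 ^ r) ^ n.factorization p := by rw [← pow_mul, ← pow_mul, mul_comm]
            _ ≤ p ^ n.factorization p := Nat.pow_le_pow_left (not_lt.1 h) _
    _ = (∏ p ∈ n.primeFactors, if p < 2 ^ r then r ^ r else 1) * n := by
        rw [Finset.prod_mul_distrib]
        congr 1
        exact Nat.prod_factorization_pow_eq_self hn
    _ ≤ (r ^ r) ^ 2 ^ r * n := by
        refine Nat.mul_le_mul_right n ?_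
        rw [Finset.prod_ite, Finset.prod_const, Finset.prod_const_one, mul_one]
        refine Nat.pow_le_pow_right hrr ?_
        calc _ ≤ (Finset.range (2 ^ r)).card := Finset.card_le_card fun p hp => by
              simpa using (Finset.mem_filter.1 hp).2
          _ = 2 ^ r := Finset.card_range _

namespace Sizes

variable {w : ℕ} (P : Sizes w) (Z : ℕ → ℕ)

/-- A coincidence that is present for all hash functions, but is not a solution. -/
def Degenerate (i j c : ℕ) : Prop :=
  ∃ k < P.g, ∃ k' < P.g, Z (i * P.g + k) + Z (j * P.g + k') = Z c + P.S ∧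
    (i * P.g + k = j * P.g + k' ∨ i * P.g + k = c ∨ j * P.g + k' = c)

variable {P Z} {m : ℕ}

/-- A congruence that is an equality but yields no solution must have coinciding indices. Any other
congruence makes `m` a divisor of a nonzero difference, and this is unlikely for random `m`. -/
theorem Bad.cases {i j c : ℕ} (hj : j < P.G) (h : P.Bad Z m i j c) :
    P.Degenerate Z i j c ∨ ∃ k < P.g, ∃ k' < P.g,
      Nat.dist (Z (i * P.g + k) + Z (j * P.g + k')) (Z c + P.S) ≠ 0 ∧
      m ∣ Nat.dist (Z (i * P.g + k) + Z (j * P.g + k')) (Z c + P.S) := by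
  obtain ⟨⟨k, hk, k', hk', h1⟩, h2⟩ := h
  by_cases he : Z (i * P.g + k) + Z (j * P.g + k') = Z c + P.S
  · refine Or.inl ⟨k, hk, k', hk', he, ?_⟩
    by_contra h3
    push Not at h3
    exact h2 ⟨k, hk, _, P.group_lt hj hk', he, h3⟩
  · refine Or.inr ⟨k, hk, k', hk', fun h3 => he (Nat.eq_of_dist_eq_zero h3), ?_⟩
    rcases le_total (Z (i * P.g + k) + Z (j * P.g + k')) (Z c + P.S) with h3 | h3
    · rw [Nat.dist_eq_sub_of_le h3]
      exact (Nat.modEq_iff_dvd' h3).1 h1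
    · rw [Nat.dist_comm, Nat.dist_eq_sub_of_le h3]
      exact (Nat.modEq_iff_dvd' h3).1 h1.symm

open Classical in
-- Each of the three possible coincidences determines both `a` and `b` when `c` is fixed, because
-- the numbers are distinct, and thereby the pair of groups.
theorem card_degenerate_le (hZ : Nums P Z) {c : ℕ} (hc : c < P.L) :
    ((Finset.range P.G ×ˢ Finset.range P.G).filter fun x => P.Degenerate Z x.1 x.2 c).card ≤ 3 := by
  have hg := P.g_pos
  have hdiv : ∀ {i k : ℕ}, k < P.g → (i * P.g + k) / P.g = i := fun h => mul_add_div_of_lt h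
  let D : (ℕ → ℕ → Prop) → Finset (ℕ × ℕ) := fun R =>
    (Finset.range P.G ×ˢ Finset.range P.G).filter fun x => ∃ k < P.g, ∃ k' < P.g,
      Z (x.1 * P.g + k) + Z (x.2 * P.g + k') = Z c + P.S ∧ R (x.1 * P.g + k) (x.2 * P.g + k')
  have hsub : (Finset.range P.G ×ˢ Finset.range P.G).filter (fun x => P.Degenerate Z x.1 x.2 c) ⊆
      D (fun a b => a = b) ∪ (D (fun a _ => a = c) ∪ D (fun _ b => b = c)) := by
    intro x hx
    obtain ⟨h1, k, hk, k', hk', he, h2⟩ := Finset.mem_filter.1 hx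
    simp only [D, Finset.mem_union, Finset.mem_filter, h1, true_and]
    rcases h2 with h2 | h2 | h2
    · exact Or.inl ⟨k, hk, k', hk', he, h2⟩
    · exact Or.inr (Or.inl ⟨k, hk, k', hk', he, h2⟩)
    · exact Or.inr (Or.inr ⟨k, hk, k', hk', he, h2⟩)
  have hD : ∀ R : ℕ → ℕ → Prop, (∀ a < P.L, ∀ b < P.L, ∀ a' < P.L, ∀ b' < P.L, R a b → R a' b' →
      Z a + Z b = Z c + P.S → Z a' + Z b' = Z c + P.S → a = a' ∧ b = b') → (D R).card ≤ 1 := by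
    intro R hR
    refine Finset.card_le_one.2 ?_
    rintro ⟨i, j⟩ hx ⟨i', j'⟩ hy
    simp only [D, Finset.mem_filter, Finset.mem_product, Finset.mem_range] at hx hy
    obtain ⟨⟨hi, hj⟩, k, hk, l, hl, h1, h2⟩ := hx
    obtain ⟨⟨hi', hj'⟩, k', hk', l', hl', h1', h2'⟩ := hy
    obtain ⟨h3, h4⟩ := hR _ (P.group_lt hi hk) _ (P.group_lt hj hl) _ (P.group_lt hi' hk') _
      (P.group_lt hj' hl') h2 h2' h1 h1'
    rw [← hdiv (i := i) hk, ← hdiv (i := j) hl, h3, h4, hdiv hk', hdiv hl']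
  have h1 : (D (fun a b => a = b)).card ≤ 1 := hD (fun a b => a = b) (by
    rintro a ha b hb a' ha' b' hb' rfl rfl h1 h2
    have := hZ.inj ha ha' (by omega)
    exact ⟨this, this⟩)
  have h2 : (D (fun a _ => a = c)).card ≤ 1 := hD (fun a _ => a = c) (by
    rintro a ha b hb a' ha' b' hb' rfl rfl h1 h2
    exact ⟨rfl, hZ.inj hb hb' (by omega)⟩)
  have h3 : (D (fun _ b => b = c)).card ≤ 1 := hD (fun _ b => b = c) (by
    rintro a ha b hb a' ha' b' hb' rfl rfl h1 h2
    exact ⟨hZ.inj ha ha' (by omega), rfl⟩)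
  have h4 := Finset.card_le_card hsub
  have h5 := Finset.card_union_le (D (fun a b => a = b)) (D (fun a _ => a = c) ∪ D (fun _ b => b = c))
  have h6 := Finset.card_union_le (D (fun a _ => a = c)) (D (fun _ b => b = c))
  omega

theorem dist_le (hZ : Nums P Z) {a b c : ℕ} (ha : a < P.L) (hb : b < P.L) (hc : c < P.L) :
    Nat.dist (Z a + Z b) (Z c + P.S) ≤ 2 * P.B := by
  have h1 := hZ.le a ha
  have h2 := hZ.le b hb
  have h3 := hZ.le c hc
  unfold Nat.dist
  omega

open Classical in
-- The sum runs over moduli. A degenerate triple may be bad for all of them; otherwise a bad modulus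
-- divides one of `g * g` nonzero differences, each with at most `T` divisors.
theorem sum_bad_le (hZ : Nums P Z) {T : ℕ} (hT : ∀ x, x ≠ 0 → x ≤ 2 * P.B → x.divisors.card ≤ T)
    {i j c : ℕ} (hi : i < P.G) (hj : j < P.G) (hc : c < P.L) (M : Finset ℕ) :
    ∑ m ∈ M, (if P.Bad Z m i j c then 1 else 0) ≤
      M.card * (if P.Degenerate Z i j c then 1 else 0) + P.g * P.g * T := by
  let δ := fun k k' => Nat.dist (Z (i * P.g + k) + Z (j * P.g + k')) (Z c + P.S)
  have h1 : ∀ m ∈ M, (if P.Bad Z m i j c then 1 else 0) ≤ (if P.Degenerate Z i j c then 1 else 0) +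
      ∑ k ∈ Finset.range P.g, ∑ k' ∈ Finset.range P.g, if δ k k' ≠ 0 ∧ m ∣ δ k k' then 1 else 0 := by
    intro m _
    by_cases hb : P.Bad Z m i j c
    · rw [if_pos hb]
      rcases hb.cases hj with h | ⟨k, hk, k', hk', h⟩
      · rw [if_pos h]; exact Nat.le_add_right _ _
      · refine le_trans ?_ (Nat.le_add_left _ _)
        refine le_trans ?_ (Finset.single_le_sum (fun _ _ => Nat.zero_le _) (Finset.mem_range.2 hk))
        refine le_trans ?_ (Finset.single_le_sum (fun _ _ => Nat.zero_le _) (Finset.mem_range.2 hk'))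
        rw [if_pos h]
    · rw [if_neg hb]; exact Nat.zero_le _
  refine (Finset.sum_le_sum h1).trans ?_
  rw [Finset.sum_add_distrib, Finset.sum_const, smul_eq_mul]
  refine Nat.add_le_add_left ?_ _
  rw [Finset.sum_comm]
  calc _ ≤ ∑ k ∈ Finset.range P.g, P.g * T := Finset.sum_le_sum fun k hk => ?_
    _ = P.g * P.g * T := by simp [mul_assoc]
  rw [Finset.sum_comm]
  calc _ ≤ ∑ k' ∈ Finset.range P.g, T := Finset.sum_le_sum fun k' hk' => ?_
    _ = P.g * T := by simp
  by_cases h0 : δ k k' = 0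
  · simp [h0]
  · refine le_trans ?_ (hT (δ k k') h0 (dist_le hZ (P.group_lt hi (Finset.mem_range.1 hk))
      (P.group_lt hj (Finset.mem_range.1 hk')) hc))
    rw [← Finset.card_filter]
    exact Finset.card_le_card fun m hm => Nat.mem_divisors.2 ⟨(Finset.mem_filter.1 hm).2.2, h0⟩

/-- For every modulus there are at most three degenerate pairs per number, hence the term `3 *
M.card * L`. All staircases together have at most `2 * (G * L)` entries, each bad for at most `g * g
* T` moduli for other reasons. -/
theorem sum_totalBads_le (hZ : Nums P Z) {T : ℕ}
    (hT : ∀ x, x ≠ 0 → x ≤ 2 * P.B → x.divisors.card ≤ T) (M : Finset ℕ) :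
    ∑ m ∈ M, P.totalBads Z m ≤ 3 * M.card * P.L + 2 * (P.G * P.L) * (P.g * P.g * T) := by
  classical
  let I := fun c i => Finset.Icc (P.stair Z c (i + 1)) (P.stair Z c i)
  have hI : ∀ c i, ∀ j ∈ I c i, j < P.G := fun c i j hj =>
    (Finset.mem_Icc.1 hj).2.trans_lt (P.stair_lt c i)
  calc ∑ m ∈ M, P.totalBads Z m
      = ∑ i ∈ Finset.range P.G, ∑ c ∈ Finset.range P.L, ∑ j ∈ I c i, ∑ m ∈ M,
          (if P.Bad Z m i j c then 1 else 0) := by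
        simp only [totalBads, bads, Finset.card_filter]
        rw [Finset.sum_comm]
        refine Finset.sum_congr rfl fun i _ => ?_
        rw [Finset.sum_comm]
        exact Finset.sum_congr rfl fun c _ => Finset.sum_comm
    _ ≤ ∑ i ∈ Finset.range P.G, ∑ c ∈ Finset.range P.L, ∑ j ∈ I c i,
          (M.card * (if P.Degenerate Z i j c then 1 else 0) + P.g * P.g * T) :=
        Finset.sum_le_sum fun i hi => Finset.sum_le_sum fun c hc => Finset.sum_le_sum fun j hj =>
          sum_bad_le hZ hT (Finset.mem_range.1 hi) (hI c i j hj) (Finset.mem_range.1 hc) M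
    _ = M.card * (∑ i ∈ Finset.range P.G, ∑ c ∈ Finset.range P.L, ∑ j ∈ I c i,
            (if P.Degenerate Z i j c then 1 else 0)) +
          (∑ i ∈ Finset.range P.G, ∑ c ∈ Finset.range P.L, (I c i).card) * (P.g * P.g * T) := by
        simp only [Finset.sum_add_distrib, Finset.mul_sum, Finset.sum_mul, Finset.sum_const, smul_eq_mul]
    _ ≤ 3 * M.card * P.L + 2 * (P.G * P.L) * (P.g * P.g * T) := by
        refine add_le_add ?_ (Nat.mul_le_mul_right _ ?_)
        · rw [mul_comm 3, mul_assoc]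
          refine Nat.mul_le_mul_left _ ?_
          rw [Finset.sum_comm]
          calc _ ≤ ∑ c ∈ Finset.range P.L, 3 := Finset.sum_le_sum fun c hc => ?_
            _ = 3 * P.L := by simp [mul_comm]
          refine le_trans ?_ (card_degenerate_le hZ (Finset.mem_range.1 hc))
          rw [Finset.card_filter, Finset.sum_product]
          exact Finset.sum_le_sum fun i _ => Finset.sum_le_sum_of_subset fun j hj =>
            Finset.mem_range.2 (hI c i j hj)
        · refine le_trans (le_of_eq ?_) (Prog.sum_stair_le P Z)
          refine Finset.sum_congr rfl fun i _ => Finset.sum_congr rfl fun c _ => ?_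
          have := P.stair_succ_le (Z := Z) c i
          simp only [I, Nat.card_Icc]
          omega

end Sizes

/-- The average of a function of a random word which only depends on its residue. -/
theorem sum_mod_le (f : ℕ → ℝ≥0∞) {Y : ℕ} (hY : 0 < Y) (W : ℕ) :
    ∑ k ∈ Finset.range W, f (k % Y) ≤ (W / Y + 1 : ℕ) * ∑ r ∈ Finset.range Y, f r := by
  have h1 : ∀ n : ℕ, ∑ k ∈ Finset.range (n * Y), f (k % Y) = n * ∑ r ∈ Finset.range Y, f r := by
    intro n
    induction n with
    | zero => simp
    | succ n ih =>
      rw [add_mul, one_mul, Finset.sum_range_add, ih, Nat.cast_succ, add_mul, one_mul]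
      refine congrArg _ (Finset.sum_congr rfl fun t ht => ?_)
      rw [Nat.mul_add_mod', Nat.mod_eq_of_lt (Finset.mem_range.1 ht)]
  rw [← h1]
  -- The range is extended to complete periods of length `Y`.
  refine Finset.sum_le_sum_of_subset fun k hk => ?_
  have h2 : W < Y * (W / Y + 1) := Nat.lt_mul_div_succ W hY
  rw [mul_comm] at h2
  exact Finset.mem_range.2 ((Finset.mem_range.1 hk).trans h2)

/-! ## The numbers -/

/-- The numbers `A i + S`, followed by numbers that are not involved in any solution. -/
def padded {n : ℕ} (A : Fin n → ℤ) (S i : ℕ) : ℕ :=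
  if h : i < n then (A ⟨i, h⟩ + S).toNat else 5 * S * (i + 1)

section Padded

variable {n : ℕ} {A : Fin n → ℤ} {S : ℕ}

theorem padded_of_lt (hA : ∀ i, |A i| ≤ S) {i : ℕ} (h : i < n) :
    (padded A S i : ℤ) = A ⟨i, h⟩ + S ∧ padded A S i ≤ 2 * S := by
  have h1 := abs_le.1 (hA ⟨i, h⟩)
  rw [padded, dif_pos h]
  omega

theorem padded_of_le {i : ℕ} (h : n ≤ i) : padded A S i = 5 * S * (i + 1) := by
  rw [padded, dif_neg (by omega)]

theorem padded_inj (hA : ∀ i, |A i| ≤ S) (hinj : Function.Injective A) (hS : 0 < S) {i j : ℕ}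
    (h : padded A S i = padded A S j) : i = j := by
  have hpad : ∀ i, 5 * S * (i + 1) ≥ 5 * S := fun i => Nat.le_mul_of_pos_right _ (by omega)
  by_cases hi : i < n
  · have h1 := padded_of_lt hA hi
    by_cases hj : j < n
    · have h2 := padded_of_lt hA hj
      have h3 : A ⟨i, hi⟩ = A ⟨j, hj⟩ := by omega
      simpa using hinj h3
    · rw [padded_of_le (not_lt.1 hj)] at h
      have := hpad j
      omega
  · rw [padded_of_le (not_lt.1 hi)] at h
    by_cases hj : j < n
    · have h2 := padded_of_lt hA hj
      have := hpad i
      omega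
    · rw [padded_of_le (not_lt.1 hj)] at h
      have := Nat.eq_of_mul_eq_mul_left (by omega) h
      omega

theorem padded_le (hA : ∀ i, |A i| ≤ S) {i L : ℕ} (hi : i < L) : padded A S i ≤ 5 * S * L := by
  by_cases h : i < n
  · have := (padded_of_lt hA h).2
    nlinarith
  · rw [padded_of_le (not_lt.1 h)]
    exact Nat.mul_le_mul_left _ hi

/-- A multiple of `5 * S` of absolute value at most `3 * S` vanishes. This separates padding from
genuine numbers. -/
theorem mul_ne_of_abs_le {S : ℕ} (hS : 0 < S) {x t : ℤ} (hx : |x| ≤ 3 * S) (h : x = 5 * S * t) : t = 0 := by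
  by_contra ht
  have h1 : 1 ≤ |t| := Int.one_le_abs ht
  rw [h, abs_mul, abs_of_nonneg (by positivity : (0 : ℤ) ≤ 5 * S)] at hx
  nlinarith

/-- Every padded number is `x + 5 * S * t` with `0 ≤ x ≤ 2 * S`, where `t = 0` for genuine numbers,
and `x = 0`, `t = i + 1` for padding. In a relation the two parts balance separately. Two padding
summands would give `0 = z + S`; a single one forces the right-hand side to be the same padding
element, against distinctness; with none, the right-hand side has `t = 0` and is genuine. -/
theorem exists_padded_iff (hA : ∀ i, |A i| ≤ S) (hS : 0 < S) {L : ℕ} (hL : n ≤ L) :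
    (∃ i < L, ∃ j < L, ∃ k < L, padded A S i + padded A S j = padded A S k + S ∧
      i ≠ j ∧ i ≠ k ∧ j ≠ k) ↔ HasThreeSum A := by
  constructor
  · rintro ⟨i, hi, j, hj, k, hk, h, h1, h2, h3⟩
    have hS' : (0 : ℤ) < S := by exact_mod_cast hS
    have hz : ∀ i, ∃ x t : ℤ, (padded A S i : ℤ) = x + 5 * S * t ∧ 0 ≤ x ∧ x ≤ 2 * S ∧
        (i < n → t = 0) ∧ (n ≤ i → x = 0 ∧ t = i + 1) := by
      intro i
      by_cases hi : i < n
      · have h1 := padded_of_lt hA hi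
        exact ⟨padded A S i, 0, by simp, by omega, by omega, fun _ => rfl, fun _ => by omega⟩
      · exact ⟨0, i + 1, by rw [padded_of_le (not_lt.1 hi)]; push_cast; ring, le_rfl, by omega,
          fun _ => by omega, fun _ => ⟨rfl, rfl⟩⟩
    obtain ⟨x, t, ex, x0, x1, x2, x3⟩ := hz i
    obtain ⟨y, u, ey, y0, y1, y2, y3⟩ := hz j
    obtain ⟨z, v, ez, z0, z1, z2, z3⟩ := hz k
    have h' : (padded A S i : ℤ) + padded A S j = padded A S k + S := by exact_mod_cast h
    rw [ex, ey, ez] at h'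
    have ht : v - t - u = 0 := mul_ne_of_abs_le hS (x := x + y - z - S)
      (by rw [abs_le]; omega) (by linear_combination h')
    have e : x + y = z + S := by
      have : v = t + u := by omega
      rw [this] at h'
      linear_combination h'
    have hi : i < n := by by_contra hi; by_cases hj : j < n <;> by_cases hk : k < n <;> omega
    have hj : j < n := by by_contra hj; by_cases hk : k < n <;> omega
    have hk : k < n := by by_contra hk; omega
    refine ⟨⟨i, hi⟩, ⟨j, hj⟩, ⟨k, hk⟩, by simpa using h1, by simpa using h2, by simpa using h3, ?_⟩
    have e1 := (padded_of_lt hA hi).1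
    have e2 := (padded_of_lt hA hj).1
    have e3 := (padded_of_lt hA hk).1
    omega
  · rintro ⟨i, j, k, h1, h2, h3, h⟩
    refine ⟨i, by omega, j, by omega, k, by omega, ?_, by omega, by omega, by omega⟩
    have e1 := (padded_of_lt hA i.2).1
    have e2 := (padded_of_lt hA j.2).1
    have e3 := (padded_of_lt hA k.2).1
    simp only [Fin.eta] at e1 e2 e3
    omega

theorem sol_iff (hA : ∀ i, |A i| ≤ S) (hS : 0 < S) {w : ℕ} {P : Sizes w} (hPS : P.S = S) (hL : n ≤ P.L)
    {X Z : ℕ → ℕ} (hX : ∀ i < P.L, X i = padded A S i) (hZ : Prog.IsSorting X Z P.L)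
    (hXi : ∀ i < P.L, ∀ j < P.L, X i = X j → i = j) : P.Sol Z ↔ HasThreeSum A := by
  rw [← exists_padded_iff hA hS hL, Sizes.Sol, hPS]
  have hinj : ∀ a < P.L, ∀ b < P.L, Z a = Z b → a = b := by
    intro a ha b hb h
    rcases lt_trichotomy a b with h1 | h1 | h1
    · have := hZ.lt a b h1 hb; omega
    · exact h1
    · have := hZ.lt b a h1 ha; omega
  constructor
  · rintro ⟨a, ha, b, hb, c, hc, h, h1, h2, h3⟩
    obtain ⟨i, hi, e1⟩ := hZ.mem a ha
    obtain ⟨j, hj, e2⟩ := hZ.mem b hb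
    obtain ⟨k, hk, e3⟩ := hZ.mem c hc
    refine ⟨i, hi, j, hj, k, hk, by rw [← hX i hi, ← hX j hj, ← hX k hk]; omega, ?_, ?_, ?_⟩
    · rintro rfl; exact h1 (hinj a ha b hb (by rw [e1, e2]))
    · rintro rfl; exact h2 (hinj a ha c hc (by rw [e1, e3]))
    · rintro rfl; exact h3 (hinj b hb c hc (by rw [e2, e3]))
  · rintro ⟨i, hi, j, hj, k, hk, h, h1, h2, h3⟩
    obtain ⟨a, ha, e1⟩ := hZ.surj i hi
    obtain ⟨b, hb, e2⟩ := hZ.surj j hj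
    obtain ⟨c, hc, e3⟩ := hZ.surj k hk
    refine ⟨a, ha, b, hb, c, hc, by rw [e1, e2, e3, hX i hi, hX j hj, hX k hk]; omega, ?_, ?_, ?_⟩
    · rintro rfl; exact h1 (hXi i hi j hj (by rw [← e1, ← e2]))
    · rintro rfl; exact h2 (hXi i hi k hk (by rw [← e1, ← e3]))
    · rintro rfl; exact h3 (hXi j hj k hk (by rw [← e2, ← e3]))

/-- Adding `S` modulo `2 ^ w` to a word in two's complement gives the true sum if that sum is
nonnegative and fits. For this the user's language has a wrapping addition. -/
theorem toNat_ofInt_add {w : ℕ} {a : ℤ} {S : ℕ} (h0 : 0 ≤ a + S) (h : a + S < 2 ^ w) :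
    ((BitVec.ofInt w a).toNat + S) % 2 ^ w = (a + S).toNat := by
  rw [BitVec.toNat_ofInt]
  zify
  rw [Int.toNat_of_nonneg (Int.emod_nonneg _ (by positivity)), Int.emod_add_emod, Int.emod_eq_of_lt h0 h,
    Int.toNat_of_nonneg h0]

end Padded

/-! ### Computing the sizes and the sorted numbers on the machine. -/

namespace NatExpr

/-- The power `e ^ k`. -/
def pow (e : NatExpr) : ℕ → NatExpr
  | 0 => 1
  | k + 1 => pow e k * e

theorem pow_spec {N w : ℕ} {pre : Bool} {σ : UState N} {e : NatExpr} {x : ℕ} (hw : w ≠ 0) (he : e.Ok pre w σ)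
    (hx : e.nat w σ = x) : ∀ {k : ℕ}, (x + 1) ^ k < 2 ^ w → (e.pow k).Ok pre w σ ∧ (e.pow k).nat w σ = x ^ k
  | 0, _ => ⟨by simp [pow, hw], by simp [pow]⟩
  | k + 1, h => by
    have h1 : (x + 1) ^ k ≤ (x + 1) ^ (k + 1) := Nat.pow_le_pow_right (by omega) (by omega)
    obtain ⟨h2, h3⟩ := pow_spec hw he hx (k := k) (by omega)
    have h4 : x ^ k * x < 2 ^ w :=
      lt_of_le_of_lt (by rw [← pow_succ]; exact Nat.pow_le_pow_left (by omega) _) h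
    refine ⟨?_, ?_⟩
    · rw [pow, ok_mul, h3, hx]
      exact ⟨h2, he, h4⟩
    · rw [pow, nat_mul, h3, hx, pow_succ]

end NatExpr

namespace Prog

/-- Store the integral part of the `e`-th root of `X` in variable `x`. -/
def root (x : ℕ) (X : NatExpr) (e : ℕ) : Prog :=
  assign x 0 ;; loop (((V x + 1).pow e).lt (X + 1)) (assign x (V x + 1))

/-- Compute all sizes from the number of numbers, stored in variable `0`. -/
def computeSizes (κ b e : ℕ) : Prog :=
  assign 3 (V 0) ;;
  assign 4 ((V 3).pow κ) ;;
  root 5 ((V 3).pow (2 * b)) e ;;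
  root 6 (V 3) e ;;
  assign 8 ((V 6).pow (b - 1)) ;;
  assign 12 ((V 6).pow (b - 2)) ;;
  assign 9 (V 3 / V 8 + 1) ;;
  assign 10 (V 9 * V 8) ;;
  assign 11 (V 5 / 4) ;;
  assign 13 ((5 * V 4 + V 5 + 1) * (V 10 + 1))

/-- Make the padded array. -/
def fillIn : Prog :=
  for' 16 (V 10) (ite ((V 16).lt (V 3)) (write 3 (V 16) ((rd 0 (V 16)).wadd (V 4)))
    (write 3 (V 16) (5 * V 4 * (V 16 + 1))))

/-- Make the table of positions. -/
def makeTable : Prog := for' 16 (V 10) (write 6 (rd 5 (V 16)) (V 16))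

/-- The preparations that do not depend on random numbers. -/
def setup (κ b e : ℕ) : Prog := computeSizes κ b e ;; fillIn ;; sort 3 5 ;; makeTable

variable {N : ℕ} {w : ℕ} {G : SimpleGraph (Fin N)} {d : ℕ}

/-- The root is found by counting up from `0`. The hypothesis on `(root + 2) ^ e` keeps the power in
the test from overflowing. -/
theorem wp_root {x : ℕ} {X : NatExpr} {e : ℕ} {σ : UState N} {Q : UState N → Prop} {y : ℕ} (hw : w ≠ 0)
    (he : e ≠ 0) (hX : ∀ σ₁, σ.Agree (root x X e) σ₁ → X.Ok true w σ₁ ∧ X.nat w σ₁ = y)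
    (hy : y + 1 < 2 ^ w) (hr : (Nat.nthRoot e y + 2) ^ e < 2 ^ w)
    (hQ : ∀ σ', σ.Agree (root x X e) σ' → σ'.v x = Nat.nthRoot e y →
      σ'.time ≤ σ.time + (2 * Nat.nthRoot e y + 2) → Q σ') :
    (root x X e).wp true w G d Q σ := by
  refine wp_mono_agree _ (Q := fun σ' => σ'.v x = Nat.nthRoot e y ∧
      σ'.time ≤ σ.time + (2 * Nat.nthRoot e y + 2)) ?_ (fun σ' ha h => hQ σ' ha h.1 h.2)
  have hle : Nat.nthRoot e y + 2 < 2 ^ w := lt_of_le_of_lt (Nat.le_self_pow he _) hr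
  rw [root, wp_seq, wp_assign]
  refine ⟨by simp, by simp, ?_⟩
  have hag0 : σ.Agree (root x X e) (σ.set x 0) :=
    ⟨fun y hy => by simp [root, modV] at hy; simp [hy], fun _ _ => rfl,
      fun _ => ⟨rfl, rfl, rfl, rfl⟩⟩
  refine wp_loop (fun σ₁ => σ₁.v x ≤ Nat.nthRoot e y ∧ σ₁.time = σ.time + 1 + 2 * σ₁.v x)
    (fun σ₁ => Nat.nthRoot e y - σ₁.v x) (by simp) ?_
  rintro σ₁ h ⟨h1, h2⟩
  have h3 := hX σ₁ (hag0.trans (h.mono (by simp [root, modV]) (by simp [root, modA]) (by simp [root, local'])))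
  obtain ⟨h4, h5⟩ := NatExpr.pow_spec (σ := σ₁) (pre := true) (e := V x + 1) (x := σ₁.v x + 1) (k := e) hw
    (by simp [hw]; omega) (by simp) (lt_of_le_of_lt (Nat.pow_le_pow_left (by omega) e) hr)
  have h6 : (((V x + 1).pow e).lt (X + 1)).nat w σ₁ = if σ₁.v x + 1 ≤ Nat.nthRoot e y then 1 else 0 := by
    simp [h5, h3.2, Nat.le_nthRoot_iff he]
  rw [h6, NatExpr.ok_lt]
  refine ⟨⟨h4, ?_⟩, fun h7 => ?_, fun h7 => ?_⟩
  · simp [h3.1, h3.2, hw, hy]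
  · have h8 : σ₁.v x + 1 ≤ Nat.nthRoot e y := by
      by_contra h8; simp [h8] at h7
    rw [wp_assign]
    simp [hw]
    omega
  · have h8 : ¬ σ₁.v x + 1 ≤ Nat.nthRoot e y := by
      intro h8; simp [h8] at h7
    simp
    omega

/-- The sizes for `n` numbers. -/
structure _root_.Sizes.IsFor (P : Sizes w) (κ b e n : ℕ) : Prop where
  S : P.S = n ^ κ
  d : P.d = Nat.nthRoot e (n ^ (2 * b))
  g : P.g = Nat.nthRoot e n ^ (b - 1)
  X : P.X = Nat.nthRoot e n ^ (b - 2)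
  -- The additional group makes `L` exceed `n` even if `g` divides `n`.
  G : P.G = n / P.g + 1
  Y : P.Y = P.d / 4
  B : P.B = (5 * P.S + P.d + 1) * (P.L + 1)

theorem _root_.Sizes.IsFor.lt {P : Sizes w} {κ b e n : ℕ} (h : P.IsFor κ b e n) : n < P.L := by
  rw [Sizes.L, h.G, mul_comm]
  exact Nat.lt_mul_div_succ n P.g_pos

theorem wp_computeSizes (P : Sizes w) {κ b e n : ℕ} (hP : P.IsFor κ b e n) (he : e ≠ 0)
    {σ : UState N} {Q : UState N → Prop} (hn : σ.v 0 = n)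
    (hw1 : (n + 2) ^ κ < 2 ^ w) (hw2 : (n + 2) ^ (2 * b) < 2 ^ w) (hw3 : (P.d + 2) ^ e < 2 ^ w)
    (hw4 : (Nat.nthRoot e n + 2) ^ e < 2 ^ w)
    (hw5 : (Nat.nthRoot e n + 2) ^ b < 2 ^ w)
    (hQ : ∀ σ', σ.Agree (computeSizes κ b e) σ' → σ'.v 3 = n → σ'.v 4 = P.S → σ'.v 5 = P.d →
      σ'.v 8 = P.g → σ'.v 9 = P.G → σ'.v 10 = P.L → σ'.v 11 = P.Y → σ'.v 12 = P.X → σ'.v 13 = P.B →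
      σ'.time ≤ σ.time + (2 * P.d + 2 * Nat.nthRoot e n + 12) → Q σ') :
    (computeSizes κ b e).wp true w G d Q σ := by
  refine wp_mono_agree _ (Q := fun σ' => σ'.v 3 = n ∧ σ'.v 4 = P.S ∧ σ'.v 5 = P.d ∧
      σ'.v 8 = P.g ∧ σ'.v 9 = P.G ∧ σ'.v 10 = P.L ∧ σ'.v 11 = P.Y ∧ σ'.v 12 = P.X ∧ σ'.v 13 = P.B ∧
      σ'.time ≤ σ.time + (2 * P.d + 2 * Nat.nthRoot e n + 12)) ?_ (fun σ' ha h => by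
    obtain ⟨h1, h2, h3, h4, h5, h6, h7, h8, h9, h10⟩ := h
    exact hQ σ' ha h1 h2 h3 h4 h5 h6 h7 h8 h9 h10)
  have hw0 := P.hw0
  have hB := P.B_lt'
  have hLB := P.L_le
  have hnL := hP.lt
  have hdL := P.d_L_le
  rw [computeSizes, wp_seq, wp_assign]
  refine ⟨by simp, by simp, ?_⟩
  rw [wp_seq, wp_assign]
  obtain ⟨h1, h2⟩ := NatExpr.pow_spec (σ := σ.set 3 n) (pre := true) (e := V 3) (x := n) (k := κ) hw0
    (by simp) (by simp) (lt_of_le_of_lt (Nat.pow_le_pow_left (by omega) _) hw1)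
  simp only [NatExpr.nat_var, hn]
  refine ⟨h1, by simp, ?_⟩
  rw [h2, wp_seq]
  set σ₁ := (σ.set 3 n).set 4 (n ^ κ) with hσ₁
  have e3 : σ₁.v 3 = n := rfl
  have e4 : σ₁.v 4 = P.S := hP.S.symm
  have et : σ₁.time = σ.time + 2 := rfl
  clear_value σ₁
  have hd0 := hP.d
  refine wp_root (y := n ^ (2 * b)) hw0 he (fun σ' ha => ?_) ?_ (by rwa [← hd0]) fun σ₂ ha2 h5 ht2 => ?_
  · have := ha.v 3 (by simp [root, modV])
    exact NatExpr.pow_spec hw0 (by simp) (by simp [this, e3])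
      (lt_of_le_of_lt (Nat.pow_le_pow_left (by omega) _) hw2)
  · have : n ^ (2 * b) + 1 ≤ (n + 2) ^ (2 * b) := by
      -- For `b = 0` the root would be `1`, contradicting `4 * Y ≤ d` with `Y` positive.
      rcases Nat.eq_zero_or_pos b with rfl | hb
      · exfalso
        have h1 : P.d = 1 := by
          rw [hP.d]
          simp [Nat.nthRoot_one_right]
        have := P.Y_le
        have := P.Y_pos
        omega
      · exact Nat.pow_lt_pow_left (by omega) (by omega)
    omega
  · rw [← hd0] at h5 ht2
    have k3 := ha2.v 3 (by simp [root, modV])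
    have k4 := ha2.v 4 (by simp [root, modV])
    rw [wp_seq]
    refine wp_root (y := n) hw0 he (fun σ' ha => ?_) (by omega) hw4 fun σ₃ ha3 h6 ht3 => ?_
    · have := ha.v 3 (by simp [root, modV])
      simp [this, k3, e3]
    · have l3 := ha3.v 3 (by simp [root, modV])
      have l4 := ha3.v 4 (by simp [root, modV])
      have l5 := ha3.v 5 (by simp [root, modV])
      rw [k3, e3] at l3
      rw [k4, e4] at l4
      rw [h5] at l5
      rw [wp_seq, wp_assign]
      have hb1 : (Nat.nthRoot e n + 1) ^ (b - 1) < 2 ^ w := lt_of_le_of_lt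
        ((Nat.pow_le_pow_left (by omega) _).trans (Nat.pow_le_pow_right (by omega) (by omega))) hw5
      have hb2 : (Nat.nthRoot e n + 1) ^ (b - 2) < 2 ^ w := lt_of_le_of_lt
        ((Nat.pow_le_pow_left (by omega) _).trans (Nat.pow_le_pow_right (by omega) (by omega))) hw5
      obtain ⟨g1, g2⟩ := NatExpr.pow_spec (σ := σ₃) (pre := true) (e := V 6) (k := b - 1) hw0 (by simp)
        (by simpa using h6) hb1
      rw [g2, ← hP.g]
      refine ⟨g1, by simp, ?_⟩
      rw [wp_seq, wp_assign]
      obtain ⟨q1, q2⟩ := NatExpr.pow_spec (σ := σ₃.set 8 P.g) (pre := true) (e := V 6) (k := b - 2) hw0 (by simp)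
        (by simpa using h6) hb2
      rw [q2, ← hP.X]
      refine ⟨q1, by simp, ?_⟩
      have hG1 := hP.G
      have hL1 : P.G * P.g = P.L := rfl
      have hdiv := Nat.div_le_self n P.g
      have hY := hP.Y
      have hBe := hP.B
      have hmul1 : 5 * P.S + P.d + 1 ≤ P.B := by
        rw [hBe]; exact Nat.le_mul_of_pos_right _ (by omega)
      have h4w : 4 < 2 ^ w := by
        have := P.Y_le; have := P.Y_pos; omega
      simp only [wp_seq, wp_assign]
      simp [l3, l4, l5, ← hG1, hL1, ← hY, ← hBe, hw0]
      omega

theorem wp_setup (P : Sizes w) {κ b e n : ℕ} (hP : P.IsFor κ b e n) (he : e ≠ 0) (hS : 0 < P.S)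
    {σ : UState N} {Q : UState N → Prop} (hn : σ.v 0 = n)
    (hw1 : (n + 2) ^ κ < 2 ^ w) (hw2 : (n + 2) ^ (2 * b) < 2 ^ w) (hw3 : (P.d + 2) ^ e < 2 ^ w)
    (hw4 : (Nat.nthRoot e n + 2) ^ e < 2 ^ w)
    (hw5 : (Nat.nthRoot e n + 2) ^ b < 2 ^ w) {A : Fin n → ℤ} (hA : IsThreeSumInstance κ n A)
    (ha0 : ∀ i (h : i < n), σ.a 0 i = (BitVec.ofInt w (A ⟨i, h⟩)).toNat)
    (hQ : ∀ σ' : UState N, ∀ Z, σ'.nf = σ.nf → σ'.nq = σ.nq → Base P Z σ' → Nums P Z →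
      (P.Sol Z ↔ HasThreeSum A) →
      σ'.time ≤ σ.time + (2 * P.d + 2 * Nat.nthRoot e n + P.G * (6 * P.g + 6) +
        P.L * (4 * P.G + 6 * P.g + 19) + 21) → Q σ') :
    (setup κ b e).wp true w G d Q σ := by
  have hw0 := P.hw0
  have hB := P.B_lt'
  have hLB := P.L_le
  have hnL := hP.lt
  have hdL := P.d_L_le
  have hAS : ∀ i, |A i| ≤ (P.S : ℤ) := fun i => by
    have := hA.2 i
    rw [hP.S]
    exact_mod_cast this
  have hXB : ∀ i < P.L, padded A P.S i + P.S < P.B := by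
    intro i hi
    have h1 := padded_le hAS hi
    rw [hP.B]
    have h2 : (5 * P.S) * (P.L + 1) + (P.L + 1) ≤ (5 * P.S + P.d + 1) * (P.L + 1) := by
      rw [← Nat.add_one_mul]; exact Nat.mul_le_mul_right _ (by omega)
    rw [mul_add_one] at h2
    omega
  refine wp_mono_agree _ (Q := fun σ' => ∃ Z, Base P Z σ' ∧ Nums P Z ∧
      (P.Sol Z ↔ HasThreeSum A) ∧
      σ'.time ≤ σ.time + (2 * P.d + 2 * Nat.nthRoot e n + P.G * (6 * P.g + 6) +
        P.L * (4 * P.G + 6 * P.g + 19) + 21)) ?_ (fun σ' ha h => ?_)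
  swap
  · obtain ⟨Z, h1, h2, h3, h4⟩ := h
    have hg := ha.ghost (by simp [setup, computeSizes, root, fillIn, sort, nextMin, makeTable, for', local'])
    exact hQ σ' Z hg.2.2.1 hg.2.2.2 h1 h2 h3 h4
  rw [setup, wp_seq]
  refine wp_computeSizes P hP he hn hw1 hw2 hw3 hw4 hw5
    fun σ₁ ha1 v3 v4 v5 v8 v9 v10 v11 v12 v13 ht1 => ?_
  have a0 : σ₁.a 0 = _ := ha1.a 0 (by simp [computeSizes, root, modA])
  rw [wp_seq]
  refine wp_for_const P.L (fun i σ' => ∀ u < i, σ'.a 3 u = padded A P.S u) 2 (by omega) (by simp [modV])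
    (by simp) ?_ (by simp) ?_ ?_
  · intro σ' h
    have := h.v 10 (by simp [modV, for'])
    simp [this, v10]
  · intro i hi σ' h hi1 hI
    have e10 := h.v 10 (by simp [modV, for'])
    have e3 := h.v 3 (by simp [modV, for'])
    have e4 := h.v 4 (by simp [modV, for'])
    have ea : σ'.a 0 = _ := h.a 0 (by simp [modA, for'])
    rw [v3] at e3
    rw [v4] at e4
    rw [a0] at ea
    have hX1 := hXB i hi
    have hcons : ∀ x, x = padded A P.S i → ∀ u < i + 1, (σ'.tick.put 3 i x).a 3 u = padded A P.S u := by
      intro x hx u hu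
      by_cases hui : u = i
      · simp [hui, hx]
      · simpa [hui] using hI u (by omega)
    rw [wp_ite, wp_write, wp_write]
    simp only [NatExpr.ok_lt, NatExpr.ok_var, NatExpr.nat_lt, NatExpr.nat_var, hi1, e3,
      NatExpr.ok_wadd, NatExpr.ok_read, NatExpr.nat_wadd, NatExpr.nat_read, UState.tick_v, UState.tick_a,
      e4, ea, UState.put_time, UState.tick_time]
    refine ⟨by simp, fun hlt => ?_, fun hge => ?_⟩
    · have hin : i < n := by by_contra hin; simp [hin] at hlt
      refine ⟨by simp, by simp, by simp, le_rfl, hcons _ ?_⟩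
      have h1 := abs_le.1 (hAS ⟨i, hin⟩)
      rw [ha0 i hin, toNat_ofInt_add (by omega) (by
        have h2 := (padded_of_lt hAS hin).1
        rw [← h2]
        exact_mod_cast (by omega : padded A P.S i < 2 ^ w)), padded, dif_pos hin]
    · have hin : n ≤ i := by by_contra hin; simp [not_le.1 hin] at hge
      have hpad := padded_of_le (A := A) (S := P.S) hin
      have h5 : 5 * P.S ≤ 5 * P.S * (i + 1) := Nat.le_mul_of_pos_right _ (by omega)
      have h5w : 5 < 2 ^ w := by
        have := P.Y_le; have := P.Y_pos; omega
      refine ⟨by simp, ?_, by simp, le_rfl, hcons _ ?_⟩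
      · simp [hi1, e4, hw0]
        omega
      · simp [hi1, e4, hpad]
  · intro σ₂ ha2 hi1 hX ht2
    have w3 := ha2.v 3 (by simp [for', modV])
    have w4 := ha2.v 4 (by simp [for', modV])
    have w5 := ha2.v 5 (by simp [for', modV])
    have w8 := ha2.v 8 (by simp [for', modV])
    have w9 := ha2.v 9 (by simp [for', modV])
    have w10 := ha2.v 10 (by simp [for', modV])
    have w11 := ha2.v 11 (by simp [for', modV])
    have w12 := ha2.v 12 (by simp [for', modV])
    have w13 := ha2.v 13 (by simp [for', modV])
    have hXinj : ∀ i < P.L, ∀ j < P.L, σ₂.a 3 i = σ₂.a 3 j → i = j := by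
      intro i hi j hj h
      rw [hX i hi, hX j hj] at h
      exact padded_inj hAS hA.1 hS h
    rw [wp_seq]
    refine wp_sort (by norm_num) (by norm_num) (by norm_num) (by norm_num) (by norm_num) (g := P.g)
      (n := P.G) (by rw [w8, v8]) (by rw [w9, v9]) (by rw [w10, v10]; rfl) P.g_pos ?_
      (by rw [w13, v13]; exact hLB) (by rw [w13, v13]; omega) hXinj fun σ₃ ha3 hsort ht3 => ?_
    · intro i hi
      rw [hX i hi, w13, v13]
      exact lt_of_le_of_lt (Nat.le_add_right _ _) (hXB i hi)
    have hsol : P.Sol (σ₃.a 5) ↔ HasThreeSum A := sol_iff hAS hS rfl hnL.le hX hsort hXinj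
    have hnums : Nums P (σ₃.a 5) := by
      refine ⟨hsort.lt, fun t ht => ?_⟩
      obtain ⟨i, hi, h⟩ := hsort.mem t ht
      rw [h, hX i hi]
      exact (hXB i hi).le
    have x10 := ha3.v 10 (by simp [sort, nextMin, for', modV])
    refine wp_for_const P.L (fun i σ' => ∀ u < i, σ'.a 6 (σ₃.a 5 u) = u) 1 (by omega) (by simp [modV])
      (by simp) ?_ (by simp) ?_ ?_
    · intro σ' h
      have := h.v 10 (by simp [modV, for'])
      simp [this, x10, w10, v10]
    · intro i hi σ' h hi1 hI
      have ea : σ'.a 5 = _ := h.a 5 (by simp [modA, for'])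
      rw [wp_write]
      simp only [NatExpr.nat_read, NatExpr.nat_var, hi1, ea]
      refine ⟨by simp, by simp, by simp, by simp, fun u hu => ?_⟩
      by_cases hui : u = i
      · simp [hui]
      · have h1 : σ₃.a 5 u ≠ σ₃.a 5 i := fun h => hui (hnums.inj (by omega) hi h)
        simpa [h1] using hI u (by omega)
    · intro σ₄ ha4 hi1 hT ht4
      have y5 : σ₄.a 5 = _ := ha4.a 5 (by simp [modA, for'])
      have hv : ∀ x, 4 ≤ x → x ≤ 13 → σ₄.v x = σ₁.v x := by
        intro x h1 h2
        rw [ha4.v x (by simp [modV, for']; omega), ha3.v x (by simp [sort, nextMin, modV, for']; omega),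
          ha2.v x (by simp [modV, for']; omega)]
      refine ⟨σ₃.a 5, ⟨?_, ?_, ?_, ?_, ?_, ?_, ?_, ?_, y5, hT⟩, hnums, hsol, ?_⟩
      · rw [hv 4 (by norm_num) (by norm_num), v4]
      · rw [hv 5 (by norm_num) (by norm_num), v5]
      · rw [hv 8 (by norm_num) (by norm_num), v8]
      · rw [hv 9 (by norm_num) (by norm_num), v9]
      · rw [hv 10 (by norm_num) (by norm_num), v10]
      · rw [hv 11 (by norm_num) (by norm_num), v11]
      · rw [hv 12 (by norm_num) (by norm_num), v12]
      · rw [hv 13 (by norm_num) (by norm_num), v13]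
      · change σ₃.time ≤ σ₂.time + (P.G * (6 * P.g + 6) + P.L * (4 * P.G + 6 * P.g + 12) + 5) at ht3
        simp only [mul_add] at ht3 ⊢
        omega

end Prog

/-! ## The reduction as a program for the word RAM -/

namespace MState

/-- Advance the clock. -/
def shift {w : ℕ} (x : ℕ) (s : MState w) : MState w := { s with clock := s.clock + x }

theorem shift_resetClock {w : ℕ} (s : MState w) : s.resetClock.shift s.clock = s := by
  simp [shift, resetClock]

end MState

/-- Programs cannot read the clock, so a later start only shifts the final reading; an instance of
`Cmd.exp_frame`. -/
theorem Cmd.exp_shift {w : ℕ} (c : Cmd) (hc : c.NeverWrites 2) (f : MState w → ℝ≥0∞) (x : ℕ)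
    (s : MState w) : c.exp f (s.shift x) = c.exp (fun t => f (t.shift x)) s := by
  obtain ⟨M, hM⟩ := c.exists_below
  refine Cmd.exp_frame (φ := MState.shift x) (M := M) (β := s.arr 2) ⟨fun s => ?_, fun _ _ _ _ => rfl, fun _ _ _ _ _ _ _ => rfl,
    fun _ _ _ => rfl, fun _ _ _ _ => rfl⟩ c hM hc _ _ (fun _ _ => rfl) s rfl
  simp only [MState.shift, MState.tick]
  congr 1
  omega

namespace FailureOracle

variable {w N : ℕ} (D : FailureOracle)

theorem opsExp_shift (x : ℕ) (f : MState w → ℝ≥0∞) (ops : List (FailureOp N w)) :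
    ∀ s, D.opsExp ops f (s.shift x) = D.opsExp ops (fun t => f (t.shift x)) s := by
  induction ops with
  | nil => exact fun s => rfl
  | cons o ops ih =>
    intro s
    cases o with
    | fail F b =>
      simp only [opsExp, ← funext ih]
      exact D.fail.exp_shift D.fail_readOnly _ x (failInput F b s)
    | query u v =>
      simp only [opsExp, ← funext ih]
      exact D.query.exp_shift D.query_readOnly _ x (queryInput u v s)

theorem opsExp_one_resetClock (ops : List (FailureOp N w)) (s : MState w) :
    D.opsExp ops (fun _ => 1) s.resetClock = D.opsExp ops (fun _ => 1) s := by
  conv_rhs => rw [← s.shift_resetClock, opsExp_shift]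

/-- The amortized bounds measure the operations from a reset clock. Here the reading before them is
split off again; the inequality comes from runs that may not halt. -/
theorem opsExp_clock_le (ops : List (FailureOp N w)) (s : MState w) :
    D.opsExp ops (fun t => t.clock) s
      ≤ s.clock + D.opsExp ops (fun t => t.clock) s.resetClock := by
  conv_lhs => rw [← s.shift_resetClock, opsExp_shift]
  simp only [MState.shift, Nat.cast_add]
  rw [opsExp_add, add_comm]
  gcongr
  calc D.opsExp ops (fun _ => (s.clock : ℝ≥0∞)) s.resetClock
      = D.opsExp ops (fun _ => (s.clock : ℝ≥0∞) * 1) s.resetClock := by simp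
    _ ≤ s.clock * 1 := by
      rw [opsExp_const_mul]
      gcongr
      exact D.opsExp_le_one (fun _ => le_rfl) _ _
    _ = s.clock := mul_one _

end FailureOracle

theorem expectedTime_eq {w : ℕ} {E : (MState w → ℝ≥0∞) → ℝ≥0∞} (h : E (fun _ => 1) = 1) :
    expectedTime E = E (fun s => s.clock) := if_pos h

theorem exp_one_of_expectedTime_le {w : ℕ} {E : (MState w → ℝ≥0∞) → ℝ≥0∞} {T : ℝ≥0∞} (hT : T ≠ ⊤)
    (h : expectedTime E ≤ T) : E (fun _ => 1) = 1 ∧ E (fun s => s.clock) ≤ T := by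
  by_cases h1 : E (fun _ => 1) = 1
  · exact ⟨h1, by rwa [expectedTime_eq h1] at h⟩
  · rw [expectedTime, if_neg h1, top_le_iff] at h
    exact absurd h hT

/-- Without deletions and queries the sequence of operations is empty, so the program is a plain
transformation of states. Compatibility can be arranged at will, as `load` hides the array `2` of
`t`. -/
theorem Reach.exp_eq {N : ℕ} {D : FailureOracle} {M : ℕ} {pre : Bool} {w : ℕ}
    {G : SimpleGraph (Fin N)} {d : ℕ} {c : Cmd} {σ σ' : UState N}
    (h : Reach D M pre w G d c σ σ') (hf : σ'.nf = σ.nf) (hq : σ'.nq = σ.nq) (f : MState w → ℝ≥0∞)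
    (t : MState w) : c.exp f (σ.load M pre t) = f (σ'.load M pre t) := by
  obtain ⟨ops, -, h1, h2, -, h3⟩ := h
  obtain rfl := eq_nil_of_num_eq_zero (a := ops) (by omega) (by omega)
  have hl : ∀ (τ : UState N) b, τ.load M pre (t.setArr 2 b) = τ.load M pre t := by
    intro τ b
    simp only [UState.load, MState.setArr, MState.mk.injEq, true_and, and_true]
    funext y i
    by_cases hy : y = 2
    · subst hy; simp [UserArr]
    · simp [hy]
  have h4 := h3 (t.setArr 2 fun i => BitVec.ofNat w (σ.fz i.toNat)) (by simp [UState.Compat, MState.setArr]) rfl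
    f (fun t' => f (σ'.load M pre t')) fun _ _ => rfl
  rwa [hl, FailureOracle.opsExp, hl] at h4

/-! ### From machine states to user states, and the handover to the data structure. -/

namespace UState

/-- The memory of the machine as memory of the user. -/
def ofMState {w : ℕ} (N M : ℕ) (s : MState w) : UState N where
  v k := (s.var (machName M k)).toNat
  a k i := (s.arr (machName M k) (BitVec.ofNat w i)).toNat
  time := 0
  F := []
  fz i := (s.arr 2 (BitVec.ofNat w i)).toNat
  nf := 0
  nq := 0

theorem load_ofMState {w N M : ℕ} (pre : Bool) (s : MState w) : (ofMState N M s).load M pre s = s := by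
  have h1 : (ofMState N M s).load M pre s = ⟨s.var, s.arr, s.clock⟩ := by
    simp only [load, ofMState, MState.mk.injEq]
    refine ⟨funext fun x => ?_, funext fun y => funext fun i => ?_, Nat.zero_add _⟩
    · split_ifs with h
      · rw [machName_userName h]; simp
      · rfl
    · split_ifs with h
      · rw [machName_userName' h]; simp
      · rfl
  exact h1

theorem ofMState_bd {w N M : ℕ} (s : MState w) : (ofMState N M s).Bd w :=
  ⟨fun _ => BitVec.isLt _, fun _ _ => BitVec.isLt _⟩

/-- The same memory, at the start of the dealings with the data structure for an `N'`-vertex graph. -/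
def start {N : ℕ} (N' : ℕ) (σ : UState N) : UState N' := ⟨σ.v, σ.a, σ.time, [], σ.a 2, 0, 0⟩

end UState

open Classical in
/-- The times and the correctness of a data structure for a single graph. -/
structure FailureOracle.Works {N : ℕ} (D : FailureOracle) (w : ℕ) (G : SimpleGraph (Fin N)) (d : ℕ)
    (tp td tq : ℝ≥0) (es : List (Fin N × Fin N)) : Prop where
  prep : ∀ s : MState w, expectedTime (fun f => D.prep.exp f (graphInput d es s)) ≤ tp
  ops : ∀ (s : MState w) (ops : List (FailureOp N w)), LegalOps d [] ops →
    D.prep.exp (D.opsErrors G [] ops) (graphInput d es s) = 0 ∧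
      expectedTime (fun f =>
        D.prep.exp (fun t => D.opsExp ops f t.resetClock) (graphInput d es s)) ≤
        numFails ops * td + numQueries ops * tq

namespace FailureOracle

variable {N N₀ M w d : ℕ} {D : FailureOracle} {G : SimpleGraph (Fin N)} {tp td tq : ℝ≥0}
  {es : List (Fin N × Fin N)}

/-- Before the preprocessing the shared names belong to the user, and afterwards to the data
structure. As the memory already contains the graph in the required form, setting up the input
changes only the clock, and the overlay restores the time elapsed. -/
theorem prep_exp_load (hD : D.Below M) {σ : UState N₀} {t : MState w} (ht : t.clock = 0)
    (h0 : σ.v 0 = N) (h1 : σ.v 1 = es.length) (h2 : σ.v 2 = d)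
    (hes : ∀ k (h : k < es.length), σ.a 0 k = es[k].1 ∧ σ.a 1 k = es[k].2)
    {f f' : MState w → ℝ≥0∞}
    (hf : ∀ t', (σ.start N).Compat t' → f ((σ.start N).load M false t') = f' t') :
    D.prep.exp f (σ.load M true t) = D.prep.exp f' (graphInput d es (σ.load M true t)) := by
  rw [← D.prep.exp_frame (isFrame_load (σ.start N)) hD.2.1 D.prep_readOnly f f' hf]
  · congr 1
    have h3 : ∀ x, UserVar M true x ↔ x < 3 ∨ M + 3 ≤ x := fun x => by simp [UserVar]
    have h4 : ∀ x, UserVar M false x ↔ M + 3 ≤ x := fun x => by simp [UserVar]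
    have hM := hD.1
    have h5 : graphInput d es (σ.load M true t) = ⟨(σ.load M true t).var, (σ.load M true t).arr, 0⟩ := by
      simp only [graphInput, MState.setVar, MState.setArr, MState.resetClock, MState.mk.injEq, and_true]
      constructor
      · funext x
        simp only [Function.update_apply]
        by_cases hx2 : x = 2
        · subst hx2; simp [UState.load, h3, userName, h2]
        by_cases hx1 : x = 1
        · subst hx1; simp [UState.load, h3, userName, h1]
        by_cases hx0 : x = 0
        · subst hx0; simp [UState.load, h3, userName, h0]
        simp [hx0, hx1, hx2]
      · funext y i
        simp only [Function.update_apply]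
        by_cases hx1 : y = 1
        · subst hx1
          simp only [if_true, withPrefix, List.length_map, List.getElem_map]
          split_ifs with h
          · simp [UState.load, UserArr, h3, userName, (hes _ h).2]
          · rfl
        by_cases hx0 : y = 0
        · subst hx0
          rw [if_neg hx1, if_pos rfl]
          simp only [withPrefix, List.length_map, List.getElem_map]
          split_ifs with h
          · simp [UState.load, UserArr, h3, userName, (hes _ h).1]
          · rfl
        simp [hx0, hx1]
    rw [h5]
    simp only [UState.load, MState.mk.injEq, UState.start, ht, and_true]
    constructor
    · funext x
      by_cases h : M + 3 ≤ x <;> simp [h3, h4, h]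
    · funext y i
      by_cases h : M + 3 ≤ y <;> by_cases h' : y = 2 <;> simp [h3, h4, h, h', UserArr]
  · simp [graphInput, MState.setVar, MState.setArr, MState.resetClock, UState.load, UserArr,
      UState.start, userName]

/-- Preprocessing followed by a program `p` of the user. -/
theorem Works.exp_prep_seq (hD : D.Below M) (hw : 0 < w) (h : D.Works w G d tp td tq es)
    {σ : UState N₀} {t : MState w} (ht : t.clock = 0) (hσ : σ.Bd w)
    (h0 : σ.v 0 = N) (h1 : σ.v 1 = es.length) (h2 : σ.v 2 = d)
    (hes : ∀ k (h : k < es.length), σ.a 0 k = es[k].1 ∧ σ.a 1 k = es[k].2)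
    {p : Prog} {Q : UState N → Prop} (hp : p.wp false w G d Q (σ.start N)) :
    ∃ σ' : UState N, Q σ' ∧
      (∀ f : MState w → ℝ≥0∞, (∀ t', f (σ'.load M false t') = 0) →
        (Cmd.seq D.prep (p.compile D M)).exp f (σ.load M true t) = 0) ∧
      (∀ f : MState w → ℝ≥0∞, (∀ t', f (σ'.load M false t') = 1) →
        (Cmd.seq D.prep (p.compile D M)).exp f (σ.load M true t) = 1) ∧
      ∀ (f : MState w → ℝ≥0∞) (x : ℕ), (∀ t', f (σ'.load M false t') = x + t'.clock) →
        (Cmd.seq D.prep (p.compile D M)).exp f (σ.load M true t)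
          ≤ x + σ'.nf * td + σ'.nq * tq + tp := by
  classical
  obtain ⟨σ', ⟨ops, -, hnf, hnq, hl, hr⟩, -, hQ⟩ := Prog.wp_sound hD hw p hp hσ
  have hnf' : σ'.nf = numFails ops := by simpa [UState.start] using hnf
  have hnq' : σ'.nq = numQueries ops := by simpa [UState.start] using hnq
  set s := σ.load M true t with hs
  have key : ∀ f g : MState w → ℝ≥0∞, (∀ t', f (σ'.load M false t') = g t') →
      (Cmd.seq D.prep (p.compile D M)).exp f s = D.prep.exp (D.opsExp ops g) (graphInput d es s) := by
    intro f g hfg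
    -- As in the composition of programs, states after the preprocessing from which the operations
    -- may err have probability zero, and the function is left as it is there.
    rw [Cmd.exp, prep_exp_load hD ht h0 h1 h2 hes (f' := fun t' =>
      if D.opsErrors G [] ops t' = 0 then D.opsExp ops g t' else
        (p.compile D M).exp f ((σ.start N).load M false t'))]
    · exact Cmd.exp_congr_of_exp_eq_zero _ (h.ops s ops hl).1 fun t' ht' => if_pos ht'
    · intro t' ht'
      split_ifs with h3
      · exact hr t' ht' h3 f g fun t' _ => hfg t'
      · rfl
  have hfin : (numFails ops * td + numQueries ops * tq : ℝ≥0∞) ≠ ⊤ := by finiteness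
  obtain ⟨ho1, ho2⟩ := exp_one_of_expectedTime_le hfin (h.ops s ops hl).2
  obtain ⟨hp1, hp2⟩ := exp_one_of_expectedTime_le ENNReal.coe_ne_top (h.prep s)
  simp only [opsExp_one_resetClock] at ho1
  refine ⟨σ', hQ, fun f hf => ?_, fun f hf => ?_, fun f x hf => ?_⟩
  · rw [key f (fun _ => 0) hf]
    have h3 : D.opsExp ops (fun _ : MState w => (0 : ℝ≥0∞)) = fun _ => 0 := by
      funext t
      simpa using D.opsExp_const_mul 0 (fun _ => 0) ops t
    rw [h3]
    simpa using D.prep.exp_const_mul 0 (fun _ => 0) (graphInput d es s)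
  · rw [key f (fun _ => 1) hf]
    exact ho1
  · rw [key f _ hf]
    -- The final reading consists of the user's own time `x`, the time of the preprocessing, and the
    -- time of the operations from a reset clock. Each is then bounded by its own hypothesis.
    have h3 : D.opsExp ops (fun t' : MState w => (x : ℝ≥0∞) + t'.clock)
        ≤ fun t' => (x * D.opsExp ops (fun _ => 1) t' + t'.clock)
          + D.opsExp ops (fun t => t.clock) t'.resetClock := by
      intro t'
      have h4 := D.opsExp_add (fun _ => (x : ℝ≥0∞) * 1) (fun t => t.clock) ops t'
      simp only [opsExp_const_mul] at h4
      simp only [mul_one] at h4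
      beta_reduce
      rw [h4, add_assoc]
      gcongr
      exact D.opsExp_clock_le ops t'
    refine (Cmd.exp_mono _ h3 _).trans ?_
    rw [Cmd.exp_add, Cmd.exp_add, Cmd.exp_const_mul, ho1, hnf', hnq', mul_one, add_right_comm,
      add_assoc (x : ℝ≥0∞) (_ * _) (_ * _)]
    gcongr

end FailureOracle

namespace Prog

/-- The reduction, after the choice of the random number. -/
def round (D : FailureOracle) (M : ℕ) : Cmd :=
  .seq (prepare.compile D M) (.seq (.seq D.prep (search.compile D M))
    (.assign 0 (.var (machName M 20))))

/-- The reduction, for instances with at least `n₀` numbers. -/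
def reduction (D : FailureOracle) (M κ b e n₀ : ℕ) : Cmd :=
  -- For few numbers the program runs forever. This is no wrong answer, and the lower bounds concern
  -- large `n` only.
  .cond (.op .lt (.var 0) (.lit n₀)) (.loop (.lit 1) .skip)
    (.seq ((setup κ b e).compile D M) (.seq (.rand (machName M 14)) (round D M)))

variable {D : FailureOracle} {M w : ℕ} {P : Sizes w} {Z : ℕ → ℕ} {tp td tq : ℝ≥0}

theorem exp_round (hD : D.Below M) (hZ : Nums P Z)
    (hW : ∀ m, P.Y ≤ m → m < 2 * P.Y → ∀ es, EdgeList P Z m (P.G * P.X * P.g) es →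
      D.Works w (P.graph Z m) P.d tp td tq es)
    {σ : UState 0} (hσ : σ.Bd w) (hb : Base P Z σ) {t : MState w} (ht : t.clock = 0) {ans : ℕ}
    (hans : (P.Sol Z → ans = 1) ∧ (¬ P.Sol Z → ans = 0)) {NF : ℕ}
    (hNF : P.G * (P.d / P.X + 1) ≤ NF) :
    (∀ f : MState w → ℝ≥0∞, (∀ t', t'.var 0 = BitVec.ofNat w ans → f t' = 0) →
      (round D M).exp f (σ.load M true t) = 0) ∧
    (round D M).exp (fun _ => 1) (σ.load M true t) = 1 ∧
    (round D M).exp (fun t' => t'.clock) (σ.load M true t) ≤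
      (σ.time + (7 * P.d + 90 * (P.G * P.L) + 90 * (P.g * P.L) + 19 * (P.g * NF) +
        14 * P.g * P.totalBads Z (P.Y + σ.v 14 % P.Y)) : ℕ)
        + (NF * td + (2 * (P.G * P.L) : ℕ) * tq + tp) := by
  have hw := Nat.pos_of_ne_zero P.hw0
  have hY := P.Y_pos
  have hYd := P.Y_le
  set m := P.Y + σ.v 14 % P.Y with hm
  have hmY : σ.v 14 % P.Y < P.Y := Nat.mod_lt _ hY
  -- The preparations make no calls of the data structure, so an empty graph and `d = 0` serve as
  -- placeholders.
  obtain ⟨σ₁, hr, hσ₁, ⟨hnf, hnq⟩, hready, es, hes, h01, h0, h1, h2, htime⟩ :=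
    wp_sound (G := (⊥ : SimpleGraph (Fin 0))) (d := 0) hD hw prepare
      (Q := fun σ' => (σ'.nf = σ.nf ∧ σ'.nq = σ.nq) ∧ Ready P Z m σ' ∧
        ∃ es : List (Fin (P.numV m) × Fin (P.numV m)), EdgeList P Z m (P.G * P.X * P.g) es ∧
        (∀ k (h : k < es.length), σ'.a 0 k = es[k].1 ∧ σ'.a 1 k = es[k].2) ∧
        σ'.v 0 = P.numV m ∧ σ'.v 1 = es.length ∧ σ'.v 2 = P.d ∧
        σ'.time ≤ σ.time + (P.G * (6 * P.g + 6) + P.L * (4 * P.G + 6 * P.g + 12) + m * 7 +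
          P.G * P.X * P.g * 9 + P.L * 6 + 30))
      (wp_prepare P hZ hb hm rfl fun σ' hl hr es h1 h2 h3 h4 h5 h6 =>
        ⟨hl (by decide), hr, es, h1, h2, h3, h4, h5, h6⟩) hσ
  have hr' : Ready P Z m (σ₁.start (P.numV m)) := by
    obtain ⟨⟨v4, v5, v8, v9, v10, v11, v12, v13, a5, a6⟩, v14, v15, v20, v21, a8, hp, a11⟩ := hready
    exact ⟨⟨v4, v5, v8, v9, v10, v11, v12, v13, a5, a6⟩, v14, v15, v20, v21, a8, hp, a11⟩
  obtain ⟨σ₂, ⟨hs1, hs2, hs3, hs4, hs5⟩, hzero, hone, hclock⟩ :=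
    (hW m (by omega) (by omega) es hes).exp_prep_seq hD hw ht hσ₁ h0 h1 h2 h01
      (wp_search (d := P.d) (Q := fun σ' => (P.Sol Z → σ'.v 20 = 1) ∧ (¬ P.Sol Z → σ'.v 20 = 0) ∧
        σ'.nf ≤ P.G * (m / P.X + 1) ∧ σ'.nq ≤ 2 * (P.G * P.L) ∧
        σ'.time ≤ σ₁.time + 30 * (P.G * P.L) + (P.g * 11 + 8) * σ'.nf + 10 * σ'.nq +
          (P.g * 12 + 2) * (1 + P.totalBads Z m) + 2)
        hZ (by omega) (by omega) le_rfl hr' rfl rfl fun σ' a1 a2 a3 a4 a5 => ⟨a1, a2, a3, a4, a5⟩)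
  have hexp : ∀ f, (round D M).exp f (σ.load M true t)
      = (Cmd.seq D.prep (search.compile D M)).exp
        ((Cmd.assign 0 (.var (machName M 20))).exp f) (σ₁.load M true t) := by
    intro f
    exact hr.exp_eq hnf hnq _ t
  have hfin : ∀ (f : MState w → ℝ≥0∞) t', (Cmd.assign 0 (.var (machName M 20))).exp f
      (σ₂.load M false t') = f ((σ₂.load M false t').tick.setVar 0 (BitVec.ofNat w (σ₂.v 20))) := by
    intro f t'
    rw [Cmd.exp, Expr.eval, load_var _ _ (by norm_num)]
  have h20 : σ₂.v 20 = ans := by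
    by_cases h : P.Sol Z
    · rw [hs1 h, hans.1 h]
    · rw [hs2 h, hans.2 h]
  refine ⟨fun f hf => ?_, ?_, ?_⟩
  · rw [hexp]
    refine hzero _ fun t' => ?_
    rw [hfin]
    exact hf _ (by simp [MState.setVar, h20])
  · rw [hexp]
    exact hone _ fun t' => rfl
  · rw [hexp]
    have hnfNF : σ₂.nf ≤ NF := hs3.trans (le_trans (Nat.mul_le_mul_left _
      (Nat.add_le_add_right (Nat.div_le_div_right (by omega)) 1)) hNF)
    have hL := P.L_pos
    have e1 : P.G * P.g = P.L := rfl
    have e2 : P.L ≤ P.G * P.L := Nat.le_mul_of_pos_left _ P.G_pos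
    have e3 : P.g ≤ P.g * P.L := Nat.le_mul_of_pos_right _ hL
    have e4 : P.G * P.X * P.g ≤ P.g * P.L := by
      rw [mul_comm (P.G * P.X)]; exact Nat.mul_le_mul_left _ P.GX_le
    have e5 : P.g * σ₂.nf ≤ P.g * NF := Nat.mul_le_mul_left _ hnfNF
    have e6 : σ₂.nf ≤ P.g * σ₂.nf := Nat.le_mul_of_pos_left _ P.g_pos
    have e7 : P.totalBads Z m ≤ P.g * P.totalBads Z m := Nat.le_mul_of_pos_left _ P.g_pos
    have e8 : P.G ≤ P.L := Nat.le_mul_of_pos_right _ P.g_pos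
    have hg := P.g_pos
    have htot : σ₂.time + 1 ≤ σ.time + (7 * P.d + 90 * (P.G * P.L) + 90 * (P.g * P.L) +
        19 * (P.g * NF) + 14 * P.g * P.totalBads Z m) := by
      have f1 : P.G * (6 * P.g + 6) = 6 * P.L + 6 * P.G := by rw [← e1]; ring
      have f2 : P.L * (4 * P.G + 6 * P.g + 12) = 4 * (P.G * P.L) + 6 * (P.g * P.L) + 12 * P.L := by
        ring
      have f3 : (P.g * 11 + 8) * σ₂.nf = 11 * (P.g * σ₂.nf) + 8 * σ₂.nf := by ring
      have f4 : (P.g * 12 + 2) * (1 + P.totalBads Z m) =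
          12 * (P.g * P.totalBads Z m) + 2 * P.totalBads Z m + 12 * P.g + 2 := by ring
      have f5 : 14 * P.g * P.totalBads Z m = 14 * (P.g * P.totalBads Z m) := by ring
      omega
    refine (hclock _ (σ₂.time + 1) fun t' => ?_).trans ?_
    · rw [hfin]
      simp only [MState.setVar, MState.tick, UState.load]
      push_cast
      ring
    · rw [← add_assoc, ← add_assoc]
      gcongr

open Classical in
theorem exp_reduction (hD : D.Below M) {κ b e n n₀ T H NF : ℕ} (hP : P.IsFor κ b e n) (he : e ≠ 0)
    (hS : 0 < P.S) (hn : n₀ ≤ n) (hw1 : (n + 2) ^ κ < 2 ^ w) (hw2 : (n + 2) ^ (2 * b) < 2 ^ w)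
    (hw3 : (P.d + 2) ^ e < 2 ^ w) (hw4 : (Nat.nthRoot e n + 2) ^ e < 2 ^ w)
    (hw5 : (Nat.nthRoot e n + 2) ^ b < 2 ^ w)
    (hW : ∀ Z m, P.Y ≤ m → m < 2 * P.Y → ∀ es, EdgeList P Z m (P.G * P.X * P.g) es →
      D.Works w (P.graph Z m) P.d tp td tq es)
    (hNF : P.G * (P.d / P.X + 1) ≤ NF) (hT : ∀ x, x ≠ 0 → x ≤ 2 * P.B → x.divisors.card ≤ T)
    (hH : 2 * (P.G * P.L) * (P.g * P.g * T) ≤ P.Y * H)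
    {A : Fin n → ℤ} (hA : IsThreeSumInstance κ n A) (s : MState w) :
    (reduction D M κ b e n₀).exp (fun t => if t.var 0 = (if HasThreeSum A then 1 else 0) then 0 else 1)
      (threeSumInput A s) = 0 ∧
    expectedTime (fun f => (reduction D M κ b e n₀).exp f (threeSumInput A s)) ≤
      (9 * P.d + 2 * Nat.nthRoot e n + 130 * (P.G * P.L) + 210 * (P.g * P.L) + 19 * (P.g * NF) +
        28 * P.g * H : ℕ) + (NF * td + (2 * (P.G * P.L) : ℕ) * tq + tp) := by
  have hw := Nat.pos_of_ne_zero P.hw0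
  have hnw : n < 2 ^ w := by
    have := hP.lt; have := P.L_le; have := P.B_lt'; omega
  set t := threeSumInput A s with ht
  set σ : UState 0 := (UState.ofMState 0 M t).tick with hσ
  have hload : σ.load M true t = t.tick := by
    rw [hσ, ← load_tick, UState.load_ofMState]
  have ht0 : t.var 0 = BitVec.ofNat w n := rfl
  have hv0 : σ.v 0 = n := by
    have : σ.v 0 = (t.var 0).toNat := rfl
    rw [this, ht0]
    simp [Nat.mod_eq_of_lt hnw]
  have ha0 : ∀ i (h : i < n), σ.a 0 i = (BitVec.ofInt w (A ⟨i, h⟩)).toNat := by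
    intro i h
    have h1 : σ.a 0 i = (t.arr 0 (BitVec.ofNat w i)).toNat := rfl
    have h2 : i % 2 ^ w = i := Nat.mod_eq_of_lt (h.trans hnw)
    rw [h1, ht]
    simp [threeSumInput, MState.setArr, MState.resetClock, h2, h]
  obtain ⟨σ₁, hr, hσ₁, ⟨hnf, hnq⟩, Z, hb, hZ, hsol, htime⟩ :=
    wp_sound (G := (⊥ : SimpleGraph (Fin 0))) (d := 0) hD hw (setup κ b e)
      (Q := fun σ' => (σ'.nf = σ.nf ∧ σ'.nq = σ.nq) ∧ ∃ Z, Base P Z σ' ∧ Nums P Z ∧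
        (P.Sol Z ↔ HasThreeSum A) ∧
        σ'.time ≤ σ.time + (2 * P.d + 2 * Nat.nthRoot e n + P.G * (6 * P.g + 6) +
          P.L * (4 * P.G + 6 * P.g + 19) + 21))
      (wp_setup P hP he hS hv0 hw1 hw2 hw3 hw4 hw5 hA ha0 fun σ' Z h1 h2 h3 h4 h5 h6 =>
        ⟨⟨h1, h2⟩, Z, h3, h4, h5, h6⟩) (UState.ofMState_bd (N := 0) t)
  have hexp : ∀ f, (reduction D M κ b e n₀).exp f t
      = (∑ k ∈ Finset.range (2 ^ w), (round D M).exp f ((σ₁.set 14 k).load M true t)) / 2 ^ w := by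
    intro f
    have hlt : ¬ (Expr.op .lt (.var 0) (.lit n₀)).eval t ≠ 0 := by
      simp [Expr.eval, WordOp.eval, ht0, Nat.mod_eq_of_lt hnw, Nat.mod_eq_of_lt (hn.trans_lt hnw), hn]
    rw [reduction, Cmd.exp, if_neg hlt, ← hload, Cmd.exp, hr.exp_eq hnf hnq, Cmd.exp, Cmd.exp]
    simp only [load_set (pre := true) _ _ (Or.inl rfl)]
  obtain ⟨ans, ha1, ha2, ha3⟩ : ∃ ans : ℕ, (P.Sol Z → ans = 1) ∧ (¬ P.Sol Z → ans = 0) ∧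
      (if HasThreeSum A then 1 else 0) = BitVec.ofNat w ans := by
    rw [hsol]
    by_cases h : HasThreeSum A
    · exact ⟨1, by simp [h], by simp [h], by simp [h]⟩
    · exact ⟨0, by simp [h], by simp [h], by simp [h]⟩
  have hround := fun k (hk : k ∈ Finset.range (2 ^ w)) => exp_round (tp := tp) (td := td) (tq := tq) hD hZ (hW Z)
    (hσ₁.set (x := 14) (Finset.mem_range.1 hk)) (hb.of_eq (fun x h1 h2 => by simp; omega) rfl rfl)
    (t := t) rfl ⟨ha1, ha2⟩ hNF
  have h2w : (2 ^ w : ℝ≥0∞) ≠ 0 := by positivity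
  have h2w' : (2 ^ w : ℝ≥0∞) ≠ ⊤ := by finiteness
  refine ⟨?_, ?_⟩
  · rw [hexp, Finset.sum_eq_zero, ENNReal.zero_div]
    intro k hk
    refine (hround k hk).1 _ fun t' h => ?_
    rw [if_pos]
    rw [h, ← ha3]
  rw [expectedTime_eq]
  swap
  · rw [hexp, Finset.sum_congr rfl fun k hk => (hround k hk).2.1]
    simp only [Finset.sum_const, Finset.card_range, nsmul_eq_mul, mul_one, Nat.cast_pow, Nat.cast_ofNat]
    exact ENNReal.div_self h2w h2w'
  rw [hexp]
  refine ENNReal.div_le_of_le_mul ?_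
  have hY := P.Y_pos
  have hYw : P.Y ≤ 2 ^ w := by
    have := P.Y_le; have := P.d_L_le; have := P.B_lt'; omega
  -- The residues of a random word are uniform up to a factor `2`, because `Y ≤ 2 ^ w`. The average
  -- number of bad queries is therefore at most twice its average over the moduli from `Y` to `2 * Y
  -- - 1`.
  have hbads : ∑ k ∈ Finset.range (2 ^ w), (P.totalBads Z (P.Y + k % P.Y) : ℝ≥0∞)
      ≤ 2 ^ w * (6 * P.L + 2 * H : ℕ) := by
    have h1 := sum_mod_le (fun r => (P.totalBads Z (P.Y + r) : ℝ≥0∞)) hY (2 ^ w)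
    have h2 : ∑ r ∈ Finset.range P.Y, P.totalBads Z (P.Y + r) ≤ P.Y * (3 * P.L + H) := by
      have h3 := P.sum_totalBads_le hZ hT ((Finset.range P.Y).map (addLeftEmbedding P.Y))
      rw [Finset.sum_map, Finset.card_map, Finset.card_range] at h3
      refine h3.trans ?_
      nlinarith
    refine h1.trans ?_
    rw [← Nat.cast_sum]
    have h3 : (2 ^ w / P.Y + 1) * P.Y ≤ 2 * 2 ^ w := by
      have := Nat.div_mul_le_self (2 ^ w) P.Y
      rw [add_mul, one_mul]; omega
    have h4 : (2 ^ w / P.Y + 1) * ∑ r ∈ Finset.range P.Y, P.totalBads Z (P.Y + r)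
        ≤ 2 ^ w * (6 * P.L + 2 * H) := by
      calc _ ≤ (2 ^ w / P.Y + 1) * (P.Y * (3 * P.L + H)) := Nat.mul_le_mul_left _ h2
        _ = (2 ^ w / P.Y + 1) * P.Y * (3 * P.L + H) := by ring
        _ ≤ 2 * 2 ^ w * (3 * P.L + H) := Nat.mul_le_mul_right _ h3
        _ = _ := by ring
    exact_mod_cast h4
  set R := (NF * td + (2 * (P.G * P.L) : ℕ) * tq + tp : ℝ≥0∞) with hR
  set U := σ.time + (2 * P.d + 2 * Nat.nthRoot e n + P.G * (6 * P.g + 6) +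
          P.L * (4 * P.G + 6 * P.g + 19) + 21) + 1 + (7 * P.d + 90 * (P.G * P.L) +
          90 * (P.g * P.L) + 19 * (P.g * NF)) with hU
  calc ∑ k ∈ Finset.range (2 ^ w), (round D M).exp (fun t' => t'.clock) ((σ₁.set 14 k).load M true t)
      ≤ ∑ k ∈ Finset.range (2 ^ w),
          ((U + R) + (14 * P.g : ℕ) * (P.totalBads Z (P.Y + k % P.Y) : ℝ≥0∞)) := by
        refine Finset.sum_le_sum fun k hk => ((hround k hk).2.2).trans ?_
        rw [add_right_comm (U : ℝ≥0∞)]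
        refine add_le_add ?_ le_rfl
        have : σ₁.time + 1 + (7 * P.d + 90 * (P.G * P.L) + 90 * (P.g * P.L) + 19 * (P.g * NF) +
          14 * P.g * P.totalBads Z (P.Y + k % P.Y))
          ≤ U + 14 * P.g * P.totalBads Z (P.Y + k % P.Y) := by omega
        rw [← Nat.cast_mul, ← Nat.cast_add, Nat.cast_le]
        simpa using this
    _ ≤ 2 ^ w * (U + R) + (14 * P.g : ℕ) * (2 ^ w * (6 * P.L + 2 * H : ℕ)) := by
        rw [Finset.sum_add_distrib, ← Finset.mul_sum]
        simp only [Finset.sum_const, Finset.card_range, nsmul_eq_mul, Nat.cast_pow, Nat.cast_ofNat]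
        gcongr
    _ = ((U + 14 * P.g * (6 * P.L + 2 * H) : ℕ) + R) * 2 ^ w := by
        push_cast
        ring
    _ ≤ _ := by
        gcongr (?_ + _) * _
        rw [Nat.cast_le]
        have hL := P.L_pos
        have e1 : P.G * P.g = P.L := rfl
        have e2 : P.L ≤ P.G * P.L := Nat.le_mul_of_pos_left _ P.G_pos
        have e3 : P.L ≤ P.g * P.L := Nat.le_mul_of_pos_left _ P.g_pos
        have e8 : P.G ≤ P.L := Nat.le_mul_of_pos_right _ P.g_pos
        have f1 : P.G * (6 * P.g + 6) = 6 * P.L + 6 * P.G := by rw [← e1]; ring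
        have f2 : P.L * (4 * P.G + 6 * P.g + 19) = 4 * (P.G * P.L) + 6 * (P.g * P.L) + 19 * P.L := by
          ring
        have f3 : 14 * P.g * (6 * P.L + 2 * H) = 84 * (P.g * P.L) + 28 * P.g * H := by ring
        have f4 : σ.time = 1 := rfl
        omega

end Prog

/-! ## The choice of the sizes -/

section NthRoot

variable {b e n : ℕ}

theorem nthRoot_pow_le (he : e ≠ 0) : Nat.nthRoot e n ^ e ≤ n := (Nat.le_nthRoot_iff he).1 le_rfl

theorem nthRoot_le_self (he : e ≠ 0) : Nat.nthRoot e n ≤ n :=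
  (Nat.le_self_pow he _).trans (nthRoot_pow_le he)

theorem le_two_nthRoot_pow (he : e ≠ 0) (hK : 1 ≤ Nat.nthRoot e n) :
    n ≤ 2 ^ e * Nat.nthRoot e n ^ e := by
  rw [← mul_pow]
  exact (Nat.lt_pow_nthRoot_add_one he n).le.trans (Nat.pow_le_pow_left (by omega) e)

/-- With `nthRoot_pow_le_mul` this shows that `d` is `K ^ (2 * b)` up to the constant factor `4 ^
b`. -/
theorem nthRoot_pow_le_nthRoot (he : e ≠ 0) :
    Nat.nthRoot e n ^ (2 * b) ≤ Nat.nthRoot e (n ^ (2 * b)) := by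
  rw [Nat.le_nthRoot_iff he, ← pow_mul, mul_comm, pow_mul]
  exact Nat.pow_le_pow_left (nthRoot_pow_le he) _

theorem nthRoot_pow_le_mul (he : e ≠ 0) (hb : 0 < b) (hK : 1 ≤ Nat.nthRoot e n) :
    Nat.nthRoot e (n ^ (2 * b)) ≤ 4 ^ b * Nat.nthRoot e n ^ (2 * b) := by
  rw [show (4 : ℕ) = 2 ^ 2 by norm_num, ← pow_mul, ← mul_pow]
  refine (Nat.nthRoot_lt_iff he).2 ?_ |>.le.trans (Nat.pow_le_pow_left
    (show Nat.nthRoot e n + 1 ≤ 2 * Nat.nthRoot e n by omega) _)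
  rw [pow_right_comm]
  exact Nat.pow_lt_pow_left (Nat.lt_pow_nthRoot_add_one he n) (by omega)

theorem nthRoot_pow_le_self (he : e ≠ 0) (hn : 0 < n) (hbe : 2 * b ≤ e) : Nat.nthRoot e (n ^ (2 * b)) ≤ n := by
  exact Nat.le_of_lt_succ ((Nat.nthRoot_lt_iff he).2 (lt_of_le_of_lt (Nat.pow_le_pow_right hn hbe)
    (Nat.pow_lt_pow_left (Nat.lt_succ_self n) he)))

end NthRoot

namespace Sizes

variable {w κ b e n : ℕ}

/-- From `2 ≤ K` follows `4 ≤ d`, so `Y = d / 4` is positive. The word length suffices because `B +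
2 ≤ (n + 2) ^ (κ + 5)`. -/
theorem exists_isFor (hb : 3 ≤ b) (hbe : 2 * b ≤ e) (hK : 2 ≤ Nat.nthRoot e n)
    (hw : (n + 2) ^ (2 * κ + 10) ≤ 2 ^ w) : ∃ P : Sizes w, P.IsFor κ b e n := by
  have he : e ≠ 0 := by omega
  set K := Nat.nthRoot e n with hKdef
  set d := Nat.nthRoot e (n ^ (2 * b)) with hd
  have hKe : K ^ e ≤ n := nthRoot_pow_le he
  have hn64 : 64 ≤ n := by
    calc 64 = 2 ^ 6 := by norm_num
      _ ≤ 2 ^ e := Nat.pow_le_pow_right (by norm_num) (by omega)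
      _ ≤ K ^ e := Nat.pow_le_pow_left hK _
      _ ≤ n := hKe
  have hdn : d ≤ n := nthRoot_pow_le_self he (by omega) hbe
  have hd4 : 4 ≤ d := by
    calc 4 = 2 ^ 2 := by norm_num
      _ ≤ 2 ^ (2 * b) := Nat.pow_le_pow_right (by norm_num) (by omega)
      _ ≤ K ^ (2 * b) := Nat.pow_le_pow_left hK _
      _ ≤ d := nthRoot_pow_le_nthRoot he
  have hgn : K ^ (b - 1) ≤ n := (Nat.pow_le_pow_right (by omega) (by omega)).trans hKe
  have hGg : (n / K ^ (b - 1) + 1) * K ^ (b - 1) ≤ 2 * n := by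
    have := Nat.div_mul_le_self n (K ^ (b - 1))
    rw [add_mul, one_mul]; omega
  refine ⟨⟨n ^ κ, d, K ^ (b - 1), n / K ^ (b - 1) + 1, d / 4, K ^ (b - 2),
    (5 * n ^ κ + d + 1) * ((n / K ^ (b - 1) + 1) * K ^ (b - 1) + 1), by positivity, by positivity,
    by positivity, Nat.pow_le_pow_right (by omega) (by omega), by omega, by omega, le_rfl, ?_⟩,
    rfl, rfl, rfl, rfl, rfl, rfl, rfl⟩
  refine le_trans ?_ hw
  have h1 : 5 * n ^ κ + d + 1 ≤ (n + 2) ^ (κ + 2) := by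
    have h2 : n ^ κ ≤ (n + 2) ^ κ := Nat.pow_le_pow_left (by omega) _
    have h3 : 1 ≤ (n + 2) ^ κ := Nat.one_le_pow _ _ (by omega)
    have h4 : (n + 2) ^ κ * (6 * (n + 2)) ≤ (n + 2) ^ κ * ((n + 2) * (n + 2)) :=
      Nat.mul_le_mul_left _ (Nat.mul_le_mul_right _ (by omega))
    have h5 : (n + 2) ^ κ ≤ (n + 2) ^ κ * (n + 2) := Nat.le_mul_of_pos_right _ (by omega)
    have h6 : n + 2 ≤ (n + 2) ^ κ * (n + 2) := Nat.le_mul_of_pos_left _ h3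
    rw [pow_add, pow_two]
    linarith
  have h2 : (n / K ^ (b - 1) + 1) * K ^ (b - 1) + 1 ≤ (n + 2) ^ 2 := by nlinarith
  have h3 : (5 * n ^ κ + d + 1) * ((n / K ^ (b - 1) + 1) * K ^ (b - 1) + 1) + 2 ≤ (n + 2) ^ (κ + 5) := by
    have h4 : 1 ≤ (n + 2) ^ (κ + 4) := Nat.one_le_pow _ _ (by omega)
    have h5 := Nat.mul_le_mul h1 h2
    rw [← pow_add] at h5
    rw [pow_succ _ (κ + 4)]
    nlinarith
  calc _ ≤ (n + 2) ^ (κ + 5) * (n + 2) ^ (κ + 5) := Nat.mul_le_mul h3 h3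
    _ = (n + 2) ^ (2 * κ + 10) := by rw [← pow_add]; congr 1; omega

variable {P : Sizes w}

namespace IsFor

theorem G_le (hP : P.IsFor κ b e n) (hb : 0 < b) (hbe : b ≤ e) (hK : 1 ≤ Nat.nthRoot e n) :
    P.G ≤ 2 ^ (e + 1) * Nat.nthRoot e n ^ (e - b + 1) := by
  have he : e ≠ 0 := by omega
  have h1 : 1 ≤ Nat.nthRoot e n ^ (e - b + 1) := Nat.one_le_pow _ _ hK
  have h2 : 1 ≤ 2 ^ e := Nat.one_le_pow _ _ (by norm_num)
  have h3 : n / P.g ≤ 2 ^ e * Nat.nthRoot e n ^ (e - b + 1) := by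
    refine Nat.div_le_of_le_mul ?_
    rw [hP.g, mul_left_comm, ← pow_add, show b - 1 + (e - b + 1) = e by omega]
    exact le_two_nthRoot_pow he hK
  rw [hP.G, pow_succ]
  nlinarith

theorem L_le (hP : P.IsFor κ b e n) (hb : 0 < b) (hbe : b ≤ e) (hK : 1 ≤ Nat.nthRoot e n) :
    P.L ≤ 2 ^ (e + 1) * Nat.nthRoot e n ^ e := by
  calc P.L ≤ 2 ^ (e + 1) * Nat.nthRoot e n ^ (e - b + 1) * P.g :=
        Nat.mul_le_mul_right _ (hP.G_le hb hbe hK)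
    _ = _ := by rw [hP.g, mul_assoc, ← pow_add]; congr 2; omega

theorem GX_le (hP : P.IsFor κ b e n) (hb : 2 ≤ b) (hbe : b ≤ e) (hK : 1 ≤ Nat.nthRoot e n) :
    P.G * P.X ≤ 2 ^ (e + 1) * Nat.nthRoot e n ^ (e - 1) := by
  calc P.G * P.X ≤ 2 ^ (e + 1) * Nat.nthRoot e n ^ (e - b + 1) * P.X :=
        Nat.mul_le_mul_right _ (hP.G_le (by omega) hbe hK)
    _ = _ := by rw [hP.X, mul_assoc, ← pow_add]; congr 2; omega

theorem GL_le (hP : P.IsFor κ b e n) (hb : 0 < b) (hbe : b ≤ e) (hK : 1 ≤ Nat.nthRoot e n) :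
    P.G * P.L ≤ 4 ^ (e + 1) * Nat.nthRoot e n ^ (2 * e - b + 1) := by
  calc P.G * P.L ≤ (2 ^ (e + 1) * Nat.nthRoot e n ^ (e - b + 1)) * (2 ^ (e + 1) * Nat.nthRoot e n ^ e) :=
        Nat.mul_le_mul (hP.G_le hb hbe hK) (hP.L_le hb hbe hK)
    _ = (2 ^ (e + 1) * 2 ^ (e + 1)) * (Nat.nthRoot e n ^ (e - b + 1) * Nat.nthRoot e n ^ e) := by ring
    _ = _ := by rw [← mul_pow, ← pow_add]; norm_num; congr 1; omega

/-- The deletions number about `G * d / X`, that is, `K` to the exponent `(e - b + 1) + 2 * b - (b -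
2) = e + 3`. -/
theorem fails_le (hP : P.IsFor κ b e n) (hb : 3 ≤ b) (hbe : b ≤ e) (hK : 1 ≤ Nat.nthRoot e n) :
    P.G * (P.d / P.X + 1) ≤ 2 ^ (e + 2) * 4 ^ b * Nat.nthRoot e n ^ (e + 3) := by
  have he : e ≠ 0 := by omega
  have h1 : P.d / P.X ≤ 4 ^ b * Nat.nthRoot e n ^ (b + 2) := by
    refine Nat.div_le_of_le_mul ?_
    rw [hP.X, hP.d, mul_left_comm, ← pow_add, show b - 2 + (b + 2) = 2 * b by omega]
    exact nthRoot_pow_le_mul he (by omega) hK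
  have h2 : 1 ≤ 4 ^ b * Nat.nthRoot e n ^ (b + 2) := by
    have := hK; exact Nat.pos_of_ne_zero (by positivity)
  calc P.G * (P.d / P.X + 1) ≤ (2 ^ (e + 1) * Nat.nthRoot e n ^ (e - b + 1)) *
        (2 * (4 ^ b * Nat.nthRoot e n ^ (b + 2))) :=
        Nat.mul_le_mul (hP.G_le (by omega) hbe hK) (by omega)
    _ = 2 ^ (e + 2) * 4 ^ b * (Nat.nthRoot e n ^ (e - b + 1) * Nat.nthRoot e n ^ (b + 2)) := by ring
    _ = _ := by rw [← pow_add]; congr 2; omega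

theorem exists_card_divisors_le (κ e : ℕ) (he : 6 ≤ e) : ∃ C : ℕ, ∀ {w b n : ℕ} {P : Sizes w},
    P.IsFor κ b e n → 3 ≤ b → 2 * b ≤ e → 2 ≤ Nat.nthRoot e n →
    ∀ x, x ≠ 0 → x ≤ 2 * P.B → x.divisors.card ≤ C * Nat.nthRoot e n := by
  -- With this `r`, the bound `n ^ (κ + 3)` on `B` is `K ^ r` up to a constant, so the `r`-th root
  -- in the divisor bound leaves just one factor `K`.
  set r := e * (κ + 3) with hr
  have hr0 : 0 < r := by positivity
  refine ⟨((r ^ r) ^ 2 ^ r) * 2 ^ (e * (κ + 3)) * 2 * 64, fun {w b n P} hP hb hbe hK x hx hxB => ?_⟩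
  have hn := le_two_nthRoot_pow (n := n) (e := e) (by omega) (by omega)
  have hn64 : 64 ≤ n := by
    calc 64 = 2 ^ 6 := by norm_num
      _ ≤ 2 ^ e := Nat.pow_le_pow_right (by norm_num) (by omega)
      _ ≤ Nat.nthRoot e n ^ e := Nat.pow_le_pow_left hK _
      _ ≤ n := nthRoot_pow_le (by omega)
  refine (Nat.pow_le_pow_iff_left hr0.ne').1 ((card_divisors_pow_le hr0 hx).trans ?_)
  have hd : P.d ≤ n := hP.d ▸ nthRoot_pow_le_self (by omega) (by omega) hbe
  have hB : P.B ≤ 64 * n ^ (κ + 3) := by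
    have hL : P.L ≤ 2 * n := by
      have hgn : P.g ≤ n := by
        rw [hP.g]
        exact (Nat.pow_le_pow_right (by omega) (by omega)).trans (nthRoot_pow_le (e := e) (by omega))
      have := Nat.div_mul_le_self n P.g
      rw [Sizes.L, hP.G, add_mul, one_mul]; omega
    have h1 : 1 ≤ n ^ κ := Nat.one_le_pow _ _ (by omega)
    have h2 : 5 * P.S + P.d + 1 ≤ 7 * (n ^ κ * n) := by rw [hP.S]; nlinarith
    rw [hP.B]
    calc _ ≤ 7 * (n ^ κ * n) * (3 * n) := Nat.mul_le_mul h2 (by omega)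
      _ = 21 * (n ^ κ * n * n) := by ring
      _ ≤ 64 * (n ^ κ * n * n * n) := Nat.mul_le_mul (by norm_num) (Nat.le_mul_of_pos_right _ (by omega))
      _ = 64 * n ^ (κ + 3) := by ring
  have h3 : n ^ (κ + 3) ≤ 2 ^ (e * (κ + 3)) * Nat.nthRoot e n ^ r := by
    rw [hr, pow_mul, pow_mul, ← mul_pow]
    exact Nat.pow_le_pow_left hn _
  rw [mul_pow _ (Nat.nthRoot e n)]
  set U := ((r ^ r) ^ 2 ^ r) with hU
  calc U * x ≤ U * (2 * (64 * (2 ^ (e * (κ + 3)) * Nat.nthRoot e n ^ r))) := by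
        gcongr
        exact hxB.trans (Nat.mul_le_mul_left _ (hB.trans (Nat.mul_le_mul_left _ h3)))
    _ = (U * 2 ^ (e * (κ + 3)) * 2 * 64) * Nat.nthRoot e n ^ r := by ring
    _ ≤ _ := Nat.mul_le_mul_right _ (Nat.le_self_pow hr0.ne' _)

end IsFor

end Sizes

/-! ## The running time of the reduction -/

/-- Converts powers of `K` into powers of `d`, by `K ^ (2 * b) ≤ d`. -/
theorem nthRoot_rpow_le {b e n : ℕ} (he : e ≠ 0) (hK : 1 ≤ Nat.nthRoot e n) {x y : ℝ}
    (hx : 0 ≤ x) (h : y ≤ 2 * b * x) :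
    (Nat.nthRoot e n : ℝ) ^ y ≤ (Nat.nthRoot e (n ^ (2 * b)) : ℝ) ^ x := by
  have h1 : (Nat.nthRoot e n : ℝ) ^ (2 * b) ≤ Nat.nthRoot e (n ^ (2 * b)) := by
    exact_mod_cast nthRoot_pow_le_nthRoot he
  have hK' : (1 : ℝ) ≤ Nat.nthRoot e n := by exact_mod_cast hK
  calc (Nat.nthRoot e n : ℝ) ^ y ≤ (Nat.nthRoot e n : ℝ) ^ (2 * b * x) :=
        Real.rpow_le_rpow_of_exponent_le hK' h
    _ = ((Nat.nthRoot e n : ℝ) ^ (2 * b)) ^ x := by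
        rw [Real.rpow_mul (by positivity)]
        congr 1
        rw [← Real.rpow_natCast]
        push_cast
        rfl
    _ ≤ _ := Real.rpow_le_rpow (by positivity) h1 hx

namespace Sizes.IsFor

variable {w κ b e n : ℕ} {P : Sizes w} {γ : ℝ}

theorem vertices_le (hP : P.IsFor κ b e n) (hγ : 1 / 2 ≤ γ) (hγ' : γ < 1) (hb : 2 ≤ b) (hbe : b ≤ e)
    (h : (e : ℝ) - 1 / 2 ≤ b / (1 - γ)) (hK : 4 ^ (e + 3) ≤ Nat.nthRoot e n) :
    (P.d : ℝ) / 2 + 1 + (P.G * P.X : ℕ) ≤ (P.d : ℝ) ^ (1 / (2 - 2 * γ)) := by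
  have hK0 : 1 ≤ Nat.nthRoot e n := (Nat.one_le_pow _ _ (by norm_num)).trans hK
  have he : e ≠ 0 := by omega
  have hx : 1 ≤ 1 / (2 - 2 * γ) := by rw [le_div_iff₀ (by linarith)]; linarith
  have hd1 : (1 : ℝ) ≤ P.d := by
    have := P.Y_pos; have := P.Y_le
    exact_mod_cast (by omega : 1 ≤ P.d)
  have h1 : (P.d : ℝ) ≤ (P.d : ℝ) ^ (1 / (2 - 2 * γ)) := by
    calc (P.d : ℝ) = (P.d : ℝ) ^ (1 : ℝ) := (Real.rpow_one _).symm
      _ ≤ _ := Real.rpow_le_rpow_of_exponent_le hd1 hx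
  have h2 := nthRoot_rpow_le (b := b) he hK0 (x := 1 / (2 - 2 * γ)) (y := (e : ℝ) - 1 / 2)
    (by linarith) (h.trans (le_of_eq (by field_simp)))
  rw [← hP.d] at h2
  set K := Nat.nthRoot e n with hKdef
  have hKp : (0 : ℝ) < K := by exact_mod_cast hK0
  -- There are about `K ^ (e - 1)` set vertices, while the bound is at least `K ^ (e - 1 / 2)`; the
  -- surplus `K ^ (1 / 2)` absorbs the constants. For this `X` was chosen smaller than `g` by a
  -- factor `K`. The hash values fit since `d ≤ d ^ (1 / (2 - 2γ))` for `γ ≥ 1 / 2`.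
  have h3 : (2 : ℝ) ^ (e + 3) ≤ (K : ℝ) ^ (1 / 2 : ℝ) := by
    rw [← Real.sqrt_eq_rpow]
    refine Real.le_sqrt_of_sq_le ?_
    rw [← pow_mul, mul_comm, pow_mul]
    norm_num
    exact_mod_cast hK
  have h4 : (K : ℝ) ^ ((e : ℝ) - 1 / 2) = (K : ℝ) ^ (e - 1) * (K : ℝ) ^ (1 / 2 : ℝ) := by
    rw [← Real.rpow_natCast, ← Real.rpow_add hKp]
    congr 1
    rw [Nat.cast_sub (by omega)]
    push_cast; ring
  have h5 : ((P.G * P.X : ℕ) : ℝ) ≤ 2 ^ (e + 1) * (K : ℝ) ^ (e - 1) := by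
    exact_mod_cast hP.GX_le hb hbe hK0
  have h6 : (1 : ℝ) ≤ (K : ℝ) ^ (e - 1) := one_le_pow₀ (by exact_mod_cast hK0)
  have h7 : (1 : ℝ) ≤ 2 ^ (e + 1) := one_le_pow₀ (by norm_num)
  have h8 : (K : ℝ) ^ (e - 1) * 2 ^ (e + 3) ≤ (K : ℝ) ^ (e - 1) * (K : ℝ) ^ (1 / 2 : ℝ) := by gcongr
  have h9 : (2 : ℝ) ^ (e + 3) = 4 * 2 ^ (e + 1) := by ring
  rw [h4] at h2
  rw [h9] at h8
  nlinarith

/-- Each set vertex has at most `g ≤ d ^ (1 / 2)` neighbors, and the exponent for edges exceeds that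
for vertices by exactly `1 / 2`. -/
theorem edges_le (hP : P.IsFor κ b e n) (hγ : 1 / 2 ≤ γ) (hγ' : γ < 1) (hb : 2 ≤ b) (hbe : b ≤ e)
    (h : (e : ℝ) - 1 / 2 ≤ b / (1 - γ)) (hK : 4 ^ (e + 3) ≤ Nat.nthRoot e n) :
    (P.d : ℝ) / 2 + (P.G * P.X * P.g : ℕ) ≤ (P.d : ℝ) ^ ((2 - γ) / (2 - 2 * γ)) := by
  have hK0 : 1 ≤ Nat.nthRoot e n := (Nat.one_le_pow _ _ (by norm_num)).trans hK
  have hV := hP.vertices_le hγ hγ' hb hbe h hK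
  have h1 := nthRoot_rpow_le (b := b) (x := 1 / 2) (y := (b - 1 : ℕ)) (by omega) hK0 (by norm_num) (by
    rw [Nat.cast_sub (by omega)]; push_cast; linarith)
  rw [← hP.d, Real.rpow_natCast, show (Nat.nthRoot e n : ℝ) ^ (b - 1) = P.g by rw [hP.g]; push_cast; rfl] at h1
  have hd1 : (1 : ℝ) ≤ P.d := by
    have := P.Y_pos; have := P.Y_le
    exact_mod_cast (by omega : 1 ≤ P.d)
  have hg : (1 : ℝ) ≤ P.g := by exact_mod_cast P.g_pos
  have h2 : (P.d : ℝ) ^ ((2 - γ) / (2 - 2 * γ))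
      = (P.d : ℝ) ^ (1 / (2 - 2 * γ)) * (P.d : ℝ) ^ (1 / 2 : ℝ) := by
    rw [← Real.rpow_add (by linarith)]
    congr 1
    have : 1 - γ ≠ 0 := by linarith
    rw [show 2 - 2 * γ = 2 * (1 - γ) by ring]
    field_simp
    ring
  rw [h2]
  calc (P.d : ℝ) / 2 + (P.G * P.X * P.g : ℕ) ≤ ((P.d : ℝ) / 2 + 1 + (P.G * P.X : ℕ)) * P.g := by
        push_cast; nlinarith
    _ ≤ _ := by gcongr

theorem works (hP : P.IsFor κ b e n) (hγ : 1 / 2 ≤ γ) (hγ' : γ < 1) (hb : 2 ≤ b) (hbe : b ≤ e)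
    (h : (e : ℝ) - 1 / 2 ≤ b / (1 - γ)) (hK : 4 ^ (e + 3) ≤ Nat.nthRoot e n) {D : FailureOracle}
    {k : ℕ} {tp td tq : ℕ → ℝ≥0}
    (hD : ∀ (d w N : ℕ) (G : SimpleGraph (Fin N)) (es : List (Fin N × Fin N)) (s : MState w),
      0 < d → (d + 2) ^ k ≤ 2 ^ w → IsEdgeList G es →
      (N : ℝ) ≤ (d : ℝ) ^ (1 / (2 - 2 * γ)) →
      (es.length : ℝ) ≤ (d : ℝ) ^ ((2 - γ) / (2 - 2 * γ)) →
      expectedTime (fun f => D.prep.exp f (graphInput d es s)) ≤ tp d ∧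
      ∀ ops : List (FailureOp N w), LegalOps d [] ops →
        D.prep.exp (D.opsErrors G [] ops) (graphInput d es s) = 0 ∧
        expectedTime (fun f =>
          D.prep.exp (fun t => D.opsExp ops f t.resetClock) (graphInput d es s)) ≤
          numFails ops * td d + numQueries ops * tq d)
    (hw : (P.d + 2) ^ k ≤ 2 ^ w) (Z : ℕ → ℕ) (m : ℕ) (hm : P.Y ≤ m) (hm' : m < 2 * P.Y)
    (es : List (Fin (P.numV m) × Fin (P.numV m))) (hes : EdgeList P Z m (P.G * P.X * P.g) es) :
    D.Works w (P.graph Z m) P.d (tp P.d) (td P.d) (tq P.d) es := by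
  have hY := P.Y_pos
  have hY' := P.Y_le
  have hmd : (m : ℝ) ≤ P.d / 2 := by
    rw [le_div_iff₀ (by norm_num)]
    exact_mod_cast (by omega : m * 2 ≤ P.d)
  have hV : ((P.numV m : ℕ) : ℝ) ≤ (P.d : ℝ) ^ (1 / (2 - 2 * γ)) := by
    refine le_trans ?_ (hP.vertices_le hγ hγ' hb hbe h hK)
    rw [Sizes.numV, Nat.cast_add, Nat.cast_add, Nat.cast_one]
    gcongr
  have hE : (es.length : ℝ) ≤ (P.d : ℝ) ^ ((2 - γ) / (2 - 2 * γ)) := by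
    refine le_trans ?_ (hP.edges_le hγ hγ' hb hbe h hK)
    calc (es.length : ℝ) ≤ ((m + P.G * P.X * P.g : ℕ) : ℝ) := by exact_mod_cast hes.len
      _ ≤ _ := by rw [Nat.cast_add]; gcongr
  have key := fun s => hD P.d w _ (P.graph Z m) es s (by omega) hw (isEdgeList_graph (by omega) hes) hV hE
  exact ⟨fun s => (key s).1, fun s => (key s).2⟩

end Sizes.IsFor

namespace Prog

theorem exp_reduction_of_lt {D : FailureOracle} {M w κ b e n₀ n : ℕ} (hn : n < n₀)
    (hw : n₀ < 2 ^ w) (f : MState w → ℝ≥0∞) (A : Fin n → ℤ) (s : MState w) :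
    (reduction D M κ b e n₀).exp f (threeSumInput A s) = 0 := by
  have hw0 : w ≠ 0 := by
    rintro rfl
    simp at hw; omega
  have h1 : (1 : BitVec w) ≠ 0 := by
    intro h
    have := congrArg BitVec.toNat h
    simp [hw0] at this
  have hlt : (Expr.op .lt (.var 0) (.lit n₀)).eval (threeSumInput A s) ≠ 0 := by
    have h0 : (threeSumInput A s).var 0 = BitVec.ofNat w n := rfl
    simpa [Expr.eval, WordOp.eval, h0, Nat.mod_eq_of_lt (hn.trans hw), Nat.mod_eq_of_lt hw, hn] using h1
  rw [reduction, Cmd.exp, if_pos hlt]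
  refine Cmd.exp_loop_of_forall_ne (fun _ => True) trivial (fun t _ => ?_) fun t _ g hg => ?_
  · simpa [Expr.eval] using h1
  · exact hg _ trivial

/-- The running time, in terms of `K = ⌊n ^ (1 / e)⌋`. -/
theorem exists_reduction {γ : ℝ} (hγ : 1 / 2 ≤ γ) (hγ' : γ < 1) {D : FailureOracle}
    {tp td tq : ℕ → ℝ≥0} (hD : D.HasTimes γ tp td tq) (κ : ℕ) {b e : ℕ} (hb : 3 ≤ b)
    (hbe : 2 * b ≤ e) (h : (e : ℝ) - 1 / 2 ≤ b / (1 - γ)) :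
    ∃ (k : ℕ) (c : Cmd) (C : ℕ), SolvesThreeSum κ k c ∧ ∀ n, 4 ^ (e + 3) ≤ Nat.nthRoot e n →
      threeSumTime κ k c n ≤ (C * Nat.nthRoot e n ^ (2 * e - 1) : ℕ) +
        ((C * Nat.nthRoot e n ^ (e + 3) : ℕ) * td (Nat.nthRoot e (n ^ (2 * b))) +
        (C * Nat.nthRoot e n ^ (2 * e - b + 1) : ℕ) * tq (Nat.nthRoot e (n ^ (2 * b))) +
        tp (Nat.nthRoot e (n ^ (2 * b)))) := by
  obtain ⟨k₀, hk₀⟩ := hD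
  obtain ⟨M, hM⟩ := D.exists_below
  obtain ⟨c₁, hc₁⟩ := Sizes.IsFor.exists_card_divisors_le κ e (by omega)
  have he : e ≠ 0 := by omega
  set n₀ := (4 ^ (e + 3)) ^ e with hn₀
  have hn₀K : ∀ n, n₀ ≤ n ↔ 4 ^ (e + 3) ≤ Nat.nthRoot e n := fun n => (Nat.le_nthRoot_iff he).symm
  -- The summand `n₀` ensures that `n₀` fits into a word for every `n`, so that small instances are
  -- recognized reliably.
  set k := 2 * κ + 10 + 2 * b + e + k₀ + 1 + n₀ with hk
  set c₂ := 2 ^ (e + 2) * 4 ^ b with hc₂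
  set c₃ := 4 ^ (e + 1) with hc₃
  set c₄ := 16 * c₃ * c₁ with hc₄
  set C := 9 * 4 ^ b + 2 + 130 * c₃ + 210 * 2 ^ (e + 1) + 19 * c₂ + 28 * c₄ with hC
  have main : ∀ (n w : ℕ) (A : Fin n → ℤ) (s : MState w), (n + 2) ^ k ≤ 2 ^ w →
      IsThreeSumInstance κ n A → n₀ ≤ n →
      (open Classical in (reduction D M κ b e n₀).exp
        (fun t => if t.var 0 = (if HasThreeSum A then 1 else 0) then 0 else 1) (threeSumInput A s) = 0) ∧
      expectedTime (fun f => (reduction D M κ b e n₀).exp f (threeSumInput A s)) ≤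
        (C * Nat.nthRoot e n ^ (2 * e - 1) : ℕ) +
        ((C * Nat.nthRoot e n ^ (e + 3) : ℕ) * td (Nat.nthRoot e (n ^ (2 * b))) +
        (C * Nat.nthRoot e n ^ (2 * e - b + 1) : ℕ) * tq (Nat.nthRoot e (n ^ (2 * b))) +
        tp (Nat.nthRoot e (n ^ (2 * b)))) := by
    intro n w A s hw hA hn
    have hK := (hn₀K n).1 hn
    have hK0 : 1 ≤ 4 ^ (e + 3) := Nat.one_le_pow _ _ (by norm_num)
    have hK4 : 4 ≤ 4 ^ (e + 3) := Nat.le_self_pow (by omega) _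
    have hpow : ∀ a, a < k → (n + 2) ^ a < 2 ^ w := fun a ha =>
      (Nat.pow_lt_pow_right (by omega) ha).trans_le hw
    obtain ⟨P, hP⟩ := Sizes.exists_isFor (κ := κ) hb hbe (by omega) (hpow (2 * κ + 10) (by omega)).le
    have hn0 : 0 < n := (show 0 < n₀ by positivity).trans_le hn
    have hdn : P.d ≤ n := hP.d ▸ nthRoot_pow_le_self he hn0 hbe
    have hKn : Nat.nthRoot e n ≤ n := nthRoot_le_self he
    set K := Nat.nthRoot e n with hKdef
    have hK1 : 1 ≤ K := by omega
    have hGL := hP.GL_le (by omega) (by omega) hK1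
    -- The expected number of bad queries is `O(K ^ (2 * e - b))`, apart from the degenerate ones.
    -- Each costs `O(g)` steps with `g = K ^ (b - 1)`, which gives the exponent `2 * e - 1`: the
    -- saving over `n ^ 2`.
    have hH : 2 * (P.G * P.L) * (P.g * P.g * (c₁ * K)) ≤ P.Y * (c₄ * K ^ (2 * e - b)) := by
      have hd := nthRoot_pow_le_nthRoot (b := b) (n := n) he
      rw [← hP.d] at hd
      have hY : P.d ≤ 8 * P.Y := by have := P.Y_pos; rw [hP.Y] at this ⊢; omega
      calc 2 * (P.G * P.L) * (P.g * P.g * (c₁ * K))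
          ≤ 2 * (c₃ * K ^ (2 * e - b + 1)) * (P.g * P.g * (c₁ * K)) := by gcongr
        _ = 2 * c₃ * c₁ * (K ^ (2 * e - b + 1) * K ^ (b - 1) * K ^ (b - 1) * K ^ 1) := by
            rw [hP.g]; ring
        _ = 2 * c₃ * c₁ * (K ^ (2 * b) * K ^ (2 * e - b)) := by
            simp only [← pow_add]; congr 2; omega
        _ ≤ 2 * c₃ * c₁ * (8 * P.Y * K ^ (2 * e - b)) := by gcongr; exact hd.trans hY
        _ = P.Y * (c₄ * K ^ (2 * e - b)) := by rw [hc₄]; ring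
    obtain ⟨h1, h2⟩ := exp_reduction (n₀ := n₀) (tp := tp P.d) (td := td P.d) (tq := tq P.d)
      (H := c₄ * K ^ (2 * e - b)) (NF := c₂ * K ^ (e + 3)) (T := c₁ * K) hM hP he
      (by rw [hP.S]; positivity) hn (hpow _ (by omega)) (hpow _ (by omega))
      ((Nat.pow_le_pow_left (by omega) _).trans_lt (hpow e (by omega)))
      ((Nat.pow_le_pow_left (by omega) _).trans_lt (hpow e (by omega)))
      ((Nat.pow_le_pow_left (by omega) _).trans_lt (hpow b (by omega)))
      (hP.works hγ hγ' (by omega) (by omega) h hK hk₀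
        ((Nat.pow_le_pow_left (by omega) _).trans (hpow k₀ (by omega)).le))
      (hP.fails_le hb (by omega) hK1) (hc₁ hP hb hbe (by omega)) hH hA s
    refine ⟨h1, h2.trans ?_⟩
    have hCc₂ : c₂ ≤ C := by omega
    have hCc₃ : 2 * c₃ ≤ C := by omega
    rw [← hP.d]
    gcongr (?_ : ℕ) + ((?_ : ℕ) * _ + (?_ : ℕ) * _ + _)
    · set R := K ^ (2 * e - 1) with hR
      have hQ : ∀ a, a ≤ 2 * e - 1 → K ^ a ≤ R := fun a ha => Nat.pow_le_pow_right hK1 ha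
      have g1 : P.d ≤ 4 ^ b * R := by
        rw [hP.d]
        exact (nthRoot_pow_le_mul he (by omega) hK1).trans (Nat.mul_le_mul_left _ (hQ _ (by omega)))
      have g2 : K ≤ R := (pow_one K).symm.le.trans (hQ 1 (by omega))
      have g3 : P.G * P.L ≤ c₃ * R := hGL.trans (Nat.mul_le_mul_left _ (hQ _ (by omega)))
      have g4 : P.g * P.L ≤ 2 ^ (e + 1) * R := by
        calc P.g * P.L ≤ K ^ (b - 1) * (2 ^ (e + 1) * K ^ e) := by
              rw [hP.g]; exact Nat.mul_le_mul_left _ (hP.L_le (by omega) (by omega) hK1)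
          _ = 2 ^ (e + 1) * K ^ (b - 1 + e) := by rw [pow_add]; ring
          _ ≤ _ := Nat.mul_le_mul_left _ (hQ _ (by omega))
      have g5 : P.g * (c₂ * K ^ (e + 3)) ≤ c₂ * R := by
        calc P.g * (c₂ * K ^ (e + 3)) = c₂ * K ^ (b - 1 + (e + 3)) := by rw [hP.g, pow_add]; ring
          _ ≤ _ := Nat.mul_le_mul_left _ (hQ _ (by omega))
      have g6 : P.g * (c₄ * K ^ (2 * e - b)) ≤ c₄ * R := by
        calc P.g * (c₄ * K ^ (2 * e - b)) = c₄ * K ^ (b - 1 + (2 * e - b)) := by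
              rw [hP.g, pow_add]; ring
          _ ≤ _ := Nat.mul_le_mul_left _ (hQ _ (by omega))
      calc _ ≤ 9 * (4 ^ b * R) + 2 * R + 130 * (c₃ * R) + 210 * (2 ^ (e + 1) * R) + 19 * (c₂ * R) +
            28 * (c₄ * R) := by rw [mul_assoc 28]; omega
        _ = C * R := by rw [hC]; ring
    · exact Nat.mul_le_mul_right _ hCc₂
    · calc 2 * (P.G * P.L) ≤ 2 * (c₃ * K ^ (2 * e - b + 1)) := Nat.mul_le_mul_left _ hGL
        _ = 2 * c₃ * K ^ (2 * e - b + 1) := (mul_assoc _ _ _).symm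
        _ ≤ _ := Nat.mul_le_mul_right _ hCc₃
  refine ⟨k, reduction D M κ b e n₀, C, fun n w A s hw hA => ?_, fun n hK => ?_⟩
  · by_cases hn : n₀ ≤ n
    · exact (main n w A s hw hA hn).1
    · refine exp_reduction_of_lt (by omega) ?_ _ A s
      refine lt_of_lt_of_le ?_ hw
      calc n₀ < 2 ^ n₀ := Nat.lt_two_pow_self
        _ ≤ 2 ^ k := Nat.pow_le_pow_right (by norm_num) (by omega)
        _ ≤ (n + 2) ^ k := Nat.pow_le_pow_left (by omega) _
  · exact iSup_le fun w => iSup_le fun A => iSup_le fun s => iSup_le fun hw => iSup_le fun hA =>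
      (main n w A s hw hA ((hn₀K n).2 hK)).2

end Prog

/-! ## Asymptotics -/

section Asymptotics

/-- The tradeoff as a real number. -/
noncomputable def realTradeoff (γ : ℝ) (tp td tq : ℕ → ℝ≥0) (d : ℕ) : ℝ :=
  tp d + (d : ℝ) ^ (1 / (2 - 2 * γ)) * td d + (d : ℝ) ^ ((1 + γ) / (2 - 2 * γ)) * tq d

theorem realTradeoff_nonneg (γ : ℝ) (tp td tq : ℕ → ℝ≥0) (d : ℕ) : 0 ≤ realTradeoff γ tp td tq d := by
  unfold realTradeoff; positivity

variable {γ : ℝ} {tp td tq : ℕ → ℝ≥0}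

/-- The factor `n ^ (4 / e)` stands for `K ^ 4`. Splitting it off from the numbers of deletions and
queries leaves `K ^ (e - 1)` and `K ^ (2 * e - b - 3)`, which are at most the powers of `d` in the
tradeoff because `e - 1 / 2 ≤ b / (1 - γ)`. -/
theorem exists_time_le (hγ : 1 / 2 ≤ γ) (hγ' : γ < 1) {D : FailureOracle}
    (hD : D.HasTimes γ tp td tq) (κ : ℕ) {b e : ℕ} (hb : 3 ≤ b)
    (hbe : 2 * b ≤ e) (h : (e : ℝ) - 1 / 2 ≤ b / (1 - γ)) :
    ∃ (k : ℕ) (c : Cmd) (C : ℝ), 1 ≤ C ∧ SolvesThreeSum κ k c ∧ ∀ᶠ n : ℕ in atTop,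
      threeSumTime κ k c n ≤ ENNReal.ofReal (C * (n : ℝ) ^ (2 - 1 / e : ℝ) +
        C * (n : ℝ) ^ (4 / e : ℝ) * realTradeoff γ tp td tq (Nat.nthRoot e (n ^ (2 * b)))) := by
  obtain ⟨k, c, C, hc, hT⟩ := Prog.exists_reduction hγ hγ' hD κ hb hbe h
  have he : e ≠ 0 := by omega
  refine ⟨k, c, C + 1, by simp, hc, ?_⟩
  filter_upwards [eventually_ge_atTop ((4 ^ (e + 3)) ^ e)] with n hn
  have hK : 4 ^ (e + 3) ≤ Nat.nthRoot e n := (Nat.le_nthRoot_iff he).2 hn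
  refine (hT n hK).trans ?_
  have hK0 : 1 ≤ Nat.nthRoot e n := (Nat.one_le_pow _ _ (by norm_num)).trans hK
  have hKn : (Nat.nthRoot e n : ℝ) ^ e ≤ n := by exact_mod_cast nthRoot_pow_le he
  set K := Nat.nthRoot e n
  set d := Nat.nthRoot e (n ^ (2 * b)) with hd
  have he' : (0 : ℝ) < e := by positivity
  have hK1 : (1 : ℝ) ≤ K := by exact_mod_cast hK0
  have hKp : (0 : ℝ) < K := by linarith
  have hpow : ∀ m : ℕ, (K : ℝ) ^ m ≤ (n : ℝ) ^ ((m : ℝ) / e) := by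
    intro m
    calc (K : ℝ) ^ m = ((K : ℝ) ^ e) ^ ((m : ℝ) / e) := by
          rw [← Real.rpow_natCast, ← Real.rpow_natCast, ← Real.rpow_mul hKp.le]
          congr 1
          field_simp
      _ ≤ _ := Real.rpow_le_rpow (by positivity) hKn (by positivity)
  have h1γ : 0 < 1 - γ := by linarith
  have e1 : (K : ℝ) ^ (2 * e - 1) ≤ (n : ℝ) ^ (2 - 1 / e : ℝ) := by
    refine (hpow _).trans (le_of_eq ?_)
    congr 1
    rw [Nat.cast_sub (by omega)]
    push_cast
    field_simp
  have e2 : (K : ℝ) ^ 4 ≤ (n : ℝ) ^ (4 / e : ℝ) := by exact_mod_cast hpow 4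
  have e3 : (K : ℝ) ^ (e + 3) ≤ K ^ 4 * (d : ℝ) ^ (1 / (2 - 2 * γ)) := by
    have h2 := nthRoot_rpow_le (b := b) (x := 1 / (2 - 2 * γ)) (y := (e - 1 : ℕ)) he hK0
      (div_nonneg zero_le_one (by linarith)) (by
        rw [Nat.cast_sub (by omega), Nat.cast_one, show 2 * (b : ℝ) * (1 / (2 - 2 * γ)) = b / (1 - γ) by
          field_simp]
        linarith)
    rw [Real.rpow_natCast] at h2
    rw [show e + 3 = 4 + (e - 1) by omega, pow_add]
    gcongr
  have e4 : (K : ℝ) ^ (2 * e - b + 1) ≤ K ^ 4 * (d : ℝ) ^ ((1 + γ) / (2 - 2 * γ)) := by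
    have h2 := nthRoot_rpow_le (b := b) (x := (1 + γ) / (2 - 2 * γ)) (y := (2 * e - b - 3 : ℕ)) he hK0
      (div_nonneg (by linarith) (by linarith)) (by
        rw [Nat.cast_sub (by omega), Nat.cast_sub (by omega),
          show 2 * (b : ℝ) * ((1 + γ) / (2 - 2 * γ)) = 2 * (b / (1 - γ)) - b by
            field_simp; ring]
        push_cast
        linarith)
    rw [Real.rpow_natCast] at h2
    rw [show 2 * e - b + 1 = 4 + (2 * e - b - 3) by omega, pow_add]
    gcongr
  have hreal : ((C * K ^ (2 * e - 1) : ℕ) : ℝ) + ((C * K ^ (e + 3) : ℕ) * td d +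
      (C * K ^ (2 * e - b + 1) : ℕ) * tq d + tp d) ≤ (C + 1) * (n : ℝ) ^ (2 - 1 / e : ℝ) +
        (C + 1) * (n : ℝ) ^ (4 / e : ℝ) * realTradeoff γ tp td tq d := by
    have hC0 : (0 : ℝ) ≤ C := by positivity
    have hx : (1 : ℝ) ≤ (C + 1) * (n : ℝ) ^ (4 / e : ℝ) := by
      have : (1 : ℝ) ≤ (n : ℝ) ^ (4 / e : ℝ) := (one_le_pow₀ hK1).trans e2
      nlinarith
    have hx2 : C * (K : ℝ) ^ 4 ≤ (C + 1) * (n : ℝ) ^ (4 / e : ℝ) := by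
      gcongr; linarith
    unfold realTradeoff
    rw [mul_add, mul_add]
    push_cast
    have g1 : (C : ℝ) * K ^ (2 * e - 1) ≤ (C + 1) * (n : ℝ) ^ (2 - 1 / e : ℝ) := by
      gcongr; linarith
    have g2 : (C : ℝ) * K ^ (e + 3) * td d
        ≤ (C + 1) * (n : ℝ) ^ (4 / e : ℝ) * ((d : ℝ) ^ (1 / (2 - 2 * γ)) * td d) := by
      calc (C : ℝ) * K ^ (e + 3) * td d ≤ C * (K ^ 4 * (d : ℝ) ^ (1 / (2 - 2 * γ))) * td d := by gcongr
        _ = C * (K : ℝ) ^ 4 * ((d : ℝ) ^ (1 / (2 - 2 * γ)) * td d) := by ring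
        _ ≤ _ := by gcongr
    have g3 : (C : ℝ) * K ^ (2 * e - b + 1) * tq d
        ≤ (C + 1) * (n : ℝ) ^ (4 / e : ℝ) * ((d : ℝ) ^ ((1 + γ) / (2 - 2 * γ)) * tq d) := by
      calc (C : ℝ) * K ^ (2 * e - b + 1) * tq d
          ≤ C * (K ^ 4 * (d : ℝ) ^ ((1 + γ) / (2 - 2 * γ))) * tq d := by gcongr
        _ = C * (K : ℝ) ^ 4 * ((d : ℝ) ^ ((1 + γ) / (2 - 2 * γ)) * tq d) := by ring
        _ ≤ _ := by gcongr
    have g4 : (tp d : ℝ) ≤ (C + 1) * (n : ℝ) ^ (4 / e : ℝ) * tp d :=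
      le_mul_of_one_le_left (by positivity) hx
    linarith
  refine le_trans (le_of_eq ?_) (ENNReal.ofReal_le_ofReal hreal)
  rw [ENNReal.ofReal_add (by positivity) (by positivity), ENNReal.ofReal_add (by positivity) (by positivity),
    ENNReal.ofReal_add (by positivity) (by positivity), ENNReal.ofReal_mul (by positivity),
    ENNReal.ofReal_mul (by positivity)]
  simp only [ENNReal.ofReal_natCast, ENNReal.ofReal_coe_nnreal]

/-- The parameters of the reduction exist. -/
theorem exists_exponents (hγ : 1 / 2 ≤ γ) (hγ' : γ < 1) (b₀ : ℕ) :
    ∃ b e : ℕ, 3 ≤ b ∧ b₀ ≤ b ∧ 2 * b ≤ e ∧ (e : ℝ) - 1 / 2 ≤ b / (1 - γ) ∧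
      (b : ℝ) / (1 - γ) ≤ e + 1 / 2 := by
  set b := b₀ + 3 with hb
  have h1 : 0 < 1 - γ := by linarith
  have h2 : 2 * (b : ℝ) ≤ b / (1 - γ) := by
    rw [le_div_iff₀ h1]; nlinarith [(Nat.cast_nonneg b : (0 : ℝ) ≤ b)]
  have h3 : 0 ≤ (b : ℝ) / (1 - γ) + 1 / 2 := by positivity
  -- The number `e` is `b / (1 - γ)` rounded to a nearest integer; it is at least `2 * b` because `γ
  -- ≥ 1 / 2`.
  refine ⟨b, ⌊(b : ℝ) / (1 - γ) + 1 / 2⌋₊, by omega, by omega, ?_, ?_, ?_⟩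
  · refine Nat.le_floor ?_
    push_cast
    linarith
  · have := Nat.floor_le h3
    linarith
  · have := Nat.lt_floor_add_one ((b : ℝ) / (1 - γ) + 1 / 2)
    linarith

/-- The quotient of the logarithms of `F d` and `d` is the exact exponent of `F d`. Its deficit
against `x`, cut off at `0`, serves as the `o(1)` term. -/
theorem isOmegaPow_of_forall {F : ℕ → ℝ} {x : ℝ}
    (h : ∀ ε : ℝ, 0 < ε → ∀ᶠ d : ℕ in atTop, (d : ℝ) ^ (x - ε) ≤ F d) :
    IsOmegaPow (fun d => ENNReal.ofReal (F d)) x := by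
  refine ⟨fun d => max 0 (x - Real.log (F d) / Real.log d), ?_, 1, one_pos, ?_⟩
  · rw [Metric.tendsto_atTop']
    intro ε hε
    obtain ⟨n, hn⟩ := eventually_atTop.1 (h (ε / 2) (by positivity))
    refine ⟨max n 2, fun d hd => ?_⟩
    have hd2 : (1 : ℝ) < d := by exact_mod_cast (by have := le_max_right n 2; omega : 1 < d)
    have h1 := hn d (by have := le_max_left n 2; omega)
    have hl : 0 < Real.log d := Real.log_pos hd2
    have h2 : x - ε / 2 ≤ Real.log (F d) / Real.log d := by
      rw [le_div_iff₀ hl, ← Real.log_rpow (by linarith)]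
      exact Real.log_le_log (by positivity) h1
    rw [Real.dist_eq, sub_zero, abs_of_nonneg (le_max_left _ _)]
    exact max_lt hε (by linarith)
  · filter_upwards [h 1 one_pos, eventually_ge_atTop 2] with d h1 hd
    have hd2 : (1 : ℝ) < d := by exact_mod_cast (by omega : 1 < d)
    have hl : 0 < Real.log d := Real.log_pos hd2
    have hF : 0 < F d := lt_of_lt_of_le (by positivity) h1
    refine ENNReal.ofReal_le_ofReal ?_
    rw [one_mul]
    calc (d : ℝ) ^ (x - max 0 (x - Real.log (F d) / Real.log d))
        ≤ (d : ℝ) ^ (Real.log (F d) / Real.log d) :=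
          Real.rpow_le_rpow_of_exponent_le hd2.le (by
            linarith [le_max_right 0 (x - Real.log (F d) / Real.log d)])
      _ = F d := by
          rw [Real.rpow_def_of_pos (by linarith), mul_div_cancel₀ _ hl.ne', Real.exp_log hF]

end Asymptotics

/-! ### Both forms of the conjecture applied to the reduction. -/

section LowerBound

theorem eventually_mul_rpow_le (C : ℝ) {c x y : ℝ} (hc : 0 < c) (h : x < y) :
    ∀ᶠ n : ℕ in atTop, C * (n : ℝ) ^ x ≤ c * (n : ℝ) ^ y := by
  have h1 := ((tendsto_rpow_atTop (sub_pos.2 h)).comp tendsto_natCast_atTop_atTop).eventually_ge_atTop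
    (C / c)
  filter_upwards [h1, eventually_gt_atTop 0] with n h1 hn
  have hn' : (0 : ℝ) < n := by exact_mod_cast hn
  simp only [Function.comp_apply, div_le_iff₀ hc] at h1
  calc C * (n : ℝ) ^ x ≤ (n : ℝ) ^ (y - x) * c * (n : ℝ) ^ x := by gcongr
    _ = c * ((n : ℝ) ^ (y - x) * (n : ℝ) ^ x) := by ring
    _ = _ := by rw [← Real.rpow_add hn']; congr 2; ring

/-- Every `d` arises from some `n`, so that the conclusion covers all large `d`. Rounding up does
not reach `d + 1`, since `d ^ s + 1 ≤ (d + 1) ^ s` for the exponent `s = e / (2 * b) ≥ 1`. -/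
theorem nthRoot_ceil_pow {b e d : ℕ} (hb : 0 < b) (hbe : 2 * b ≤ e) (hd : 0 < d) :
    Nat.nthRoot e (⌈(d : ℝ) ^ ((e : ℝ) / (2 * b))⌉₊ ^ (2 * b)) = d := by
  have he : e ≠ 0 := by omega
  have hd' : (0 : ℝ) < d := by exact_mod_cast hd
  have hbr : (0 : ℝ) < 2 * b := by positivity
  have hpow : ∀ a : ℝ, 0 ≤ a → (a ^ ((e : ℝ) / (2 * b))) ^ (2 * b) = a ^ e := by
    intro a ha
    rw [← Real.rpow_natCast, ← Real.rpow_natCast, ← Real.rpow_mul ha]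
    push_cast
    congr 1
    field_simp
  have h1 : 1 ≤ (e : ℝ) / (2 * b) := by
    rw [le_div_iff₀ hbr]; exact_mod_cast (by omega : 1 * (2 * b) ≤ e)
  refine Nat.nthRoot_eq_of_le_of_lt ?_ ?_
  · have : (d : ℝ) ^ e ≤ (⌈(d : ℝ) ^ ((e : ℝ) / (2 * b))⌉₊ : ℝ) ^ (2 * b) := by
      rw [← hpow _ hd'.le]
      gcongr
      exact Nat.le_ceil _
    exact_mod_cast this
  · have : (⌈(d : ℝ) ^ ((e : ℝ) / (2 * b))⌉₊ : ℝ) ^ (2 * b) < ((d : ℝ) + 1) ^ e := by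
      rw [← hpow _ (by positivity)]
      refine pow_lt_pow_left₀ ?_ (by positivity) (by omega)
      refine (Nat.ceil_lt_add_one (by positivity)).trans_le ?_
      have := Real.add_rpow_le_rpow_add hd'.le zero_le_one h1
      rwa [Real.one_rpow] at this
    exact_mod_cast this

variable {γ : ℝ} {tp td tq : ℕ → ℝ≥0} {D : FailureOracle}

theorem le_realTradeoff (hγ : 1 / 2 ≤ γ) (hγ' : γ < 1) (hD : D.HasTimes γ tp td tq)
    (hconj : ThreeSumConjecture) {ε : ℝ} (hε : 0 < ε) :
    ∀ᶠ d : ℕ in atTop, (d : ℝ) ^ (1 / (1 - γ) - ε) ≤ realTradeoff γ tp td tq d := by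
  obtain ⟨κ, hκ⟩ := hconj
  obtain ⟨b, e, hb, hbε, hbe, he1, he2⟩ := exists_exponents hγ hγ' ⌈3 / ε⌉₊
  obtain ⟨k, c, C, hC, hc, hT⟩ := exists_time_le hγ hγ' hD κ hb hbe he1
  obtain ⟨δ, hδ, c₀, hc₀, hlow⟩ := hκ k c hc
  have he : (0 : ℝ) < e := by exact_mod_cast (by omega : 0 < e)
  have he6 : (6 : ℝ) ≤ e := by exact_mod_cast (by omega : 6 ≤ e)
  have hbr : (0 : ℝ) < b := by exact_mod_cast (by omega : 0 < b)
  have key : ∀ᶠ n : ℕ in atTop, (n : ℝ) ^ (2 - 5 / e : ℝ) ≤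
      realTradeoff γ tp td tq (Nat.nthRoot e (n ^ (2 * b))) := by
    have h5 : ∀ᶠ n : ℕ in atTop, δ n ≤ 1 / (4 * e) :=
      (hδ.eventually (gt_mem_nhds (by positivity : (0 : ℝ) < 1 / (4 * e)))).mono fun _ h => le_of_lt h
    -- Once `δ n ≤ 1 / (4 * e)`, the conjectured lower bound dominates twice the term `C * n ^ (2 -
    -- 1 / e)`. So at least that much is left for the tradeoff term, and division by `n ^ (4 / e)`
    -- gives the exponent `2 - 5 / e`.
    have hexp : (2 - 1 / e : ℝ) < 2 - 1 / (4 * e) := by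
      have : 1 / (4 * e : ℝ) < 1 / e := by gcongr; linarith
      linarith
    filter_upwards [hT, hlow, h5, eventually_mul_rpow_le (2 * C) hc₀ hexp, eventually_ge_atTop 1]
      with n h1 h2 h3 h4 h6
    have hn : (1 : ℝ) ≤ n := by exact_mod_cast h6
    have hn0 : (0 : ℝ) < n := by linarith
    have hF := realTradeoff_nonneg γ tp td tq (Nat.nthRoot e (n ^ (2 * b)))
    set F := realTradeoff γ tp td tq (Nat.nthRoot e (n ^ (2 * b)))
    have h7 := (ENNReal.ofReal_le_ofReal_iff (by positivity)).1 (h2.trans h1)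
    have h8 : c₀ * (n : ℝ) ^ (2 - 1 / (4 * e) : ℝ) ≤ c₀ * (n : ℝ) ^ (2 - δ n) := by
      gcongr
    have h9 : (n : ℝ) ^ (2 - 1 / e : ℝ) = (n : ℝ) ^ (4 / e : ℝ) * (n : ℝ) ^ (2 - 5 / e : ℝ) := by
      rw [← Real.rpow_add hn0]; congr 1; ring
    have h10 : C * (n : ℝ) ^ (4 / e : ℝ) * (n : ℝ) ^ (2 - 5 / e : ℝ) ≤ C * (n : ℝ) ^ (4 / e : ℝ) * F := by
      rw [mul_assoc, ← h9]
      linarith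
    exact le_of_mul_le_mul_left h10 (by positivity)
  have htend : Tendsto (fun d : ℕ => ⌈(d : ℝ) ^ ((e : ℝ) / (2 * b))⌉₊) atTop atTop :=
    tendsto_nat_ceil_atTop.comp ((tendsto_rpow_atTop (by positivity)).comp tendsto_natCast_atTop_atTop)
  filter_upwards [htend.eventually key, eventually_ge_atTop 1] with d h1 hd
  rw [nthRoot_ceil_pow (by omega) hbe (by omega)] at h1
  refine le_trans ?_ h1
  have hd1 : (1 : ℝ) ≤ d := by exact_mod_cast hd
  have h2 : (0 : ℝ) ≤ 2 - 5 / e := by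
    rw [sub_nonneg, div_le_iff₀ he]; linarith
  calc (d : ℝ) ^ (1 / (1 - γ) - ε) ≤ (d : ℝ) ^ ((e : ℝ) / (2 * b) * (2 - 5 / e)) := by
        refine Real.rpow_le_rpow_of_exponent_le hd1 ?_
        have h3 : 3 / ε ≤ b := (Nat.le_ceil _).trans (by exact_mod_cast hbε)
        rw [div_le_iff₀ hε] at h3
        -- By `e ≥ b / (1 - γ) - 1 / 2` this is at least `1 / (1 - γ) - 3 / b`; hence the choice `b
        -- ≥ 3 / ε`.
        have h4 : (e : ℝ) / (2 * b) * (2 - 5 / e) = (e - 5 / 2) / b := by field_simp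
        rw [h4, le_div_iff₀ hbr, sub_mul, one_div, inv_mul_eq_div]
        linarith
    _ = ((d : ℝ) ^ ((e : ℝ) / (2 * b))) ^ (2 - 5 / e : ℝ) := Real.rpow_mul (by positivity) _ _
    _ ≤ _ := by
        gcongr
        exact Nat.le_ceil _

theorem not_realTradeoff_le (hγ : 1 / 2 ≤ γ) (hγ' : γ < 1) (hD : D.HasTimes γ tp td tq)
    (hconj : ThreeSumConjectureNoAlgorithm) {ε C : ℝ} (hε : 0 < ε) (hε1 : ε ≤ 1) (hC : 0 ≤ C)
    (h : ∀ᶠ d : ℕ in atTop, realTradeoff γ tp td tq d ≤ C * (d : ℝ) ^ (1 / (1 - γ) - ε)) : False := by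
  obtain ⟨κ, hκ⟩ := hconj
  obtain ⟨b, e, hb, hbε, hbe, he1, he2⟩ := exists_exponents hγ hγ' ⌈3 / ε⌉₊
  obtain ⟨k, c, C', hC', hc, hT⟩ := exists_time_le hγ hγ' hD κ hb hbe he1
  have he0 : e ≠ 0 := by omega
  have he : (0 : ℝ) < e := by exact_mod_cast (by omega : 0 < e)
  have hbr : (0 : ℝ) < b := by exact_mod_cast (by omega : 0 < b)
  refine hκ k c hc (1 / e) (by positivity) ⟨C' + C' * C, ?_⟩
  have htend : Tendsto (fun n : ℕ => Nat.nthRoot e (n ^ (2 * b))) atTop atTop := by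
    refine tendsto_atTop.2 fun a => ?_
    filter_upwards [eventually_ge_atTop (a ^ e)] with n hn
    exact (Nat.le_nthRoot_iff he0).2 (hn.trans (Nat.le_self_pow (by omega) n))
  filter_upwards [hT, htend.eventually h, eventually_ge_atTop 1] with n h1 h2 hn
  refine h1.trans (ENNReal.ofReal_le_ofReal ?_)
  have hn1 : (1 : ℝ) ≤ n := by exact_mod_cast hn
  have hn0 : (0 : ℝ) < n := by linarith
  have h1γ : 0 < 1 - γ := by linarith
  -- A nonnegative exponent is needed to replace `d` by its upper bound; this is the role of `ε ≤
  -- 1`.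
  have hx : 0 ≤ 1 / (1 - γ) - ε := by
    have : 1 ≤ 1 / (1 - γ) := by rw [le_div_iff₀ h1γ]; linarith
    linarith
  have hd : (Nat.nthRoot e (n ^ (2 * b)) : ℝ) ≤ (n : ℝ) ^ ((2 * b : ℝ) / e) := by
    have h3 : (Nat.nthRoot e (n ^ (2 * b)) : ℝ) ^ e ≤ (n : ℝ) ^ (2 * b) := by
      exact_mod_cast nthRoot_pow_le he0
    refine le_of_pow_le_pow_left₀ he0 (by positivity) (h3.trans (le_of_eq ?_))
    rw [← Real.rpow_natCast, ← Real.rpow_natCast, ← Real.rpow_mul hn0.le]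
    push_cast
    congr 1
    field_simp
  have h3 : 3 / ε ≤ b := (Nat.le_ceil _).trans (by exact_mod_cast hbε)
  rw [div_le_iff₀ hε] at h3
  have h4 : (n : ℝ) ^ (4 / e : ℝ) * (n : ℝ) ^ ((2 * b : ℝ) / e * (1 / (1 - γ) - ε))
      ≤ (n : ℝ) ^ (2 - 1 / e : ℝ) := by
    rw [← Real.rpow_add hn0]
    refine Real.rpow_le_rpow_of_exponent_le hn1 ?_
    -- With `b / (1 - γ) ≤ e + 1 / 2` and `b * ε ≥ 3` the numerator is at most `4 + (2 * e + 1) - 6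
    -- = 2 * e - 1`.
    have h5 : (4 / e : ℝ) + (2 * b : ℝ) / e * (1 / (1 - γ) - ε)
        = (4 + 2 * (b / (1 - γ)) - 2 * (b * ε)) / e := by ring
    have h6 : (2 - 1 / e : ℝ) = (2 * e - 1) / e := by field_simp
    rw [h5, h6]
    exact div_le_div_of_nonneg_right (by linarith) he.le
  calc _ ≤ C' * (n : ℝ) ^ (2 - 1 / e : ℝ) +
        C' * (n : ℝ) ^ (4 / e : ℝ) * (C * ((n : ℝ) ^ ((2 * b : ℝ) / e)) ^ (1 / (1 - γ) - ε)) := by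
        gcongr
        exact h2.trans (by gcongr)
    _ = C' * (n : ℝ) ^ (2 - 1 / e : ℝ) + C' * C *
        ((n : ℝ) ^ (4 / e : ℝ) * (n : ℝ) ^ ((2 * b : ℝ) / e * (1 / (1 - γ) - ε))) := by
        rw [← Real.rpow_mul hn0.le]; ring
    _ ≤ C' * (n : ℝ) ^ (2 - 1 / e : ℝ) + C' * C * (n : ℝ) ^ (2 - 1 / e : ℝ) := by gcongr
    _ = _ := by ring

theorem not_ofReal_realTradeoff_le (hγ : 1 / 2 ≤ γ) (hγ' : γ < 1) (hD : D.HasTimes γ tp td tq)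
    (hconj : ThreeSumConjectureNoAlgorithm) {ε C : ℝ} (hε : 0 < ε)
    (h : ∀ᶠ d : ℕ in atTop, realTradeoff γ tp td tq d ≤ C * (d : ℝ) ^ (1 / (1 - γ) - ε)) : False := by
  refine not_realTradeoff_le hγ hγ' hD hconj (ε := min ε 1) (C := |C|) (by positivity)
    (min_le_right _ _) (abs_nonneg _) ?_
  filter_upwards [h, eventually_ge_atTop 1] with d h hd
  have hd1 : (1 : ℝ) ≤ d := by exact_mod_cast hd
  refine h.trans ?_
  gcongr
  · exact le_abs_self C
  · exact min_le_left _ _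

/-- The query term of the tradeoff, compared with the others. -/
theorem realTradeoff_eq (hγ' : γ < 1) (d : ℕ) :
    realTradeoff γ tp td tq d = (tp d + (d : ℝ) ^ (1 / (2 - 2 * γ)) * td d) +
      (d : ℝ) ^ (1 / (1 - γ) - 1 / 2) * tq d := by
  have h1γ : (1 - γ) ≠ 0 := by linarith
  rw [realTradeoff, show (1 + γ) / (2 - 2 * γ) = 1 / (1 - γ) - 1 / 2 by
    rw [show 2 - 2 * γ = 2 * (1 - γ) by ring]; field_simp; ring]

theorem le_query (hγ : 1 / 2 ≤ γ) (hγ' : γ < 1) (hD : D.HasTimes γ tp td tq)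
    (hconj : ThreeSumConjecture) (hcheap : CheapPrepAndFail γ tp td) {ε : ℝ} (hε : 0 < ε) :
    ∀ᶠ d : ℕ in atTop, (d : ℝ) ^ (1 / 2 - ε) ≤ tq d := by
  obtain ⟨ε₀, hε₀, C, hC⟩ := hcheap
  set ε₁ := min ε ε₀ / 2 with hε₁
  have h1 : 0 < ε₁ := by positivity
  -- One gap, `ε₁ < ε₀`, makes the cheap terms at most half of the lower bound; the other, `ε₁ < ε`,
  -- absorbs the remaining factor `1 / 2`.
  have h2 : ε₁ < ε := by have := min_le_left ε ε₀; linarith [lt_min hε hε₀]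
  have h3 : ε₁ < ε₀ := by have := min_le_right ε ε₀; linarith [lt_min hε hε₀]
  filter_upwards [hC, le_realTradeoff hγ hγ' hD hconj h1, eventually_gt_atTop 0,
    eventually_mul_rpow_le (2 * C) (c := 1 / 2) (by norm_num)
      (by linarith : 1 / (1 - γ) - ε₀ < 1 / (1 - γ) - ε₁),
    eventually_mul_rpow_le 1 (c := 1 / 2) (by norm_num) (by linarith : 1 / 2 - ε < 1 / 2 - ε₁)]
    with d h4 h5 hd h6 h7
  have hd' : (0 : ℝ) < d := by exact_mod_cast hd
  rw [realTradeoff_eq hγ' d] at h5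
  have h8 : (d : ℝ) ^ (1 / (1 - γ) - ε₁) = (d : ℝ) ^ (1 / (1 - γ) - 1 / 2) * (d : ℝ) ^ (1 / 2 - ε₁) := by
    rw [← Real.rpow_add hd']; congr 1; ring
  have h9 : (d : ℝ) ^ (1 / (1 - γ) - 1 / 2) * (1 / 2 * (d : ℝ) ^ (1 / 2 - ε₁))
      ≤ (d : ℝ) ^ (1 / (1 - γ) - 1 / 2) * tq d := by
    rw [mul_left_comm, ← h8]
    linarith [h4.1, h4.2]
  have h10 := le_of_mul_le_mul_left h9 (by positivity)
  linarith

theorem not_query_le (hγ : 1 / 2 ≤ γ) (hγ' : γ < 1) (hD : D.HasTimes γ tp td tq)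
    (hconj : ThreeSumConjectureNoAlgorithm) (hcheap : CheapPrepAndFail γ tp td) {ε C : ℝ} (hε : 0 < ε)
    (h : ∀ᶠ d : ℕ in atTop, (tq d : ℝ) ≤ C * (d : ℝ) ^ (1 / 2 - ε)) : False := by
  obtain ⟨ε₀, hε₀, C₀, hC₀⟩ := hcheap
  -- A fast query time would make the whole tradeoff small: two cheap terms contribute `2 * |C₀|`
  -- and the query term contributes `|C|`.
  refine not_ofReal_realTradeoff_le hγ hγ' hD hconj (ε := min ε ε₀) (C := 2 * |C₀| + |C|) (by positivity) ?_
  filter_upwards [hC₀, h, eventually_ge_atTop 1] with d h1 h2 hd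
  have hd1 : (1 : ℝ) ≤ d := by exact_mod_cast hd
  have hd' : (0 : ℝ) < d := by linarith
  rw [realTradeoff_eq hγ' d]
  have h3 : C₀ * (d : ℝ) ^ (1 / (1 - γ) - ε₀) ≤ |C₀| * (d : ℝ) ^ (1 / (1 - γ) - min ε ε₀) := by
    gcongr
    · exact le_abs_self _
    · exact min_le_right _ _
  have h4 : (d : ℝ) ^ (1 / (1 - γ) - 1 / 2) * tq d ≤ |C| * (d : ℝ) ^ (1 / (1 - γ) - min ε ε₀) := by
    calc (d : ℝ) ^ (1 / (1 - γ) - 1 / 2) * tq d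
        ≤ (d : ℝ) ^ (1 / (1 - γ) - 1 / 2) * (|C| * (d : ℝ) ^ (1 / 2 - ε)) := by
          gcongr
          exact h2.trans (by gcongr; exact le_abs_self _)
      _ = |C| * (d : ℝ) ^ (1 / (1 - γ) - ε) := by
          rw [mul_left_comm, ← Real.rpow_add hd']; congr 2; ring
      _ ≤ _ := by
          gcongr
          exact min_le_left _ _
  linarith [h1.1, h1.2]

theorem le_of_ofReal_le {x C y : ℝ} (hy : 0 ≤ y) (h : ENNReal.ofReal x ≤ ENNReal.ofReal (C * y)) :
    x ≤ |C| * y :=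
  (ENNReal.ofReal_le_ofReal_iff (by positivity)).1
    (h.trans (ENNReal.ofReal_le_ofReal (by gcongr; exact le_abs_self _)))

end LowerBound

theorem mainTheorem10 (γ : ℝ) (hγ : 1 / 2 ≤ γ) (hγ' : γ < 1) (D : FailureOracle)
    (tp td tq : ℕ → ℝ≥0) (hD : D.HasTimes γ tp td tq) :
    (ThreeSumConjecture →
      IsOmegaPow (failureTradeoff γ tp td tq) (1 / (1 - γ)) ∧
      (CheapPrepAndFail γ tp td → IsOmegaPow (fun d => (tq d : ℝ≥0∞)) (1 / 2))) ∧
    (ThreeSumConjectureNoAlgorithm →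
      IsNeverBigOPow (failureTradeoff γ tp td tq) (1 / (1 - γ)) ∧
      (CheapPrepAndFail γ tp td → IsNeverBigOPow (fun d => (tq d : ℝ≥0∞)) (1 / 2))) := by
  have htq : (fun d => (tq d : ℝ≥0∞)) = fun d => ENNReal.ofReal (tq d) :=
    funext fun d => (ENNReal.ofReal_coe_nnreal).symm
  rw [htq]
  refine ⟨fun h => ⟨isOmegaPow_of_forall fun ε hε => le_realTradeoff hγ hγ' hD h hε,
    fun hc => isOmegaPow_of_forall fun ε hε => le_query hγ hγ' hD h hc hε⟩, fun h => ⟨?_, fun hc => ?_⟩⟩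
  · rintro ε hε ⟨C, hC⟩
    exact not_ofReal_realTradeoff_le hγ hγ' hD h hε
      (hC.mono fun d hd => le_of_ofReal_le (by positivity) hd)
  · rintro ε hε ⟨C, hC⟩
    exact not_query_le hγ hγ' hD h hc hε (hC.mono fun d hd => le_of_ofReal_le (by positivity) hd)
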